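/- **Setting.** Let $\Pi=(0,1)\times\mathbb R$ with points $(x,y)$. For $\sigma>0$ let $L^\pm_\sigma$ be the space of $g:\Pi\to\mathbb C$ with $e^{\pm\sigma y}g\in L^2(\Pi)$ (the same notation is used for pairs), and $$X^\pm_\sigma=\{u\in L^\pm_\sigma:\ (i\partial_x+\partial_y)u\in L^\pm_\sigma,\ u(0,\cdot)=0\},\qquad Y^\pm_\sigma=\{v\in L^\pm_\sigma:\ (-i\partial_x+\partial_y)v\in L^\pm_\sigma,\ v(1,\cdot)=0\},$$ where derivatives are distributional and the boundary conditions are understood in the weak sense (Green's formula without a boundary term on the edge in question). For $\omega>0$ consider the problem $$(-i\partial_x+\partial_y)v-\omega u=g,\qquad (-i\partial_x-\partial_y)u-\omega v=h\quad\text{in }\Pi,\qquad u(0,y)=0,\quad v(1,y)=0.\tag{P}$$ For $j\ge1$ let $\kappa_j$ be the maximum point of $\kappa^{-2}\sin^2\kappa$ on $[(j-1)\pi,j\pi)$ (so $\kappa_1=0$), and let $\omega_j=\sqrt{\kappa_j^2+1}$. Fix $N\ge2$, and for $\varepsilon\ge0$ let $\omega_\varepsilon$ be given by $\omega_\varepsilon^{-1}=\omega_N^{-1}+\varepsilon$.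 The characteristic equation is $$\cos\kappa-\lambda\,\frac{\sin\kappa}{\kappa}=0,\qquad \kappa^2=\omega^2-\lambda^2.\tag{K}$$ **Waves.** Let $\omega=\omega_\varepsilon$ with $\omega_{N-1}<\omega$. For $1\le j\le N-1$ let $\kappa_j^{+}<\kappa_j<\kappa_j^{-}$ be the solutions in $((j-1)\pi,j\pi)$ of $\sin\kappa/\kappa=(-1)^{j+1}/\omega$ (only $\kappa_1^-$ if $j=1$), let $\lambda_j^\pm=\kappa_j^\pm\cot\kappa_j^\pm$, and put $$\mathbf w_j^\pm(x,y)=\frac{\sqrt{\omega}}{\sqrt{|\lambda_j^\pm-1|}}\;e^{-i\lambda_j^\pm y}\bigl(\sin(\kappa_j^\pm x),\ (-1)^{j+1}i\sin(\kappa_j^\pm(x-1))\bigr).$$ For $j=N$ let $\kappa(\lambda)=\sqrt{\omega^2-\lambda^2}$ and $G(\lambda)=\frac{\sin\kappa(\lambda)}{\kappa(\lambda)}-\frac{(-1)^{N+1}}{\omega}$. For small $\varepsilon>0$ the double root $\lambda=1$ of $G$ at $\varepsilon=0$ splits into two roots $\lambda_+,\ \lambda_-=\overline{\lambda_+}$ with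 $\operatorname{Im}\lambda_+>0$. Let $0<r<\omega-1$ be such that the roots of $G$ in $|\lambda-1|\le r$ are exactly $\lambda_\pm$ (the double root $1$ if $\varepsilon=0$) and lie in $|\lambda-1|<r$, and let $$\mathbf w^{\varepsilon+}=\frac1{2\pi i}\oint_{|\lambda-1|=r}\frac{e^{-i\lambda y}}{G(\lambda)}\binom{\sin(\kappa(\lambda)x)}{(-1)^{N+1}i\sin(\kappa(\lambda)(x-1))}d\lambda,\qquad \mathbf w^{\varepsilon-}=\frac1{2\pi i}\oint_{|\lambda-1|=r}\frac{(\lambda-1)e^{-i\lambda y}}{G(\lambda)}\binom{\sin(\kappa(\lambda)x)}{(-1)^{N+1}i\sin(\kappa(\lambda)(x-1))}d\lambda .$$ With $q(w,\tilde w)=-\int_0^1(u\overline{\tilde v}-v\overline{\tilde u})\,dx$ for $w=(u,v)$, $\tilde w=(\tilde u,\tilde v)$, taken at $y=0$, let $a=iq(\mathbf w^{\varepsilon+},\mathbf w^{\varepsilon+})$, $b=-iq(\mathbf w^{\varepsilon+},\mathbf w^{\varepsilon-})$, $c=-iq(\mathbf w^{\varepsilon-},\mathbf w^{\varepsilon-})$,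 $\alpha=a/b$, and put $$\mathbf w_N^+=\frac{\mathbf w^{\varepsilon+}+\alpha\,\mathbf w^{\varepsilon-}}{\sqrt{a+\alpha^2c}},\qquad \mathbf w_N^-=\frac{\mathbf w^{\varepsilon+}}{\sqrt a}.$$ **Theorem.** Let $N\ge2$. There are numbers $\gamma>0$ such that all roots of (K) for $\omega=\omega_N$ in the strip $|\operatorname{Im}\lambda|\le\gamma$ are real. For every such $\gamma$ there is $\varepsilon_N>0$ with the following properties. (a) For every $\varepsilon\in[0,\varepsilon_N]$ one has $\omega_\varepsilon>\omega_{N-1}$; a radius $r<\gamma$ as above exists, so that $|\operatorname{Im}\lambda_\pm|<\gamma$; and every root of (K) for $\omega=\omega_\varepsilon$ in $|\operatorname{Im}\lambda|\le\gamma$ is real or equal to $\lambda_+$ or $\lambda_-$. (b) Let $\varepsilon\in[0,\varepsilon_N]$, $\omega=\omega_\varepsilon$, and $(g,h)\in L^+_\gamma\cap L^-_\gamma$, and let $(u^\pm,v^\pm)\in X^\pm_\gamma\times Y^\pm_\gamma$ be solutions of (P). Then, for every $r$ as above, $$(u^+,v^+)=(u^-,v^-)+\sum_{j=2}^{N}C_j^+\mathbf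 w_j^+ +\sum_{j=1}^{N}C_j^-\mathbf w_j^-\quad\text{a.e. in }\Pi,$$ where $$-iC_j^+=\int_\Pi (g,h)\cdot\overline{\mathbf w_j^+}\,dx\,dy,\qquad iC_j^-=\int_\Pi (g,h)\cdot\overline{\mathbf w_j^-}\,dx\,dy,$$ and all these integrals converge absolutely. -/

import Mathlib

open Set MeasureTheory Complex
open scoped ComplexConjugate

noncomputable section

namespace DiracStrip

/-! ### The strip, weighted spaces and the Dirac system -/

/-- The strip `(0,1) × ℝ`; points are `(x, y)`. -/
def strip : Set (ℝ × ℝ) := Ioo (0 : ℝ) 1 ×ˢ univ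

/-- `e^{s y} g ∈ L²(strip)`. For `σ > 0` the space `L_σ^+` is the case `s = σ`, and `L_σ^-` is the
case `s = -σ`. -/
def MemWeightedL2 (s : ℝ) (g : ℝ × ℝ → ℂ) : Prop :=
  MemLp (fun p : ℝ × ℝ => (Real.exp (s * p.2) : ℂ) * g p) 2 (volume.restrict strip)

/-- The first order operator `c ∂_x + ∂_y` applied to a smooth function. -/
def dOp (c : ℂ) (φ : ℝ × ℝ → ℂ) (p : ℝ × ℝ) : ℂ :=
  c * fderiv ℝ φ p (1, 0) + fderiv ℝ φ p (0, 1)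

/-- Green's formula `∫ u (c ∂_x + ∂_y) φ = - ∫ f φ` over the strip, for all smooth `φ` with compact
support in the open set `U`.

* For `U = strip` this says `(c ∂_x + ∂_y) u = f` in the sense of distributions on the strip.
* For `U = {x < 1}` the test functions are unrestricted at the edge `x = 0`, and the formula says
  in addition that the trace of `u` on that edge vanishes, `u(0, y) = 0`.
* For `U = {x > 0}` it says in addition that `u(1, y) = 0`. -/
def HasWeakOp (c : ℂ) (U : Set (ℝ × ℝ)) (u f : ℝ × ℝ → ℂ) : Prop :=
  ∀ φ : ℝ × ℝ → ℂ, ContDiff ℝ (⊤ : ℕ∞) φ → HasCompactSupport φ → tsupport φ ⊆ U →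
    ∫ p in strip, u p * dOp c φ p = - ∫ p in strip, f p * φ p

/-- `u` and `(i ∂_x + ∂_y) u` lie in the weighted `L²` space and `u(0, y) = 0`. -/
def MemX (s : ℝ) (u : ℝ × ℝ → ℂ) : Prop :=
  MemWeightedL2 s u ∧ ∃ f, MemWeightedL2 s f ∧ HasWeakOp I {p | p.1 < 1} u f

/-- `v` and `(-i ∂_x + ∂_y) v` lie in the weighted `L²` space and `v(1, y) = 0`. -/
def MemY (s : ℝ) (v : ℝ × ℝ → ℂ) : Prop :=
  MemWeightedL2 s v ∧ ∃ f, MemWeightedL2 s f ∧ HasWeakOp (-I) {p | 0 < p.1} v f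

/-- `(u, v) ∈ X × Y` (with weight `e^{s y}`, boundary conditions included) solves
`(-i ∂_x + ∂_y) v - ω u = g` and `(-i ∂_x - ∂_y) u - ω v = h` in the strip. -/
structure IsSolution (ω s : ℝ) (g h u v : ℝ × ℝ → ℂ) : Prop where
  memX : MemX s u
  memY : MemY s v
  eq₁ : HasWeakOp (-I) strip v (fun p => g p + ω * u p)
  eq₂ : HasWeakOp I strip u (fun p => -(h p + ω * v p))

/-! ### Thresholds -/

/-- `κ_j`: the (unique) maximum point of `κ⁻² sin² κ` on `[(j-1)π, jπ)`, for `j ≥ 1`. -/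
def kappaThr (j : ℕ) : ℝ :=
  sSup {κ | κ ∈ Ico (((j : ℝ) - 1) * Real.pi) (j * Real.pi) ∧
    IsMaxOn (fun t => Real.sinc t ^ 2) (Ico (((j : ℝ) - 1) * Real.pi) (j * Real.pi)) κ}

/-- The threshold `ω_j`. -/
def omegaThr (j : ℕ) : ℝ := Real.sqrt (kappaThr j ^ 2 + 1)

/-- `ω_ε`, with `1/ω_ε = 1/ω_N + ε`. -/
def omegaEps (N : ℕ) (ε : ℝ) : ℝ := omegaThr N / (1 + ε * omegaThr N)

/-! ### The characteristic equation -/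

/-- The entire function `sin z / z`. -/
def csinc (z : ℂ) : ℂ := if z = 0 then 1 else Complex.sin z / z

/-- `κ(lam) = √(ω² - lam²)`, principal branch. -/
def kappaOf (ω : ℝ) (lam : ℂ) : ℂ := ((ω : ℂ) ^ 2 - lam ^ 2) ^ (1 / 2 : ℂ)

/-- `cos κ - lam · sin κ / κ` with `κ² = ω² - lam²`. Its roots are the `lam` for which
`e^{-i lam y} (U(x), V(x))` solves the homogeneous problem for some `(U, V) ≠ 0`. -/
def dispersionFun (ω : ℝ) (lam : ℂ) : ℂ :=
  Complex.cos (kappaOf ω lam) - lam * csinc (kappaOf ω lam)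

/-- `g(lam, ε) - (-1)^{N+1} / ω_ε`, where `g(lam, ε) = sin κ / κ` and `κ = √(ω_ε² - lam²)`. -/
def threshFun (N : ℕ) (ε : ℝ) (lam : ℂ) : ℂ :=
  csinc (kappaOf (omegaEps N ε) lam) - (-1) ^ (N + 1) / (omegaEps N ε : ℂ)

/-- Every root in the closed strip `|Im lam| ≤ γ` at the threshold `ω = ω_N` is real. -/
def IsThresholdWidth (N : ℕ) (γ : ℝ) : Prop :=
  ∀ lam : ℂ, |lam.im| ≤ γ → dispersionFun (omegaThr N) lam = 0 → lam.im = 0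

/-- The closed disc of radius `r` about `1` lies in `|lam| < ω_ε` (so `κ(lam)` is analytic and
nonzero on it), and the roots of `threshFun N ε` in it are exactly the two roots `lam₊`,
`lam₋ = conj lam₊`, lying in its interior, into which the double root `1` for `ε = 0` splits. -/
def IsThresholdRadius (N : ℕ) (ε r : ℝ) : Prop :=
  0 < r ∧ r < omegaEps N ε - 1 ∧
    ∃ lamP : ℂ, ‖lamP - 1‖ < r ∧ (ε = 0 → lamP = 1) ∧ (0 < ε → 0 < lamP.im) ∧
      ∀ lam : ℂ, ‖lam - 1‖ ≤ r → (threshFun N ε lam = 0 ↔ lam = lamP ∨ lam = conj lamP)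

/-- For `0 ≤ ε ≤ ε_N`: `ω_ε > ω_{N-1}`, and every root for `ω = ω_ε` in the closed strip
`|Im lam| ≤ γ` is either real or one of the two roots near `1` that split off the double root;
the latter two lie in `|Im lam| < γ`. -/
def IsSpectralStrip (N : ℕ) (γ εN : ℝ) : Prop :=
  ∀ ε ∈ Icc 0 εN, omegaThr (N - 1) < omegaEps N ε ∧
    ∃ r < γ, IsThresholdRadius N ε r ∧
      ∀ lam : ℂ, |lam.im| ≤ γ → dispersionFun (omegaEps N ε) lam = 0 →
        lam.im = 0 ∨ (‖lam - 1‖ < r ∧ threshFun N ε lam = 0)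

/-! ### The oscillatory waves -/

/-- `κ_j^+`: the (unique) `κ ∈ ((j-1)π, jπ)` with `κ < κ_j` and `sin κ / κ = (-1)^{j+1} / ω`. -/
def kappaPlus (ω : ℝ) (j : ℕ) : ℝ :=
  sSup {κ | κ ∈ Ioo (((j : ℝ) - 1) * Real.pi) (j * Real.pi) ∧ κ < kappaThr j ∧
    Real.sin κ / κ = (-1) ^ (j + 1) / ω}

/-- `κ_j^-`: the (unique) `κ ∈ ((j-1)π, jπ)` with `κ > κ_j` and `sin κ / κ = (-1)^{j+1} / ω`. -/
def kappaMinus (ω : ℝ) (j : ℕ) : ℝ :=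
  sSup {κ | κ ∈ Ioo (((j : ℝ) - 1) * Real.pi) (j * Real.pi) ∧ kappaThr j < κ ∧
    Real.sin κ / κ = (-1) ^ (j + 1) / ω}

/-- `e^{-i lam y} (sin (κ x), (-1)^{j+1} i sin (κ (x - 1)))`. -/
def expWave (j : ℕ) (lam κ : ℂ) (p : ℝ × ℝ) : ℂ × ℂ :=
  Complex.exp (-I * lam * p.2) •
    (Complex.sin (κ * p.1), (-1) ^ (j + 1) * I * Complex.sin (κ * ((p.1 : ℂ) - 1)))

/-- The normalised wave `√ω / √|lam - 1| · w` with `lam = κ cot κ`, for real `κ`. -/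
def oscWave (ω : ℝ) (j : ℕ) (κ : ℝ) (p : ℝ × ℝ) : ℂ × ℂ :=
  ((Real.sqrt ω / Real.sqrt |κ * Real.cot κ - 1| : ℝ) : ℂ) •
    expWave j ((κ * Real.cot κ : ℝ) : ℂ) (κ : ℂ) p

/-! ### The waves attached to the threshold -/

/-- `(2πi)⁻¹ ∮_{|lam - 1| = r} e^{-i lam y} (sin κx, (-1)^{N+1} i sin κ(x-1))
/ (g(lam, ε) - (-1)^{N+1}/ω_ε) dlam`. -/
def threshWavePlus (N : ℕ) (ε r : ℝ) (p : ℝ × ℝ) : ℂ × ℂ :=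
  (2 * (Real.pi : ℂ) * I)⁻¹ • ∮ lam in C(1, r),
    (threshFun N ε lam)⁻¹ • expWave N lam (kappaOf (omegaEps N ε) lam) p

/-- The same integral with the additional factor `lam - 1`. -/
def threshWaveMinus (N : ℕ) (ε r : ℝ) (p : ℝ × ℝ) : ℂ × ℂ :=
  (2 * (Real.pi : ℂ) * I)⁻¹ • ∮ lam in C(1, r),
    ((lam - 1) / threshFun N ε lam) • expWave N lam (kappaOf (omegaEps N ε) lam) p

/-- The symplectic form `q(w, w') = - ∫₀¹ (u conj v' - v conj u') dx`, evaluated on the section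
`y = 0`. (For solutions of the homogeneous problem every section gives the same value.) -/
def qForm (w w' : ℝ × ℝ → ℂ × ℂ) : ℂ :=
  - ∫ x in (0 : ℝ)..1,
    ((w (x, 0)).1 * conj (w' (x, 0)).2 - (w (x, 0)).2 * conj (w' (x, 0)).1)

/-- `a^ε = i q(w^{ε+}, w^{ε+})` (a real number). -/
def aEps (N : ℕ) (ε r : ℝ) : ℝ :=
  (I * qForm (threshWavePlus N ε r) (threshWavePlus N ε r)).re

/-- `b^ε = -i q(w^{ε+}, w^{ε-})` (a real number). -/
def bEps (N : ℕ) (ε r : ℝ) : ℝ :=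
  (-I * qForm (threshWavePlus N ε r) (threshWaveMinus N ε r)).re

/-- `c^ε = -i q(w^{ε-}, w^{ε-})` (a real number). -/
def cEps (N : ℕ) (ε r : ℝ) : ℝ :=
  (-I * qForm (threshWaveMinus N ε r) (threshWaveMinus N ε r)).re

/-- `α_ε = a^ε / b^ε`. -/
def alphaEps (N : ℕ) (ε r : ℝ) : ℝ := aEps N ε r / bEps N ε r

/-- The normalising factor for which `q(𝐰_N^+, 𝐰_N^+) = i`. -/
def normOne (N : ℕ) (ε r : ℝ) : ℝ := Real.sqrt (aEps N ε r + alphaEps N ε r ^ 2 * cEps N ε r)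

/-- The normalising factor for which `q(𝐰_N^-, 𝐰_N^-) = -i`. -/
def normTwo (N : ℕ) (ε r : ℝ) : ℝ := Real.sqrt (aEps N ε r)

/-! ### All waves -/

/-- `𝐰_j^+`, for `2 ≤ j ≤ N`. -/
def wavePlus (N : ℕ) (ε r : ℝ) (j : ℕ) (p : ℝ × ℝ) : ℂ × ℂ :=
  if j = N then
    ((normOne N ε r)⁻¹ : ℂ) • (threshWavePlus N ε r p + (alphaEps N ε r : ℂ) • threshWaveMinus N ε r p)
  else oscWave (omegaEps N ε) j (kappaPlus (omegaEps N ε) j) p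

/-- `𝐰_j^-`, for `1 ≤ j ≤ N`. -/
def waveMinus (N : ℕ) (ε r : ℝ) (j : ℕ) (p : ℝ × ℝ) : ℂ × ℂ :=
  if j = N then ((normTwo N ε r)⁻¹ : ℂ) • threshWavePlus N ε r p
  else oscWave (omegaEps N ε) j (kappaMinus (omegaEps N ε) j) p

/-- `(g, h) · conj w` at a point. -/
def pairing (g h : ℝ × ℝ → ℂ) (w : ℝ × ℝ → ℂ × ℂ) (p : ℝ × ℝ) : ℂ :=
  g p * conj (w p).1 + h p * conj (w p).2

end DiracStrip

end

noncomputable section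

namespace DiracStrip

open Filter Topology

/-! ### Entire functions of the square root -/

/-! The difference of the two solutions solves the homogeneous problem and grows slower than
`e^{γ|y|}` in a weighted L² sense. Two facts give the formula: a tempered homogeneous solution is
determined by finitely many symplectic fluxes, and these fluxes are the integrals of the data
against the waves.

Uniqueness (`IsHomogeneous.ae_eq_zero`). Green's formula is applied with the test pair `e^{iλy}
η(y)` times an explicit resolvent kernel on `[0,1]`. For `Im λ > γ` it shows that the transform of
`v` over `y > 0` against `e^{iθx}`, plus an entire correction, multiplied by `i D(λ) (ω² - λ² -
θ²)`, is an entire function `resPair`; here `D` is the characteristic function. For `Im λ < -γ`,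
minus the transform over `y ≤ 0` is tied to the same `resPair`, because `η` and `η - 1` have the
same derivative. So one meromorphic function continues both transforms. For large `θ` its only
possible poles with `|Im λ| ≤ γ` are roots of `D`, and the obstruction there is `leftPair`, the flux
through the exponential solutions. If it vanishes to the order of `D`, the function is entire. It is
bounded off a strip and of at most exponential growth far out in it, hence bounded by
Phragmén–Lindelöf, constant by Liouville, and zero because it decays up the imaginary axis.
Analyticity in `θ` and injectivity of the Fourier transform give `v = 0`, and the equation then
gives `u = 0`.

Spectrum. With `S = sin κ / κ` and `C = cos κ`, `D (C + λS) = 1 - ω² S²`. Real roots are `λ = κ cot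
κ` with `|sin κ / κ| = 1/ω`, and the peak of `|sin κ / κ|` on the `j`-th interval has height
`1/ω_j`. At a root, `D'` is a nonzero multiple of `λ - 1`, so only `λ = 1` can be multiple; it is a
double root at `ω_N`. Just below `ω_N` the level `1/ω` lies above the peak, so the double root
leaves the real axis as a conjugate pair. No third root appears, since the second derivative stays
away from zero. Compactness and the growth of `D` along the strip control the remaining roots.

Waves. The symplectic form does not depend on the section, so exponential waves with `λ ≠ conj μ`
are orthogonal. An oscillatory wave has flux proportional to `i (λ - 1)`, which fixes the sign of
its normalised flux. The threshold pair is given by contour integrals that stay continuous as the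
roots merge. At `ε = 0` it spans the Jordan chain of the double root, with `a > 0`, `b ≠ 0`, `c =
0`, so the normalisation makes sense for small `ε`. The Gram matrix of all waves is then diagonal
with entries `±i`. Subtracting the corresponding combination of waves leaves a solution with zero
fluxes, and this vanishes by uniqueness.

Coefficients (`integral_pairing_eq`). Green's formula with cutoff `η` for the solution decaying at
`+∞` and `1 - η` for the one decaying at `-∞` turns the integral of the data against a wave into
minus the flux of the difference. -/

theorem cpow_half_sq (K : ℂ) : (K ^ (1 / 2 : ℂ)) ^ 2 = K := by
  rw [← Complex.cpow_nat_mul]; norm_num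

theorem Function.Even.apply_eq_of_sq_eq {F : ℂ → ℂ} (hF : ∀ z, F (-z) = F z) {a b : ℂ}
    (h : a ^ 2 = b ^ 2) : F a = F b := by
  rcases sq_eq_sq_iff_eq_or_eq_neg.1 h with h | h
  · rw [h]
  · rw [h, hF]

/-- Evenness hides the choice of branch: off the slit the principal root is analytic, on it `I *
√(-K)` is another square root of `K`, and the origin is a removable point because the composite is
continuous there. -/
theorem differentiable_comp_sqrt {F : ℂ → ℂ} (hd : Differentiable ℂ F)
    (hF : ∀ z, F (-z) = F z) : Differentiable ℂ (fun K : ℂ => F (K ^ (1 / 2 : ℂ))) := by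
  have key : ∀ K : ℂ, K ≠ 0 → DifferentiableAt ℂ (fun K : ℂ => F (K ^ (1 / 2 : ℂ))) K := by
    intro K hK
    by_cases hs : K ∈ slitPlane
    · exact (hd _).comp K (differentiableAt_fun_id.cpow_const hs)
    · have hs' : -K ∈ slitPlane := by
        rw [mem_slitPlane_iff] at hs ⊢
        push Not at hs
        left
        rcases lt_or_eq_of_le hs.1 with h | h
        · simpa using h
        · exact absurd (Complex.ext h hs.2) hK
      have : (fun K : ℂ => F (K ^ (1 / 2 : ℂ))) = fun K : ℂ => F (I * (-K) ^ (1 / 2 : ℂ)) := by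
        funext z
        apply Function.Even.apply_eq_of_sq_eq hF
        rw [mul_pow, cpow_half_sq, cpow_half_sq, I_sq]; ring
      rw [this]
      exact (hd _).comp K ((differentiableAt_fun_id.fun_neg.cpow_const hs').const_mul I)
  intro K
  by_cases hK : K = 0
  · subst hK
    apply AnalyticAt.differentiableAt
    apply analyticAt_of_differentiable_on_punctured_nhds_of_continuousAt
    · filter_upwards [self_mem_nhdsWithin] with z hz using key z hz
    · refine ContinuousAt.comp (f := fun K : ℂ => K ^ (1 / 2 : ℂ)) (g := F)
        (hd _).continuousAt ?_
      exact continuousAt_cpow_const_of_re_pos (Or.inl le_rfl) (by norm_num)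
  · exact key K hK

theorem csinc_eq_dslope : csinc = dslope Complex.sin 0 := by
  funext z
  by_cases hz : z = 0
  · subst hz; simp [csinc]
  · rw [dslope_of_ne _ hz]; simp [csinc, hz, slope, div_eq_inv_mul]

theorem differentiable_csinc : Differentiable ℂ csinc := by
  rw [csinc_eq_dslope, ← differentiableOn_univ]
  exact (Complex.differentiableOn_dslope univ_mem).2 Complex.differentiable_sin.differentiableOn

theorem csinc_neg (z : ℂ) : csinc (-z) = csinc z := by
  unfold csinc; by_cases hz : z = 0 <;> simp [hz]

theorem mul_csinc (z : ℂ) : z * csinc z = Complex.sin z := by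
  unfold csinc; by_cases hz : z = 0
  · simp [hz]
  · simp [hz]; field_simp

/-- `cos (√K x)`, an entire function of `K`. -/
def cosRt (x : ℝ) (K : ℂ) : ℂ := Complex.cos (K ^ (1 / 2 : ℂ) * x)

/-- `sin (√K x) / √K`, an entire function of `K`. -/
def sincRt (x : ℝ) (K : ℂ) : ℂ := x * csinc (K ^ (1 / 2 : ℂ) * x)

theorem differentiable_cosRt (x : ℝ) : Differentiable ℂ (cosRt x) :=
  differentiable_comp_sqrt (F := fun z => Complex.cos (z * x)) (by fun_prop) (by simp)

theorem differentiable_sincRt (x : ℝ) : Differentiable ℂ (sincRt x) :=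
  differentiable_comp_sqrt (F := fun z => x * csinc (z * x))
    ((differentiable_csinc.comp (differentiable_id.mul_const _)).const_mul _)
    (by intro z; rw [neg_mul, csinc_neg])

theorem cosRt_sq (x : ℝ) (κ : ℂ) : cosRt x (κ ^ 2) = Complex.cos (κ * x) :=
  Function.Even.apply_eq_of_sq_eq (F := fun z => Complex.cos (z * x)) (by simp) (cpow_half_sq _)

theorem sincRt_sq (x : ℝ) (κ : ℂ) : sincRt x (κ ^ 2) = x * csinc (κ * x) :=
  Function.Even.apply_eq_of_sq_eq (F := fun z => (x : ℂ) * csinc (z * x))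
    (by intro z; simp only [neg_mul, csinc_neg]) (cpow_half_sq _)

theorem mul_sincRt_sq (x : ℝ) (κ : ℂ) : κ * sincRt x (κ ^ 2) = Complex.sin (κ * x) := by
  rw [sincRt_sq, ← mul_csinc]; ring

theorem sincRt_sq_of_ne (x : ℝ) {κ : ℂ} (hκ : κ ≠ 0) :
    sincRt x (κ ^ 2) = Complex.sin (κ * x) / κ := by
  rw [← mul_sincRt_sq]; field_simp

theorem sincRt_zero_right (x : ℝ) : sincRt x 0 = x := by simp [sincRt, csinc]

theorem cosRt_zero_right (x : ℝ) : cosRt x 0 = 1 := by simp [cosRt]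

theorem exists_sq_eq (K : ℂ) : ∃ κ : ℂ, K = κ ^ 2 := ⟨_, (cpow_half_sq K).symm⟩

@[simp] theorem cosRt_zero_left (K : ℂ) : cosRt 0 K = 1 := by simp [cosRt]
@[simp] theorem sincRt_zero_left (K : ℂ) : sincRt 0 K = 0 := by simp [sincRt]

theorem cosRt_sq_add (x : ℝ) (K : ℂ) : cosRt x K ^ 2 + K * sincRt x K ^ 2 = 1 := by
  obtain ⟨κ, rfl⟩ := exists_sq_eq K
  rw [← mul_pow, mul_sincRt_sq, cosRt_sq, Complex.cos_sq_add_sin_sq]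

theorem hasDerivAt_ofReal_mul (κ : ℂ) (x : ℝ) : HasDerivAt (fun x : ℝ => κ * (x : ℂ)) κ x := by
  simpa using (Complex.ofRealCLM.hasDerivAt (x := x)).const_mul κ

theorem hasDerivAt_cosRt (K : ℂ) (x : ℝ) :
    HasDerivAt (fun x : ℝ => cosRt x K) (-K * sincRt x K) x := by
  obtain ⟨κ, rfl⟩ := exists_sq_eq K
  simp only [cosRt_sq]
  have := (Complex.hasDerivAt_cos (κ * x)).comp x (hasDerivAt_ofReal_mul κ x)
  refine this.congr_deriv ?_
  rw [← mul_sincRt_sq]; ring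

theorem hasDerivAt_sincRt (K : ℂ) (x : ℝ) :
    HasDerivAt (fun x : ℝ => sincRt x K) (cosRt x K) x := by
  obtain ⟨κ, rfl⟩ := exists_sq_eq K
  by_cases hκ : κ = 0
  · subst hκ
    simp only [ne_eq, OfNat.ofNat_ne_zero, not_false_eq_true, zero_pow, sincRt_zero_right,
      cosRt_zero_right]
    exact Complex.ofRealCLM.hasDerivAt (x := x)
  · simp only [cosRt_sq, sincRt_sq_of_ne _ hκ]
    have := ((Complex.hasDerivAt_sin (κ * x)).comp x (hasDerivAt_ofReal_mul κ x)).div_const κ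
    refine this.congr_deriv ?_
    field_simp

theorem contDiff_cosRt (K : ℂ) {n : WithTop ℕ∞} : ContDiff ℝ n (fun x : ℝ => cosRt x K) := by
  unfold cosRt
  exact (Complex.contDiff_cos (n := n)).restrict_scalars ℝ |>.comp
    (contDiff_const.mul Complex.ofRealCLM.contDiff)

theorem contDiff_sincRt (K : ℂ) {n : WithTop ℕ∞} : ContDiff ℝ n (fun x : ℝ => sincRt x K) := by
  obtain ⟨κ, rfl⟩ := exists_sq_eq K
  by_cases hκ : κ = 0
  · subst hκ
    simp only [ne_eq, OfNat.ofNat_ne_zero, not_false_eq_true, zero_pow, sincRt_zero_right]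
    exact Complex.ofRealCLM.contDiff
  · simp only [sincRt_sq_of_ne _ hκ]
    exact ((Complex.contDiff_sin (n := n)).restrict_scalars ℝ |>.comp
      (contDiff_const.mul Complex.ofRealCLM.contDiff)).div_const κ

/-- Computed by differentiating `κ ↦ cosRt x (κ²)` in two ways and cancelling the chain-rule factor
`2κ`, which is why `K = 0` is excluded. -/
theorem hasDerivAt_cosRt_right (x : ℝ) {K : ℂ} (hK : K ≠ 0) :
    HasDerivAt (cosRt x) (-(x * sincRt x K / 2)) K := by
  obtain ⟨κ, rfl⟩ := exists_sq_eq K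
  have hκ : κ ≠ 0 := by rintro rfl; simp at hK
  have h1 := (differentiable_cosRt x (κ ^ 2)).hasDerivAt
  have h2 : HasDerivAt (fun κ : ℂ => cosRt x (κ ^ 2)) (deriv (cosRt x) (κ ^ 2) * (2 * κ)) κ := by
    have := HasDerivAt.comp κ (h₂ := cosRt x) (h := fun κ => κ ^ 2) h1 (hasDerivAt_pow 2 κ)
    refine this.congr_deriv ?_
    simp
  have h3 : HasDerivAt (fun κ : ℂ => cosRt x (κ ^ 2)) (-Complex.sin (κ * x) * x) κ := by
    simp only [cosRt_sq]
    refine ((Complex.hasDerivAt_cos (κ * x)).comp κ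
      ((hasDerivAt_id κ).mul_const (x : ℂ))).congr_deriv ?_
    simp
  have h4 := h2.unique h3
  refine h1.congr_deriv ?_
  rw [← mul_sincRt_sq] at h4
  have : (2 * κ) ≠ 0 := by simpa using hκ
  apply mul_right_cancel₀ this
  rw [h4]; ring

theorem hasDerivAt_sincRt_right (x : ℝ) {K : ℂ} (hK : K ≠ 0) :
    HasDerivAt (sincRt x) ((x * cosRt x K - sincRt x K) / (2 * K)) K := by
  obtain ⟨κ, rfl⟩ := exists_sq_eq K
  have hκ : κ ≠ 0 := by rintro rfl; simp at hK
  have h1 := (differentiable_sincRt x (κ ^ 2)).hasDerivAt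
  have h2 : HasDerivAt (fun κ : ℂ => κ * sincRt x (κ ^ 2))
      (sincRt x (κ ^ 2) + κ * (deriv (sincRt x) (κ ^ 2) * (2 * κ))) κ := by
    have := HasDerivAt.comp κ (h₂ := sincRt x) (h := fun κ => κ ^ 2) h1 (hasDerivAt_pow 2 κ)
    refine ((hasDerivAt_id κ).mul this).congr_deriv ?_
    simp
  have h3 : HasDerivAt (fun κ : ℂ => κ * sincRt x (κ ^ 2)) (Complex.cos (κ * x) * x) κ := by
    simp only [mul_sincRt_sq]
    refine ((Complex.hasDerivAt_sin (κ * x)).comp κ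
      ((hasDerivAt_id κ).mul_const (x : ℂ))).congr_deriv ?_
    simp
  have h4 := h2.unique h3
  refine h1.congr_deriv ?_
  rw [← cosRt_sq] at h4
  rw [eq_div_iff (by simpa using hκ)]
  linear_combination h4

/-! ### Exponential bounds for the entire functions -/

theorem norm_cos_le_exp (z : ℂ) : ‖Complex.cos z‖ ≤ Real.exp ‖z‖ := by
  rw [Complex.cos]
  have h1 : ‖Complex.exp (z * I)‖ ≤ Real.exp ‖z‖ := by
    simpa using Complex.norm_exp_le_exp_norm (z * I)
  have h2 : ‖Complex.exp (-z * I)‖ ≤ Real.exp ‖z‖ := by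
    simpa using Complex.norm_exp_le_exp_norm (-z * I)
  rw [norm_div]
  have := norm_add_le (Complex.exp (z * I)) (Complex.exp (-z * I))
  simp only [Complex.norm_ofNat]
  linarith

theorem norm_exp_sub_one_le_mul_exp (z : ℂ) : ‖Complex.exp z - 1‖ ≤ ‖z‖ * Real.exp ‖z‖ := by
  simpa using Complex.norm_exp_sub_sum_le_norm_mul_exp z 1

theorem norm_csinc_le_exp (z : ℂ) : ‖csinc z‖ ≤ Real.exp ‖z‖ := by
  by_cases hz : z = 0
  · simp [csinc, hz]
  have h1 : ‖Complex.exp (z * I) - 1‖ ≤ ‖z‖ * Real.exp ‖z‖ := by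
    simpa using norm_exp_sub_one_le_mul_exp (z * I)
  have h2 : ‖Complex.exp (-z * I) - 1‖ ≤ ‖z‖ * Real.exp ‖z‖ := by
    simpa using norm_exp_sub_one_le_mul_exp (-z * I)
  have h3 : ‖Complex.sin z‖ ≤ ‖z‖ * Real.exp ‖z‖ := by
    have : Complex.sin z =
        ((Complex.exp (-z * I) - 1) - (Complex.exp (z * I) - 1)) * I / 2 := by
      rw [Complex.sin]; ring
    rw [this, norm_div, norm_mul]
    have := norm_sub_le (Complex.exp (-z * I) - 1) (Complex.exp (z * I) - 1)
    simp only [Complex.norm_ofNat, norm_I, mul_one]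
    linarith
  simp only [csinc, hz, if_false, norm_div]
  rw [div_le_iff₀ (norm_pos_iff.2 hz)]
  linarith

theorem norm_cpow_half_mul_le {x : ℝ} (hx : x ∈ Icc (0 : ℝ) 1) {K : ℂ} {R : ℝ} (hR : 0 ≤ R)
    (hK : ‖K‖ ≤ R ^ 2) : ‖K ^ (1 / 2 : ℂ) * x‖ ≤ R := by
  rw [norm_mul, Complex.norm_real, Real.norm_of_nonneg hx.1]
  have : ‖K ^ (1 / 2 : ℂ)‖ ≤ R := by
    refine le_of_pow_le_pow_left₀ two_ne_zero hR ?_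
    rw [← norm_pow, cpow_half_sq]; exact hK
  nlinarith [norm_nonneg (K ^ (1 / 2 : ℂ)), hx.1, hx.2]

theorem norm_cosRt_le {x : ℝ} (hx : x ∈ Icc (0 : ℝ) 1) {K : ℂ} {R : ℝ} (hR : 0 ≤ R)
    (hK : ‖K‖ ≤ R ^ 2) : ‖cosRt x K‖ ≤ Real.exp R :=
  (norm_cos_le_exp _).trans (Real.exp_le_exp.2 (norm_cpow_half_mul_le hx hR hK))

theorem norm_sincRt_le {x : ℝ} (hx : x ∈ Icc (0 : ℝ) 1) {K : ℂ} {R : ℝ} (hR : 0 ≤ R)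
    (hK : ‖K‖ ≤ R ^ 2) : ‖sincRt x K‖ ≤ x * Real.exp R := by
  rw [sincRt, norm_mul, Complex.norm_real, Real.norm_of_nonneg hx.1]
  exact mul_le_mul_of_nonneg_left
    ((norm_csinc_le_exp _).trans (Real.exp_le_exp.2 (norm_cpow_half_mul_le hx hR hK))) hx.1

/-! ### The characteristic function as an entire function, and its derivative -/

theorem dispersionFun_eq (ω : ℝ) (lam : ℂ) :
    dispersionFun ω lam = cosRt 1 ((ω : ℂ) ^ 2 - lam ^ 2) -
      lam * sincRt 1 ((ω : ℂ) ^ 2 - lam ^ 2) := by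
  simp [dispersionFun, kappaOf, cosRt, sincRt]

theorem threshFun_eq (N : ℕ) (ε : ℝ) (lam : ℂ) :
    threshFun N ε lam = sincRt 1 ((omegaEps N ε : ℂ) ^ 2 - lam ^ 2) -
      (-1) ^ (N + 1) / (omegaEps N ε : ℂ) := by
  simp [threshFun, kappaOf, sincRt]

theorem kappaOf_sq (ω : ℝ) (lam : ℂ) : kappaOf ω lam ^ 2 = (ω : ℂ) ^ 2 - lam ^ 2 :=
  cpow_half_sq _

theorem differentiable_dispersionFun (ω : ℝ) : Differentiable ℂ (dispersionFun ω) := by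
  have : dispersionFun ω = fun lam => cosRt 1 ((ω : ℂ) ^ 2 - lam ^ 2) -
      lam * sincRt 1 ((ω : ℂ) ^ 2 - lam ^ 2) := funext (dispersionFun_eq ω)
  rw [this]
  have h : Differentiable ℂ (fun lam : ℂ => (ω : ℂ) ^ 2 - lam ^ 2) := by fun_prop
  exact ((differentiable_cosRt 1).comp h).sub (differentiable_id.mul
    ((differentiable_sincRt 1).comp h))

theorem hasDerivAt_cosRt_lam (x ω : ℝ) {lam : ℂ} (hK : (ω : ℂ) ^ 2 - lam ^ 2 ≠ 0) :
    HasDerivAt (fun lam : ℂ => cosRt x ((ω : ℂ) ^ 2 - lam ^ 2))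
      (lam * x * sincRt x ((ω : ℂ) ^ 2 - lam ^ 2)) lam := by
  have h : HasDerivAt (fun lam : ℂ => (ω : ℂ) ^ 2 - lam ^ 2) (-(2 * lam)) lam := by
    simpa using (hasDerivAt_pow 2 lam).const_sub ((ω : ℂ) ^ 2)
  refine ((hasDerivAt_cosRt_right x hK).comp lam h).congr_deriv ?_
  ring

theorem hasDerivAt_sincRt_lam (x ω : ℝ) {lam : ℂ} (hK : (ω : ℂ) ^ 2 - lam ^ 2 ≠ 0) :
    HasDerivAt (fun lam : ℂ => sincRt x ((ω : ℂ) ^ 2 - lam ^ 2))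
      (-(lam * (x * cosRt x ((ω : ℂ) ^ 2 - lam ^ 2) - sincRt x ((ω : ℂ) ^ 2 - lam ^ 2)) /
        ((ω : ℂ) ^ 2 - lam ^ 2))) lam := by
  have h : HasDerivAt (fun lam : ℂ => (ω : ℂ) ^ 2 - lam ^ 2) (-(2 * lam)) lam := by
    simpa using (hasDerivAt_pow 2 lam).const_sub ((ω : ℂ) ^ 2)
  refine ((hasDerivAt_sincRt_right x hK).comp lam h).congr_deriv ?_
  field_simp

/-- `D (C + λ S) = 1 - ω² S²`. -/
theorem dispersionFun_mul (ω : ℝ) (lam : ℂ) :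
    dispersionFun ω lam * (cosRt 1 ((ω : ℂ) ^ 2 - lam ^ 2) +
      lam * sincRt 1 ((ω : ℂ) ^ 2 - lam ^ 2)) = 1 - (ω * sincRt 1 ((ω : ℂ) ^ 2 - lam ^ 2)) ^ 2 := by
  rw [dispersionFun_eq]
  linear_combination cosRt_sq_add 1 ((ω : ℂ) ^ 2 - lam ^ 2)

theorem sq_eq_one_of_root {ω : ℝ} {lam : ℂ} (h : dispersionFun ω lam = 0) :
    (ω * sincRt 1 ((ω : ℂ) ^ 2 - lam ^ 2)) ^ 2 = 1 := by
  have := dispersionFun_mul ω lam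
  rw [h, zero_mul] at this
  linear_combination this

theorem K_ne_zero_of_sq_eq_one {ω : ℝ} (hω : 1 < ω) {lam : ℂ}
    (h : (ω * sincRt 1 ((ω : ℂ) ^ 2 - lam ^ 2)) ^ 2 = 1) : (ω : ℂ) ^ 2 - lam ^ 2 ≠ 0 := by
  intro h0
  rw [h0, sincRt_zero_right] at h
  norm_cast at h
  nlinarith

theorem hasDerivAt_dispersionFun {ω : ℝ} {lam : ℂ} (hK : (ω : ℂ) ^ 2 - lam ^ 2 ≠ 0) :
    HasDerivAt (dispersionFun ω) (lam * sincRt 1 ((ω : ℂ) ^ 2 - lam ^ 2) -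
      sincRt 1 ((ω : ℂ) ^ 2 - lam ^ 2) + lam ^ 2 * (cosRt 1 ((ω : ℂ) ^ 2 - lam ^ 2) -
        sincRt 1 ((ω : ℂ) ^ 2 - lam ^ 2)) / ((ω : ℂ) ^ 2 - lam ^ 2)) lam := by
  have : dispersionFun ω = fun lam => cosRt 1 ((ω : ℂ) ^ 2 - lam ^ 2) -
      lam * sincRt 1 ((ω : ℂ) ^ 2 - lam ^ 2) := funext (dispersionFun_eq ω)
  rw [this]
  refine ((hasDerivAt_cosRt_lam 1 ω hK).sub
    ((hasDerivAt_id lam).mul (hasDerivAt_sincRt_lam 1 ω hK))).congr_deriv ?_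
  simp
  field_simp
  ring

/-- At a root the cosine equals `lam` times the sinc term, and after this substitution the
derivative acquires the factor `lam - 1`. Hence `1` is the only possible multiple root. -/
theorem deriv_dispersionFun_of_root {ω : ℝ} (hω : 1 < ω) {lam : ℂ}
    (h : dispersionFun ω lam = 0) :
    deriv (dispersionFun ω) lam = (lam - 1) * (sincRt 1 ((ω : ℂ) ^ 2 - lam ^ 2) * ω ^ 2 /
      ((ω : ℂ) ^ 2 - lam ^ 2)) := by
  have hK := K_ne_zero_of_sq_eq_one hω (sq_eq_one_of_root h)
  rw [(hasDerivAt_dispersionFun hK).deriv]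
  rw [dispersionFun_eq] at h
  rw [show cosRt 1 ((ω : ℂ) ^ 2 - lam ^ 2) = lam * sincRt 1 ((ω : ℂ) ^ 2 - lam ^ 2) by
    linear_combination h]
  field_simp
  ring

theorem deriv_dispersionFun_ne_zero {ω : ℝ} (hω : 1 < ω) {lam : ℂ}
    (h : dispersionFun ω lam = 0) (h1 : lam ≠ 1) : deriv (dispersionFun ω) lam ≠ 0 := by
  rw [deriv_dispersionFun_of_root hω h]
  have hS := sq_eq_one_of_root h
  have hK := K_ne_zero_of_sq_eq_one hω hS
  have hS0 : sincRt 1 ((ω : ℂ) ^ 2 - lam ^ 2) ≠ 0 := by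
    intro h0; rw [h0] at hS; simp at hS
  have : (ω : ℂ) ≠ 0 := by exact_mod_cast (by linarith : ω ≠ 0)
  exact mul_ne_zero (sub_ne_zero.2 h1) (div_ne_zero (mul_ne_zero hS0 (pow_ne_zero _ this)) hK)

/-! ### Holomorphic dependence of integrals on a parameter -/

/-- No bound on the derivative is assumed: Cauchy's estimate on a smaller disc supplies it from the
bound on the integrand. -/
theorem hasDerivAt_integral_of_holomorphic {α : Type*} [MeasurableSpace α] {μ : Measure α}
    {F : ℂ → α → ℂ} {z₀ : ℂ} {r : ℝ} (hr : 0 < r) {b : α → ℝ} (hb : Integrable b μ)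
    (hm : ∀ z ∈ Metric.ball z₀ r, AEStronglyMeasurable (F z) μ)
    (hd : ∀ᵐ a ∂μ, DifferentiableOn ℂ (fun z => F z a) (Metric.ball z₀ r))
    (hF : ∀ᵐ a ∂μ, ∀ z ∈ Metric.ball z₀ r, ‖F z a‖ ≤ b a) :
    HasDerivAt (fun z => ∫ a, F z a ∂μ) (∫ a, deriv (fun z => F z a) z₀ ∂μ) z₀ := by
  have hr2 : 0 < r / 2 := by positivity
  have hz0 : z₀ ∈ Metric.ball z₀ r := Metric.mem_ball_self hr
  have hmeas : AEStronglyMeasurable (fun a => deriv (fun z => F z a) z₀) μ := by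
    -- Measurability of the derivative comes from writing it as a pointwise limit of measurable
    -- difference quotients along these steps, which stay inside the disc.
    let u : ℕ → ℂ := fun n => ((r / 2 / (n + 1) : ℝ) : ℂ)
    have hu0 : ∀ n, u n ≠ 0 := fun n => by
      simp only [u]; exact_mod_cast (by positivity : r / 2 / (n + 1 : ℝ) ≠ 0)
    have hu : Tendsto u atTop (𝓝 0) := by
      have : Tendsto (fun n : ℕ => r / 2 / ((n : ℝ) + 1)) atTop (𝓝 0) := by
        have := tendsto_one_div_add_atTop_nhds_zero_nat (𝕜 := ℝ)
        simpa [div_eq_mul_inv] using this.const_mul (r / 2)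
      exact (Complex.continuous_ofReal.tendsto' 0 0 Complex.ofReal_zero).comp this
    have humem : ∀ n, z₀ + u n ∈ Metric.ball z₀ r := fun n => by
      simp only [Metric.mem_ball, dist_eq_norm, add_sub_cancel_left, u, Complex.norm_real]
      rw [Real.norm_of_nonneg (by positivity)]
      have : r / 2 / ((n : ℝ) + 1) ≤ r / 2 := div_le_self hr2.le (by linarith [n.cast_nonneg (α := ℝ)])
      linarith
    refine aestronglyMeasurable_of_tendsto_ae atTop
      (f := fun n a => (u n)⁻¹ • (F (z₀ + u n) a - F z₀ a)) (fun n => ?_) ?_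
    · exact ((hm _ (humem n)).sub (hm _ hz0)).const_smul (u n)⁻¹
    · filter_upwards [hd] with a ha
      have h1 := (ha.differentiableAt (Metric.isOpen_ball.mem_nhds hz0)).hasDerivAt
      rw [hasDerivAt_iff_tendsto_slope_zero] at h1
      refine h1.comp (tendsto_nhdsWithin_iff.2 ⟨hu, Eventually.of_forall fun n => hu0 n⟩)
  refine (hasDerivAt_integral_of_dominated_loc_of_deriv_le (F' := fun z a => deriv (fun z => F z a) z)
    (s := Metric.ball z₀ (r / 2)) (bound := fun a => b a / (r / 2 / 2))
    (Metric.ball_mem_nhds z₀ hr2) ?_ ?_ hmeas ?_ (hb.div_const _) ?_).2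
  · filter_upwards [Metric.ball_mem_nhds z₀ hr] with z hz using hm z hz
  · exact hb.mono' (hm _ hz0) (by filter_upwards [hF] with a ha using ha _ hz0)
  · filter_upwards [hF, hd] with a ha hda z hz
    have hsub : Metric.closedBall z (r / 2 / 2) ⊆ Metric.ball z₀ r := by
      intro w hw
      simp only [Metric.mem_closedBall, Metric.mem_ball] at hw hz ⊢
      have := dist_triangle w z z₀
      linarith
    refine Complex.norm_deriv_le_of_forall_mem_sphere_norm_le (by positivity)
      (DifferentiableOn.diffContOnCl (hda.mono (Metric.closure_ball_subset_closedBall.trans hsub)))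
      fun w hw => ha w (hsub (Metric.sphere_subset_closedBall hw))
  · filter_upwards [hd] with a ha z hz
    refine (ha.differentiableAt (Metric.isOpen_ball.mem_nhds ?_)).hasDerivAt
    exact Metric.ball_subset_ball (by linarith) hz

/-! ### The first order operator -/

theorem measurableSet_strip : MeasurableSet strip := measurableSet_Ioo.prod MeasurableSet.univ

theorem isOpen_strip : IsOpen strip := isOpen_Ioo.prod isOpen_univ

theorem strip_ae_eq : strip =ᵐ[volume] (Icc (0 : ℝ) 1 ×ˢ (univ : Set ℝ)) :=
  Measure.set_prod_ae_eq Ioo_ae_eq_Icc (ae_eq_refl _)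

theorem dOp_mul {c : ℂ} {φ χ : ℝ × ℝ → ℂ} {p : ℝ × ℝ} (hφ : DifferentiableAt ℝ φ p)
    (hχ : DifferentiableAt ℝ χ p) :
    dOp c (fun p => φ p * χ p) p = φ p * dOp c χ p + χ p * dOp c φ p := by
  simp only [dOp, fderiv_fun_mul hφ hχ]
  simp
  ring

theorem dOp_add {c : ℂ} {φ χ : ℝ × ℝ → ℂ} {p : ℝ × ℝ} (hφ : DifferentiableAt ℝ φ p)
    (hχ : DifferentiableAt ℝ χ p) :
    dOp c (fun p => φ p + χ p) p = dOp c φ p + dOp c χ p := by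
  simp only [dOp, fderiv_fun_add hφ hχ]
  simp
  ring

theorem dOp_const_mul {c a : ℂ} {φ : ℝ × ℝ → ℂ} {p : ℝ × ℝ} (hφ : DifferentiableAt ℝ φ p) :
    dOp c (fun p => a * φ p) p = a * dOp c φ p := by
  simp only [dOp, fderiv_const_mul hφ]
  simp
  ring

theorem fderiv_eq_of_partial {φ : ℝ × ℝ → ℂ} {p : ℝ × ℝ} {a b : ℂ} (hφ : DifferentiableAt ℝ φ p)
    (h1 : HasDerivAt (fun x => φ (x, p.2)) a p.1) (h2 : HasDerivAt (fun y => φ (p.1, y)) b p.2) :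
    fderiv ℝ φ p (1, 0) = a ∧ fderiv ℝ φ p (0, 1) = b := by
  constructor
  · have e : HasFDerivAt φ (fderiv ℝ φ p) ((fun x : ℝ => (x, p.2)) p.1) := hφ.hasFDerivAt
    have := e.comp_hasDerivAt p.1 ((hasDerivAt_id p.1).prodMk (hasDerivAt_const p.1 p.2))
    exact this.unique h1
  · have e : HasFDerivAt φ (fderiv ℝ φ p) ((fun y : ℝ => (p.1, y)) p.2) := hφ.hasFDerivAt
    have := e.comp_hasDerivAt p.2 ((hasDerivAt_const p.2 p.1).prodMk (hasDerivAt_id p.2))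
    exact this.unique h2

theorem dOp_eq_of_partial {c : ℂ} {φ : ℝ × ℝ → ℂ} {p : ℝ × ℝ} {a b : ℂ}
    (hφ : DifferentiableAt ℝ φ p)
    (h1 : HasDerivAt (fun x => φ (x, p.2)) a p.1) (h2 : HasDerivAt (fun y => φ (p.1, y)) b p.2) :
    dOp c φ p = c * a + b := by
  obtain ⟨h3, h4⟩ := fderiv_eq_of_partial hφ h1 h2
  rw [dOp, h3, h4]

theorem dOp_prod {c : ℂ} {X Y : ℝ → ℂ} {x y : ℝ} (hX : DifferentiableAt ℝ X x)
    (hY : DifferentiableAt ℝ Y y) :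
    dOp c (fun p : ℝ × ℝ => X p.1 * Y p.2) (x, y) = c * (deriv X x * Y y) + X x * deriv Y y := by
  apply dOp_eq_of_partial
  · exact (hX.comp (x, y) (g := X) differentiableAt_fst).mul
      (hY.comp (x, y) (g := Y) differentiableAt_snd)
  · exact hX.hasDerivAt.mul_const (Y y)
  · exact hY.hasDerivAt.const_mul (X x)

theorem dOp_conj {c : ℂ} {φ : ℝ × ℝ → ℂ} {p : ℝ × ℝ} (hφ : DifferentiableAt ℝ φ p) :
    dOp c (fun p => conj (φ p)) p = conj (dOp (conj c) φ p) := by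
  have h : HasFDerivAt (fun p => conj (φ p))
      (Complex.conjCLE.toContinuousLinearMap.comp (fderiv ℝ φ p)) p :=
    (Complex.conjCLE.toContinuousLinearMap.hasFDerivAt).comp p hφ.hasFDerivAt
  simp [dOp, h.fderiv]

theorem continuous_dOp {c : ℂ} {φ : ℝ × ℝ → ℂ} (hφ : ContDiff ℝ 1 φ) : Continuous (dOp c φ) := by
  have h := hφ.continuous_fderiv one_ne_zero
  unfold dOp
  fun_prop

/-! ### Divergence theorem on the strip -/

theorem integral_strip_dOp_eq_zero {c : ℂ} {w : ℝ × ℝ → ℂ} (hw : ContDiff ℝ 1 w)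
    (hc : HasCompactSupport w) (h0 : ∀ y, w (0, y) = 0) (h1 : ∀ y, w (1, y) = 0) :
    ∫ p in strip, dOp c w p = 0 := by
  obtain ⟨R, hR0, hR⟩ : ∃ R : ℝ, 0 < R ∧ ∀ p : ℝ × ℝ, R ≤ |p.2| → w p = 0 ∧ dOp c w p = 0 := by
    obtain ⟨R, hR⟩ := hc.isCompact.isBounded.subset_ball 0
    refine ⟨max R 1, by positivity, fun p hp => ?_⟩
    have hp' : p ∉ tsupport w := by
      intro h
      have := hR h
      rw [mem_ball_zero_iff, Prod.norm_def] at this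
      have h2 : |p.2| < R := (le_max_right _ _).trans_lt this
      linarith [le_max_left R 1]
    have h3 : w =ᶠ[𝓝 p] 0 := notMem_tsupport_iff_eventuallyEq.1 hp'
    refine ⟨h3.eq_of_nhds, ?_⟩
    simp only [dOp, h3.fderiv_eq]
    simp
  have hdiv := integral_divergence_prod_Icc_of_hasFDerivAt_of_le (fun p => c * w p) w
    (fun p => c • fderiv ℝ w p) (fun p => fderiv ℝ w p) (0, -R) (1, R)
    (by constructor <;> simp; linarith)
    (by have := hw.continuous; fun_prop) hw.continuous.continuousOn
    (fun p _ => ((hw.differentiable one_ne_zero p).hasFDerivAt).const_mul c)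
    (fun p _ => (hw.differentiable one_ne_zero p).hasFDerivAt)
    ((continuous_dOp (c := c) hw).continuousOn.integrableOn_compact isCompact_Icc)
  have e1 : ∀ x, w (x, R) = 0 := fun x => (hR (x, R) (le_abs_self _)).1
  have e2 : ∀ x, w (x, -R) = 0 := fun x => (hR (x, -R) (by simp [le_abs_self])).1
  simp only [h0, h1, e1, e2] at hdiv
  simp only [intervalIntegral.integral_zero, mul_zero, sub_zero, add_zero] at hdiv
  rw [setIntegral_congr_set strip_ae_eq]
  rw [← hdiv]
  refine setIntegral_eq_of_subset_of_forall_sdiff_eq_zero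
    (measurableSet_Icc.prod MeasurableSet.univ) ?_ ?_
  · rw [← Icc_prod_Icc]
    exact prod_mono le_rfl (subset_univ _)
  · rintro ⟨x, y⟩ ⟨hx, hn⟩
    apply (hR (x, y) _).2
    by_contra hlt
    push Not at hlt
    apply hn
    rw [← Icc_prod_Icc]
    exact ⟨hx.1, (abs_lt.1 hlt).1.le, (abs_lt.1 hlt).2.le⟩

/-- The disjunctions say that on each edge either `u` vanishes or every admissible test function
does, so the product has no boundary flux. -/
theorem hasWeakOp_of_contDiff {c : ℂ} {U : Set (ℝ × ℝ)} {u : ℝ × ℝ → ℂ} (hu : ContDiff ℝ 1 u)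
    (h0 : ∀ y, u (0, y) = 0 ∨ (0, y) ∉ U) (h1 : ∀ y, u (1, y) = 0 ∨ (1, y) ∉ U) :
    HasWeakOp c U u (dOp c u) := by
  intro φ hφ hφc hφU
  have hφ1 : ContDiff ℝ 1 φ := hφ.of_le (by exact_mod_cast le_top)
  have hz : ∀ p, p ∉ U → φ p = 0 := fun p hp => image_eq_zero_of_notMem_tsupport fun h => hp (hφU h)
  have h := integral_strip_dOp_eq_zero (c := c) (w := fun p => u p * φ p) (hu.mul hφ1)
    (hφc.mul_left)
    (fun y => by rcases h0 y with h | h <;> simp [h, hz])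
    (fun y => by rcases h1 y with h | h <;> simp [h, hz])
  have e : ∀ p, dOp c (fun p => u p * φ p) p = u p * dOp c φ p + dOp c u p * φ p := fun p => by
    rw [dOp_mul (hu.differentiable one_ne_zero p) (hφ1.differentiable one_ne_zero p)]; ring
  simp only [e] at h
  have hcs : HasCompactSupport (dOp c φ) := by
    refine hφc.mono' (fun p hp => ?_)
    by_contra hn
    apply hp
    have h3 : φ =ᶠ[𝓝 p] 0 := notMem_tsupport_iff_eventuallyEq.1 hn
    simp only [dOp, h3.fderiv_eq]
    simp
  have i1 : IntegrableOn (fun p => u p * dOp c φ p) strip :=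
    ((hu.continuous.mul (continuous_dOp hφ1)).integrable_of_hasCompactSupport
      hcs.mul_left).integrableOn
  have i2 : IntegrableOn (fun p => dOp c u p * φ p) strip :=
    (((continuous_dOp hu).mul hφ1.continuous).integrable_of_hasCompactSupport
      hφc.mul_left).integrableOn
  rw [integral_add i1 i2] at h
  linear_combination h

/-! ### Green's formula with general test functions -/

theorem exists_bound_deriv_smoothTransition :
    ∃ M : ℝ, 0 < M ∧ ∀ t, |deriv Real.smoothTransition t| ≤ M := by
  have hc : Continuous (deriv Real.smoothTransition) :=
    (Real.smoothTransition.contDiff (n := 1)).continuous_deriv le_rfl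
  obtain ⟨M, hM⟩ := isCompact_Icc.exists_bound_of_continuousOn (s := Icc (-1 : ℝ) 2) hc.continuousOn
  refine ⟨max M 1, by positivity, fun t => ?_⟩
  by_cases ht : t ∈ Icc (-1 : ℝ) 2
  · exact (hM t ht).trans (le_max_left _ _)
  · have : deriv Real.smoothTransition t = 0 := by
      rw [mem_Icc, not_and_or] at ht
      rcases ht with h | h
      · have : Real.smoothTransition =ᶠ[𝓝 t] fun _ => 0 := by
          filter_upwards [Iio_mem_nhds (not_le.1 h)] with s hs
          exact Real.smoothTransition.zero_of_nonpos (by rw [mem_Iio] at hs; linarith)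
        rw [this.deriv_eq]; simp
      · have : Real.smoothTransition =ᶠ[𝓝 t] fun _ => 1 := by
          filter_upwards [Ioi_mem_nhds (not_le.1 h)] with s hs
          exact Real.smoothTransition.one_of_one_le (by rw [mem_Ioi] at hs; linarith)
        rw [this.deriv_eq]; simp
    rw [this]; simp

theorem deriv_smoothTransition_eq_zero {t : ℝ} (ht : t < 0 ∨ 1 < t) :
    deriv Real.smoothTransition t = 0 := by
  rcases ht with h | h
  · have : Real.smoothTransition =ᶠ[𝓝 t] fun _ => 0 := by
      filter_upwards [Iio_mem_nhds h] with s hs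
      exact Real.smoothTransition.zero_of_nonpos (le_of_lt hs)
    rw [this.deriv_eq]; simp
  · have : Real.smoothTransition =ᶠ[𝓝 t] fun _ => 1 := by
      filter_upwards [Ioi_mem_nhds h] with s hs
      exact Real.smoothTransition.one_of_one_le (le_of_lt hs)
    rw [this.deriv_eq]; simp

/-- Cutoff in the direction across the strip: vanishes near the edge `x₀ + σ x = 0`. -/
def xCut (x₀ σ : ℝ) (n : ℕ) (x : ℝ) : ℝ := Real.smoothTransition ((x₀ + σ * x) * (n + 1) - 1)

/-- Cutoff along the strip. -/
def yCut (n : ℕ) (y : ℝ) : ℝ := Real.smoothTransition (2 - y ^ 2 / (n + 1) ^ 2)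

theorem contDiff_xCut (x₀ σ : ℝ) (n : ℕ) {k : ℕ∞} : ContDiff ℝ k (xCut x₀ σ n) :=
  Real.smoothTransition.contDiff.comp (by fun_prop)

theorem contDiff_yCut (n : ℕ) {k : ℕ∞} : ContDiff ℝ k (yCut n) :=
  Real.smoothTransition.contDiff.comp (by fun_prop)

theorem hasDerivAt_smoothTransition (t : ℝ) :
    HasDerivAt Real.smoothTransition (deriv Real.smoothTransition t) t :=
  ((Real.smoothTransition.contDiff (n := 1)).differentiable one_ne_zero t).hasDerivAt

/-- The derivative of the cutoff has size `n + 1` but is supported where the distance to the edge is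
at most `2 / (n + 1)`. Weighted by that distance it is bounded uniformly in `n`, so a test function
vanishing only linearly at the edge can be admitted in Green's formula. -/
theorem abs_deriv_xCut_mul_le {M : ℝ} (hM : ∀ t, |deriv Real.smoothTransition t| ≤ M)
    {x₀ σ : ℝ} (hσ : |σ| = 1) (n : ℕ) {x : ℝ} (hx : 0 ≤ x₀ + σ * x) :
    |deriv (xCut x₀ σ n) x| * (x₀ + σ * x) ≤ 2 * M := by
  have hd : HasDerivAt (xCut x₀ σ n)
      (deriv Real.smoothTransition ((x₀ + σ * x) * (n + 1) - 1) * (σ * (n + 1))) x := by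
    refine (hasDerivAt_smoothTransition _).comp x ?_
    have := (((hasDerivAt_id x).const_mul σ).const_add x₀).mul_const ((n : ℝ) + 1) |>.sub_const 1
    simpa using this
  rw [hd.deriv, abs_mul, abs_mul, hσ, one_mul, abs_of_pos (by positivity : (0 : ℝ) < n + 1)]
  by_cases h : 1 < (x₀ + σ * x) * (n + 1) - 1
  · rw [deriv_smoothTransition_eq_zero (Or.inr h)]
    simp
    exact (abs_nonneg _).trans (hM 0)
  · push Not at h
    have h2 : (x₀ + σ * x) * (n + 1) ≤ 2 := by linarith
    have h3 := hM ((x₀ + σ * x) * (n + 1) - 1)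
    have h4 := abs_nonneg (deriv Real.smoothTransition ((x₀ + σ * x) * (n + 1) - 1))
    have h5 : 0 ≤ (x₀ + σ * x) * (n + 1) := by positivity
    nlinarith

theorem abs_deriv_yCut_le {M : ℝ} (hM : ∀ t, |deriv Real.smoothTransition t| ≤ M)
    (n : ℕ) (y : ℝ) : |deriv (yCut n) y| ≤ 4 * M := by
  have hd : HasDerivAt (yCut n)
      (deriv Real.smoothTransition (2 - y ^ 2 / (n + 1) ^ 2) * (-(2 * y / (n + 1) ^ 2))) y := by
    refine (hasDerivAt_smoothTransition _).comp y ?_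
    have := ((hasDerivAt_pow 2 y).div_const (((n : ℝ) + 1) ^ 2)).const_sub 2
    simpa using this
  have hM0 : 0 ≤ M := (abs_nonneg _).trans (hM 0)
  rw [hd.deriv, abs_mul]
  by_cases h : 2 - y ^ 2 / ((n : ℝ) + 1) ^ 2 < 0
  · rw [deriv_smoothTransition_eq_zero (Or.inl h)]
    simp [hM0]
  · push Not at h
    have hn : (1 : ℝ) ≤ n + 1 := by linarith [n.cast_nonneg (α := ℝ)]
    have h2 : y ^ 2 ≤ 2 * ((n : ℝ) + 1) ^ 2 := by
      rw [sub_nonneg, div_le_iff₀ (by positivity)] at h; exact h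
    have h3 : |y| ≤ 2 * ((n : ℝ) + 1) := abs_le_of_sq_le_sq (by nlinarith) (by positivity)
    have h4 : |-(2 * y / ((n : ℝ) + 1) ^ 2)| ≤ 4 := by
      rw [abs_neg, abs_div, abs_mul, abs_two, abs_of_pos (by positivity : (0 : ℝ) < ((n : ℝ) + 1) ^ 2),
        div_le_iff₀ (by positivity)]
      nlinarith
    have := mul_le_mul (hM (2 - y ^ 2 / ((n : ℝ) + 1) ^ 2)) h4 (abs_nonneg _) hM0
    linarith

/-- Green's formula for test functions which need not have compact support, and which only vanish
linearly at the edge `x₀ + σ x = 0`. -/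
theorem HasWeakOp.green {c : ℂ} {x₀ σ : ℝ} (hσ : |σ| = 1)
    (hℓ : ∀ x ∈ Ioo (0 : ℝ) 1, x₀ + σ * x ∈ Ioo (0 : ℝ) 1) {u f : ℝ × ℝ → ℂ}
    (h : HasWeakOp c {p | 0 < x₀ + σ * p.1} u f)
    (hu : AEStronglyMeasurable u (volume.restrict strip))
    (hf : AEStronglyMeasurable f (volume.restrict strip))
    {φ : ℝ × ℝ → ℂ} (hφ : ContDiff ℝ (⊤ : ℕ∞) φ) {B : ℝ → ℝ}
    (hB1 : ∀ x ∈ Ioo (0 : ℝ) 1, ∀ y, ‖φ (x, y)‖ ≤ (x₀ + σ * x) * B y)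
    (hB2 : ∀ x ∈ Ioo (0 : ℝ) 1, ∀ y, ‖dOp c φ (x, y)‖ ≤ B y)
    (huB : Integrable (fun p => ‖u p‖ * B p.2) (volume.restrict strip))
    (hfB : Integrable (fun p => ‖f p‖ * B p.2) (volume.restrict strip)) :
    ∫ p in strip, u p * dOp c φ p = - ∫ p in strip, f p * φ p := by
  obtain ⟨M, hM0, hM⟩ := exists_bound_deriv_smoothTransition
  have hφ1 : ContDiff ℝ 1 φ := hφ.of_le (by exact_mod_cast le_top)
  set χ : ℕ → ℝ × ℝ → ℂ := fun n p => (xCut x₀ σ n p.1 : ℂ) * (yCut n p.2 : ℂ) with hχ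
  have hcx : ∀ n, ContDiff ℝ (⊤ : ℕ∞) (fun x : ℝ => (xCut x₀ σ n x : ℂ)) := fun n =>
    Complex.ofRealCLM.contDiff.comp (contDiff_xCut x₀ σ n)
  have hcy : ∀ n, ContDiff ℝ (⊤ : ℕ∞) (fun x : ℝ => (yCut n x : ℂ)) := fun n =>
    Complex.ofRealCLM.contDiff.comp (contDiff_yCut n)
  have hχs : ∀ n, ContDiff ℝ (⊤ : ℕ∞) (χ n) := fun n =>
    ((hcx n).comp contDiff_fst).mul ((hcy n).comp contDiff_snd)
  have hχ1 : ∀ n p, ‖χ n p‖ ≤ 1 := fun n p => by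
    simp only [hχ, norm_mul, Complex.norm_real, xCut, yCut]
    rw [Real.norm_of_nonneg (Real.smoothTransition.nonneg _),
      Real.norm_of_nonneg (Real.smoothTransition.nonneg _)]
    exact mul_le_one₀ (Real.smoothTransition.le_one _) (Real.smoothTransition.nonneg _)
      (Real.smoothTransition.le_one _)
  have hder : ∀ n x y, dOp c (χ n) (x, y) =
      c * ((deriv (xCut x₀ σ n) x : ℝ) * (yCut n y : ℂ)) +
        (xCut x₀ σ n x : ℂ) * (deriv (yCut n) y : ℝ) := fun n x y => by
    have e1 : HasDerivAt (fun x : ℝ => (xCut x₀ σ n x : ℂ)) (deriv (xCut x₀ σ n) x : ℝ) x :=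
      ((contDiff_xCut x₀ σ n (k := 1)).differentiable one_ne_zero x).hasDerivAt.ofReal_comp
    have e2 : HasDerivAt (fun x : ℝ => (yCut n x : ℂ)) (deriv (yCut n) y : ℝ) y :=
      ((contDiff_yCut n (k := 1)).differentiable one_ne_zero y).hasDerivAt.ofReal_comp
    have := dOp_prod (c := c) e1.differentiableAt e2.differentiableAt
    rw [e1.deriv, e2.deriv] at this
    exact this
  have hB0 : ∀ y, 0 ≤ B y := fun y => (norm_nonneg _).trans (hB2 (1 / 2) (by norm_num) y)
  have hsT : ∀ t, ‖((Real.smoothTransition t : ℝ) : ℂ)‖ ≤ 1 := fun t => by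
    rw [Complex.norm_real, Real.norm_of_nonneg (Real.smoothTransition.nonneg _)]
    exact Real.smoothTransition.le_one _
  have hφχ : ∀ n, ∀ x ∈ Ioo (0 : ℝ) 1, ∀ y, ‖φ (x, y) * dOp c (χ n) (x, y)‖ ≤
      (‖c‖ * (2 * M) + 4 * M) * B y := by
    intro n x hx y
    rw [norm_mul, hder]
    have hl := hℓ x hx
    have k1 := abs_deriv_xCut_mul_le hM hσ n hl.1.le
    have k2 := abs_deriv_yCut_le hM n y
    have k3 : ‖c * ((deriv (xCut x₀ σ n) x : ℝ) * (yCut n y : ℂ)) +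
        (xCut x₀ σ n x : ℂ) * (deriv (yCut n) y : ℝ)‖ ≤
        ‖c‖ * |deriv (xCut x₀ σ n) x| + |deriv (yCut n) y| := by
      refine (norm_add_le _ _).trans (add_le_add ?_ ?_)
      · rw [norm_mul, norm_mul, Complex.norm_real, Real.norm_eq_abs]
        exact mul_le_mul_of_nonneg_left
          (mul_le_of_le_one_right (abs_nonneg _) (hsT _)) (norm_nonneg _)
      · rw [norm_mul, Complex.norm_real (deriv (yCut n) y), Real.norm_eq_abs]
        exact mul_le_of_le_one_left (abs_nonneg _) (hsT _)
    calc ‖φ (x, y)‖ * _ ≤ ((x₀ + σ * x) * B y) *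
          (‖c‖ * |deriv (xCut x₀ σ n) x| + |deriv (yCut n) y|) :=
          mul_le_mul (hB1 x hx y) k3 (norm_nonneg _) (mul_nonneg hl.1.le (hB0 y))
      _ = (‖c‖ * (|deriv (xCut x₀ σ n) x| * (x₀ + σ * x)) +
            (x₀ + σ * x) * |deriv (yCut n) y|) * B y := by ring
      _ ≤ _ := by
          refine mul_le_mul_of_nonneg_right (add_le_add ?_ ?_) (hB0 y)
          · exact mul_le_mul_of_nonneg_left k1 (norm_nonneg _)
          · have := mul_le_mul hl.2.le k2 (abs_nonneg _) zero_le_one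
            linarith
  have hn : ∀ n, ∫ p in strip, u p * dOp c (fun p => χ n p * φ p) p =
      - ∫ p in strip, f p * (χ n p * φ p) := by
    intro n
    -- An auxiliary cutoff in `x`, equal to `1` on the strip: it makes the support compact beyond
    -- the far edge without changing any integral. It vanishes for `x² ≥ 8`, hence the interval
    -- `[-3, 3]`.
    set ψ : ℝ × ℝ → ℂ := fun p => (yCut 1 p.1 : ℂ) with hψ
    set S : Set (ℝ × ℝ) := {p | 1 ≤ (x₀ + σ * p.1) * ((n : ℝ) + 1)} ∩
      (Icc (-3) 3 ×ˢ Icc (-(2 * ((n : ℝ) + 1))) (2 * ((n : ℝ) + 1))) with hS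
    have hScl : IsClosed {p : ℝ × ℝ | 1 ≤ (x₀ + σ * p.1) * ((n : ℝ) + 1)} :=
      isClosed_le continuous_const (by fun_prop)
    have hSc : IsCompact S := (isCompact_Icc.prod isCompact_Icc).inter_left hScl
    have hzero : ∀ p, p ∉ S → ψ p * (χ n p * φ p) = 0 := by
      intro p hp
      by_contra hne
      apply hp
      simp only [hψ, hχ, mul_eq_zero, not_or, Complex.ofReal_eq_zero, xCut, yCut,
        Real.smoothTransition.zero_iff_nonpos, not_le] at hne
      obtain ⟨e1, ⟨e2, e3⟩, -⟩ := hne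
      have e1' : p.1 ^ 2 / 2 ^ 2 < 2 := by push_cast at e1; norm_num at e1 ⊢; linarith
      have e3' : p.2 ^ 2 / ((n : ℝ) + 1) ^ 2 < 2 := by linarith
      rw [div_lt_iff₀ (by positivity)] at e1' e3'
      refine ⟨by simp only [mem_ofPred_eq]; linarith, ?_, ?_⟩
      · exact abs_le.1 (abs_le_of_sq_le_sq (by linarith) (by norm_num))
      · exact abs_le.1 (abs_le_of_sq_le_sq (by nlinarith) (by positivity))
    have hsub : tsupport (fun p => ψ p * (χ n p * φ p)) ⊆ S :=
      closure_minimal (fun p hp => by_contra fun hn => hp (hzero p hn)) hSc.isClosed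
    have key := h (fun p => ψ p * (χ n p * φ p))
      (((hcy 1).comp contDiff_fst).mul ((hχs n).mul hφ))
      (HasCompactSupport.intro hSc fun p hp => hzero p hp) (hsub.trans ?_)
    · have hψ1 : ∀ p ∈ strip, (fun p => ψ p * (χ n p * φ p)) =ᶠ[𝓝 p] fun p => χ n p * φ p := by
        intro p hp
        filter_upwards [isOpen_strip.mem_nhds hp] with q hq
        have : ψ q = 1 := by
          simp only [hψ, yCut]
          rw [Real.smoothTransition.one_of_one_le]
          · simp
          · have h1 := hq.1.1
            have h2 := hq.1.2
            norm_num
            nlinarith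
        rw [this, one_mul]
      rw [setIntegral_congr_fun measurableSet_strip (g := fun p => u p * dOp c
        (fun p => ψ p * (χ n p * φ p)) p), key, setIntegral_congr_fun measurableSet_strip]
      · intro p hp
        simp only [(hψ1 p hp).eq_of_nhds]
      · intro p hp
        simp only [dOp, (hψ1 p hp).fderiv_eq]
    · intro p hp
      have h1 : 1 ≤ (x₀ + σ * p.1) * ((n : ℝ) + 1) := hp.1
      by_contra hcon
      simp only [mem_ofPred_eq, not_lt] at hcon
      nlinarith [n.cast_nonneg (α := ℝ)]
  have hmem : ∀ᵐ p ∂(volume.restrict strip), p ∈ strip := ae_restrict_mem measurableSet_strip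
  -- Near each point of the strip the cutoffs are eventually identically `1`, so their derivatives
  -- disappear in the pointwise limit; the uniform bound `hφχ` then allows dominated convergence.
  have hev : ∀ p ∈ strip, ∀ᶠ n in atTop, χ n =ᶠ[𝓝 p] fun _ => 1 := by
    rintro ⟨x, y⟩ hp
    have hl := (hℓ x hp.1).1
    obtain ⟨m, hm⟩ := exists_nat_gt (max (3 / (x₀ + σ * x)) (|y| + 1))
    filter_upwards [eventually_ge_atTop m] with n hn
    have hmn : (m : ℝ) ≤ n := by exact_mod_cast hn
    have a1 : 3 < (x₀ + σ * x) * n := by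
      have := (le_max_left _ _).trans_lt hm
      rw [div_lt_iff₀ hl] at this
      nlinarith
    have a2 : |y| < n := by linarith [(le_max_right _ _).trans_lt hm]
    have o1 : ∀ᶠ q : ℝ × ℝ in 𝓝 (x, y), 3 < (x₀ + σ * q.1) * n :=
      (isOpen_lt continuous_const (by fun_prop)).mem_nhds a1
    have o2 : ∀ᶠ q : ℝ × ℝ in 𝓝 (x, y), |q.2| < n :=
      (isOpen_lt (by fun_prop) continuous_const).mem_nhds a2
    filter_upwards [o1, o2] with q h1 h2
    have h0 : 0 < x₀ + σ * q.1 := by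
      by_contra hcon
      push Not at hcon
      nlinarith [n.cast_nonneg (α := ℝ)]
    simp only [hχ, xCut, yCut]
    rw [Real.smoothTransition.one_of_one_le (by nlinarith),
      Real.smoothTransition.one_of_one_le]
    · simp
    · have : q.2 ^ 2 / ((n : ℝ) + 1) ^ 2 ≤ 1 := by
        rw [div_le_one (by positivity), ← sq_abs]
        apply pow_le_pow_left₀ (abs_nonneg _)
        linarith
      linarith
  have hχd : ∀ n p, DifferentiableAt ℝ (χ n) p := fun n p =>
    (hχs n).differentiable (by simp) p
  have t1 : Tendsto (fun n => ∫ p in strip, u p * dOp c (fun p => χ n p * φ p) p) atTop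
      (𝓝 (∫ p in strip, u p * dOp c φ p)) := by
    refine tendsto_integral_of_dominated_convergence
      (fun p => (1 + (‖c‖ * (2 * M) + 4 * M)) * (‖u p‖ * B p.2)) ?_ (huB.const_mul _) ?_ ?_
    · intro n
      exact hu.mul (continuous_dOp (((hχs n).of_le (by exact_mod_cast le_top)).mul hφ1)).aestronglyMeasurable
    · intro n
      filter_upwards [hmem] with ⟨x, y⟩ hp
      rw [dOp_mul (hχd n _) (hφ1.differentiable one_ne_zero _), norm_mul]
      have k1 := hφχ n x hp.1 y
      have k2 : ‖χ n (x, y) * dOp c φ (x, y)‖ ≤ B y := by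
        rw [norm_mul]
        exact (mul_le_of_le_one_left (norm_nonneg _) (hχ1 n _)).trans (hB2 x hp.1 y)
      have k3 := norm_add_le (χ n (x, y) * dOp c φ (x, y)) (φ (x, y) * dOp c (χ n) (x, y))
      have : ‖χ n (x, y) * dOp c φ (x, y) + φ (x, y) * dOp c (χ n) (x, y)‖ ≤
        (1 + (‖c‖ * (2 * M) + 4 * M)) * B y := by linarith
      calc _ ≤ ‖u (x, y)‖ * ((1 + (‖c‖ * (2 * M) + 4 * M)) * B y) :=
            mul_le_mul_of_nonneg_left this (norm_nonneg _)
        _ = _ := by ring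
    · filter_upwards [hmem] with p hp
      refine tendsto_const_nhds.congr' ?_
      filter_upwards [hev p hp] with n hn
      have : (fun p => χ n p * φ p) =ᶠ[𝓝 p] φ := by
        filter_upwards [hn] with q hq
        rw [hq, one_mul]
      simp only [dOp, this.fderiv_eq]
  have t2 : Tendsto (fun n => - ∫ p in strip, f p * (χ n p * φ p)) atTop
      (𝓝 (- ∫ p in strip, f p * φ p)) := by
    refine Tendsto.neg (tendsto_integral_of_dominated_convergence
      (fun p => (‖f p‖ * B p.2)) ?_ hfB ?_ ?_)
    · intro n
      exact hf.mul ((hχs n).continuous.mul hφ1.continuous).aestronglyMeasurable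
    · intro n
      filter_upwards [hmem] with ⟨x, y⟩ hp
      rw [norm_mul]
      refine mul_le_mul_of_nonneg_left ?_ (norm_nonneg _)
      rw [norm_mul]
      refine (mul_le_of_le_one_left (norm_nonneg _) (hχ1 n _)).trans ((hB1 x hp.1 y).trans ?_)
      exact mul_le_of_le_one_left (hB0 y) (hℓ x hp.1).2.le
    · filter_upwards [hmem] with p hp
      refine tendsto_const_nhds.congr' ?_
      filter_upwards [hev p hp] with n hn
      rw [hn.eq_of_nhds, one_mul]
  simp only [hn] at t1
  exact tendsto_nhds_unique t1 t2

/-! ### Functions of moderate growth along the strip -/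

/-- `e^{-γ|y|} u ∈ L²(strip)`. -/
def MemTempered (γ : ℝ) (u : ℝ × ℝ → ℂ) : Prop :=
  MemLp (fun p : ℝ × ℝ => (Real.exp (-(γ * |p.2|)) : ℂ) * u p) 2 (volume.restrict strip)

theorem integrable_exp_neg_abs {a : ℝ} (ha : 0 < a) :
    Integrable (fun y : ℝ => Real.exp (-(a * |y|))) := by
  rw [← integrableOn_univ, ← Iic_union_Ioi (a := (0 : ℝ))]
  refine IntegrableOn.union ?_ ?_
  · refine (integrableOn_exp_mul_Iic ha 0).congr_fun (fun y hy => ?_) measurableSet_Iic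
    rw [mem_Iic] at hy
    simp only [abs_of_nonpos hy]; ring_nf
  · refine (integrableOn_exp_mul_Ioi (neg_lt_zero.2 ha) 0).congr_fun (fun y hy => ?_)
      measurableSet_Ioi
    rw [mem_Ioi] at hy
    simp only [abs_of_pos hy]; ring_nf

theorem volume_restrict_strip :
    (volume : Measure (ℝ × ℝ)).restrict strip = (volume.restrict (Ioo (0 : ℝ) 1)).prod volume := by
  rw [strip, Measure.volume_eq_prod, ← Measure.prod_restrict, Measure.restrict_univ]

theorem integrable_strip_of_snd {b : ℝ → ℝ} (hb : Integrable b) :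
    Integrable (fun p : ℝ × ℝ => b p.2) (volume.restrict strip) := by
  rw [volume_restrict_strip]
  exact hb.comp_snd _

theorem memLp_exp_neg_abs {a : ℝ} (ha : 0 < a) :
    MemLp (fun p : ℝ × ℝ => Real.exp (-(a * |p.2|))) 2 (volume.restrict strip) := by
  rw [memLp_two_iff_integrable_sq (by fun_prop)]
  refine (integrable_strip_of_snd (integrable_exp_neg_abs (a := 2 * a) (by positivity))).congr
    (Eventually.of_forall fun p => ?_)
  simp only [← Real.exp_nat_mul]
  congr 1; push_cast; ring

theorem aestronglyMeasurable_of_exp_mul {w : ℝ × ℝ → ℝ} (hw : Continuous w) {u : ℝ × ℝ → ℂ}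
    {μ : Measure (ℝ × ℝ)}
    (h : AEStronglyMeasurable (fun p => (Real.exp (w p) : ℂ) * u p) μ) :
    AEStronglyMeasurable u μ := by
  have h2 : AEStronglyMeasurable (fun p => (Real.exp (-(w p)) : ℂ)) μ := by
    apply Continuous.aestronglyMeasurable; fun_prop
  refine (h2.mul h).congr (Eventually.of_forall fun p => ?_)
  simp only [Pi.mul_apply]
  rw [← mul_assoc, ← Complex.ofReal_mul, ← Real.exp_add]
  simp

theorem MemTempered.aestronglyMeasurable {γ : ℝ} {u : ℝ × ℝ → ℂ} (h : MemTempered γ u) :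
    AEStronglyMeasurable u (volume.restrict strip) :=
  aestronglyMeasurable_of_exp_mul (w := fun p => -(γ * |p.2|)) (by fun_prop) h.1

theorem MemTempered.integrable {γ s : ℝ} (hs : γ < s) {u : ℝ × ℝ → ℂ} (h : MemTempered γ u) :
    Integrable (fun p => ‖u p‖ * Real.exp (-(s * |p.2|))) (volume.restrict strip) := by
  have h1 := MemLp.integrable_mul (memLp_exp_neg_abs (sub_pos.2 hs)) h.norm
  refine h1.congr (Eventually.of_forall fun p => ?_)
  simp only [Pi.mul_apply, norm_mul, Complex.norm_real, Real.norm_of_nonneg (Real.exp_pos _).le]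
  rw [← mul_assoc, ← Real.exp_add, mul_comm]
  congr 2; ring

theorem MemTempered.add {γ : ℝ} {u v : ℝ × ℝ → ℂ} (hu : MemTempered γ u) (hv : MemTempered γ v) :
    MemTempered γ (fun p => u p + v p) := by
  refine (MemLp.add hu hv).congr_norm ?_ (Eventually.of_forall fun p => ?_)
  · exact (MemLp.add hu hv).1.congr (Eventually.of_forall fun p => by simp [mul_add])
  · simp [mul_add]

theorem MemTempered.const_mul {γ : ℝ} {u : ℝ × ℝ → ℂ} (hu : MemTempered γ u) (c : ℂ) :
    MemTempered γ (fun p => c * u p) := by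
  have := MemLp.const_mul hu c
  unfold MemTempered
  convert this using 2
  ring

theorem MemTempered.of_norm_le {β γ : ℝ} (hβ : β < γ) {u : ℝ × ℝ → ℂ} (hu : Continuous u) {C : ℝ}
    (h : ∀ x ∈ Ioo (0 : ℝ) 1, ∀ y, ‖u (x, y)‖ ≤ C * Real.exp (β * |y|)) : MemTempered γ u := by
  refine ((memLp_exp_neg_abs (sub_pos.2 hβ)).const_mul C).mono' (by
    apply Continuous.aestronglyMeasurable; fun_prop) ?_
  filter_upwards [ae_restrict_mem measurableSet_strip] with ⟨x, y⟩ hp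
  simp only [norm_mul, Complex.norm_real, Real.norm_of_nonneg (Real.exp_pos _).le]
  calc Real.exp (-(γ * |y|)) * ‖u (x, y)‖ ≤ Real.exp (-(γ * |y|)) * (C * Real.exp (β * |y|)) :=
        mul_le_mul_of_nonneg_left (h x hp.1 y) (Real.exp_pos _).le
    _ = C * Real.exp (-((γ - β) * |y|)) := by
        rw [mul_left_comm, ← Real.exp_add]; congr 2; ring

theorem MemWeightedL2.memTempered {s γ : ℝ} (hs : |s| ≤ γ) {u : ℝ × ℝ → ℂ}
    (h : MemWeightedL2 s u) : MemTempered γ u := by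
  refine MemLp.mono h ?_ (Eventually.of_forall fun p => ?_)
  · have := aestronglyMeasurable_of_exp_mul (w := fun p : ℝ × ℝ => s * p.2) (by fun_prop) h.1
    refine AEStronglyMeasurable.mul ?_ this
    apply Continuous.aestronglyMeasurable; fun_prop
  · simp only [norm_mul, Complex.norm_real, Real.norm_of_nonneg (Real.exp_pos _).le]
    refine mul_le_mul_of_nonneg_right (Real.exp_le_exp.2 ?_) (norm_nonneg _)
    have h1 := neg_abs_le (s * p.2)
    rw [abs_mul] at h1
    nlinarith [abs_nonneg p.2]

/-! ### The homogeneous problem and Green's formula for product test functions -/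

/-- `(u, v)` is a tempered solution of the homogeneous problem. -/
structure IsHomogeneous (ω γ : ℝ) (u v : ℝ × ℝ → ℂ) : Prop where
  memU : MemTempered γ u
  memV : MemTempered γ v
  eqU : HasWeakOp I {p | p.1 < 1} u (fun p => -(ω * v p))
  eqV : HasWeakOp (-I) {p | 0 < p.1} v (fun p => ω * u p)

theorem HasWeakOp.green_right {c : ℂ} {u f : ℝ × ℝ → ℂ} (h : HasWeakOp c {p | p.1 < 1} u f)
    (hu : AEStronglyMeasurable u (volume.restrict strip))
    (hf : AEStronglyMeasurable f (volume.restrict strip))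
    {φ : ℝ × ℝ → ℂ} (hφ : ContDiff ℝ (⊤ : ℕ∞) φ) {B : ℝ → ℝ}
    (hB1 : ∀ x ∈ Ioo (0 : ℝ) 1, ∀ y, ‖φ (x, y)‖ ≤ (1 - x) * B y)
    (hB2 : ∀ x ∈ Ioo (0 : ℝ) 1, ∀ y, ‖dOp c φ (x, y)‖ ≤ B y)
    (huB : Integrable (fun p => ‖u p‖ * B p.2) (volume.restrict strip))
    (hfB : Integrable (fun p => ‖f p‖ * B p.2) (volume.restrict strip)) :
    ∫ p in strip, u p * dOp c φ p = - ∫ p in strip, f p * φ p := by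
  refine HasWeakOp.green (x₀ := 1) (σ := -1) (by simp) (fun x hx => ?_) ?_ hu hf hφ
    (B := B) (fun x hx y => ?_) hB2 huB hfB
  · constructor <;> linarith [hx.1, hx.2]
  · have e : {p : ℝ × ℝ | 0 < 1 + -1 * p.1} = {p | p.1 < 1} := by
      ext p; simp only [mem_ofPred_eq]; constructor <;> intro h <;> linarith
    rwa [e]
  · convert hB1 x hx y using 2; ring

theorem HasWeakOp.green_left {c : ℂ} {u f : ℝ × ℝ → ℂ} (h : HasWeakOp c {p | 0 < p.1} u f)
    (hu : AEStronglyMeasurable u (volume.restrict strip))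
    (hf : AEStronglyMeasurable f (volume.restrict strip))
    {φ : ℝ × ℝ → ℂ} (hφ : ContDiff ℝ (⊤ : ℕ∞) φ) {B : ℝ → ℝ}
    (hB1 : ∀ x ∈ Ioo (0 : ℝ) 1, ∀ y, ‖φ (x, y)‖ ≤ x * B y)
    (hB2 : ∀ x ∈ Ioo (0 : ℝ) 1, ∀ y, ‖dOp c φ (x, y)‖ ≤ B y)
    (huB : Integrable (fun p => ‖u p‖ * B p.2) (volume.restrict strip))
    (hfB : Integrable (fun p => ‖f p‖ * B p.2) (volume.restrict strip)) :
    ∫ p in strip, u p * dOp c φ p = - ∫ p in strip, f p * φ p := by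
  refine HasWeakOp.green (x₀ := 0) (σ := 1) (by simp) (fun x hx => ?_) ?_ hu hf hφ
    (B := B) (fun x hx y => ?_) hB2 huB hfB
  · constructor <;> linarith [hx.1, hx.2]
  · have e : {p : ℝ × ℝ | 0 < 0 + 1 * p.1} = {p | 0 < p.1} := by
      ext p; simp only [mem_ofPred_eq]; constructor <;> intro h <;> linarith
    rwa [e]
  · convert hB1 x hx y using 2; ring

theorem exists_bound_of_contDiff {X : ℝ → ℂ} (hX : ContDiff ℝ (⊤ : ℕ∞) X) :
    ∃ C : ℝ, 0 ≤ C ∧ ∀ x ∈ Icc (0 : ℝ) 1, ‖X x‖ ≤ C ∧ ‖deriv X x‖ ≤ C ∧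
      ‖X x - X 0‖ ≤ x * C ∧ ‖X x - X 1‖ ≤ (1 - x) * C := by
  have hd : Continuous (deriv X) := hX.continuous_deriv (by simp)
  obtain ⟨C1, h1⟩ := isCompact_Icc.exists_bound_of_continuousOn (s := Icc (0 : ℝ) 1)
    hX.continuous.continuousOn
  obtain ⟨C2, h2⟩ := isCompact_Icc.exists_bound_of_continuousOn (s := Icc (0 : ℝ) 1) hd.continuousOn
  have h01 : (0 : ℝ) ∈ Icc (0 : ℝ) 1 := by simp
  have h11 : (1 : ℝ) ∈ Icc (0 : ℝ) 1 := by simp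
  have hC2 : 0 ≤ C2 := (norm_nonneg _).trans (h2 0 h01)
  have hlip : ∀ a ∈ Icc (0 : ℝ) 1, ∀ b ∈ Icc (0 : ℝ) 1, ‖X b - X a‖ ≤ C2 * ‖b - a‖ :=
    fun a ha b hb => (convex_Icc (0 : ℝ) 1).norm_image_sub_le_of_norm_deriv_le
      (fun x _ => hX.differentiable (by simp) x) h2 ha hb
  refine ⟨max C1 C2, hC2.trans (le_max_right _ _), fun x hx => ⟨(h1 x hx).trans (le_max_left _ _),
    (h2 x hx).trans (le_max_right _ _), ?_, ?_⟩⟩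
  · have := hlip 0 h01 x hx
    rw [sub_zero, Real.norm_of_nonneg hx.1] at this
    nlinarith [hx.1, le_max_right C1 C2]
  · have := hlip 1 h11 x hx
    rw [norm_sub_rev x 1, Real.norm_of_nonneg (by linarith [hx.2])] at this
    nlinarith [hx.2, le_max_right C1 C2]

/-- Green's formula for a homogeneous solution and a pair of product test functions. -/
theorem IsHomogeneous.green_prod {ω γ s : ℝ} {u v : ℝ × ℝ → ℂ} (h : IsHomogeneous ω γ u v)
    (hs : γ < s) {P Q Y : ℝ → ℂ} (hP : ContDiff ℝ (⊤ : ℕ∞) P) (hQ : ContDiff ℝ (⊤ : ℕ∞) Q)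
    (hY : ContDiff ℝ (⊤ : ℕ∞) Y) (hP1 : P 1 = 0) (hQ0 : Q 0 = 0) {A : ℝ}
    (hY1 : ∀ y, ‖Y y‖ ≤ A * Real.exp (-(s * |y|)))
    (hY2 : ∀ y, ‖deriv Y y‖ ≤ A * Real.exp (-(s * |y|))) :
    ∫ p in strip, (u p * (I * deriv P p.1 * Y p.2 + P p.1 * deriv Y p.2 + ω * (Q p.1 * Y p.2)) +
      v p * (-I * deriv Q p.1 * Y p.2 + Q p.1 * deriv Y p.2 - ω * (P p.1 * Y p.2))) = 0 := by
  obtain ⟨CP, hCP0, hCP⟩ := exists_bound_of_contDiff hP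
  obtain ⟨CQ, hCQ0, hCQ⟩ := exists_bound_of_contDiff hQ
  have hA : 0 ≤ A := by
    have := (norm_nonneg _).trans (hY1 0)
    simpa using this
  have hYd : ∀ y, DifferentiableAt ℝ Y y := fun y => hY.differentiable (by simp) y
  have hdP : ∀ c : ℂ, ∀ x y, dOp c (fun p : ℝ × ℝ => P p.1 * Y p.2) (x, y) =
      c * (deriv P x * Y y) + P x * deriv Y y := fun c x y =>
    dOp_prod (hP.differentiable (by simp) x) (hYd y)
  have hdQ : ∀ c : ℂ, ∀ x y, dOp c (fun p : ℝ × ℝ => Q p.1 * Y p.2) (x, y) =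
      c * (deriv Q x * Y y) + Q x * deriv Y y := fun c x y =>
    dOp_prod (hQ.differentiable (by simp) x) (hYd y)
  have hum := h.memU.aestronglyMeasurable
  have hvm := h.memV.aestronglyMeasurable
  have iu : ∀ C : ℝ, Integrable (fun p => ‖u p‖ * (C * Real.exp (-(s * |p.2|))))
      (volume.restrict strip) := fun C =>
    ((h.memU.integrable hs).const_mul C).congr (Eventually.of_forall fun p => by ring)
  have iv : ∀ C : ℝ, Integrable (fun p => ‖v p‖ * (C * Real.exp (-(s * |p.2|))))
      (volume.restrict strip) := fun C =>
    ((h.memV.integrable hs).const_mul C).congr (Eventually.of_forall fun p => by ring)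
  have hbd : ∀ (X : ℝ → ℂ) (C : ℝ) (c : ℂ), ‖c‖ = 1 → 0 ≤ C → ∀ x y, ‖X x‖ ≤ C → ‖deriv X x‖ ≤ C →
      ‖c * (deriv X x * Y y) + X x * deriv Y y‖ ≤ 2 * C * A * Real.exp (-(s * |y|)) := by
    intro X C c hc hC x y h1 h2
    refine (norm_add_le _ _).trans ?_
    rw [norm_mul, hc, one_mul, norm_mul, norm_mul]
    have k1 := mul_le_mul h2 (hY1 y) (norm_nonneg _) hC
    have k2 := mul_le_mul h1 (hY2 y) (norm_nonneg _) hC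
    linarith
  have e0 : ∀ y, 0 ≤ Real.exp (-(s * |y|)) := fun y => (Real.exp_pos _).le
  have g1 := h.eqU.green_right hum ((hvm.const_mul (ω : ℂ)).neg)
    (φ := fun p => P p.1 * Y p.2) ((hP.comp contDiff_fst).mul (hY.comp contDiff_snd))
    (B := fun y => 2 * CP * A * Real.exp (-(s * |y|)))
    (fun x hx y => by
      have h1 := (hCP x (Ioo_subset_Icc_self hx)).2.2.2
      rw [hP1, sub_zero] at h1
      rw [norm_mul]
      have := mul_le_mul h1 (hY1 y) (norm_nonneg _) (mul_nonneg (by linarith [hx.2]) hCP0)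
      have h3 : 0 ≤ (1 - x) * CP * (A * Real.exp (-(s * |y|))) :=
        mul_nonneg (mul_nonneg (by linarith [hx.2]) hCP0) (mul_nonneg hA (e0 y))
      linarith)
    (fun x hx y => by
      have h1 := hCP x (Ioo_subset_Icc_self hx)
      rw [hdP]
      exact hbd P CP I (by simp) hCP0 x y h1.1 h1.2.1)
    (iu _) (((iv (2 * CP * A)).const_mul |ω|).congr (Eventually.of_forall fun p => by
      simp; ring))
  have g2 := h.eqV.green_left hvm (hum.const_mul (ω : ℂ))
    (φ := fun p => Q p.1 * Y p.2) ((hQ.comp contDiff_fst).mul (hY.comp contDiff_snd))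
    (B := fun y => 2 * CQ * A * Real.exp (-(s * |y|)))
    (fun x hx y => by
      have h1 := (hCQ x (Ioo_subset_Icc_self hx)).2.2.1
      rw [hQ0, sub_zero] at h1
      rw [norm_mul]
      have := mul_le_mul h1 (hY1 y) (norm_nonneg _) (mul_nonneg (by linarith [hx.1]) hCQ0)
      have h3 : 0 ≤ x * CQ * (A * Real.exp (-(s * |y|))) :=
        mul_nonneg (mul_nonneg (by linarith [hx.1]) hCQ0) (mul_nonneg hA (e0 y))
      linarith)
    (fun x hx y => by
      have h1 := hCQ x (Ioo_subset_Icc_self hx)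
      rw [hdQ]
      exact hbd Q CQ (-I) (by simp) hCQ0 x y h1.1 h1.2.1)
    (iv _) (((iu (2 * CQ * A)).const_mul |ω|).congr (Eventually.of_forall fun p => by
      simp; ring))
  have mP : Continuous (deriv P) := hP.continuous_deriv (by simp)
  have mQ : Continuous (deriv Q) := hQ.continuous_deriv (by simp)
  have mY : Continuous (deriv Y) := hY.continuous_deriv (by simp)
  have cP := hP.continuous
  have cQ := hQ.continuous
  have cY := hY.continuous
  have int : ∀ (w : ℝ × ℝ → ℂ) (k : ℝ × ℝ → ℂ) (C : ℝ),
      AEStronglyMeasurable w (volume.restrict strip) → Continuous k →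
      Integrable (fun p => ‖w p‖ * (C * Real.exp (-(s * |p.2|)))) (volume.restrict strip) →
      (∀ x ∈ Ioo (0 : ℝ) 1, ∀ y, ‖k (x, y)‖ ≤ C * Real.exp (-(s * |y|))) →
      Integrable (fun p => w p * k p) (volume.restrict strip) := by
    intro w k C hw hk hi hb
    refine hi.mono' (hw.mul hk.aestronglyMeasurable) ?_
    filter_upwards [ae_restrict_mem measurableSet_strip] with ⟨x, y⟩ hp
    rw [norm_mul]
    exact mul_le_mul_of_nonneg_left (hb x hp.1 y) (norm_nonneg _)
  have bP : ∀ x ∈ Ioo (0 : ℝ) 1, ∀ y, ‖P x * Y y‖ ≤ CP * A * Real.exp (-(s * |y|)) :=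
    fun x hx y => by
      rw [norm_mul, mul_assoc]
      exact mul_le_mul (hCP x (Ioo_subset_Icc_self hx)).1 (hY1 y) (norm_nonneg _) hCP0
  have bQ : ∀ x ∈ Ioo (0 : ℝ) 1, ∀ y, ‖Q x * Y y‖ ≤ CQ * A * Real.exp (-(s * |y|)) :=
    fun x hx y => by
      rw [norm_mul, mul_assoc]
      exact mul_le_mul (hCQ x (Ioo_subset_Icc_self hx)).1 (hY1 y) (norm_nonneg _) hCQ0
  have i1 := int u (fun p => I * (deriv P p.1 * Y p.2) + P p.1 * deriv Y p.2) _ hum (by fun_prop)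
    (iu (2 * CP * A)) (fun x hx y => by
      have h1 := hCP x (Ioo_subset_Icc_self hx)
      exact hbd P CP I (by simp) hCP0 x y h1.1 h1.2.1)
  have i2 := int v (fun p => -I * (deriv Q p.1 * Y p.2) + Q p.1 * deriv Y p.2) _ hvm (by fun_prop)
    (iv (2 * CQ * A)) (fun x hx y => by
      have h1 := hCQ x (Ioo_subset_Icc_self hx)
      exact hbd Q CQ (-I) (by simp) hCQ0 x y h1.1 h1.2.1)
  have i3 := (int v (fun p => P p.1 * Y p.2) _ hvm (by fun_prop) (iv (CP * A)) bP).const_mul (ω : ℂ)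
  have i4 := (int u (fun p => Q p.1 * Y p.2) _ hum (by fun_prop) (iu (CQ * A)) bQ).const_mul (ω : ℂ)
  have g1' : ∫ p in strip, u p * (I * (deriv P p.1 * Y p.2) + P p.1 * deriv Y p.2) =
      ∫ p in strip, (ω : ℂ) * (v p * (P p.1 * Y p.2)) := by
    rw [← integral_neg] at g1
    convert g1 using 2
    · funext p; rw [← hdP]
    · funext p; ring
  have g2' : ∫ p in strip, v p * (-I * (deriv Q p.1 * Y p.2) + Q p.1 * deriv Y p.2) =
      - ∫ p in strip, (ω : ℂ) * (u p * (Q p.1 * Y p.2)) := by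
    convert g2 using 2
    · funext p; rw [← hdQ]
    · congr 1; funext p; ring
  have : ∀ p : ℝ × ℝ, (u p * (I * deriv P p.1 * Y p.2 + P p.1 * deriv Y p.2 + ω * (Q p.1 * Y p.2)) +
      v p * (-I * deriv Q p.1 * Y p.2 + Q p.1 * deriv Y p.2 - ω * (P p.1 * Y p.2))) =
      (u p * (I * (deriv P p.1 * Y p.2) + P p.1 * deriv Y p.2) - ω * (v p * (P p.1 * Y p.2))) +
      (v p * (-I * (deriv Q p.1 * Y p.2) + Q p.1 * deriv Y p.2) + ω * (u p * (Q p.1 * Y p.2))) :=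
    fun p => by ring
  simp only [this]
  refine (integral_add (Integrable.sub i1 i3) (Integrable.add i2 i4)).trans ?_
  rw [integral_sub' i1 i3, integral_add' i2 i4, g1', g2']
  ring

/-! ### Transforms along the strip -/

/-- Families of functions on `[0,1]`, entire and of exponential type in the parameter. -/
structure IsKernel (k : ℂ → ℝ → ℂ) : Prop where
  diff : ∀ x, Differentiable ℂ (fun lam => k lam x)
  cont : ∀ lam, Continuous (k lam)
  bound : ∃ A B : ℝ, 0 ≤ A ∧ 0 ≤ B ∧
    ∀ lam : ℂ, ∀ x ∈ Icc (0 : ℝ) 1, ‖k lam x‖ ≤ A * Real.exp (B * ‖lam‖)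

namespace IsKernel

theorem add {k l : ℂ → ℝ → ℂ} (hk : IsKernel k) (hl : IsKernel l) :
    IsKernel (fun lam x => k lam x + l lam x) := by
  refine ⟨fun x => (hk.diff x).add (hl.diff x), fun lam => (hk.cont lam).add (hl.cont lam), ?_⟩
  obtain ⟨A, B, hA, hB, h⟩ := hk.bound
  obtain ⟨A', B', hA', hB', h'⟩ := hl.bound
  refine ⟨A + A', max B B', by positivity, by positivity, fun lam x hx => ?_⟩
  have e1 : Real.exp (B * ‖lam‖) ≤ Real.exp (max B B' * ‖lam‖) :=
    Real.exp_le_exp.2 (mul_le_mul_of_nonneg_right (le_max_left _ _) (norm_nonneg _))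
  have e2 : Real.exp (B' * ‖lam‖) ≤ Real.exp (max B B' * ‖lam‖) :=
    Real.exp_le_exp.2 (mul_le_mul_of_nonneg_right (le_max_right _ _) (norm_nonneg _))
  calc _ ≤ _ := norm_add_le _ _
    _ ≤ A * Real.exp (max B B' * ‖lam‖) + A' * Real.exp (max B B' * ‖lam‖) :=
      add_le_add ((h lam x hx).trans (mul_le_mul_of_nonneg_left e1 hA))
        ((h' lam x hx).trans (mul_le_mul_of_nonneg_left e2 hA'))
    _ = _ := by ring

theorem mul {k l : ℂ → ℝ → ℂ} (hk : IsKernel k) (hl : IsKernel l) :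
    IsKernel (fun lam x => k lam x * l lam x) := by
  refine ⟨fun x => (hk.diff x).mul (hl.diff x), fun lam => (hk.cont lam).mul (hl.cont lam), ?_⟩
  obtain ⟨A, B, hA, hB, h⟩ := hk.bound
  obtain ⟨A', B', hA', hB', h'⟩ := hl.bound
  refine ⟨A * A', B + B', by positivity, by positivity, fun lam x hx => ?_⟩
  rw [norm_mul]
  calc _ ≤ (A * Real.exp (B * ‖lam‖)) * (A' * Real.exp (B' * ‖lam‖)) :=
      mul_le_mul (h lam x hx) (h' lam x hx) (norm_nonneg _) (by positivity)
    _ = _ := by rw [mul_mul_mul_comm, ← Real.exp_add]; ring_nf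

theorem ofFun {c : ℝ → ℂ} (hc : Continuous c) : IsKernel (fun _ x => c x) := by
  refine ⟨fun x => differentiable_const _, fun _ => hc, ?_⟩
  obtain ⟨C, hC⟩ := isCompact_Icc.exists_bound_of_continuousOn (s := Icc (0 : ℝ) 1) hc.continuousOn
  have : 0 ≤ C := (norm_nonneg _).trans (hC 0 (by simp))
  exact ⟨C, 0, this, le_rfl, fun lam x hx => by simpa using hC x hx⟩

theorem const (c : ℂ) : IsKernel (fun _ _ => c) := ofFun continuous_const

theorem param : IsKernel (fun lam _ => lam) := by
  refine ⟨fun x => differentiable_id, fun _ => continuous_const, 1, 1, by simp, by simp, ?_⟩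
  intro lam x _
  have := Real.add_one_le_exp ‖lam‖
  simp only [one_mul]
  linarith

theorem neg {k : ℂ → ℝ → ℂ} (hk : IsKernel k) : IsKernel (fun lam x => - k lam x) := by
  simpa using (const (-1)).mul hk

theorem sub {k l : ℂ → ℝ → ℂ} (hk : IsKernel k) (hl : IsKernel l) :
    IsKernel (fun lam x => k lam x - l lam x) := by
  simpa [sub_eq_add_neg] using hk.add hl.neg

theorem eval {k : ℂ → ℝ → ℂ} (hk : IsKernel k) {x₀ : ℝ} (hx : x₀ ∈ Icc (0 : ℝ) 1) :
    IsKernel (fun lam _ => k lam x₀) := by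
  obtain ⟨A, B, hA, hB, h⟩ := hk.bound
  exact ⟨fun x => hk.diff x₀, fun _ => continuous_const, A, B, hA, hB, fun lam x _ => h lam x₀ hx⟩

theorem norm_K_le (ω : ℝ) (lam : ℂ) : ‖(ω : ℂ) ^ 2 - lam ^ 2‖ ≤ (|ω| + ‖lam‖) ^ 2 := by
  refine (norm_sub_le _ _).trans ?_
  rw [norm_pow, norm_pow, Complex.norm_real, Real.norm_eq_abs]
  nlinarith [abs_nonneg ω, norm_nonneg lam, mul_nonneg (abs_nonneg ω) (norm_nonneg lam)]

theorem cos (ω : ℝ) : IsKernel (fun lam x => cosRt x ((ω : ℂ) ^ 2 - lam ^ 2)) := by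
  refine ⟨fun x => (differentiable_cosRt x).comp (by fun_prop),
    fun lam => (contDiff_cosRt _ (n := 0)).continuous, Real.exp |ω|, 1, by positivity, by simp, ?_⟩
  intro lam x hx
  rw [← Real.exp_add, one_mul]
  exact norm_cosRt_le hx (by positivity) (norm_K_le ω lam)

theorem sinc (ω : ℝ) : IsKernel (fun lam x => sincRt x ((ω : ℂ) ^ 2 - lam ^ 2)) := by
  refine ⟨fun x => (differentiable_sincRt x).comp (by fun_prop),
    fun lam => (contDiff_sincRt _ (n := 0)).continuous, Real.exp |ω|, 1, by positivity, by simp, ?_⟩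
  intro lam x hx
  rw [← Real.exp_add, one_mul]
  refine (norm_sincRt_le hx (by positivity) (norm_K_le ω lam)).trans ?_
  exact mul_le_of_le_one_left (Real.exp_pos _).le hx.2

theorem disp (ω : ℝ) : IsKernel (fun lam _ => dispersionFun ω lam) := by
  simp only [dispersionFun_eq]
  exact ((cos ω).eval (x₀ := 1) (by simp)).sub (param.mul ((sinc ω).eval (x₀ := 1) (by simp)))

end IsKernel

/-- `∬ e^{iλy} ζ(y) k(λ, x) w(x, y)` over the strip. -/
def stripInt (ζ : ℝ → ℝ) (k : ℂ → ℝ → ℂ) (w : ℝ × ℝ → ℂ) (lam : ℂ) : ℂ :=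
  ∫ p in strip, cexp (I * lam * p.2) * ζ p.2 * k lam p.1 * w p

theorem norm_exp_I_mul (lam : ℂ) (y : ℝ) : ‖cexp (I * lam * y)‖ = Real.exp (-(lam.im * y)) := by
  rw [Complex.norm_exp]; simp

theorem norm_exp_I_mul_le (lam : ℂ) {y : ℝ} (hy : y ∈ Icc (0 : ℝ) 1) :
    ‖cexp (I * lam * y)‖ ≤ Real.exp ‖lam‖ := by
  rw [norm_exp_I_mul, Real.exp_le_exp]
  have := (abs_le.1 (Complex.abs_im_le_norm lam)).1
  nlinarith [hy.1, hy.2, norm_nonneg lam]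

/-- Cutoff functions supported in `[0,1]`. -/
structure IsCutoff (ζ : ℝ → ℝ) (M : ℝ) : Prop where
  meas : Measurable ζ
  le : ∀ y, |ζ y| ≤ M
  supp : ∀ y, y ∉ Icc (0 : ℝ) 1 → ζ y = 0

section
variable {ζ : ℝ → ℝ} {M : ℝ} {k : ℂ → ℝ → ℂ} {w : ℝ × ℝ → ℂ} {s : ℝ}

/-- The cutoff lives on `[0,1]`, where the exponential costs at most `e^{‖lam‖}` and the weight
`e^{-s|y|}` can be inserted at the price of `e^{|s|}`. So these transforms are entire of exponential
type whatever the growth of `w`. -/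
theorem stripInt_aux (hζ : IsCutoff ζ M) (hk : IsKernel k) :
    ∃ A B : ℝ, 0 ≤ A ∧ 0 ≤ B ∧ ∀ lam : ℂ, ∀ p ∈ strip,
      ‖cexp (I * lam * p.2) * ζ p.2 * k lam p.1 * w p‖ ≤
        A * Real.exp (B * ‖lam‖) * (‖w p‖ * Real.exp (-(s * |p.2|))) := by
  obtain ⟨A, B, hA, hB, h⟩ := hk.bound
  have hM : 0 ≤ M := (abs_nonneg _).trans (hζ.le 0)
  refine ⟨M * A * Real.exp |s|, B + 1, by positivity, by positivity, ?_⟩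
  rintro lam ⟨x, y⟩ hp
  by_cases hy : y ∈ Icc (0 : ℝ) 1
  · have h1 := norm_exp_I_mul_le lam hy
    have h2 : ‖(ζ y : ℂ)‖ ≤ M := by rw [Complex.norm_real]; exact hζ.le y
    have h3 := h lam x (Ioo_subset_Icc_self hp.1)
    have h4 : 1 ≤ Real.exp |s| * Real.exp (-(s * |y|)) := by
      rw [← Real.exp_add]
      apply Real.one_le_exp
      rw [abs_of_nonneg hy.1]
      nlinarith [le_abs_self s, hy.1, hy.2, abs_nonneg s]
    simp only [norm_mul] at *
    calc _ ≤ Real.exp ‖lam‖ * M * (A * Real.exp (B * ‖lam‖)) * (‖w (x, y)‖ *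
          (Real.exp |s| * Real.exp (-(s * |y|)))) := by
          gcongr
          exact le_mul_of_one_le_right (norm_nonneg _) h4
      _ = _ := by
          rw [add_mul, one_mul, Real.exp_add]; ring
  · simp only [hζ.supp y hy, Complex.ofReal_zero, mul_zero, zero_mul, norm_zero]
    positivity

theorem aestronglyMeasurable_stripInt (hζ : IsCutoff ζ M) (hk : IsKernel k)
    (hw : AEStronglyMeasurable w (volume.restrict strip)) (lam : ℂ) :
    AEStronglyMeasurable (fun p : ℝ × ℝ => cexp (I * lam * p.2) * ζ p.2 * k lam p.1 * w p)
      (volume.restrict strip) := by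
  have h1 : Measurable (fun p : ℝ × ℝ => cexp (I * lam * p.2) * ζ p.2 * k lam p.1) := by
    have a1 : Measurable (fun p : ℝ × ℝ => cexp (I * lam * p.2)) :=
      Continuous.measurable (by fun_prop)
    have a2 : Measurable (fun p : ℝ × ℝ => (ζ p.2 : ℂ)) :=
      Complex.measurable_ofReal.comp (hζ.meas.comp measurable_snd)
    have a3 : Measurable (fun p : ℝ × ℝ => k lam p.1) := (hk.cont lam).measurable.comp measurable_fst
    exact (a1.mul a2).mul a3
  exact h1.aestronglyMeasurable.mul hw

theorem integrable_stripInt (hζ : IsCutoff ζ M) (hk : IsKernel k)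
    (hw : AEStronglyMeasurable w (volume.restrict strip))
    (hi : Integrable (fun p => ‖w p‖ * Real.exp (-(s * |p.2|))) (volume.restrict strip)) (lam : ℂ) :
    Integrable (fun p : ℝ × ℝ => cexp (I * lam * p.2) * ζ p.2 * k lam p.1 * w p)
      (volume.restrict strip) := by
  obtain ⟨A, B, hA, hB, h⟩ := stripInt_aux (w := w) (s := s) hζ hk
  refine (hi.const_mul (A * Real.exp (B * ‖lam‖))).mono'
    (aestronglyMeasurable_stripInt hζ hk hw lam) ?_
  filter_upwards [ae_restrict_mem measurableSet_strip] with p hp using h lam p hp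

theorem norm_stripInt_le (hζ : IsCutoff ζ M) (hk : IsKernel k)
    (hi : Integrable (fun p => ‖w p‖ * Real.exp (-(s * |p.2|))) (volume.restrict strip)) :
    ∃ A B : ℝ, 0 ≤ A ∧ 0 ≤ B ∧ ∀ lam, ‖stripInt ζ k w lam‖ ≤ A * Real.exp (B * ‖lam‖) := by
  obtain ⟨A, B, hA, hB, h⟩ := stripInt_aux (w := w) (s := s) hζ hk
  refine ⟨A * ∫ p in strip, ‖w p‖ * Real.exp (-(s * |p.2|)), B, by positivity, hB, fun lam => ?_⟩
  have := norm_integral_le_of_norm_le (hi.const_mul (A * Real.exp (B * ‖lam‖)))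
    (f := fun p : ℝ × ℝ => cexp (I * lam * p.2) * ζ p.2 * k lam p.1 * w p)
    (by filter_upwards [ae_restrict_mem measurableSet_strip] with p hp using h lam p hp)
  rw [integral_const_mul] at this
  refine this.trans (le_of_eq ?_)
  ring

theorem hasDerivAt_stripInt (hζ : IsCutoff ζ M) (hk : IsKernel k)
    (hw : AEStronglyMeasurable w (volume.restrict strip))
    (hi : Integrable (fun p => ‖w p‖ * Real.exp (-(s * |p.2|))) (volume.restrict strip)) (lam : ℂ) :
    HasDerivAt (stripInt ζ k w) (∫ p in strip,
      deriv (fun lam => cexp (I * lam * p.2) * ζ p.2 * k lam p.1 * w p) lam) lam := by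
  obtain ⟨A, B, hA, hB, h⟩ := stripInt_aux (w := w) (s := s) hζ hk
  refine hasDerivAt_integral_of_holomorphic zero_lt_one
    (hi.const_mul (A * Real.exp (B * (‖lam‖ + 1))))
    (fun z _ => aestronglyMeasurable_stripInt hζ hk hw z) ?_ ?_
  · refine Eventually.of_forall fun p => Differentiable.differentiableOn ?_
    have := hk.diff p.1
    fun_prop
  · filter_upwards [ae_restrict_mem measurableSet_strip] with p hp z hz
    refine (h z p hp).trans ?_
    have h1 : ‖z‖ ≤ ‖lam‖ + 1 := by
      rw [mem_ball_iff_norm] at hz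
      have := norm_add_le (z - lam) lam
      rw [sub_add_cancel] at this
      linarith
    gcongr

theorem differentiable_stripInt (hζ : IsCutoff ζ M) (hk : IsKernel k)
    (hw : AEStronglyMeasurable w (volume.restrict strip))
    (hi : Integrable (fun p => ‖w p‖ * Real.exp (-(s * |p.2|))) (volume.restrict strip)) :
    Differentiable ℂ (stripInt ζ k w) := fun lam =>
  (hasDerivAt_stripInt hζ hk hw hi lam).differentiableAt

end

/-! ### The smooth step and the half-strip transforms -/

/-- The transition function from `0` (for `y ≤ 0`) to `1` (for `y ≥ 1`). -/
abbrev eta : ℝ → ℝ := Real.smoothTransition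

theorem exists_isCutoff_deriv_eta : ∃ M, IsCutoff (deriv eta) M := by
  obtain ⟨M, -, hM⟩ := exists_bound_deriv_smoothTransition
  refine ⟨M, measurable_deriv _, hM, fun y hy => ?_⟩
  rw [mem_Icc, not_and_or, not_le, not_le] at hy
  exact deriv_smoothTransition_eq_zero hy

/-- The difference between the smooth and the sharp cutoff. -/
def etaDiff (y : ℝ) : ℝ := eta y - (Ioi (0 : ℝ)).indicator 1 y

theorem isCutoff_etaDiff : IsCutoff etaDiff 1 := by
  refine ⟨?_, fun y => ?_, fun y hy => ?_⟩
  · exact Real.smoothTransition.continuous.measurable.sub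
      (measurable_one.indicator measurableSet_Ioi)
  · have h0 := Real.smoothTransition.nonneg y
    have h1 := Real.smoothTransition.le_one y
    unfold etaDiff eta
    by_cases hy : y ∈ Ioi (0 : ℝ) <;> simp only [hy, indicator_of_mem, indicator_of_notMem,
      not_false_eq_true, Pi.one_apply, abs_le] <;> constructor <;> linarith
  · rw [mem_Icc, not_and_or, not_le, not_le] at hy
    unfold etaDiff eta
    rcases hy with hy | hy
    · rw [Real.smoothTransition.zero_of_nonpos hy.le, indicator_of_notMem (by simpa using hy.le)]
      simp
    · rw [Real.smoothTransition.one_of_one_le hy.le, indicator_of_mem (by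
        simp only [mem_Ioi]; linarith)]
      simp

/-- `∬_{y ∈ S} e^{iλy} e^{iθx} v` over the strip. -/
def halfInt (S : Set ℝ) (v : ℝ × ℝ → ℂ) (θ lam : ℂ) : ℂ :=
  ∫ p in strip, cexp (I * lam * p.2) * (S.indicator 1 p.2 : ℝ) * cexp (I * θ * p.1) * v p

section
variable {S : Set ℝ} {v : ℝ × ℝ → ℂ} {s : ℝ}

theorem aestronglyMeasurable_halfInt (hS : MeasurableSet S)
    (hv : AEStronglyMeasurable v (volume.restrict strip)) (θ lam : ℂ) :
    AEStronglyMeasurable (fun p : ℝ × ℝ => cexp (I * lam * p.2) * (S.indicator 1 p.2 : ℝ) *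
      cexp (I * θ * p.1) * v p) (volume.restrict strip) := by
  have a1 : Measurable (fun p : ℝ × ℝ => cexp (I * lam * p.2)) :=
    Continuous.measurable (by fun_prop)
  have a2 : Measurable (fun p : ℝ × ℝ => ((S.indicator 1 p.2 : ℝ) : ℂ)) :=
    Complex.measurable_ofReal.comp ((measurable_one.indicator hS).comp measurable_snd)
  have a3 : Measurable (fun p : ℝ × ℝ => cexp (I * θ * p.1)) :=
    Continuous.measurable (by fun_prop)
  exact ((a1.mul a2).mul a3).aestronglyMeasurable.mul hv

/-- The hypothesis on `S` covers both half-strips at once: `y > 0` with `Im lam ≥ s`, and `y ≤ 0`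
with `-Im lam ≥ s`. -/
theorem norm_halfInt_integrand_le {lam : ℂ} (h : ∀ y ∈ S, -(lam.im * y) ≤ -(s * |y|)) (θ : ℂ)
    {p : ℝ × ℝ} (hp : p ∈ strip) :
    ‖cexp (I * lam * p.2) * (S.indicator 1 p.2 : ℝ) * cexp (I * θ * p.1) * v p‖ ≤
      Real.exp |θ.im| * (‖v p‖ * Real.exp (-(s * |p.2|))) := by
  by_cases hy : p.2 ∈ S
  · simp only [indicator_of_mem hy, Pi.one_apply, Complex.ofReal_one, mul_one, norm_mul,
      norm_exp_I_mul]
    have h1 : Real.exp (-(lam.im * p.2)) ≤ Real.exp (-(s * |p.2|)) := Real.exp_le_exp.2 (h _ hy)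
    have h2 : Real.exp (-(θ.im * p.1)) ≤ Real.exp |θ.im| := by
      apply Real.exp_le_exp.2
      have := hp.1.1; have := hp.1.2
      nlinarith [neg_abs_le θ.im, abs_nonneg θ.im]
    calc _ ≤ Real.exp (-(s * |p.2|)) * Real.exp |θ.im| * ‖v p‖ := by gcongr
      _ = _ := by ring
  · simp only [indicator_of_notMem hy, Complex.ofReal_zero, mul_zero, zero_mul, norm_zero]
    positivity

theorem integrable_halfInt (hS : MeasurableSet S)
    (hv : AEStronglyMeasurable v (volume.restrict strip))
    (hi : Integrable (fun p => ‖v p‖ * Real.exp (-(s * |p.2|))) (volume.restrict strip))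
    {lam : ℂ} (h : ∀ y ∈ S, -(lam.im * y) ≤ -(s * |y|)) (θ : ℂ) :
    Integrable (fun p : ℝ × ℝ => cexp (I * lam * p.2) * (S.indicator 1 p.2 : ℝ) *
      cexp (I * θ * p.1) * v p) (volume.restrict strip) := by
  refine (hi.const_mul (Real.exp |θ.im|)).mono' (aestronglyMeasurable_halfInt hS hv θ lam) ?_
  filter_upwards [ae_restrict_mem measurableSet_strip] with p hp
    using norm_halfInt_integrand_le h θ hp

theorem norm_halfInt_le
    (hi : Integrable (fun p => ‖v p‖ * Real.exp (-(s * |p.2|))) (volume.restrict strip))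
    {lam : ℂ} (h : ∀ y ∈ S, -(lam.im * y) ≤ -(s * |y|)) (θ : ℝ) :
    ‖halfInt S v θ lam‖ ≤ ∫ p in strip, ‖v p‖ * Real.exp (-(s * |p.2|)) := by
  refine norm_integral_le_of_norm_le hi ?_
  filter_upwards [ae_restrict_mem measurableSet_strip] with p hp
  simpa using norm_halfInt_integrand_le (v := v) h θ hp

theorem differentiableAt_halfInt (hS : MeasurableSet S)
    (hv : AEStronglyMeasurable v (volume.restrict strip))
    (hi : Integrable (fun p => ‖v p‖ * Real.exp (-(s * |p.2|))) (volume.restrict strip))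
    {lam : ℂ} {r : ℝ} (hr : 0 < r)
    (h : ∀ z ∈ Metric.ball lam r, ∀ y ∈ S, -(z.im * y) ≤ -(s * |y|)) (θ : ℂ) :
    DifferentiableAt ℂ (halfInt S v θ) lam := by
  refine (hasDerivAt_integral_of_holomorphic hr (hi.const_mul (Real.exp |θ.im|))
    (fun z _ => aestronglyMeasurable_halfInt hS hv θ z) ?_ ?_).differentiableAt
  · refine Eventually.of_forall fun p => Differentiable.differentiableOn ?_
    fun_prop
  · filter_upwards [ae_restrict_mem measurableSet_strip] with p hp z hz
      using norm_halfInt_integrand_le (h z hz) θ hp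

theorem differentiable_halfInt_left (hS : MeasurableSet S)
    (hv : AEStronglyMeasurable v (volume.restrict strip))
    (hi : Integrable (fun p => ‖v p‖ * Real.exp (-(s * |p.2|))) (volume.restrict strip))
    {lam : ℂ} (h : ∀ y ∈ S, -(lam.im * y) ≤ -(s * |y|)) :
    Differentiable ℂ (fun θ => halfInt S v θ lam) := by
  intro θ
  refine (hasDerivAt_integral_of_holomorphic zero_lt_one
    (hi.const_mul (Real.exp (‖θ‖ + 1)))
    (fun z _ => aestronglyMeasurable_halfInt hS hv z lam) ?_ ?_).differentiableAt
  · refine Eventually.of_forall fun p => Differentiable.differentiableOn ?_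
    fun_prop
  · filter_upwards [ae_restrict_mem measurableSet_strip] with p hp z hz
    refine (norm_halfInt_integrand_le h z hp).trans ?_
    have h1 : |z.im| ≤ ‖θ‖ + 1 := by
      rw [mem_ball_iff_norm] at hz
      have := norm_add_le (z - θ) θ
      rw [sub_add_cancel] at this
      linarith [Complex.abs_im_le_norm z]
    gcongr

/-- Decay up the imaginary axis. This identifies the constant produced by Liouville's theorem as
zero. -/
theorem tendsto_halfInt_Ioi (hv : AEStronglyMeasurable v (volume.restrict strip))
    (hi : Integrable (fun p => ‖v p‖ * Real.exp (-(s * |p.2|))) (volume.restrict strip)) (θ : ℝ) :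
    Tendsto (fun n : ℕ => halfInt (Ioi 0) v θ (I * ((s + n : ℝ) : ℂ))) atTop (𝓝 0) := by
  have him : ∀ n : ℕ, (I * ((s + n : ℝ) : ℂ)).im = s + n := fun n => by simp
  rw [show (0 : ℂ) = ∫ p in strip, (0 : ℂ) by simp]
  refine tendsto_integral_of_dominated_convergence
    (fun p => ‖v p‖ * Real.exp (-(s * |p.2|)))
    (fun n => aestronglyMeasurable_halfInt measurableSet_Ioi hv θ _) hi ?_ ?_
  · intro n
    filter_upwards [ae_restrict_mem measurableSet_strip] with p hp
    have := norm_halfInt_integrand_le (v := v) (S := Ioi 0) (s := s)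
      (lam := I * ((s + n : ℝ) : ℂ)) (fun y hy => ?_) θ hp
    · simpa using this
    · rw [him, abs_of_pos hy]
      rw [mem_Ioi] at hy
      nlinarith [n.cast_nonneg (α := ℝ)]
  · refine Eventually.of_forall fun p => ?_
    by_cases hy : p.2 ∈ Ioi (0 : ℝ)
    · have h1 : Tendsto (fun n : ℕ => cexp (I * (I * ((s + n : ℝ) : ℂ)) * p.2)) atTop (𝓝 0) := by
        rw [tendsto_zero_iff_norm_tendsto_zero]
        simp only [norm_exp_I_mul, him]
        refine Real.tendsto_exp_atBot.comp ?_
        refine tendsto_neg_atTop_atBot.comp ?_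
        refine Tendsto.atTop_mul_const hy ?_
        exact tendsto_atTop_add_const_left _ _ tendsto_natCast_atTop_atTop
      have := ((h1.mul_const (((Ioi (0 : ℝ)).indicator 1 p.2 : ℝ) : ℂ)).mul_const
        (cexp (I * (θ : ℂ) * p.1))).mul_const (v p)
      simpa only [zero_mul] using this
    · simp [indicator_of_notMem hy]

end

/-! ### The resolvent -/

/-- First component of the solution of the profile equation with `U(0) = 0`. -/
def leftU (ω : ℝ) (lam : ℂ) (x : ℝ) : ℂ := I * ω * sincRt x ((ω : ℂ) ^ 2 - lam ^ 2)

/-- Second component of the solution of the profile equation with `U(0) = 0`. -/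
def leftV (ω : ℝ) (lam : ℂ) (x : ℝ) : ℂ :=
  cosRt x ((ω : ℂ) ^ 2 - lam ^ 2) - lam * sincRt x ((ω : ℂ) ^ 2 - lam ^ 2)

theorem isKernel_leftU (ω : ℝ) : IsKernel (leftU ω) := (IsKernel.const _).mul (IsKernel.sinc ω)

theorem isKernel_leftV (ω : ℝ) : IsKernel (leftV ω) :=
  (IsKernel.cos ω).sub (IsKernel.param.mul (IsKernel.sinc ω))

theorem leftV_one (ω : ℝ) (lam : ℂ) : leftV ω lam 1 = dispersionFun ω lam :=
  (dispersionFun_eq ω lam).symm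

/-- Part of the resolvent kernel that is multiplied by the dispersion function. -/
def resU (ω θ : ℝ) (lam : ℂ) (x : ℝ) : ℂ :=
  (I * θ + lam) * (cexp (I * θ * x) -
    (cosRt x ((ω : ℂ) ^ 2 - lam ^ 2) + lam * sincRt x ((ω : ℂ) ^ 2 - lam ^ 2)))

/-- Part of the resolvent kernel that is multiplied by the dispersion function. -/
def resV (ω θ : ℝ) (lam : ℂ) (x : ℝ) : ℂ :=
  I * ω * (cexp (I * θ * x) - (I * θ + lam) * sincRt x ((ω : ℂ) ^ 2 - lam ^ 2))

/-- The coefficient of the left solution in the resolvent kernel. -/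
def resC (ω θ : ℝ) (lam : ℂ) : ℂ :=
  I * ω * ((I * θ + lam) * sincRt 1 ((ω : ℂ) ^ 2 - lam ^ 2) - cexp (I * θ))

theorem isKernel_exp (θ : ℝ) : IsKernel (fun _ x => cexp (I * θ * x)) :=
  IsKernel.ofFun (by fun_prop)

theorem isKernel_resU (ω θ : ℝ) : IsKernel (resU ω θ) :=
  ((IsKernel.const _).add IsKernel.param).mul ((isKernel_exp θ).sub
    ((IsKernel.cos ω).add (IsKernel.param.mul (IsKernel.sinc ω))))

theorem isKernel_resV (ω θ : ℝ) : IsKernel (resV ω θ) :=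
  (IsKernel.const _).mul ((isKernel_exp θ).sub
    (((IsKernel.const _).add IsKernel.param).mul (IsKernel.sinc ω)))

theorem isKernel_resC (ω θ : ℝ) : IsKernel (fun lam _ => resC ω θ lam) :=
  (IsKernel.const _).mul ((((IsKernel.const _).add IsKernel.param).mul
    ((IsKernel.sinc ω).eval (x₀ := 1) (by simp))).sub (IsKernel.const _))

section
variable (ω θ : ℝ) (lam : ℂ)

/-- The first component of the resolvent kernel. -/
def testQ (x : ℝ) : ℂ := dispersionFun ω lam * resU ω θ lam x + resC ω θ lam * leftU ω lam x

/-- The second component of the resolvent kernel. -/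
def testP (x : ℝ) : ℂ := dispersionFun ω lam * resV ω θ lam x + resC ω θ lam * leftV ω lam x

theorem contDiff_exp_mul : ContDiff ℝ (⊤ : ℕ∞) (fun x : ℝ => cexp (I * θ * x)) :=
  (Complex.contDiff_exp (𝕜 := ℝ)).comp (contDiff_const.mul Complex.ofRealCLM.contDiff)

theorem contDiff_testQ : ContDiff ℝ (⊤ : ℕ∞) (testQ ω θ lam) := by
  unfold testQ resU leftU
  have h1 := contDiff_exp_mul θ
  have h2 := contDiff_cosRt ((ω : ℂ) ^ 2 - lam ^ 2) (n := (⊤ : ℕ∞))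
  have h3 := contDiff_sincRt ((ω : ℂ) ^ 2 - lam ^ 2) (n := (⊤ : ℕ∞))
  fun_prop

theorem contDiff_testP : ContDiff ℝ (⊤ : ℕ∞) (testP ω θ lam) := by
  unfold testP resV leftV
  have h1 := contDiff_exp_mul θ
  have h2 := contDiff_cosRt ((ω : ℂ) ^ 2 - lam ^ 2) (n := (⊤ : ℕ∞))
  have h3 := contDiff_sincRt ((ω : ℂ) ^ 2 - lam ^ 2) (n := (⊤ : ℕ∞))
  fun_prop

theorem testQ_zero : testQ ω θ lam 0 = 0 := by simp [testQ, resU, leftU]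

/-- `resC` is minus the value of `resV` at `x = 1`, and `leftV` takes the value `dispersionFun`
there. Multiplying the particular solution by `dispersionFun` thus lets the left solution correct
the boundary value without any division. -/
theorem testP_one : testP ω θ lam 1 = 0 := by
  rw [testP, leftV_one, resV, resC]
  push_cast
  ring_nf

theorem hasDerivAt_exp_mul (x : ℝ) :
    HasDerivAt (fun x : ℝ => cexp (I * θ * x)) (I * θ * cexp (I * θ * x)) x := by
  exact (hasDerivAt_ofReal_mul (I * θ) x).cexp.congr_deriv (mul_comm _ _)

/-- Together with `hasDerivAt_testP`: the pair solves the profile system with a source in the first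
equation only, a multiple of `e^{iθx}`. Pairing with it therefore isolates the Fourier coefficient
of `v` in `x`. -/
theorem hasDerivAt_testQ (x : ℝ) : HasDerivAt (testQ ω θ lam)
    (lam * testQ ω θ lam x + I * ω * testP ω θ lam x +
      dispersionFun ω lam * ((ω : ℂ) ^ 2 - lam ^ 2 - θ ^ 2) * cexp (I * θ * x)) x := by
  have h1 := hasDerivAt_exp_mul θ x
  have h2 := hasDerivAt_cosRt ((ω : ℂ) ^ 2 - lam ^ 2) x
  have h3 := hasDerivAt_sincRt ((ω : ℂ) ^ 2 - lam ^ 2) x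
  refine ((((h1.sub (h2.add (h3.const_mul lam))).const_mul (I * θ + lam)).const_mul
    (dispersionFun ω lam)).add ((h3.const_mul (I * ω)).const_mul (resC ω θ lam))).congr_deriv ?_
  simp only [testQ, testP, resU, resV, leftU, leftV]
  linear_combination (dispersionFun ω lam * (θ ^ 2 * cexp (I * θ * x) - ω ^ 2 *
    (cexp (I * θ * x) - (I * θ + lam) * sincRt x ((ω : ℂ) ^ 2 - lam ^ 2)))) * I_sq

theorem hasDerivAt_testP (x : ℝ) : HasDerivAt (testP ω θ lam)
    (-lam * testP ω θ lam x + I * ω * testQ ω θ lam x) x := by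
  have h1 := hasDerivAt_exp_mul θ x
  have h2 := hasDerivAt_cosRt ((ω : ℂ) ^ 2 - lam ^ 2) x
  have h3 := hasDerivAt_sincRt ((ω : ℂ) ^ 2 - lam ^ 2) x
  refine ((((h1.sub (h3.const_mul (I * θ + lam))).const_mul (I * ω)).const_mul
    (dispersionFun ω lam)).add ((h2.sub (h3.const_mul lam)).const_mul
      (resC ω θ lam))).congr_deriv ?_
  simp only [testQ, testP, resU, resV, leftU, leftV]
  ring_nf
  simp only [I_sq]
  ring

end

/-- The pairing of a solution with the left solution of the profile equation. -/
def leftPair (ω : ℝ) (u v : ℝ × ℝ → ℂ) (lam : ℂ) : ℂ :=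
  stripInt (deriv eta) (leftV ω) u lam + stripInt (deriv eta) (leftU ω) v lam

/-- The pairing of a solution with the resolvent kernel. -/
def resPair (ω θ : ℝ) (u v : ℝ × ℝ → ℂ) (lam : ℂ) : ℂ :=
  dispersionFun ω lam * (stripInt (deriv eta) (resV ω θ) u lam +
    stripInt (deriv eta) (resU ω θ) v lam) + resC ω θ lam * leftPair ω u v lam

section
variable {ω γ s : ℝ} {u v : ℝ × ℝ → ℂ}

theorem integral_test_eq_resPair (h : IsHomogeneous ω γ u v) (θ : ℝ) (lam : ℂ) :
    Integrable (fun p : ℝ × ℝ => cexp (I * lam * p.2) * (deriv eta p.2 : ℝ) *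
        (testP ω θ lam p.1 * u p + testQ ω θ lam p.1 * v p)) (volume.restrict strip) ∧
      ∫ p in strip, cexp (I * lam * p.2) * (deriv eta p.2 : ℝ) *
        (testP ω θ lam p.1 * u p + testQ ω θ lam p.1 * v p) = resPair ω θ u v lam := by
  obtain ⟨M, hM⟩ := exists_isCutoff_deriv_eta
  have hum := h.memU.aestronglyMeasurable
  have hvm := h.memV.aestronglyMeasurable
  have hui := h.memU.integrable (lt_add_one γ)
  have hvi := h.memV.integrable (lt_add_one γ)
  have i1 := (integrable_stripInt hM (isKernel_resV ω θ) hum hui lam).const_mul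
    (dispersionFun ω lam)
  have i2 := (integrable_stripInt hM (isKernel_resU ω θ) hvm hvi lam).const_mul
    (dispersionFun ω lam)
  have i3 := (integrable_stripInt hM (isKernel_leftV ω) hum hui lam).const_mul (resC ω θ lam)
  have i4 := (integrable_stripInt hM (isKernel_leftU ω) hvm hvi lam).const_mul (resC ω θ lam)
  have e : (fun p : ℝ × ℝ => cexp (I * lam * p.2) * (deriv eta p.2 : ℝ) *
      (testP ω θ lam p.1 * u p + testQ ω θ lam p.1 * v p)) = fun p =>
      (dispersionFun ω lam * (cexp (I * lam * p.2) * (deriv eta p.2 : ℝ) *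
        resV ω θ lam p.1 * u p) +
      dispersionFun ω lam * (cexp (I * lam * p.2) * (deriv eta p.2 : ℝ) *
        resU ω θ lam p.1 * v p)) +
      (resC ω θ lam * (cexp (I * lam * p.2) * (deriv eta p.2 : ℝ) * leftV ω lam p.1 * u p) +
      resC ω θ lam * (cexp (I * lam * p.2) * (deriv eta p.2 : ℝ) * leftU ω lam p.1 * v p)) := by
    funext p
    simp only [testP, testQ]
    ring
  rw [e]
  refine ⟨(i1.add i2).add (i3.add i4), ?_⟩
  refine (integral_add (i1.add i2) (i3.add i4)).trans ?_
  rw [integral_add' i1 i2, integral_add' i3 i4]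
  simp only [integral_const_mul, resPair, leftPair, stripInt]
  ring

/-- With the test pair `e^{iλy} ζ(y)` times the resolvent kernel, the profile equations cancel
everything except the source and the term with `ζ'`. The latter is `resPair`, which depends on `ζ`
only through `ζ' = η'`, so the choices `η` and `η - 1` lead to the same entire function. -/
theorem green_resolvent (h : IsHomogeneous ω γ u v) (hs : γ < s) (θ : ℝ) (lam : ℂ) {ζ : ℝ → ℝ}
    (hζ : ContDiff ℝ (⊤ : ℕ∞) ζ) (hζ' : deriv ζ = deriv eta) {A : ℝ}
    (hA1 : ∀ y : ℝ, ‖cexp (I * lam * y) * ζ y‖ ≤ A * Real.exp (-(s * |y|)))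
    (hA2 : ∀ y : ℝ, ‖cexp (I * lam * y) * (deriv eta y : ℝ)‖ ≤ A * Real.exp (-(s * |y|))) :
    I * dispersionFun ω lam * ((ω : ℂ) ^ 2 - lam ^ 2 - θ ^ 2) *
      ∫ p in strip, cexp (I * lam * p.2) * ζ p.2 * cexp (I * θ * p.1) * v p =
      resPair ω θ u v lam := by
  have hA0 : 0 ≤ A := by have := (norm_nonneg _).trans (hA1 0); simpa using this
  have hc : ContDiff ℝ (⊤ : ℕ∞) (fun y : ℝ => cexp (I * lam * y)) :=
    (Complex.contDiff_exp (𝕜 := ℝ)).comp (contDiff_const.mul Complex.ofRealCLM.contDiff)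
  have hYc : ContDiff ℝ (⊤ : ℕ∞) (fun y : ℝ => cexp (I * lam * y) * ζ y) :=
    hc.mul (Complex.ofRealCLM.contDiff.comp hζ)
  have hYd : ∀ y : ℝ, HasDerivAt (fun y : ℝ => cexp (I * lam * y) * ζ y)
      (I * lam * (cexp (I * lam * y) * ζ y) + cexp (I * lam * y) * (deriv eta y : ℝ)) y := by
    intro y
    have h1 := (hasDerivAt_ofReal_mul (I * lam) y).cexp
    have h2 : HasDerivAt (fun y : ℝ => (ζ y : ℂ)) (deriv eta y : ℝ) y := by
      rw [← hζ']
      exact (hζ.differentiable (by simp) y).hasDerivAt.ofReal_comp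
    refine (h1.mul h2).congr_deriv (by ring)
  have g := h.green_prod (A := (‖lam‖ + 1) * A) hs (contDiff_testP ω θ lam) (contDiff_testQ ω θ lam)
    hYc (testP_one ω θ lam) (testQ_zero ω θ lam) (fun y => (hA1 y).trans (by
      have : 0 ≤ ‖lam‖ * A * Real.exp (-(s * |y|)) := by positivity
      linarith)) (fun y => by
      rw [(hYd y).deriv]
      refine (norm_add_le _ _).trans ?_
      rw [norm_mul]
      have h1 : ‖I * lam‖ = ‖lam‖ := by simp
      rw [h1]
      have := mul_le_mul_of_nonneg_left (hA1 y) (norm_nonneg lam)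
      linarith [hA2 y])
  obtain ⟨j1, j2⟩ := integral_test_eq_resPair h θ lam
  have hvm := h.memV.aestronglyMeasurable
  have j3 : Integrable (fun p : ℝ × ℝ => cexp (I * lam * p.2) * ζ p.2 * cexp (I * θ * p.1) * v p)
      (volume.restrict strip) := by
    refine ((h.memV.integrable hs).const_mul A).mono' ?_ ?_
    · refine AEStronglyMeasurable.mul (Continuous.aestronglyMeasurable ?_) hvm
      have := hζ.continuous
      fun_prop
    · refine Eventually.of_forall fun p => ?_
      rw [norm_mul, norm_mul, norm_exp_I_mul (θ : ℂ)]
      simp only [Complex.ofReal_im, zero_mul, neg_zero, Real.exp_zero, mul_one]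
      calc _ ≤ A * Real.exp (-(s * |p.2|)) * ‖v p‖ :=
            mul_le_mul_of_nonneg_right (hA1 p.2) (norm_nonneg _)
        _ = _ := by ring
  have e : ∀ p : ℝ × ℝ, (u p * (I * deriv (testP ω θ lam) p.1 * (cexp (I * lam * p.2) * ζ p.2) +
      testP ω θ lam p.1 * deriv (fun y : ℝ => cexp (I * lam * y) * ζ y) p.2 +
        ω * (testQ ω θ lam p.1 * (cexp (I * lam * p.2) * ζ p.2))) +
      v p * (-I * deriv (testQ ω θ lam) p.1 * (cexp (I * lam * p.2) * ζ p.2) +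
      testQ ω θ lam p.1 * deriv (fun y : ℝ => cexp (I * lam * y) * ζ y) p.2 -
        ω * (testP ω θ lam p.1 * (cexp (I * lam * p.2) * ζ p.2)))) =
      cexp (I * lam * p.2) * (deriv eta p.2 : ℝ) *
        (testP ω θ lam p.1 * u p + testQ ω θ lam p.1 * v p) -
      I * dispersionFun ω lam * ((ω : ℂ) ^ 2 - lam ^ 2 - θ ^ 2) *
        (cexp (I * lam * p.2) * ζ p.2 * cexp (I * θ * p.1) * v p) := by
    intro p
    rw [(hYd p.2).deriv, (hasDerivAt_testP ω θ lam p.1).deriv, (hasDerivAt_testQ ω θ lam p.1).deriv]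
    ring_nf
    simp only [I_sq]
    ring
  simp only [e] at g
  rw [integral_sub j1 (j3.const_mul _), j2, integral_const_mul] at g
  linear_combination -g

theorem norm_deriv_eta_bound (lam : ℂ) (s : ℝ) : ∃ A : ℝ, 0 ≤ A ∧ ∀ y : ℝ,
    ‖cexp (I * lam * y) * (deriv eta y : ℝ)‖ ≤ A * Real.exp (-(s * |y|)) := by
  obtain ⟨M, hM⟩ := exists_isCutoff_deriv_eta
  have hM0 : 0 ≤ M := (abs_nonneg _).trans (hM.le 0)
  refine ⟨Real.exp ‖lam‖ * M * Real.exp |s|, by positivity, fun y => ?_⟩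
  by_cases hy : y ∈ Icc (0 : ℝ) 1
  · rw [norm_mul, Complex.norm_real, mul_assoc _ (Real.exp |s|), ← Real.exp_add]
    have h1 := mul_le_mul (norm_exp_I_mul_le lam hy) (hM.le y) (abs_nonneg _) (Real.exp_pos _).le
    refine h1.trans (le_mul_of_one_le_right (by positivity) (Real.one_le_exp ?_))
    rw [abs_of_nonneg hy.1]
    nlinarith [le_abs_self s, hy.1, hy.2, abs_nonneg s]
  · rw [hM.supp y hy]
    simp
    positivity

theorem green_upper (h : IsHomogeneous ω γ u v) (θ : ℝ) {lam : ℂ} (hlam : γ < lam.im) :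
    I * dispersionFun ω lam * ((ω : ℂ) ^ 2 - lam ^ 2 - θ ^ 2) *
      (halfInt (Ioi 0) v θ lam + stripInt etaDiff (fun _ x => cexp (I * θ * x)) v lam) =
      resPair ω θ u v lam := by
  obtain ⟨A, hA0, hA⟩ := norm_deriv_eta_bound lam lam.im
  rw [← green_resolvent h hlam θ lam (ζ := eta) Real.smoothTransition.contDiff rfl
    (A := A + 1) (fun y => ?_) (fun y => (hA y).trans (by gcongr; linarith))]
  · have hvm := h.memV.aestronglyMeasurable
    have hvi := h.memV.integrable hlam
    rw [halfInt, stripInt, ← integral_add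
      (integrable_halfInt measurableSet_Ioi hvm hvi (fun y hy => by
        rw [abs_of_pos (by simpa using hy)]) θ)
      (integrable_stripInt isCutoff_etaDiff (isKernel_exp θ) hvm hvi lam)]
    congr 2
    funext p
    simp only [etaDiff]
    push_cast
    ring
  · rw [norm_mul, norm_exp_I_mul, Complex.norm_real, Real.norm_of_nonneg (Real.smoothTransition.nonneg _)]
    rcases le_or_gt y 0 with hy | hy
    · rw [Real.smoothTransition.zero_of_nonpos hy]
      simp; positivity
    · rw [abs_of_pos hy]
      have := Real.smoothTransition.le_one y
      have h0 := Real.smoothTransition.nonneg y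
      have h1 := Real.exp_pos (-(lam.im * y))
      have : Real.exp (-(lam.im * y)) * eta y ≤ Real.exp (-(lam.im * y)) * 1 :=
        mul_le_mul_of_nonneg_left this h1.le
      nlinarith

/-- Here `η - 1` is minus the indicator of `y ≤ 0` plus `etaDiff`; this is the origin of the minus
sign, while the correction term is the same as in `green_upper`. -/
theorem green_lower (h : IsHomogeneous ω γ u v) (θ : ℝ) {lam : ℂ} (hlam : γ < -lam.im) :
    I * dispersionFun ω lam * ((ω : ℂ) ^ 2 - lam ^ 2 - θ ^ 2) *
      (-halfInt (Iic 0) v θ lam + stripInt etaDiff (fun _ x => cexp (I * θ * x)) v lam) =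
      resPair ω θ u v lam := by
  obtain ⟨A, hA0, hA⟩ := norm_deriv_eta_bound lam (-lam.im)
  rw [← green_resolvent h hlam θ lam (ζ := fun y => eta y - 1)
    (Real.smoothTransition.contDiff.sub contDiff_const) (by funext y; simp)
    (A := A + Real.exp (2 * |lam.im|)) (fun y => ?_) (fun y => (hA y).trans (by gcongr; simp; positivity))]
  · have hvm := h.memV.aestronglyMeasurable
    have hvi := h.memV.integrable hlam
    rw [neg_add_eq_sub, halfInt, stripInt, ← integral_sub
      (integrable_stripInt isCutoff_etaDiff (isKernel_exp θ) hvm hvi lam)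
      (integrable_halfInt measurableSet_Iic hvm hvi (fun y hy => by
        rw [abs_of_nonpos (by simpa using hy)]; linarith) θ)]
    congr 2
    funext p
    have : (Ioi (0 : ℝ)).indicator (1 : ℝ → ℝ) p.2 + (Iic (0 : ℝ)).indicator (1 : ℝ → ℝ) p.2 = 1 := by
      by_cases hy : p.2 ≤ 0
      · simp [hy]
      · rw [indicator_of_mem (show p.2 ∈ Ioi 0 from not_le.1 hy),
          indicator_of_notMem (show p.2 ∉ Iic 0 from hy)]
        simp
    simp only [etaDiff]
    rw [show (Iic (0 : ℝ)).indicator (1 : ℝ → ℝ) p.2 = 1 - (Ioi (0 : ℝ)).indicator (1 : ℝ → ℝ) p.2 by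
      linarith]
    push_cast
    ring
  · rw [norm_mul, norm_exp_I_mul, Complex.norm_real, Real.norm_eq_abs, abs_sub_comm,
      abs_of_nonneg (sub_nonneg.2 (Real.smoothTransition.le_one _))]
    have h0 := Real.smoothTransition.nonneg y
    have h1 := Real.smoothTransition.le_one y
    have hp : (1 : ℝ) - eta y ≤ 1 := by linarith
    have hle : Real.exp (-(lam.im * y)) * (1 - eta y) ≤
        Real.exp (2 * |lam.im|) * Real.exp (-(-lam.im * |y|)) := by
      rcases le_or_gt y 1 with hy | hy
      · calc _ ≤ Real.exp (-(lam.im * y)) * 1 := by gcongr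
          _ ≤ _ := by
            rw [mul_one, ← Real.exp_add, Real.exp_le_exp]
            rcases le_or_gt y 0 with hy0 | hy0
            · rw [abs_of_nonpos hy0]
              nlinarith [abs_nonneg lam.im]
            · rw [abs_of_pos hy0]
              nlinarith [abs_nonneg lam.im, neg_abs_le lam.im]
      · have e1 : eta y = 1 := Real.smoothTransition.one_of_one_le hy.le
        rw [e1]
        simp; positivity
    have : 0 ≤ A * Real.exp (-(-lam.im * |y|)) := by positivity
    linarith

end

/-! ### Lower bounds for the dispersion function -/

theorem sinh_abs_im_le_norm_sin (z : ℂ) : (Real.exp |z.im| - 1) / 2 ≤ ‖Complex.sin z‖ := by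
  have h1 : ‖Complex.exp (-z * I)‖ = Real.exp z.im := by rw [Complex.norm_exp]; simp
  have h2 : ‖Complex.exp (z * I)‖ = Real.exp (-z.im) := by rw [Complex.norm_exp]; simp
  have h3 : ‖Complex.sin z‖ = ‖Complex.exp (-z * I) - Complex.exp (z * I)‖ / 2 := by
    rw [Complex.sin, norm_div, norm_mul]; simp
  have h4 := abs_norm_sub_norm_le (Complex.exp (-z * I)) (Complex.exp (z * I))
  rw [h1, h2] at h4
  rw [h3]
  have h5 : Real.exp |z.im| - 1 ≤ |Real.exp z.im - Real.exp (-z.im)| := by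
    rcases le_or_gt 0 z.im with h | h
    · have : Real.exp (-z.im) ≤ 1 := Real.exp_le_one_iff.2 (by linarith)
      rw [abs_of_nonneg h]
      exact le_trans (by linarith) (le_abs_self _)
    · have : Real.exp z.im ≤ 1 := Real.exp_le_one_iff.2 h.le
      rw [abs_of_neg h]
      exact le_trans (by linarith) (neg_le_abs _)
  linarith

/-- Far out in a horizontal strip `κ` is nearly imaginary: `|Im κ|` is at least half of `a = |Re
lam|`, whereas `‖κ‖ ≤ 3a/2`. The sine grows exponentially; for `a ≥ 20` the cubic term `(a/2)³/6` of
the exponential already exceeds `6a + 1`, which gives `‖sin κ‖ ≥ 3a`. -/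
theorem two_le_norm_sincRt {b W ω : ℝ} (hb : 0 ≤ b) (hω : |ω| ≤ W) {lam : ℂ}
    (him : |lam.im| ≤ b) (hre : 20 + 2 * (b + W) ≤ |lam.re|) :
    2 ≤ ‖sincRt 1 ((ω : ℂ) ^ 2 - lam ^ 2)‖ := by
  obtain ⟨κ, hκ⟩ := exists_sq_eq ((ω : ℂ) ^ 2 - lam ^ 2)
  have hW : 0 ≤ W := (abs_nonneg _).trans hω
  set a := |lam.re| with ha
  have ha2 : a ^ 2 = lam.re ^ 2 := sq_abs _
  have hre' : ω ^ 2 - (lam.re ^ 2 - lam.im ^ 2) = κ.re ^ 2 - κ.im ^ 2 := by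
    have := congrArg Complex.re hκ
    simp only [pow_two, Complex.sub_re, Complex.mul_re, Complex.ofReal_re, Complex.ofReal_im] at this
    nlinarith
  have hω2 : ω ^ 2 ≤ W ^ 2 := by rw [← sq_abs ω]; exact pow_le_pow_left₀ (abs_nonneg _) hω 2
  have him2 : lam.im ^ 2 ≤ b ^ 2 := by
    rw [← sq_abs lam.im]; exact pow_le_pow_left₀ (abs_nonneg _) him 2
  have ht : a / 2 ≤ |κ.im| := by
    refine le_of_pow_le_pow_left₀ two_ne_zero (abs_nonneg _) ?_
    rw [sq_abs]
    have h1 : 2 * b ≤ a := by linarith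
    have h2 : 2 * W ≤ a := by linarith
    nlinarith [sq_nonneg κ.re]
  have hS := mul_sincRt_sq 1 κ
  rw [← hκ] at hS
  have hS' : ‖κ‖ * ‖sincRt 1 ((ω : ℂ) ^ 2 - lam ^ 2)‖ = ‖Complex.sin κ‖ := by
    rw [← norm_mul, hS]; simp
  have hκn : ‖κ‖ ≤ 3 / 2 * a := by
    have h1 : ‖κ‖ ≤ W + ‖lam‖ := by
      refine le_of_pow_le_pow_left₀ two_ne_zero (by positivity) ?_
      rw [← norm_pow, ← hκ]
      refine (IsKernel.norm_K_le ω lam).trans ?_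
      gcongr
    have h2 := Complex.norm_le_abs_re_add_abs_im lam
    linarith
  have hsin := sinh_abs_im_le_norm_sin κ
  have hexp := Real.pow_div_factorial_le_exp _ (by positivity : 0 ≤ a / 2) 3
  have hexp2 : Real.exp (a / 2) ≤ Real.exp |κ.im| := Real.exp_le_exp.2 ht
  have ha20 : 20 ≤ a := by linarith
  have h6 : ((3).factorial : ℝ) = 6 := by norm_num [Nat.factorial]
  rw [h6] at hexp
  have hlow : 3 * a ≤ ‖Complex.sin κ‖ := by
    have : (a / 2) ^ 3 / 6 ≥ 6 * a + 1 := by nlinarith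
    linarith
  by_contra hcon
  push Not at hcon
  have : ‖κ‖ * ‖sincRt 1 ((ω : ℂ) ^ 2 - lam ^ 2)‖ < 3 * a := by
    have h0 := norm_nonneg κ
    have h1 := norm_nonneg (sincRt 1 ((ω : ℂ) ^ 2 - lam ^ 2))
    nlinarith
  linarith

/-- To be read as a lower bound for `dispersionFun`: the other factor is of exponential type, so the
reciprocal grows at most exponentially along the strip. It comes from the factorisation `1 - (ωS)²`
and `|ωS| ≥ 2`. -/
theorem one_le_norm_mul_of_re_large {b W ω : ℝ} (hb : 0 ≤ b) (hω1 : 1 ≤ ω) (hω : ω ≤ W) {lam : ℂ}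
    (him : |lam.im| ≤ b) (hre : 20 + 2 * (b + W) ≤ |lam.re|) :
    1 ≤ ‖dispersionFun ω lam‖ * ‖cosRt 1 ((ω : ℂ) ^ 2 - lam ^ 2) +
      lam * sincRt 1 ((ω : ℂ) ^ 2 - lam ^ 2)‖ := by
  have h := two_le_norm_sincRt (ω := ω) hb (by rw [abs_of_pos (by linarith)]; exact hω) him hre
  rw [← norm_mul, dispersionFun_mul]
  have h1 : 2 ≤ ‖(ω : ℂ) * sincRt 1 ((ω : ℂ) ^ 2 - lam ^ 2)‖ := by
    rw [norm_mul, Complex.norm_real, Real.norm_of_nonneg (by linarith)]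
    nlinarith
  have h2 := norm_sub_norm_le (((ω : ℂ) * sincRt 1 ((ω : ℂ) ^ 2 - lam ^ 2)) ^ 2) 1
  rw [norm_pow, norm_one, norm_sub_rev] at h2
  nlinarith

theorem dispersionFun_ne_zero_of_re_large {b W ω : ℝ} (hb : 0 ≤ b) (hω1 : 1 ≤ ω) (hω : ω ≤ W)
    {lam : ℂ} (him : |lam.im| ≤ b) (hre : 20 + 2 * (b + W) ≤ |lam.re|) :
    dispersionFun ω lam ≠ 0 := by
  intro h0
  have := one_le_norm_mul_of_re_large hb hω1 hω him hre
  rw [h0] at this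
  simp at this
  linarith

theorem eventually_ne_of_entire {f : ℂ → ℂ} (hf : Differentiable ℂ f) {w : ℂ} (hw : f w ≠ 0)
    (z : ℂ) : ∀ᶠ x in 𝓝[≠] z, f x ≠ 0 := by
  have ha : AnalyticOnNhd ℂ f univ := fun x _ => hf.analyticAt x
  rcases (ha z (mem_univ _)).eventually_eq_zero_or_eventually_ne_zero with h | h
  · exact absurd (ha.eqOn_zero_of_preconnected_of_eventuallyEq_zero isPreconnected_univ
      (mem_univ z) h (mem_univ w)) hw
  · exact h

theorem dispersionFun_eventually_ne {ω : ℝ} (hω : 1 ≤ ω) (z : ℂ) :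
    ∀ᶠ x in 𝓝[≠] z, dispersionFun ω x ≠ 0 :=
  eventually_ne_of_entire (differentiable_dispersionFun ω)
    (w := ((20 + 2 * (0 + ω) : ℝ) : ℂ)) (dispersionFun_ne_zero_of_re_large (b := 0) (W := ω) le_rfl hω
      le_rfl (by simp) (by rw [Complex.ofReal_re]; exact le_abs_self _)) z

/-! ### Gluing and a Liouville theorem -/

theorem eq_of_eventuallyEq_punctured {f g : ℂ → ℂ} {z : ℂ} (hf : ContinuousAt f z)
    (hg : ContinuousAt g z) (h : f =ᶠ[𝓝[≠] z] g) : f z = g z :=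
  tendsto_nhds_unique (hf.tendsto.mono_left nhdsWithin_le_nhds)
    ((hg.tendsto.mono_left nhdsWithin_le_nhds).congr' h.symm)

/-- Removability of singularities for a quotient that takes junk values at zeros of its denominator:
only punctured neighbourhoods of each point are consulted. -/
theorem exists_entire_of_local {f : ℂ → ℂ}
    (h : ∀ z, ∃ g, AnalyticAt ℂ g z ∧ f =ᶠ[𝓝[≠] z] g) :
    ∃ M : ℂ → ℂ, Differentiable ℂ M ∧
      ∀ z g, ContinuousAt g z → f =ᶠ[𝓝[≠] z] g → M z = g z := by
  choose g hg hfg using h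
  have key : ∀ z k, ContinuousAt k z → f =ᶠ[𝓝[≠] z] k → g z z = k z := fun z k hk hfk =>
    eq_of_eventuallyEq_punctured (hg z).continuousAt hk ((hfg z).symm.trans hfk)
  refine ⟨fun z => g z z, fun z => ?_, key⟩
  have h1 : ∀ᶠ w in 𝓝[≠] z, f =ᶠ[𝓝[≠] w] g z := by
    have := eventually_eventually_nhdsWithin.2 (hfg z)
    filter_upwards [this, self_mem_nhdsWithin] with w hw hwz
    have hwz' : w ≠ z := hwz
    have e : 𝓝[≠] w ≤ 𝓝[≠] z ⊔ 𝓝[≠] w := le_sup_right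
    have : 𝓝[{z}ᶜ] w = 𝓝 w := isOpen_compl_singleton.nhdsWithin_eq hwz'
    rw [this] at hw
    exact hw.filter_mono nhdsWithin_le_nhds
  have h2 : ∀ᶠ w in 𝓝[≠] z, AnalyticAt ℂ (g z) w :=
    (hg z).eventually_analyticAt.filter_mono nhdsWithin_le_nhds
  have h3 : (fun z => g z z) =ᶠ[𝓝 z] g z := by
    filter_upwards [eventually_nhdsWithin_iff.1 (h1.and h2)] with w hw
    by_cases hwz : w = z
    · rw [hwz]
    · exact key w (g z) (hw hwz).2.continuousAt (hw hwz).1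
  exact (hg z).differentiableAt.congr_of_eventuallyEq h3

/-- Phragmén–Lindelöf in the strip carries the bound `C` from its edges to its interior, and
Liouville's theorem finishes. -/
theorem eq_const_of_strip_growth {M : ℂ → ℂ} (hM : Differentiable ℂ M) {b C A B R : ℝ} (hb : 0 < b)
    (hA : 0 ≤ A) (hB : 0 ≤ B)
    (hout : ∀ z : ℂ, b ≤ |z.im| → ‖M z‖ ≤ C)
    (hin : ∀ z : ℂ, |z.im| ≤ b → R ≤ |z.re| → ‖M z‖ ≤ A * Real.exp (B * |z.re|)) :
    ∀ z w, M z = M w := by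
  have hbd : ∀ z : ℂ, ‖M z‖ ≤ C := by
    intro z
    rcases le_or_gt b |z.im| with hz | hz
    · exact hout z hz
    · refine PhragmenLindelof.horizontal_strip (a := -b) (b := b) hM.diffContOnCl ?_ (fun z hz => ?_)
        (fun z hz => ?_) (abs_lt.1 hz).1.le (abs_lt.1 hz).2.le
      -- The strip has width `2b`, so any exponent below `π/(2b)` is allowed in the double
      -- exponential; half of it is taken. The second constant is chosen so that `B |x| ≤ (B/c) exp
      -- (c |x|)` with `c = π/(4b)`.
      · refine ⟨Real.pi / (4 * b), ?_, B / (Real.pi / (4 * b)), ?_⟩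
        · rw [sub_neg_eq_add]
          apply div_lt_div_of_pos_left Real.pi_pos <;> linarith
        · have hc : 0 < Real.pi / (4 * b) := by have := Real.pi_pos; positivity
          refine Asymptotics.IsBigO.of_bound A ?_
          rw [Filter.eventually_inf_principal]
          have : ∀ᶠ z : ℂ in comap (_root_.abs ∘ re) atTop, R ≤ |z.re| :=
            (eventually_ge_atTop R).comap _
          filter_upwards [this] with w hw hwim
          refine (hin w (abs_le.2 ⟨hwim.1.le, hwim.2.le⟩) hw).trans ?_
          rw [Real.norm_of_nonneg (Real.exp_pos _).le]
          refine mul_le_mul_of_nonneg_left (Real.exp_le_exp.2 ?_) hA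
          have h1 := Real.add_one_le_exp (Real.pi / (4 * b) * |w.re|)
          rw [div_mul_eq_mul_div, le_div_iff₀ hc]
          nlinarith
      · exact hout z (by rw [hz, abs_neg, abs_of_pos hb])
      · exact hout z (by rw [hz, abs_of_pos hb])
  intro z w
  exact hM.apply_eq_apply_of_bounded (isBounded_iff_forall_norm_le.2 ⟨C, by rintro _ ⟨x, rfl⟩; exact hbd x⟩) z w

/-! ### Uniqueness -/

/-- The reason for taking `θ` large: the factor `ω² - lam² - θ²` then has no zero in the strip, and
only roots of `dispersionFun` can produce poles there. -/
theorem norm_K_sub_ge {ω θ b : ℝ} {lam : ℂ} (him : |lam.im| ≤ b) :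
    θ ^ 2 - ω ^ 2 - b ^ 2 ≤ ‖(ω : ℂ) ^ 2 - lam ^ 2 - θ ^ 2‖ := by
  refine le_trans ?_ (Complex.abs_re_le_norm _)
  refine le_trans ?_ (neg_le_abs _)
  have : ((ω : ℂ) ^ 2 - lam ^ 2 - θ ^ 2).re = ω ^ 2 - (lam.re ^ 2 - lam.im ^ 2) - θ ^ 2 := by
    simp [pow_two]
  rw [this]
  have him2 : lam.im ^ 2 ≤ b ^ 2 := by
    rw [← sq_abs lam.im]; exact pow_le_pow_left₀ (abs_nonneg _) him 2
  nlinarith [sq_nonneg lam.re]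

theorem K_sub_eventually_ne (ω θ : ℝ) (z : ℂ) :
    ∀ᶠ x in 𝓝[≠] z, (ω : ℂ) ^ 2 - x ^ 2 - θ ^ 2 ≠ 0 := by
  refine eventually_ne_of_entire (f := fun x => (ω : ℂ) ^ 2 - x ^ 2 - θ ^ 2) (by fun_prop)
    (w := ((|ω| + 1 : ℝ) : ℂ)) ?_ z
  norm_cast
  have : ω ^ 2 < (|ω| + 1) ^ 2 := by rw [← sq_abs ω]; nlinarith [abs_nonneg ω]
  nlinarith [sq_nonneg θ]

section
variable {ω γ : ℝ} {u v : ℝ × ℝ → ℂ}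

theorem differentiable_stripInt_eta {k : ℂ → ℝ → ℂ} (hk : IsKernel k) (hu : MemTempered γ u) :
    Differentiable ℂ (stripInt (deriv eta) k u) := by
  obtain ⟨M, hM⟩ := exists_isCutoff_deriv_eta
  exact differentiable_stripInt hM hk hu.aestronglyMeasurable (hu.integrable (lt_add_one γ))

theorem differentiable_leftPair (h : IsHomogeneous ω γ u v) : Differentiable ℂ (leftPair ω u v) :=
  (differentiable_stripInt_eta (isKernel_leftV ω) h.memU).add
    (differentiable_stripInt_eta (isKernel_leftU ω) h.memV)

/-- The resolvent quotient. -/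
def resQuot (ω θ : ℝ) (u v : ℝ × ℝ → ℂ) (lam : ℂ) : ℂ :=
  resPair ω θ u v lam / (I * dispersionFun ω lam * ((ω : ℂ) ^ 2 - lam ^ 2 - θ ^ 2)) -
    stripInt etaDiff (fun _ x => cexp (I * θ * x)) v lam

theorem differentiable_etaDiff_term (h : IsHomogeneous ω γ u v) (θ : ℝ) :
    Differentiable ℂ (stripInt etaDiff (fun _ x => cexp (I * θ * x)) v) :=
  differentiable_stripInt isCutoff_etaDiff (isKernel_exp θ) h.memV.aestronglyMeasurable
    (h.memV.integrable (lt_add_one γ))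

theorem differentiable_resPair (h : IsHomogeneous ω γ u v) (θ : ℝ) :
    Differentiable ℂ (resPair ω θ u v) :=
  ((differentiable_dispersionFun ω).mul
    ((differentiable_stripInt_eta (isKernel_resV ω θ) h.memU).add
      (differentiable_stripInt_eta (isKernel_resU ω θ) h.memV))).add
    (((isKernel_resC ω θ).diff 0).mul (differentiable_leftPair h))

theorem resQuot_eq_upper (h : IsHomogeneous ω γ u v) (hω : 1 ≤ ω) (θ : ℝ) {z : ℂ} (hz : γ < z.im) :
    resQuot ω θ u v =ᶠ[𝓝[≠] z] halfInt (Ioi 0) v θ := by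
  have h1 : ∀ᶠ w in 𝓝[≠] z, γ < w.im :=
    (continuous_im.continuousAt.eventually (lt_mem_nhds hz)).filter_mono nhdsWithin_le_nhds
  filter_upwards [h1, dispersionFun_eventually_ne hω z, K_sub_eventually_ne ω θ z] with w h1 h2 h3
  rw [resQuot, ← green_upper h θ h1]
  field_simp [I_ne_zero]
  ring

theorem resQuot_eq_lower (h : IsHomogeneous ω γ u v) (hω : 1 ≤ ω) (θ : ℝ) {z : ℂ}
    (hz : γ < -z.im) :
    resQuot ω θ u v =ᶠ[𝓝[≠] z] fun w => -halfInt (Iic 0) v θ w := by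
  have h1 : ∀ᶠ w in 𝓝[≠] z, γ < -w.im :=
    (continuous_im.neg.continuousAt.eventually (lt_mem_nhds hz)).filter_mono nhdsWithin_le_nhds
  filter_upwards [h1, dispersionFun_eventually_ne hω z, K_sub_eventually_ne ω θ z] with w h1 h2 h3
  rw [resQuot, ← green_lower h θ h1]
  field_simp [I_ne_zero]
  ring

theorem upper_exponent {s : ℝ} {z : ℂ} (hz : s ≤ z.im) :
    ∀ y ∈ Ioi (0 : ℝ), -(z.im * y) ≤ -(s * |y|) := by
  intro y hy
  rw [mem_Ioi] at hy
  rw [abs_of_pos hy]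
  nlinarith

theorem lower_exponent {s : ℝ} {z : ℂ} (hz : s ≤ -z.im) :
    ∀ y ∈ Iic (0 : ℝ), -(z.im * y) ≤ -(s * |y|) := by
  intro y hy
  rw [mem_Iic] at hy
  rw [abs_of_nonpos hy]
  nlinarith

theorem analyticAt_halfInt_upper (h : IsHomogeneous ω γ u v) (θ : ℂ) {z : ℂ} (hz : γ < z.im) :
    AnalyticAt ℂ (halfInt (Ioi 0) v θ) z := by
  have ho : IsOpen {w : ℂ | γ < w.im} := isOpen_lt continuous_const continuous_im
  refine DifferentiableOn.analyticAt (s := {w : ℂ | γ < w.im}) (fun w hw => ?_) (ho.mem_nhds hz)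
  have hw' : γ < w.im := hw
  refine (differentiableAt_halfInt measurableSet_Ioi h.memV.aestronglyMeasurable
    (h.memV.integrable (s := (γ + w.im) / 2) (by linarith)) (r := (w.im - γ) / 2) (by linarith)
    (fun x hx => upper_exponent ?_) θ).differentiableWithinAt
  have h1 := Complex.abs_im_le_norm (x - w)
  rw [mem_ball_iff_norm] at hx
  have h2 := (abs_le.1 h1).1
  rw [Complex.sub_im] at h2
  linarith

theorem analyticAt_halfInt_lower (h : IsHomogeneous ω γ u v) (θ : ℂ) {z : ℂ} (hz : γ < -z.im) :
    AnalyticAt ℂ (halfInt (Iic 0) v θ) z := by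
  have ho : IsOpen {w : ℂ | γ < -w.im} := isOpen_lt continuous_const continuous_im.neg
  refine DifferentiableOn.analyticAt (s := {w : ℂ | γ < -w.im}) (fun w hw => ?_) (ho.mem_nhds hz)
  have hw' : γ < -w.im := hw
  refine (differentiableAt_halfInt measurableSet_Iic h.memV.aestronglyMeasurable
    (h.memV.integrable (s := (γ - w.im) / 2) (by linarith)) (r := (-w.im - γ) / 2) (by linarith)
    (fun x hx => lower_exponent ?_) θ).differentiableWithinAt
  have h1 := Complex.abs_im_le_norm (x - w)
  rw [mem_ball_iff_norm] at hx
  have h2 := (abs_le.1 h1).2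
  rw [Complex.sub_im] at h2
  linarith

/-- The pairing with the left solution vanishes at the roots in the strip `|Im λ| ≤ γ`, to the
order of the dispersion function. -/
def PairVanishes (ω γ : ℝ) (u v : ℝ × ℝ → ℂ) : Prop :=
  ∀ z : ℂ, |z.im| ≤ γ → dispersionFun ω z = 0 →
    ∃ g, AnalyticAt ℂ g z ∧ ∀ᶠ w in 𝓝 z, leftPair ω u v w = dispersionFun ω w * g w

/-- In `resPair` one summand carries the factor `dispersionFun` and the other is a multiple of
`leftPair`, which `PairVanishes` makes divisible by it. So the roots in the closed strip are
removable; outside the strip the half-strip transforms provide the analytic representative. -/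
theorem resQuot_local (h : IsHomogeneous ω γ u v) (hω : 1 ≤ ω) (hL : PairVanishes ω γ u v)
    {θ : ℝ} (hθ : 0 < θ ^ 2 - ω ^ 2 - γ ^ 2) (z : ℂ) :
    ∃ g, AnalyticAt ℂ g z ∧ resQuot ω θ u v =ᶠ[𝓝[≠] z] g := by
  rcases lt_or_ge γ z.im with hz | hz
  · exact ⟨_, analyticAt_halfInt_upper h θ hz, resQuot_eq_upper h hω θ hz⟩
  rcases lt_or_ge γ (-z.im) with hz' | hz'
  · exact ⟨_, (analyticAt_halfInt_lower h θ hz').neg, resQuot_eq_lower h hω θ hz'⟩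
  have him : |z.im| ≤ γ := abs_le'.2 ⟨hz, hz'⟩
  have hK : (ω : ℂ) ^ 2 - z ^ 2 - θ ^ 2 ≠ 0 := by
    have := norm_K_sub_ge (ω := ω) (θ := θ) him
    intro h0
    rw [h0, norm_zero] at this
    linarith
  have hKa : AnalyticAt ℂ (fun z : ℂ => (ω : ℂ) ^ 2 - z ^ 2 - θ ^ 2) z := by fun_prop
  have hT : AnalyticAt ℂ (stripInt etaDiff (fun _ x => cexp (I * θ * x)) v) z :=
    (differentiable_etaDiff_term h θ).analyticAt z
  by_cases hD : dispersionFun ω z = 0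
  · obtain ⟨g, hg, hg'⟩ := hL z him hD
    have hU := (differentiable_stripInt_eta (isKernel_resV ω θ) h.memU).analyticAt z
    have hV := (differentiable_stripInt_eta (isKernel_resU ω θ) h.memV).analyticAt z
    have hC : AnalyticAt ℂ (resC ω θ) z := ((isKernel_resC ω θ).diff 0).analyticAt z
    refine ⟨fun w => (stripInt (deriv eta) (resV ω θ) u w + stripInt (deriv eta) (resU ω θ) v w +
      resC ω θ w * g w) / (I * ((ω : ℂ) ^ 2 - w ^ 2 - θ ^ 2)) -
      stripInt etaDiff (fun _ x => cexp (I * θ * x)) v w, ?_, ?_⟩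
    · refine AnalyticAt.sub (AnalyticAt.div ((hU.add hV).add (hC.mul hg))
        (analyticAt_const.mul hKa) (mul_ne_zero I_ne_zero hK)) hT
    · filter_upwards [hg'.filter_mono nhdsWithin_le_nhds, dispersionFun_eventually_ne hω z,
        K_sub_eventually_ne ω θ z] with w h1 h2 h3
      rw [resQuot, resPair, h1]
      field_simp [I_ne_zero]
  · refine ⟨resQuot ω θ u v, ?_, EventuallyEq.rfl⟩
    refine AnalyticAt.sub (AnalyticAt.div ((differentiable_resPair h θ).analyticAt z)
      ((analyticAt_const.mul ((differentiable_dispersionFun ω).analyticAt z)).mul hKa) ?_) hT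
    exact mul_ne_zero (mul_ne_zero I_ne_zero hD) hK

-- All ingredients are of exponential type; the reciprocal of `dispersionFun` is bounded by its
-- conjugate factor and that of the quadratic factor by `1 / δ`.
set_option maxHeartbeats 1000000 in
theorem norm_resQuot_le (h : IsHomogeneous ω γ u v) (hω : 1 ≤ ω) {θ b : ℝ} (hb : 0 ≤ b)
    (hθ : 0 < θ ^ 2 - ω ^ 2 - b ^ 2) :
    ∃ A B : ℝ, 0 ≤ A ∧ 0 ≤ B ∧ ∀ z : ℂ, |z.im| ≤ b → 20 + 2 * (b + ω) ≤ |z.re| →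
      ‖resQuot ω θ u v z‖ ≤ A * Real.exp (B * |z.re|) := by
  obtain ⟨M, hM⟩ := exists_isCutoff_deriv_eta
  have hui := h.memU.integrable (lt_add_one γ)
  have hvi := h.memV.integrable (lt_add_one γ)
  obtain ⟨A1, B1, hA1, hB1, h1⟩ := norm_stripInt_le hM (isKernel_resV ω θ) hui
  obtain ⟨A2, B2, hA2, hB2, h2⟩ := norm_stripInt_le hM (isKernel_resU ω θ) hvi
  obtain ⟨A3, B3, hA3, hB3, h3⟩ := norm_stripInt_le hM (isKernel_leftV ω) hui
  obtain ⟨A4, B4, hA4, hB4, h4⟩ := norm_stripInt_le hM (isKernel_leftU ω) hvi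
  obtain ⟨A5, B5, hA5, hB5, h5⟩ := norm_stripInt_le isCutoff_etaDiff (isKernel_exp θ) hvi
  obtain ⟨A6, B6, hA6, hB6, h6⟩ := (isKernel_resC ω θ).bound
  obtain ⟨A7, B7, hA7, hB7, h7⟩ := (IsKernel.disp ω).bound
  obtain ⟨A8, B8, hA8, hB8, h8⟩ := ((IsKernel.cos ω).add (IsKernel.param.mul (IsKernel.sinc ω))).bound
  set δ := θ ^ 2 - ω ^ 2 - b ^ 2 with hδ
  -- One exponent dominating all the bounds. The final `3 * m` counts two factors `E` from `resPair`
  -- and one from the reciprocal of `dispersionFun`.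
  set m := B1 + B2 + B3 + B4 + B5 + B6 + B7 + B8 with hm
  set Q := (A7 * (A1 + A2) + A6 * (A3 + A4)) * A8 / δ + A5 with hQ
  have hQ0 : 0 ≤ Q := by positivity
  refine ⟨Q * Real.exp (3 * m * b), 3 * m, by positivity, by positivity, fun z hz hzr => ?_⟩
  have hE : ∀ {B : ℝ}, B ≤ m → Real.exp (B * ‖z‖) ≤ Real.exp (m * ‖z‖) := fun hB =>
    Real.exp_le_exp.2 (mul_le_mul_of_nonneg_right hB (norm_nonneg _))
  set E := Real.exp (m * ‖z‖) with hEdef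
  have hE1 : 1 ≤ E := Real.one_le_exp (by positivity)
  have up : ∀ {A B : ℝ} {n : ℝ}, 0 ≤ A → B ≤ m → n ≤ A * Real.exp (B * ‖z‖) → n ≤ A * E :=
    fun hA hB hn => hn.trans (mul_le_mul_of_nonneg_left (hE hB) hA)
  have e1 := up hA1 (by linarith) (h1 z)
  have e2 := up hA2 (by linarith) (h2 z)
  have e3 := up hA3 (by linarith) (h3 z)
  have e4 := up hA4 (by linarith) (h4 z)
  have e5 := up hA5 (by linarith) (h5 z)
  have e6 := up hA6 (by linarith) (h6 z 0 (by simp))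
  have e7 := up hA7 (by linarith) (h7 z 0 (by simp))
  have e8 := up hA8 (by linarith) (h8 z 1 (by simp))
  have hpair : ‖resPair ω θ u v z‖ ≤ (A7 * (A1 + A2) + A6 * (A3 + A4)) * E ^ 2 := by
    rw [resPair, leftPair]
    calc _ ≤ _ := norm_add_le _ _
      _ ≤ A7 * E * (A1 * E + A2 * E) + A6 * E * (A3 * E + A4 * E) := by
        rw [norm_mul, norm_mul]
        gcongr
        · exact (norm_add_le _ _).trans (add_le_add e1 e2)
        · exact (norm_add_le _ _).trans (add_le_add e3 e4)
      _ = _ := by ring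
  have hlow := one_le_norm_mul_of_re_large hb hω le_rfl hz hzr
  have hD0 := dispersionFun_ne_zero_of_re_large hb hω le_rfl hz hzr
  have hK := norm_K_sub_ge (ω := ω) (θ := θ) hz
  have hDpos : 0 < ‖dispersionFun ω z‖ := norm_pos_iff.2 hD0
  have hDinv : 1 / ‖dispersionFun ω z‖ ≤ A8 * E := by
    rw [div_le_iff₀ hDpos]
    calc (1 : ℝ) ≤ _ := hlow
      _ ≤ ‖dispersionFun ω z‖ * (A8 * E) := by gcongr
      _ = _ := by ring
  have hKinv : 1 / ‖(ω : ℂ) ^ 2 - z ^ 2 - θ ^ 2‖ ≤ 1 / δ := one_div_le_one_div_of_le hθ hK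
  have htot : ‖resQuot ω θ u v z‖ ≤ Q * E ^ 3 := by
    rw [resQuot]
    refine (norm_sub_le _ _).trans ?_
    have : ‖resPair ω θ u v z / (I * dispersionFun ω z * ((ω : ℂ) ^ 2 - z ^ 2 - θ ^ 2))‖ =
        ‖resPair ω θ u v z‖ * (1 / ‖dispersionFun ω z‖) * (1 / ‖(ω : ℂ) ^ 2 - z ^ 2 - θ ^ 2‖) := by
      rw [norm_div, norm_mul, norm_mul, norm_I]
      field_simp
    rw [this]
    calc _ ≤ (A7 * (A1 + A2) + A6 * (A3 + A4)) * E ^ 2 * (A8 * E) * (1 / δ) + A5 * E := by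
          gcongr
      _ ≤ (A7 * (A1 + A2) + A6 * (A3 + A4)) * E ^ 2 * (A8 * E) * (1 / δ) + A5 * E ^ 3 := by
          gcongr; exact le_self_pow₀ hE1 (by norm_num)
      _ = _ := by rw [hQ]; ring
  refine htot.trans ?_
  rw [mul_assoc, ← Real.exp_add, hEdef, ← Real.exp_nat_mul]
  have := Complex.norm_le_abs_re_add_abs_im z
  have hm0 : 0 ≤ m := by positivity
  refine mul_le_mul_of_nonneg_left (Real.exp_le_exp.2 ?_) hQ0
  push_cast
  nlinarith [mul_le_mul_of_nonneg_left (this.trans (add_le_add_right hz _)) hm0]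

/-- The Liouville argument. Widening the strip to `γ + 1` leaves a margin in which both half-strip
transforms are bounded by one weighted L¹ norm of `v`, and the condition on `θ` refers to the
widened strip. -/
theorem halfInt_eq_zero_of_large (h : IsHomogeneous ω γ u v) (hω : 1 ≤ ω) (hγ : 0 < γ)
    (hL : PairVanishes ω γ u v) {θ : ℝ} (hθ : 0 < θ ^ 2 - ω ^ 2 - (γ + 1) ^ 2) :
    (∀ z : ℂ, γ < z.im → halfInt (Ioi 0) v θ z = 0) ∧
      ∀ z : ℂ, γ < -z.im → halfInt (Iic 0) v θ z = 0 := by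
  have hθ' : 0 < θ ^ 2 - ω ^ 2 - γ ^ 2 := by nlinarith
  obtain ⟨M, hM, hMeq⟩ := exists_entire_of_local (resQuot_local h hω hL hθ')
  have hup : ∀ z : ℂ, γ < z.im → M z = halfInt (Ioi 0) v θ z := fun z hz =>
    hMeq z _ (analyticAt_halfInt_upper h θ hz).continuousAt (resQuot_eq_upper h hω θ hz)
  have hlo : ∀ z : ℂ, γ < -z.im → M z = -halfInt (Iic 0) v θ z := fun z hz =>
    hMeq z _ (analyticAt_halfInt_lower h θ hz).neg.continuousAt (resQuot_eq_lower h hω θ hz)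
  have hvi := h.memV.integrable (lt_add_one γ)
  obtain ⟨A, B, hA, hB, hAB⟩ := norm_resQuot_le h hω (b := γ + 1) (by linarith) hθ
  have hconst := eq_const_of_strip_growth hM (b := γ + 1)
    (C := ∫ p in strip, ‖v p‖ * Real.exp (-((γ + 1) * |p.2|))) (A := A) (B := B)
    (R := 20 + 2 * (γ + 1 + ω)) (by linarith) hA hB (fun z hz => ?_) (fun z hz hzr => ?_)
  · have hlim := tendsto_halfInt_Ioi h.memV.aestronglyMeasurable hvi θ
    have hM0 : ∀ z, M z = 0 := by
      intro z
      refine tendsto_nhds_unique (tendsto_const_nhds (x := M z) (f := (atTop : Filter ℕ))) ?_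
      refine hlim.congr fun n => ?_
      rw [← hup _ (by simp; have := Nat.cast_nonneg (α := ℝ) n; linarith)]
      exact hconst _ _
    exact ⟨fun z hz => by rw [← hup z hz, hM0], fun z hz => by
      rw [← neg_eq_zero, ← hlo z hz, hM0]⟩
  · rcases le_abs.1 hz with hz | hz
    · rw [hup z (by linarith)]
      exact norm_halfInt_le hvi (upper_exponent hz) θ
    · rw [hlo z (by linarith), norm_neg]
      exact norm_halfInt_le hvi (lower_exponent hz) θ
  · refine le_trans (le_of_eq ?_) (hAB z hz hzr)
    congr 1
    refine hMeq z _ ?_ EventuallyEq.rfl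
    have hD0 := dispersionFun_ne_zero_of_re_large (by linarith : (0 : ℝ) ≤ γ + 1) hω le_rfl hz hzr
    have hK : (ω : ℂ) ^ 2 - z ^ 2 - θ ^ 2 ≠ 0 := by
      have := norm_K_sub_ge (ω := ω) (θ := θ) hz
      intro h0
      rw [h0, norm_zero] at this
      linarith
    refine ContinuousAt.sub (ContinuousAt.div ((differentiable_resPair h θ).continuous.continuousAt)
      (by have := (differentiable_dispersionFun ω).continuous; fun_prop)
      (mul_ne_zero (mul_ne_zero I_ne_zero hD0) hK))
      (differentiable_etaDiff_term h θ).continuous.continuousAt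

theorem eq_zero_of_eq_zero_on_large {f : ℂ → ℂ} (hf : Differentiable ℂ f) {T : ℝ}
    (h : ∀ θ : ℝ, T < θ → f θ = 0) (z : ℂ) : f z = 0 := by
  by_contra hz
  have h1 := eventually_ne_of_entire hf hz ((T + 1 : ℝ) : ℂ)
  have h2 : Tendsto (fun n : ℕ => ((T + 1 + 1 / ((n : ℝ) + 1) : ℝ) : ℂ)) atTop
      (𝓝[≠] ((T + 1 : ℝ) : ℂ)) := by
    refine tendsto_nhdsWithin_iff.2 ⟨?_, Eventually.of_forall fun n => ?_⟩
    · have := (tendsto_one_div_add_atTop_nhds_zero_nat (𝕜 := ℝ)).const_add (T + 1)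
      rw [add_zero] at this
      exact (Complex.continuous_ofReal.tendsto _).comp this
    · simp only [mem_compl_iff, mem_singleton_iff, Complex.ofReal_inj]
      have : 0 < 1 / ((n : ℝ) + 1) := by positivity
      linarith
  obtain ⟨n, hn⟩ := (h2.eventually h1).exists
  refine hn (h _ ?_)
  have : 0 < 1 / ((n : ℝ) + 1) := by positivity
  linarith

/-- Since `x` ranges over a bounded interval, the transform is entire in `θ`, so its vanishing for
large real `θ` forces it to vanish identically. -/
theorem halfInt_eq_zero (h : IsHomogeneous ω γ u v) (hω : 1 ≤ ω) (hγ : 0 < γ)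
    (hL : PairVanishes ω γ u v) (θ : ℂ) :
    (∀ z : ℂ, γ < z.im → halfInt (Ioi 0) v θ z = 0) ∧
      ∀ z : ℂ, γ < -z.im → halfInt (Iic 0) v θ z = 0 := by
  have hT : ∀ θ : ℝ, ω + (γ + 1) < θ → 0 < θ ^ 2 - ω ^ 2 - (γ + 1) ^ 2 := by
    intro θ hθ
    nlinarith [mul_pos (by linarith : 0 < ω) (by linarith : 0 < γ + 1)]
  refine ⟨fun z hz => ?_, fun z hz => ?_⟩
  · exact eq_zero_of_eq_zero_on_large (f := fun θ => halfInt (Ioi 0) v θ z)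
      (differentiable_halfInt_left measurableSet_Ioi h.memV.aestronglyMeasurable
      (h.memV.integrable hz) (upper_exponent le_rfl)) (T := ω + (γ + 1))
      (fun θ hθ => (halfInt_eq_zero_of_large h hω hγ hL (hT θ hθ)).1 z hz) θ
  · exact eq_zero_of_eq_zero_on_large (f := fun θ => halfInt (Iic 0) v θ z)
      (differentiable_halfInt_left measurableSet_Iic h.memV.aestronglyMeasurable
      (h.memV.integrable hz) (lower_exponent le_rfl)) (T := ω + (γ + 1))
      (fun θ hθ => (halfInt_eq_zero_of_large h hω hγ hL (hT θ hθ)).2 z hz) θ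

end

/-! ### Injectivity of the Fourier transform -/

section
variable {E : Type*} [NormedAddCommGroup E] [NormedSpace ℝ E] [MeasurableSpace E] [BorelSpace E]
  [SecondCountableTopology E] [CompleteSpace E] {μ : Measure E}

/-- The positive and negative parts of `f` are densities of two finite measures with equal
characteristic functions, hence of equal measures. -/
theorem ae_eq_zero_of_fourier_real {f : E → ℝ} (hf : Integrable f μ)
    (h : ∀ L : StrongDual ℝ E, ∫ x, cexp (L x * I) * f x ∂μ = 0) : f =ᵐ[μ] 0 := by
  have hfm := hf.1.aemeasurable
  have := isFiniteMeasure_withDensity_ofReal hf.2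
  have := isFiniteMeasure_withDensity_ofReal hf.neg.2
  have key : μ.withDensity (fun x => ENNReal.ofReal (f x)) =
      μ.withDensity (fun x => ENNReal.ofReal ((-f) x)) := by
    refine Measure.ext_of_charFunDual (funext fun L => ?_)
    have hexp : AEStronglyMeasurable (fun x => cexp (L x * I)) μ := by
      apply Continuous.aestronglyMeasurable; fun_prop
    have hint : ∀ g : E → ℝ, Integrable g μ →
        Integrable (fun x => cexp (L x * I) * ((g x : ℝ) : ℂ)) μ := fun g hg =>
      hg.ofReal.bdd_mul (c := 1) hexp (Eventually.of_forall fun x => by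
        rw [Complex.norm_exp_ofReal_mul_I])
    rw [charFunDual_apply, charFunDual_apply,
      integral_withDensity_eq_integral_toReal_smul₀ hfm.ennreal_ofReal (by simp),
      integral_withDensity_eq_integral_toReal_smul₀ hfm.neg.ennreal_ofReal (by simp),
      ← sub_eq_zero, ← integral_sub, ← h L]
    · refine integral_congr_ae (Eventually.of_forall fun x => ?_)
      simp only [ENNReal.toReal_ofReal', Complex.real_smul, Pi.neg_apply]
      rw [mul_comm (cexp _), ← sub_mul, ← Complex.ofReal_sub]
      congr 2
      rcases le_total 0 (f x) with h0 | h0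
      · rw [max_eq_left h0, max_eq_right (by linarith)]; ring
      · rw [max_eq_right h0, max_eq_left (by linarith)]; ring
    · refine (hint _ hf.pos_part).congr (Eventually.of_forall fun x => ?_)
      simp only [ENNReal.toReal_ofReal', Complex.real_smul]
      exact mul_comm _ _
    · refine (hint _ hf.neg.pos_part).congr (Eventually.of_forall fun x => ?_)
      simp only [ENNReal.toReal_ofReal', Complex.real_smul]
      exact mul_comm _ _
  rw [withDensity_eq_iff hfm.ennreal_ofReal hfm.neg.ennreal_ofReal
    hf.lintegral_lt_top.ne] at key
  filter_upwards [key] with x hx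
  simp only [Pi.neg_apply, Pi.zero_apply] at hx ⊢
  rcases le_total 0 (f x) with h0 | h0
  · rw [ENNReal.ofReal_of_nonpos (by linarith : -f x ≤ 0), ENNReal.ofReal_eq_zero] at hx
    linarith
  · rw [ENNReal.ofReal_of_nonpos h0, eq_comm, ENNReal.ofReal_eq_zero] at hx
    linarith

/-- The transform of `conj f` at `L` is the conjugate of that of `f` at `-L`, so it vanishes too,
and the real case applies to the real and imaginary parts. -/
theorem ae_eq_zero_of_fourier {f : E → ℂ} (hf : Integrable f μ)
    (h : ∀ L : StrongDual ℝ E, ∫ x, cexp (L x * I) * f x ∂μ = 0) : f =ᵐ[μ] 0 := by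
  have hint : ∀ L : StrongDual ℝ E, Integrable (fun x => cexp (L x * I) * f x) μ := fun L =>
    hf.bdd_mul (c := 1) (by apply Continuous.aestronglyMeasurable; fun_prop)
      (Eventually.of_forall fun x => by rw [Complex.norm_exp_ofReal_mul_I])
  have hconj : ∀ L : StrongDual ℝ E, ∫ x, conj (cexp ((-L) x * I) * f x) ∂μ = 0 := fun L => by
    rw [integral_conj, h, map_zero]
  have hc : ∀ (L : StrongDual ℝ E) x, conj (cexp (((-L) x : ℝ) * I) * f x) =
      cexp (L x * I) * conj (f x) := fun L x => by
    rw [map_mul, ← Complex.exp_conj]; simp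
  have hci : ∀ L : StrongDual ℝ E, Integrable (fun x => cexp (L x * I) * conj (f x)) μ := fun L => by
    simp_rw [← hc]
    exact (Complex.conjCLE : ℂ →L[ℝ] ℂ).integrable_comp (hint (-L))
  have hre : (fun x => (f x).re) =ᵐ[μ] 0 := by
    refine ae_eq_zero_of_fourier_real hf.re fun L => ?_
    have := integral_add (hint L) (hci L)
    rw [h] at this
    simp_rw [← hc] at this
    rw [hconj, add_zero] at this
    have e : ∀ x, cexp (L x * I) * ((f x).re : ℂ) = (1 / 2 : ℂ) *
      (cexp (L x * I) * f x + conj (cexp (((-L) x : ℝ) * I) * f x)) := fun x => by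
      rw [hc, Complex.re_eq_add_conj]; ring
    simp_rw [e]
    rw [integral_const_mul, this, mul_zero]
  have him : (fun x => (f x).im) =ᵐ[μ] 0 := by
    refine ae_eq_zero_of_fourier_real hf.im fun L => ?_
    have := integral_sub (hint L) (hci L)
    rw [h] at this
    simp_rw [← hc] at this
    rw [hconj, sub_zero] at this
    have e : ∀ x, cexp (L x * I) * ((f x).im : ℂ) = (1 / (2 * I) : ℂ) *
      (cexp (L x * I) * f x - conj (cexp (((-L) x : ℝ) * I) * f x)) := fun x => by
      rw [hc, Complex.im_eq_sub_conj]; field_simp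
    simp_rw [e]
    rw [integral_const_mul, this, mul_zero]
  filter_upwards [hre, him] with x h1 h2
  exact Complex.ext h1 h2

end

theorem ae_eq_zero_of_forall_test {f : ℝ × ℝ → ℂ} {s : ℝ}
    (hf : AEStronglyMeasurable f (volume.restrict strip))
    (hi : Integrable (fun p => ‖f p‖ * Real.exp (-(s * |p.2|))) (volume.restrict strip))
    (h : ∀ φ : ℝ × ℝ → ℂ, ContDiff ℝ (⊤ : ℕ∞) φ → HasCompactSupport φ → tsupport φ ⊆ strip →
      ∫ p in strip, f p * φ p = 0) : ∀ᵐ p ∂(volume.restrict strip), f p = 0 := by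
  rw [ae_restrict_iff' measurableSet_strip]
  have hint : IntegrableOn (fun p => (Real.exp (-(s * |p.2|)) : ℂ) * f p) strip := by
    refine hi.mono' (AEStronglyMeasurable.mul (by apply Continuous.aestronglyMeasurable; fun_prop) hf) ?_
    refine Eventually.of_forall fun p => ?_
    rw [norm_mul, Complex.norm_real, Real.norm_of_nonneg (Real.exp_pos _).le, mul_comm]
  have hloc : LocallyIntegrableOn f strip := by
    have := hint.locallyIntegrableOn.continuousOn_mul (g := fun p : ℝ × ℝ => (Real.exp (s * |p.2|) : ℂ))
      (by fun_prop) isOpen_strip.isLocallyClosed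
    refine (funext fun p => ?_ : f = _) ▸ this
    rw [← mul_assoc, ← Complex.ofReal_mul, ← Real.exp_add, add_neg_cancel, Real.exp_zero,
      Complex.ofReal_one, one_mul]
  refine isOpen_strip.ae_eq_zero_of_integral_contDiff_smul_eq_zero hloc fun g hg hgc hgs => ?_
  have := h (fun p => (g p : ℂ)) (Complex.ofRealCLM.contDiff.comp hg)
    (hgc.comp_left (g := fun x : ℝ => (x : ℂ)) Complex.ofReal_zero)
    ((tsupport_comp_subset (g := fun x : ℝ => (x : ℂ)) Complex.ofReal_zero g).trans hgs)
  rw [← this, ← setIntegral_eq_integral_of_forall_compl_eq_zero (s := strip)]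
  · refine integral_congr_ae (Eventually.of_forall fun p => ?_)
    simp [mul_comm]
  · intro p hp
    rw [image_eq_zero_of_notMem_tsupport (fun h => hp (hgs h)), zero_smul]

/-- The Fourier transform of `e^{-(γ+1)|y|} v` at frequency `(θ, τ)` splits into the two half-strip
transforms at `τ ± i(γ+1)`, both zero. Then `ω u` is the image of `v = 0` under the second operator,
and `ω ≠ 0`. -/
theorem IsHomogeneous.ae_eq_zero {ω γ : ℝ} {u v : ℝ × ℝ → ℂ} (h : IsHomogeneous ω γ u v)
    (hω : 1 ≤ ω) (hγ : 0 < γ) (hL : PairVanishes ω γ u v) :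
    ∀ᵐ p ∂(volume.restrict strip), u p = 0 ∧ v p = 0 := by
  have hvi := h.memV.integrable (lt_add_one γ)
  have hvm := h.memV.aestronglyMeasurable
  have hexpm : AEStronglyMeasurable (fun p : ℝ × ℝ => (Real.exp (-((γ + 1) * |p.2|)) : ℂ))
      (volume.restrict strip) := by apply Continuous.aestronglyMeasurable; fun_prop
  have hint : Integrable (fun p => (Real.exp (-((γ + 1) * |p.2|)) : ℂ) * v p)
      (volume.restrict strip) := by
    refine hvi.mono' (hexpm.mul hvm) (Eventually.of_forall fun p => ?_)
    rw [norm_mul, Complex.norm_real, Real.norm_of_nonneg (Real.exp_pos _).le, mul_comm]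
  have hv0 := ae_eq_zero_of_fourier hint fun L => by
    set θ := L (1, 0)
    set τ := L (0, 1)
    have hL' : ∀ p : ℝ × ℝ, L p = θ * p.1 + τ * p.2 := fun p => by
      have : p = p.1 • ((1 : ℝ), (0 : ℝ)) + p.2 • ((0 : ℝ), (1 : ℝ)) := by ext <;> simp
      conv_lhs => rw [this]
      rw [map_add, map_smul, map_smul, smul_eq_mul, smul_eq_mul]; ring
    obtain ⟨h1, h2⟩ := halfInt_eq_zero h hω hγ hL θ
    have h1 := h1 (τ + I * (γ + 1)) (by simp)
    have h2 := h2 (τ - I * (γ + 1)) (by simp)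
    have i1 := integrable_halfInt (S := Ioi 0) measurableSet_Ioi hvm hvi
      (lam := τ + I * (γ + 1)) (upper_exponent (by simp)) θ
    have i2 := integrable_halfInt (S := Iic 0) measurableSet_Iic hvm hvi
      (lam := τ - I * (γ + 1)) (lower_exponent (by simp)) θ
    have := integral_add i1 i2
    rw [← halfInt, ← halfInt, h1, h2, add_zero] at this
    rw [← this]
    refine integral_congr_ae (Eventually.of_forall fun p => ?_)
    simp only [hL']
    rw [Complex.ofReal_exp, ← mul_assoc, ← Complex.exp_add]
    rcases le_or_gt p.2 0 with hp | hp
    · have e1 : p.2 ∉ Ioi (0 : ℝ) := by simpa using hp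
      have e2 : p.2 ∈ Iic (0 : ℝ) := hp
      simp only [indicator_of_notMem e1, indicator_of_mem e2, abs_of_nonpos hp]
      simp only [Complex.ofReal_zero, Pi.one_apply, Complex.ofReal_one, mul_zero, zero_mul, zero_add,
        mul_one, ← Complex.exp_add]
      congr 2
      push_cast
      linear_combination (-(γ + 1) * p.2 : ℂ) * (-1) * I_sq
    · have e1 : p.2 ∈ Ioi (0 : ℝ) := hp
      have e2 : p.2 ∉ Iic (0 : ℝ) := by simpa using hp
      simp only [indicator_of_notMem e2, indicator_of_mem e1, abs_of_pos hp]
      simp only [Complex.ofReal_zero, Pi.one_apply, Complex.ofReal_one, mul_zero, zero_mul, add_zero,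
        mul_one, ← Complex.exp_add]
      congr 2
      push_cast
      linear_combination (-(γ + 1) * p.2 : ℂ) * I_sq
  have hv : ∀ᵐ p ∂(volume.restrict strip), v p = 0 := by
    filter_upwards [hv0] with p hp
    simpa using hp
  have hu : ∀ᵐ p ∂(volume.restrict strip), u p = 0 := by
    refine ae_eq_zero_of_forall_test h.memU.aestronglyMeasurable (h.memU.integrable (lt_add_one γ))
      fun φ hφ hφc hφs => ?_
    have h1 := h.eqV φ hφ hφc (hφs.trans fun p hp => hp.1.1)
    rw [integral_congr_ae (g := fun _ => (0 : ℂ)) (by filter_upwards [hv] with p hp; simp [hp]),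
      integral_zero, eq_comm, neg_eq_zero] at h1
    simp_rw [mul_assoc] at h1
    rw [integral_const_mul] at h1
    refine (mul_eq_zero.1 h1).resolve_left ?_
    exact Complex.ofReal_ne_zero.2 (by linarith)
  filter_upwards [hu, hv] with p h1 h2 using ⟨h1, h2⟩

/-! ### Thresholds -/

theorem sign_mul_sin_pos {n : ℕ} {κ : ℝ} (h : κ ∈ Ioo (n * Real.pi) ((n + 1) * Real.pi)) :
    0 < (-1) ^ n * Real.sin κ := by
  rw [← Real.sin_sub_nat_mul_pi]
  exact Real.sin_pos_of_pos_of_lt_pi (by linarith [h.1]) (by linarith [h.2])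

theorem neg_one_pow_mul_self (n : ℕ) : (-1 : ℝ) ^ n * (-1) ^ n = 1 := by
  rw [← mul_pow]; simp

theorem hasDerivAt_mul_cos_sub_sin (κ : ℝ) :
    HasDerivAt (fun κ => κ * Real.cos κ - Real.sin κ) (-(κ * Real.sin κ)) κ := by
  refine (((hasDerivAt_id κ).mul (Real.hasDerivAt_cos κ)).sub (Real.hasDerivAt_sin κ)).congr_deriv ?_
  simp

/-- `κ cos κ - sin κ` is the numerator of the derivative of sinc, and its own derivative `-κ sin κ`
has constant sign between multiples of `π`. So sinc has one critical point per interval. Here and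
below `n` stands for `j - 1`, and the factor `(-1)^n` makes sinc nonnegative on the interval. -/
theorem strictAntiOn_sign_mul (n : ℕ) :
    StrictAntiOn (fun κ => (-1) ^ n * (κ * Real.cos κ - Real.sin κ))
      (Icc (n * Real.pi) ((n + 1) * Real.pi)) := by
  refine strictAntiOn_of_deriv_neg (convex_Icc _ _) (by fun_prop) fun κ hκ => ?_
  rw [interior_Icc] at hκ
  rw [((hasDerivAt_mul_cos_sub_sin κ).const_mul ((-1) ^ n)).deriv]
  have h1 := sign_mul_sin_pos hκ
  have h2 : 0 < κ := lt_of_le_of_lt (by positivity) hκ.1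
  nlinarith

theorem exists_critical (n : ℕ) : ∃ k ∈ Ico (n * Real.pi) ((n + 1) * Real.pi),
    k * Real.cos k = Real.sin k := by
  set F : ℝ → ℝ := fun κ => (-1) ^ n * (κ * Real.cos κ - Real.sin κ) with hF
  have hle : n * Real.pi ≤ (n + 1) * Real.pi := by nlinarith [Real.pi_pos]
  have h0 : F (n * Real.pi) = n * Real.pi := by
    simp only [hF, Real.sin_nat_mul_pi, Real.cos_nat_mul_pi]
    linear_combination (n * Real.pi) * neg_one_pow_mul_self n
  have h1 : F ((n + 1) * Real.pi) = -((n + 1) * Real.pi) := by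
    have e1 := Real.sin_nat_mul_pi (n + 1)
    have e2 := Real.cos_nat_mul_pi (n + 1)
    push_cast at e1 e2
    simp only [hF, e1, e2]
    rw [pow_succ]
    linear_combination (-((n + 1) * Real.pi)) * neg_one_pow_mul_self n
  have hc : ContinuousOn F (Icc (n * Real.pi) ((n + 1) * Real.pi)) := by
    rw [hF]; fun_prop
  obtain ⟨k, hk, hk0⟩ := intermediate_value_Icc' hle hc (show (0 : ℝ) ∈ _ by
    rw [h0, h1]
    have := Real.pi_pos
    exact ⟨by simp; positivity, by positivity⟩)
  refine ⟨k, ⟨hk.1, lt_of_le_of_ne hk.2 ?_⟩, ?_⟩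
  · rintro rfl
    rw [h1] at hk0
    have := Real.pi_pos
    have : 0 < (n + 1) * Real.pi := by positivity
    linarith
  · have := (mul_eq_zero.1 hk0).resolve_left (pow_ne_zero _ (by norm_num))
    linarith

theorem hasDerivAt_sinc_of_pos {κ : ℝ} (hκ : 0 < κ) :
    HasDerivAt Real.sinc ((κ * Real.cos κ - Real.sin κ) / κ ^ 2) κ := by
  have h : HasDerivAt (fun x => Real.sin x / x) ((Real.cos κ * κ - Real.sin κ * 1) / κ ^ 2) κ :=
    (Real.hasDerivAt_sin κ).div (hasDerivAt_id κ) hκ.ne'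
  refine (h.congr_deriv (by ring)).congr_of_eventuallyEq ?_
  filter_upwards [lt_mem_nhds hκ] with x hx
  exact Real.sinc_of_ne_zero hx.ne'

section
variable {n : ℕ} {k : ℝ}

theorem strictMonoOn_sign_sinc (hk : k ∈ Ico (n * Real.pi) ((n + 1) * Real.pi))
    (hk0 : k * Real.cos k = Real.sin k) :
    StrictMonoOn (fun κ => (-1) ^ n * Real.sinc κ) (Icc (n * Real.pi) k) := by
  refine strictMonoOn_of_deriv_pos (convex_Icc _ _)
    (continuous_const.mul Real.continuous_sinc).continuousOn fun κ hκ => ?_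
  rw [interior_Icc] at hκ
  have h2 : 0 < κ := lt_of_le_of_lt (by have := Real.pi_pos; positivity) hκ.1
  rw [((hasDerivAt_sinc_of_pos h2).const_mul ((-1) ^ n)).deriv, ← mul_div_assoc]
  have := strictAntiOn_sign_mul n ⟨hκ.1.le, (hκ.2.trans hk.2).le⟩ ⟨hk.1, hk.2.le⟩ hκ.2
  simp only [hk0, sub_self, mul_zero] at this
  positivity

theorem strictAntiOn_sign_sinc (hk : k ∈ Ico (n * Real.pi) ((n + 1) * Real.pi))
    (hk0 : k * Real.cos k = Real.sin k) :
    StrictAntiOn (fun κ => (-1) ^ n * Real.sinc κ) (Icc k ((n + 1) * Real.pi)) := by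
  refine strictAntiOn_of_deriv_neg (convex_Icc _ _)
    (continuous_const.mul Real.continuous_sinc).continuousOn fun κ hκ => ?_
  rw [interior_Icc] at hκ
  have h2 : 0 < κ := lt_of_le_of_lt (le_trans (by have := Real.pi_pos; positivity) hk.1) hκ.1
  rw [((hasDerivAt_sinc_of_pos h2).const_mul ((-1) ^ n)).deriv, ← mul_div_assoc]
  have := strictAntiOn_sign_mul n ⟨hk.1, hk.2.le⟩ ⟨hk.1.trans hκ.1.le, hκ.2.le⟩ hκ.1
  simp only [hk0, sub_self, mul_zero] at this
  exact div_neg_of_neg_of_pos this (by positivity)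

theorem sign_sinc_pos {κ : ℝ} (h : κ ∈ Ioo (n * Real.pi) ((n + 1) * Real.pi)) :
    0 < (-1) ^ n * Real.sinc κ := by
  have h2 : 0 < κ := lt_of_le_of_lt (by have := Real.pi_pos; positivity) h.1
  rw [Real.sinc_of_ne_zero h2.ne', ← mul_div_assoc]
  exact div_pos (sign_mul_sin_pos h) h2

theorem sign_sinc_nonneg {κ : ℝ} (h : κ ∈ Ico (n * Real.pi) ((n + 1) * Real.pi)) :
    0 ≤ (-1) ^ n * Real.sinc κ := by
  rcases h.1.eq_or_lt with h0 | h0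
  · rcases Nat.eq_zero_or_pos n with hn | hn
    · subst hn; rw [← h0]; simp
    · have : (n : ℝ) * Real.pi ≠ 0 := by have := Real.pi_pos; positivity
      rw [← h0, Real.sinc_of_ne_zero this, Real.sin_nat_mul_pi]; simp
  · exact (sign_sinc_pos ⟨h0, h.2⟩).le

theorem sign_sinc_lt {κ : ℝ} (hk : k ∈ Ico (n * Real.pi) ((n + 1) * Real.pi))
    (hk0 : k * Real.cos k = Real.sin k) (h : κ ∈ Ico (n * Real.pi) ((n + 1) * Real.pi))
    (hne : κ ≠ k) : (-1) ^ n * Real.sinc κ < (-1) ^ n * Real.sinc k := by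
  rcases lt_or_gt_of_ne hne with hlt | hgt
  · exact strictMonoOn_sign_sinc hk hk0 ⟨h.1, hlt.le⟩ ⟨hk.1, le_rfl⟩ hlt
  · exact strictAntiOn_sign_sinc hk hk0 ⟨le_rfl, hk.2.le⟩ ⟨hgt.le, h.2.le⟩ hgt

theorem kappaThr_eq (hk : k ∈ Ico (n * Real.pi) ((n + 1) * Real.pi))
    (hk0 : k * Real.cos k = Real.sin k) : kappaThr (n + 1) = k := by
  have hsq : ∀ κ, Real.sinc κ ^ 2 = ((-1) ^ n * Real.sinc κ) ^ 2 := fun κ => by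
    rw [mul_pow, ← pow_mul, mul_comm n, pow_mul]; simp
  have : {κ | κ ∈ Ico (((n + 1 : ℕ) : ℝ) * Real.pi - Real.pi) (((n + 1 : ℕ) : ℝ) * Real.pi) ∧
      IsMaxOn (fun t => Real.sinc t ^ 2)
        (Ico (((n + 1 : ℕ) : ℝ) * Real.pi - Real.pi) (((n + 1 : ℕ) : ℝ) * Real.pi)) κ} = {k} := by
    have e : ((n + 1 : ℕ) : ℝ) * Real.pi - Real.pi = n * Real.pi := by push_cast; ring
    rw [e]
    push_cast
    ext κ
    simp only [mem_ofPred_eq, mem_singleton_iff]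
    constructor
    · rintro ⟨h1, h2⟩
      by_contra hne
      have := h2 hk
      simp only [mem_ofPred_eq] at this
      rw [hsq, hsq κ] at this
      have h3 := sign_sinc_lt hk hk0 h1 hne
      have h4 := sign_sinc_nonneg h1
      nlinarith
    · rintro rfl
      refine ⟨hk, fun t ht => ?_⟩
      simp only [mem_ofPred_eq]
      rw [hsq, hsq κ]
      refine pow_le_pow_left₀ (sign_sinc_nonneg ht) ?_ 2
      by_cases hne : t = κ
      · rw [hne]
      · exact (sign_sinc_lt hk hk0 ht hne).le
  rw [kappaThr]
  simp only [sub_mul, one_mul]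
  rw [this, csSup_singleton]

end

theorem kappaThr_mem (n : ℕ) :
    kappaThr (n + 1) ∈ Ico (n * Real.pi) ((n + 1) * Real.pi) := by
  obtain ⟨k, hk, hk0⟩ := exists_critical n
  rw [kappaThr_eq hk hk0]; exact hk

theorem kappaThr_mul_cos (n : ℕ) :
    kappaThr (n + 1) * Real.cos (kappaThr (n + 1)) = Real.sin (kappaThr (n + 1)) := by
  obtain ⟨k, hk, hk0⟩ := exists_critical n
  rw [kappaThr_eq hk hk0]; exact hk0

theorem kappaThr_one : kappaThr 1 = 0 :=
  kappaThr_eq (n := 0) ⟨by simp, by simpa using Real.pi_pos⟩ (by simp)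

theorem kappaThr_pos {n : ℕ} (hn : 0 < n) : 0 < kappaThr (n + 1) :=
  lt_of_lt_of_le (by have := Real.pi_pos; positivity) (kappaThr_mem n).1

theorem kappaThr_gt {n : ℕ} (hn : 0 < n) : n * Real.pi < kappaThr (n + 1) := by
  refine lt_of_le_of_ne (kappaThr_mem n).1 fun h => ?_
  have h1 := kappaThr_mul_cos n
  rw [← h, Real.sin_nat_mul_pi, Real.cos_nat_mul_pi] at h1
  have : (n : ℝ) * Real.pi * (-1) ^ n ≠ 0 := by
    have := Real.pi_pos
    have h2 : (-1 : ℝ) ^ n ≠ 0 := pow_ne_zero _ (by norm_num)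
    have : (n : ℝ) * Real.pi ≠ 0 := by positivity
    exact mul_ne_zero this h2
  exact this h1

theorem omegaThr_sq (j : ℕ) : omegaThr j ^ 2 = kappaThr j ^ 2 + 1 :=
  Real.sq_sqrt (by positivity)

theorem omegaThr_ge_one (j : ℕ) : 1 ≤ omegaThr j :=
  Real.one_le_sqrt.2 (by nlinarith [sq_nonneg (kappaThr j)])

theorem omegaThr_gt_one {n : ℕ} (hn : 0 < n) : 1 < omegaThr (n + 1) := by
  have := kappaThr_pos hn
  exact Real.lt_sqrt_of_sq_lt (by nlinarith)

theorem kappaThr_strictMono : StrictMono (fun n : ℕ => kappaThr (n + 1)) := by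
  refine strictMono_nat_of_lt_succ fun n => ?_
  have h1 := (kappaThr_mem n).2
  have h2 := (kappaThr_mem (n + 1)).1
  push_cast at h2
  linarith

theorem kappaThr_nonneg (n : ℕ) : 0 ≤ kappaThr (n + 1) :=
  le_trans (by have := Real.pi_pos; positivity) (kappaThr_mem n).1

theorem omegaThr_strictMono : StrictMono (fun n : ℕ => omegaThr (n + 1)) := by
  intro m n h
  have h1 := kappaThr_strictMono h
  simp only at h1
  exact Real.sqrt_lt_sqrt (by positivity) (by nlinarith [kappaThr_nonneg m])

/-- At the critical point `sin κ = κ cos κ`, so sinc equals `cos κ` and `cos² κ (κ² + 1) = 1`. The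
peak height is therefore exactly the reciprocal of the threshold frequency. -/
theorem sinc_kappaThr (n : ℕ) : (-1) ^ n * Real.sinc (kappaThr (n + 1)) = 1 / omegaThr (n + 1) := by
  set k := kappaThr (n + 1) with hk
  have h0 := kappaThr_mul_cos n
  rw [← hk] at h0
  have hn := sign_sinc_nonneg (kappaThr_mem n)
  rw [← hk] at hn
  have hω : 0 < omegaThr (n + 1) := lt_of_lt_of_le one_pos (omegaThr_ge_one _)
  have hω2 := omegaThr_sq (n + 1)
  rw [← hk] at hω2
  have h1 : (Real.sinc k) ^ 2 * (k ^ 2 + 1) = 1 := by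
    by_cases hk0 : k = 0
    · rw [hk0]; simp
    · have hc : Real.sinc k = Real.cos k := by
        rw [Real.sinc_of_ne_zero hk0, ← h0]; field_simp
      have h2 := Real.sin_sq_add_cos_sq k
      rw [← h0, ← hc] at h2
      linear_combination h2
  rw [eq_div_iff hω.ne']
  have : ((-1) ^ n * Real.sinc k * omegaThr (n + 1)) ^ 2 = 1 := by
    rw [mul_pow, mul_pow, hω2, ← pow_mul, mul_comm n, pow_mul]
    norm_num
    exact h1
  have h3 : 0 ≤ (-1) ^ n * Real.sinc k * omegaThr (n + 1) := by positivity
  nlinarith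

theorem sign_sinc_le {n : ℕ} {κ : ℝ} (h : κ ∈ Ico (n * Real.pi) ((n + 1) * Real.pi)) :
    (-1) ^ n * Real.sinc κ ≤ 1 / omegaThr (n + 1) := by
  rw [← sinc_kappaThr]
  by_cases hne : κ = kappaThr (n + 1)
  · rw [hne]
  · exact (sign_sinc_lt (kappaThr_mem n) (kappaThr_mul_cos n) h hne).le

theorem sign_sinc_eq_iff {n : ℕ} {κ : ℝ} (h : κ ∈ Ico (n * Real.pi) ((n + 1) * Real.pi)) :
    (-1) ^ n * Real.sinc κ = 1 / omegaThr (n + 1) ↔ κ = kappaThr (n + 1) := by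
  rw [← sinc_kappaThr]
  refine ⟨fun h1 => ?_, fun h1 => by rw [h1]⟩
  by_contra hne
  exact (sign_sinc_lt (kappaThr_mem n) (kappaThr_mul_cos n) h hne).ne h1

/-! ### The wave numbers of the oscillatory waves -/

theorem sin_div_eq_iff (n : ℕ) (ω : ℝ) {κ : ℝ} (hκ : κ ≠ 0) :
    Real.sin κ / κ = (-1) ^ (n + 1 + 1) / ω ↔ (-1) ^ n * Real.sinc κ = 1 / ω := by
  rw [← Real.sinc_of_ne_zero hκ]
  have h := neg_one_pow_mul_self n
  have e : (-1 : ℝ) ^ (n + 1 + 1) = (-1) ^ n := by rw [pow_succ, pow_succ]; ring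
  rw [e]
  constructor
  · intro h1; rw [h1, ← mul_div_assoc, h]
  · intro h1
    calc Real.sinc κ = (-1) ^ n * ((-1) ^ n * Real.sinc κ) := by rw [← mul_assoc, h, one_mul]
      _ = _ := by rw [h1]; ring

theorem kappaMinus_eq {n : ℕ} {ω κ : ℝ} (h1 : κ ∈ Ioo (kappaThr (n + 1)) ((n + 1) * Real.pi))
    (h2 : (-1) ^ n * Real.sinc κ = 1 / ω) : kappaMinus ω (n + 1) = κ := by
  have hm := kappaThr_mem n
  have h0 := kappaThr_nonneg n
  rw [kappaMinus]
  have : {κ | κ ∈ Ioo ((((n + 1 : ℕ) : ℝ) - 1) * Real.pi) (((n + 1 : ℕ) : ℝ) * Real.pi) ∧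
      kappaThr (n + 1) < κ ∧ Real.sin κ / κ = (-1) ^ (n + 1 + 1) / ω} = {κ} := by
    ext κ'
    push_cast
    rw [add_sub_cancel_right]
    simp only [mem_ofPred_eq, mem_singleton_iff]
    constructor
    · rintro ⟨h3, h4, h5⟩
      rw [sin_div_eq_iff n ω (by linarith)] at h5
      exact (strictAntiOn_sign_sinc hm (kappaThr_mul_cos n)).injOn ⟨h4.le, h3.2.le⟩
        ⟨h1.1.le, h1.2.le⟩ (h5.trans h2.symm)
    · rintro rfl
      refine ⟨⟨by linarith [hm.1, h1.1], h1.2⟩, h1.1, ?_⟩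
      rw [sin_div_eq_iff n ω (by linarith [h1.1])]
      exact h2
  rw [this, csSup_singleton]

theorem kappaPlus_eq {n : ℕ} {ω κ : ℝ} (h1 : κ ∈ Ioo (n * Real.pi) (kappaThr (n + 1)))
    (h2 : (-1) ^ n * Real.sinc κ = 1 / ω) : kappaPlus ω (n + 1) = κ := by
  have hm := kappaThr_mem n
  have hn : (0 : ℝ) ≤ n * Real.pi := by have := Real.pi_pos; positivity
  rw [kappaPlus]
  have : {κ | κ ∈ Ioo ((((n + 1 : ℕ) : ℝ) - 1) * Real.pi) (((n + 1 : ℕ) : ℝ) * Real.pi) ∧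
      κ < kappaThr (n + 1) ∧ Real.sin κ / κ = (-1) ^ (n + 1 + 1) / ω} = {κ} := by
    ext κ'
    push_cast
    rw [add_sub_cancel_right]
    simp only [mem_ofPred_eq, mem_singleton_iff]
    constructor
    · rintro ⟨h3, h4, h5⟩
      rw [sin_div_eq_iff n ω (by linarith [h3.1])] at h5
      exact (strictMonoOn_sign_sinc hm (kappaThr_mul_cos n)).injOn ⟨h3.1.le, h4.le⟩
        ⟨h1.1.le, h1.2.le⟩ (h5.trans h2.symm)
    · rintro rfl
      refine ⟨⟨h1.1, h1.2.trans hm.2⟩, h1.2, ?_⟩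
      rw [sin_div_eq_iff n ω (by linarith [h1.1])]
      exact h2
  rw [this, csSup_singleton]

theorem kappaMinus_spec {n : ℕ} {ω : ℝ} (hω : omegaThr (n + 1) < ω) :
    kappaMinus ω (n + 1) ∈ Ioo (kappaThr (n + 1)) ((n + 1) * Real.pi) ∧
      (-1) ^ n * Real.sinc (kappaMinus ω (n + 1)) = 1 / ω := by
  have hm := kappaThr_mem n
  have h1 := omegaThr_ge_one (n + 1)
  have hend : (-1) ^ n * Real.sinc ((n + 1) * Real.pi) = 0 := by
    have e1 := Real.sin_nat_mul_pi (n + 1)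
    push_cast at e1
    rw [Real.sinc_of_ne_zero (by have := Real.pi_pos; positivity), e1]; simp
  obtain ⟨κ, hκ, hκ2⟩ := intermediate_value_Ioo' hm.2.le
    (f := fun κ => (-1) ^ n * Real.sinc κ)
    (continuous_const.mul Real.continuous_sinc).continuousOn
    (show 1 / ω ∈ _ from ⟨by rw [hend]; exact one_div_pos.2 (by linarith), by
      simp only [sinc_kappaThr]; exact one_div_lt_one_div_of_lt (by linarith) hω⟩)
  rw [kappaMinus_eq hκ hκ2]
  exact ⟨hκ, hκ2⟩

theorem kappaPlus_spec {n : ℕ} (hn : 0 < n) {ω : ℝ} (hω : omegaThr (n + 1) < ω) :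
    kappaPlus ω (n + 1) ∈ Ioo (n * Real.pi) (kappaThr (n + 1)) ∧
      (-1) ^ n * Real.sinc (kappaPlus ω (n + 1)) = 1 / ω := by
  have hm := kappaThr_mem n
  have h1 := omegaThr_ge_one (n + 1)
  have hend : (-1) ^ n * Real.sinc (n * Real.pi) = 0 := by
    rw [Real.sinc_of_ne_zero (by have := Real.pi_pos; positivity), Real.sin_nat_mul_pi]; simp
  obtain ⟨κ, hκ, hκ2⟩ := intermediate_value_Ioo hm.1
    (f := fun κ => (-1) ^ n * Real.sinc κ)
    (continuous_const.mul Real.continuous_sinc).continuousOn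
    (show 1 / ω ∈ _ from ⟨by rw [hend]; exact one_div_pos.2 (by linarith), by
      simp only [sinc_kappaThr]; exact one_div_lt_one_div_of_lt (by linarith) hω⟩)
  rw [kappaPlus_eq hκ hκ2]
  exact ⟨hκ, hκ2⟩

/-- `λ - 1` has the sign of the derivative of `(-1)^n sinc`: positive to the left of the peak,
negative to the right. This sign becomes the sign of the flux of the wave. -/
theorem mul_cot_gt_one {n : ℕ} {κ : ℝ} (h : κ ∈ Ioo (n * Real.pi) (kappaThr (n + 1))) :
    1 < κ * Real.cot κ := by
  have hm := kappaThr_mem n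
  have hs := sign_mul_sin_pos ⟨h.1, h.2.trans hm.2⟩
  have := strictAntiOn_sign_mul n ⟨h.1.le, (h.2.trans hm.2).le⟩ ⟨hm.1, hm.2.le⟩ h.2
  simp only [kappaThr_mul_cos, sub_self, mul_zero] at this
  have hs0 : Real.sin κ ≠ 0 := by intro h0; rw [h0] at hs; simp at hs
  rw [Real.cot_eq_cos_div_sin, ← mul_div_assoc]
  have e : κ * Real.cos κ / Real.sin κ =
      ((-1) ^ n * (κ * Real.cos κ)) / ((-1) ^ n * Real.sin κ) := by
    rw [mul_div_mul_left _ _ (pow_ne_zero _ (by norm_num))]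
  rw [e, lt_div_iff₀ hs]
  linarith

theorem mul_cot_lt_one {n : ℕ} {κ : ℝ} (h : κ ∈ Ioo (kappaThr (n + 1)) ((n + 1) * Real.pi)) :
    κ * Real.cot κ < 1 := by
  have hm := kappaThr_mem n
  have hs := sign_mul_sin_pos ⟨lt_of_le_of_lt hm.1 h.1, h.2⟩
  have := strictAntiOn_sign_mul n ⟨hm.1, hm.2.le⟩ ⟨(lt_of_le_of_lt hm.1 h.1).le, h.2.le⟩ h.1
  simp only [kappaThr_mul_cos, sub_self, mul_zero] at this
  have hs0 : Real.sin κ ≠ 0 := by intro h0; rw [h0] at hs; simp at hs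
  rw [Real.cot_eq_cos_div_sin, ← mul_div_assoc]
  have e : κ * Real.cos κ / Real.sin κ =
      ((-1) ^ n * (κ * Real.cos κ)) / ((-1) ^ n * Real.sin κ) := by
    rw [mul_div_mul_left _ _ (pow_ne_zero _ (by norm_num))]
  rw [e, div_lt_iff₀ hs]
  linarith

theorem sq_mul_cot_add_sq {n : ℕ} {ω κ : ℝ} (hω : ω ≠ 0) (hκ : κ ≠ 0)
    (h2 : (-1) ^ n * Real.sinc κ = 1 / ω) : (κ * Real.cot κ) ^ 2 + κ ^ 2 = ω ^ 2 := by
  rw [Real.sinc_of_ne_zero hκ, eq_div_iff hω] at h2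
  have hs0 : Real.sin κ ≠ 0 := by intro h0; rw [h0] at h2; simp at h2
  have h3 : (Real.sin κ * ω) ^ 2 = κ ^ 2 := by
    have : ((-1) ^ n * (Real.sin κ / κ) * ω) ^ 2 = 1 := by rw [h2]; simp
    rw [mul_pow, mul_pow, ← pow_mul, mul_comm n, pow_mul] at this
    field_simp at this
    linear_combination this
  rw [Real.cot_eq_cos_div_sin]
  field_simp
  have := Real.sin_sq_add_cos_sq κ
  linear_combination κ ^ 2 * this - h3

/-! ### Real roots of the characteristic equation -/

theorem sincRt_one_ofReal_sq (κ : ℝ) : sincRt 1 ((κ : ℂ) ^ 2) = Real.sinc κ := by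
  by_cases h : κ = 0
  · subst h; simp [sincRt_zero_right]
  · rw [sincRt_sq_of_ne 1 (by exact_mod_cast h), Real.sinc_of_ne_zero h]
    push_cast; simp

theorem cosRt_one_ofReal_sq (κ : ℝ) : cosRt 1 ((κ : ℂ) ^ 2) = Real.cos κ := by
  rw [cosRt_sq]; push_cast; simp

/-- If `lam² ≥ ω²`, then `κ` is zero or imaginary and `ω S` is `ω` or `ω sinh μ / μ`, which exceeds
`1`; this contradicts `(ωS)² = 1`. So `κ` is real and positive, and the integer part of `κ/π`
selects the interval. -/
theorem root_real {ω lam : ℝ} (hω : 1 < ω) (h : dispersionFun ω lam = 0) :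
    ∃ (n : ℕ) (κ : ℝ), κ ∈ Ioo (n * Real.pi) ((n + 1) * Real.pi) ∧
      (-1) ^ n * Real.sinc κ = 1 / ω ∧ lam = κ * Real.cot κ := by
  have hsq := sq_eq_one_of_root h
  rw [dispersionFun_eq] at h
  have hKpos : 0 < ω ^ 2 - lam ^ 2 := by
    by_contra hcon
    push Not at hcon
    set μ := Real.sqrt (lam ^ 2 - ω ^ 2)
    have hμ : μ ^ 2 = lam ^ 2 - ω ^ 2 := Real.sq_sqrt (by linarith)
    have hK : (ω : ℂ) ^ 2 - (lam : ℂ) ^ 2 = ((μ : ℂ) * I) ^ 2 := by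
      rw [mul_pow, I_sq]
      norm_cast
      rw [hμ]; push_cast; ring
    rw [hK] at hsq
    by_cases hμ0 : μ = 0
    · rw [hμ0] at hsq
      simp only [Complex.ofReal_zero, zero_mul, ne_eq, OfNat.ofNat_ne_zero, not_false_eq_true,
        zero_pow, sincRt_zero_right, Complex.ofReal_one, mul_one] at hsq
      norm_cast at hsq
      nlinarith
    · have hμpos : 0 < μ := lt_of_le_of_ne (Real.sqrt_nonneg _) (Ne.symm hμ0)
      rw [sincRt_sq_of_ne 1 (by simp [hμ0])] at hsq
      simp only [Complex.ofReal_one, mul_one, Complex.sin_mul_I] at hsq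
      rw [mul_div_mul_right _ _ I_ne_zero] at hsq
      norm_cast at hsq
      have h1 : 1 < Real.sinh μ / μ := by
        rw [one_lt_div hμpos]; exact Real.self_lt_sinh_iff.2 hμpos
      have h2 : 1 < ω * (Real.sinh μ / μ) := by nlinarith
      nlinarith
  set κ := Real.sqrt (ω ^ 2 - lam ^ 2) with hκ
  have hκpos : 0 < κ := Real.sqrt_pos.2 hKpos
  have hκ2 : κ ^ 2 = ω ^ 2 - lam ^ 2 := Real.sq_sqrt hKpos.le
  have hK : (ω : ℂ) ^ 2 - (lam : ℂ) ^ 2 = (κ : ℂ) ^ 2 := by norm_cast; rw [hκ2]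
  rw [hK, sincRt_one_ofReal_sq] at hsq
  rw [hK, sincRt_one_ofReal_sq, cosRt_one_ofReal_sq] at h
  norm_cast at hsq h
  have hpi := Real.pi_pos
  set n := ⌊κ / Real.pi⌋₊ with hn
  have hn1 : n * Real.pi ≤ κ := by
    have := Nat.floor_le (show 0 ≤ κ / Real.pi by positivity)
    rwa [le_div_iff₀ hpi] at this
  have hn2 : κ < (n + 1) * Real.pi := by
    have := Nat.lt_floor_add_one (κ / Real.pi)
    rwa [div_lt_iff₀ hpi] at this
  have hs0 : Real.sin κ ≠ 0 := by
    intro h0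
    rw [Real.sinc_of_ne_zero hκpos.ne', h0] at hsq
    simp at hsq
  have hn1' : n * Real.pi < κ := by
    refine lt_of_le_of_ne hn1 fun h0 => hs0 ?_
    rw [← h0, Real.sin_nat_mul_pi]
  refine ⟨n, κ, ⟨hn1', hn2⟩, ?_, ?_⟩
  · have hp := sign_sinc_pos ⟨hn1', hn2⟩
    rw [eq_div_iff (by linarith)]
    have h3 : ((-1) ^ n * Real.sinc κ * ω) ^ 2 = 1 := by
      rw [mul_pow, mul_pow, ← pow_mul, mul_comm n, pow_mul]
      rw [mul_pow] at hsq
      norm_num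
      linarith
    have h4 : 0 < (-1) ^ n * Real.sinc κ * ω := by positivity
    nlinarith
  · rw [Real.sinc_of_ne_zero hκpos.ne'] at h
    rw [Real.cot_eq_cos_div_sin]
    field_simp at h ⊢
    linarith

/-- The real roots are the wave numbers of the oscillatory waves, and `1` at the threshold. -/
theorem root_real_classify {m : ℕ} {ω lam : ℝ} (hm : 0 < m) (h1 : omegaThr m < ω)
    (h2 : ω ≤ omegaThr (m + 1)) (h : dispersionFun ω lam = 0) :
    (∃ n, n < m ∧ lam = kappaMinus ω (n + 1) * Real.cot (kappaMinus ω (n + 1))) ∨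
    (∃ n, 0 < n ∧ n < m ∧ lam = kappaPlus ω (n + 1) * Real.cot (kappaPlus ω (n + 1))) ∨
    (lam = 1 ∧ ω = omegaThr (m + 1)) := by
  have hω : 1 < ω := lt_of_le_of_lt (omegaThr_ge_one m) h1
  obtain ⟨n, κ, hκ, hκ2, rfl⟩ := root_real hω h
  have hle := sign_sinc_le ⟨hκ.1.le, hκ.2⟩
  rw [hκ2, one_div_le_one_div (by linarith) (lt_of_lt_of_le one_pos (omegaThr_ge_one _))] at hle
  have hnm : n ≤ m := by
    have := hle.trans h2
    exact omegaThr_strictMono.le_iff_le.1 this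
  rcases hnm.eq_or_lt with hnm | hnm
  · subst hnm
    have hω' : ω = omegaThr (n + 1) := le_antisymm h2 hle
    rw [hω', sign_sinc_eq_iff ⟨hκ.1.le, hκ.2⟩] at hκ2
    refine Or.inr (Or.inr ⟨?_, hω'⟩)
    have hs := sign_mul_sin_pos hκ
    have hs0 : Real.sin κ ≠ 0 := by intro h0; rw [h0] at hs; simp at hs
    have := kappaThr_mul_cos n
    rw [← hκ2] at this
    rw [Real.cot_eq_cos_div_sin, ← mul_div_assoc, this, div_self hs0]
  · have hne : κ ≠ kappaThr (n + 1) := by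
      intro h0
      rw [h0, sinc_kappaThr, one_div, one_div, inv_inj] at hκ2
      have : omegaThr (n + 1) ≤ omegaThr m := by
        obtain ⟨m, rfl⟩ : ∃ m', m = m' + 1 := ⟨m - 1, by omega⟩
        exact omegaThr_strictMono.le_iff_le.2 (by omega)
      linarith
    rcases lt_or_gt_of_ne hne with hlt | hgt
    · refine Or.inr (Or.inl ⟨n, ?_, hnm, ?_⟩)
      · rcases Nat.eq_zero_or_pos n with h0 | h0
        · subst h0
          rw [zero_add, kappaThr_one] at hlt
          have := hκ.1
          simp at this
          linarith
        · exact h0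
      · rw [kappaPlus_eq ⟨hκ.1, hlt⟩ hκ2]
    · exact Or.inl ⟨n, hnm, by rw [kappaMinus_eq ⟨hgt, hκ.2⟩ hκ2]⟩

/-! ### Conjugation -/

theorem csinc_conj (z : ℂ) : csinc (conj z) = conj (csinc z) := by
  unfold csinc
  by_cases h : z = 0
  · simp [h]
  · rw [if_neg h, if_neg (by simpa using h), map_div₀, Complex.sin_conj]

theorem sincRt_conj (x : ℝ) (K : ℂ) : sincRt x (conj K) = conj (sincRt x K) := by
  obtain ⟨κ, rfl⟩ := exists_sq_eq K
  rw [map_pow, sincRt_sq, sincRt_sq, map_mul, ← csinc_conj, map_mul, Complex.conj_ofReal]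

theorem cosRt_conj (x : ℝ) (K : ℂ) : cosRt x (conj K) = conj (cosRt x K) := by
  obtain ⟨κ, rfl⟩ := exists_sq_eq K
  rw [map_pow, cosRt_sq, cosRt_sq, ← Complex.cos_conj, map_mul, Complex.conj_ofReal]

theorem K_conj (ω : ℝ) (lam : ℂ) :
    (ω : ℂ) ^ 2 - (conj lam) ^ 2 = conj ((ω : ℂ) ^ 2 - lam ^ 2) := by simp

theorem dispersionFun_conj (ω : ℝ) (lam : ℂ) :
    dispersionFun ω (conj lam) = conj (dispersionFun ω lam) := by
  rw [dispersionFun_eq, dispersionFun_eq, K_conj, sincRt_conj, cosRt_conj]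
  simp

/-! ### Joint continuity in the frequency and the spectral parameter -/

theorem continuous_cosK : Continuous (fun p : ℝ × ℂ => cosRt 1 ((p.1 : ℂ) ^ 2 - p.2 ^ 2)) :=
  (differentiable_cosRt 1).continuous.comp (by fun_prop)

theorem continuous_sincK : Continuous (fun p : ℝ × ℂ => sincRt 1 ((p.1 : ℂ) ^ 2 - p.2 ^ 2)) :=
  (differentiable_sincRt 1).continuous.comp (by fun_prop)

theorem continuous_dispersionFun_prod : Continuous (fun p : ℝ × ℂ => dispersionFun p.1 p.2) := by
  simp only [dispersionFun_eq]
  exact continuous_cosK.sub (continuous_snd.mul continuous_sincK)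

theorem exists_closedBall_of_eventually {P : ℝ → ℂ → Prop} {ω : ℝ} {z : ℂ}
    (h : ∀ᶠ p in 𝓝 (ω, z), P p.1 p.2) :
    ∃ r > 0, ∀ᶠ ω' in 𝓝 ω, ∀ w ∈ Metric.closedBall z r, P ω' w := by
  rw [nhds_prod_eq, eventually_prod_iff] at h
  obtain ⟨pa, ha, pb, hb, hab⟩ := h
  obtain ⟨r, hr, hr'⟩ := Metric.nhds_basis_closedBall.eventually_iff.1 hb
  refine ⟨r, hr, ?_⟩
  filter_upwards [ha] with ω' hω' w hw
  exact hab hω' (hr' hw)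

/-- The mean value inequality for `f z - c z`. It isolates a simple root in a disc whose radius does
not depend on the frequency. -/
theorem injOn_of_hasDerivAt_near {f f' : ℂ → ℂ} {s : Set ℂ} (hs : Convex ℝ s) {c : ℂ} (hc : c ≠ 0)
    (hf : ∀ z ∈ s, HasDerivAt f (f' z) z) (hf' : ∀ z ∈ s, ‖f' z - c‖ ≤ ‖c‖ / 2) : InjOn f s := by
  intro x hx y hy hxy
  have h := Convex.norm_image_sub_le_of_norm_hasDerivWithin_le
    (f := fun z => f z - c * z) (f' := fun z => f' z - c) (C := ‖c‖ / 2) (s := s)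
    (fun z hz => by
      have := (hf z hz).sub ((hasDerivAt_id z).const_mul c)
      rw [mul_one] at this
      exact this.hasDerivWithinAt) hf' hs hx hy
  have e : f y - c * y - (f x - c * x) = -(c * (y - x)) := by rw [hxy]; ring
  rw [e, norm_neg, norm_mul] at h
  have hcpos := norm_pos_iff.2 hc
  have : ‖y - x‖ ≤ 0 := by nlinarith [norm_nonneg (y - x)]
  exact (sub_eq_zero.1 (norm_le_zero_iff.1 this)).symm

/-- A quantitative substitute for Rouché's theorem. Subtracting the quadratic `c/2 (z - z₁)(z - z₂)`
leaves a function `F` with zeros `z₁`, `z₂` and a second derivative of size at most `‖c‖/8`. Two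
mean value estimates make `F w` too small to cancel the quadratic at a third root `w`. With `z₁` the
nearer root, `‖z₂ - z₁‖ ≤ 2 ‖w - z₂‖`, and the constant obtained is `3/8 < 1/2`. -/
theorem eq_or_eq_of_second_deriv_near {f f1 f2 : ℂ → ℂ} {s : Set ℂ} (hs : Convex ℝ s) {c : ℂ}
    (hc : c ≠ 0) (hf : ∀ z ∈ s, HasDerivAt f (f1 z) z) (hf1 : ∀ z ∈ s, HasDerivAt f1 (f2 z) z)
    (hf2 : ∀ z ∈ s, ‖f2 z - c‖ ≤ ‖c‖ / 8) {z₁ z₂ w : ℂ} (h1 : z₁ ∈ s) (h2 : z₂ ∈ s) (hw : w ∈ s)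
    (hne : z₁ ≠ z₂) (e1 : f z₁ = 0) (e2 : f z₂ = 0) (e3 : f w = 0) : w = z₁ ∨ w = z₂ := by
  wlog hle : ‖w - z₁‖ ≤ ‖w - z₂‖ generalizing z₁ z₂
  · exact (this h2 h1 hne.symm e2 e1 (le_of_not_ge hle)).symm
  by_contra hcon
  push Not at hcon
  set F : ℂ → ℂ := fun z => f z - c / 2 * ((z - z₁) * (z - z₂)) with hF
  set F1 : ℂ → ℂ := fun z => f1 z - c / 2 * (1 * (z - z₂) + (z - z₁) * 1) with hF1
  have hFd : ∀ z ∈ s, HasDerivAt F (F1 z) z := fun z hz =>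
    (hf z hz).sub ((((hasDerivAt_id z).sub_const z₁).mul ((hasDerivAt_id z).sub_const z₂)).const_mul _)
  have hF1d : ∀ z ∈ s, HasDerivAt F1 (f2 z - c) z := fun z hz => by
    refine ((hf1 z hz).sub (((((hasDerivAt_id z).sub_const z₂).const_mul 1).add
      (((hasDerivAt_id z).sub_const z₁).mul_const 1)).const_mul _)).congr_deriv ?_
    ring
  have hlip : ∀ x ∈ s, ∀ y ∈ s, ‖F1 y - F1 x‖ ≤ ‖c‖ / 8 * ‖y - x‖ := fun x hx y hy =>
    Convex.norm_image_sub_le_of_norm_hasDerivWithin_le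
      (fun z hz => (hF1d z hz).hasDerivWithinAt) hf2 hs hx hy
  have hF1' : F z₁ = 0 := by simp [hF, e1]
  have hF2' : F z₂ = 0 := by simp [hF, e2]
  have hsegd : ∀ y ∈ s, segment ℝ z₁ y ⊆ s := fun y hy => hs.segment_subset h1 hy
  have hsegn : ∀ y, ∀ z ∈ segment ℝ z₁ y, ‖z - z₁‖ ≤ ‖y - z₁‖ := fun y z hz => by
    have := norm_sub_le_of_mem_segment hz
    exact this
  have hA : ‖F1 z₁‖ ≤ ‖c‖ / 8 * ‖z₂ - z₁‖ := by
    have h := Convex.norm_image_sub_le_of_norm_hasDerivWithin_le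
      (f := fun z => F z - F1 z₁ * z) (f' := fun z => F1 z - F1 z₁)
      (C := ‖c‖ / 8 * ‖z₂ - z₁‖) (s := segment ℝ z₁ z₂)
      (fun z hz => by
        have := (hFd z (hsegd z₂ h2 hz)).sub ((hasDerivAt_id z).const_mul (F1 z₁))
        rw [mul_one] at this
        exact this.hasDerivWithinAt)
      (fun z hz => (hlip z₁ h1 z (hsegd z₂ h2 hz)).trans (by gcongr; exact hsegn z₂ z hz))
      (convex_segment _ _) (left_mem_segment _ _ _) (right_mem_segment _ _ _)
    have e : F z₂ - F1 z₁ * z₂ - (F z₁ - F1 z₁ * z₁) = -(F1 z₁ * (z₂ - z₁)) := by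
      rw [hF1', hF2']; ring
    rw [e, norm_neg, norm_mul] at h
    exact le_of_mul_le_mul_right h (norm_pos_iff.2 (sub_ne_zero.2 hne.symm))
  have htri : ‖z₂ - z₁‖ ≤ 2 * ‖w - z₂‖ := by
    have : z₂ - z₁ = (w - z₁) - (w - z₂) := by ring
    rw [this]
    refine (norm_sub_le _ _).trans ?_
    linarith
  have hB : ‖F w - F z₁‖ ≤ 3 * (‖c‖ / 8) * ‖w - z₂‖ * ‖w - z₁‖ := by
    refine Convex.norm_image_sub_le_of_norm_hasDerivWithin_le (s := segment ℝ z₁ w)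
      (fun z hz => (hFd z (hsegd w hw hz)).hasDerivWithinAt) (fun z hz => ?_)
      (convex_segment _ _) (left_mem_segment _ _ _) (right_mem_segment _ _ _)
    have h3 := hlip z₁ h1 z (hsegd w hw hz)
    have h4 := hsegn w z hz
    have h5 := norm_add_le (F1 z - F1 z₁) (F1 z₁)
    rw [sub_add_cancel] at h5
    have hc0 := norm_nonneg c
    nlinarith [mul_le_mul_of_nonneg_left htri hc0, mul_le_mul_of_nonneg_left h4 hc0,
      mul_le_mul_of_nonneg_left hle hc0]
  have hwv : F w = -(c / 2 * ((w - z₁) * (w - z₂))) := by simp [hF, e3]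
  rw [hF1', sub_zero, hwv, norm_neg, norm_mul, norm_mul, norm_div] at hB
  have p1 : 0 < ‖w - z₁‖ := norm_pos_iff.2 (sub_ne_zero.2 hcon.1)
  have p2 : 0 < ‖w - z₂‖ := norm_pos_iff.2 (sub_ne_zero.2 hcon.2)
  have p3 : 0 < ‖c‖ := norm_pos_iff.2 hc
  have p4 : 0 < ‖c‖ * (‖w - z₁‖ * ‖w - z₂‖) := by positivity
  norm_num at hB
  nlinarith

/-! ### The function whose double root splits -/

/-- `sin κ / κ - (-1)^m / ω` as a function of the spectral parameter. -/
def thrG (m : ℕ) (ω : ℝ) (lam : ℂ) : ℂ :=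
  sincRt 1 ((ω : ℂ) ^ 2 - lam ^ 2) - (-1) ^ m / (ω : ℂ)

/-- The derivative of `thrG`. -/
def thrG1 (ω : ℝ) (lam : ℂ) : ℂ :=
  -(lam * (cosRt 1 ((ω : ℂ) ^ 2 - lam ^ 2) - sincRt 1 ((ω : ℂ) ^ 2 - lam ^ 2)) /
    ((ω : ℂ) ^ 2 - lam ^ 2))

/-- The second derivative of `thrG`. -/
def thrG2 (ω : ℝ) (lam : ℂ) : ℂ :=
  -(lam ^ 2 * sincRt 1 ((ω : ℂ) ^ 2 - lam ^ 2) / ((ω : ℂ) ^ 2 - lam ^ 2) +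
    (cosRt 1 ((ω : ℂ) ^ 2 - lam ^ 2) - sincRt 1 ((ω : ℂ) ^ 2 - lam ^ 2)) *
      (1 / ((ω : ℂ) ^ 2 - lam ^ 2) + 3 * lam ^ 2 / ((ω : ℂ) ^ 2 - lam ^ 2) ^ 2))

theorem threshFun_eq_thrG (m : ℕ) (ε : ℝ) (lam : ℂ) :
    threshFun (m + 1) ε lam = thrG m (omegaEps (m + 1) ε) lam := by
  rw [threshFun_eq, thrG]
  congr 2
  rw [pow_succ, pow_succ]; ring

theorem thrG_conj (m : ℕ) (ω : ℝ) (lam : ℂ) : thrG m ω (conj lam) = conj (thrG m ω lam) := by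
  rw [thrG, thrG, K_conj, sincRt_conj]; simp

theorem differentiable_thrG (m : ℕ) (ω : ℝ) : Differentiable ℂ (thrG m ω) :=
  ((differentiable_sincRt 1).comp (by fun_prop : Differentiable ℂ fun lam : ℂ =>
    (ω : ℂ) ^ 2 - lam ^ 2)).sub (differentiable_const _)

section
variable {ω : ℝ} {lam : ℂ}

theorem hasDerivAt_thrG (m : ℕ) (hK : (ω : ℂ) ^ 2 - lam ^ 2 ≠ 0) :
    HasDerivAt (thrG m ω) (thrG1 ω lam) lam := by
  refine ((hasDerivAt_sincRt_lam 1 ω hK).sub_const _).congr_deriv ?_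
  rw [thrG1]; push_cast; ring

theorem hasDerivAt_K (ω : ℝ) (lam : ℂ) :
    HasDerivAt (fun lam : ℂ => (ω : ℂ) ^ 2 - lam ^ 2) (-(2 * lam)) lam := by
  simpa using (hasDerivAt_pow 2 lam).const_sub ((ω : ℂ) ^ 2)

theorem hasDerivAt_thrG1 (hK : (ω : ℂ) ^ 2 - lam ^ 2 ≠ 0) :
    HasDerivAt (thrG1 ω) (thrG2 ω lam) lam := by
  have h1 := hasDerivAt_cosRt_lam 1 ω hK
  have h2 := hasDerivAt_sincRt_lam 1 ω hK
  refine (((hasDerivAt_id lam).mul (h1.sub h2)).div (hasDerivAt_K ω lam) hK).neg.congr_deriv ?_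
  rw [thrG2]
  simp only [id_eq, Complex.ofReal_one, Pi.sub_apply, Pi.mul_apply]
  field_simp
  ring

/-- `1 - ω²S²` is a difference of squares. Near `lam = 1` the factors other than `dispersionFun` and
`thrG` do not vanish, so the two functions have the same zeros there, with multiplicity. -/
theorem dispersionFun_mul_eq_thrG (m : ℕ) (hω : ω ≠ 0) :
    dispersionFun ω lam * (cosRt 1 ((ω : ℂ) ^ 2 - lam ^ 2) +
      lam * sincRt 1 ((ω : ℂ) ^ 2 - lam ^ 2)) =
    -(ω ^ 2 * thrG m ω lam * (sincRt 1 ((ω : ℂ) ^ 2 - lam ^ 2) + (-1) ^ m / (ω : ℂ))) := by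
  have h : ((-1 : ℂ) ^ m) ^ 2 = 1 := by rw [← pow_mul, mul_comm, pow_mul]; simp
  have hω' : (ω : ℂ) ≠ 0 := by exact_mod_cast hω
  rw [dispersionFun_mul, thrG]
  field_simp
  linear_combination -h

end

theorem continuous_thrG (m : ℕ) {p : ℝ × ℂ} (hp : p.1 ≠ 0) :
    ContinuousAt (fun p : ℝ × ℂ => thrG m p.1 p.2) p := by
  refine continuous_sincK.continuousAt.sub (continuousAt_const.div ?_ (by exact_mod_cast hp))
  fun_prop

/-! ### The threshold frequency -/

section
variable {m : ℕ}

theorem K_thr (m : ℕ) : ((omegaThr (m + 1) : ℝ) : ℂ) ^ 2 - 1 ^ 2 = (kappaThr (m + 1) : ℂ) ^ 2 := by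
  norm_cast; rw [omegaThr_sq]; ring

theorem sinc_thr (m : ℕ) : sincRt 1 (((omegaThr (m + 1) : ℝ) : ℂ) ^ 2 - 1 ^ 2) =
    (-1) ^ m / (omegaThr (m + 1) : ℂ) := by
  rw [K_thr, sincRt_one_ofReal_sq]
  have h := sinc_kappaThr m
  have h2 := neg_one_pow_mul_self m
  have : Real.sinc (kappaThr (m + 1)) = (-1) ^ m / omegaThr (m + 1) := by
    calc _ = (-1) ^ m * ((-1) ^ m * Real.sinc (kappaThr (m + 1))) := by
          rw [← mul_assoc, h2, one_mul]
      _ = _ := by rw [h]; ring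
  rw [this]; push_cast; ring

theorem cos_thr (hm : 0 < m) : cosRt 1 (((omegaThr (m + 1) : ℝ) : ℂ) ^ 2 - 1 ^ 2) =
    (-1) ^ m / (omegaThr (m + 1) : ℂ) := by
  rw [← sinc_thr, K_thr, sincRt_one_ofReal_sq, cosRt_one_ofReal_sq,
    Real.sinc_of_ne_zero (kappaThr_pos hm).ne', ← kappaThr_mul_cos]
  have := (kappaThr_pos hm).ne'
  congr 1
  field_simp

theorem K_thr_ne_zero (hm : 0 < m) : ((omegaThr (m + 1) : ℝ) : ℂ) ^ 2 - 1 ^ 2 ≠ 0 := by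
  rw [K_thr]
  exact pow_ne_zero _ (by exact_mod_cast (kappaThr_pos hm).ne')

theorem sign_div_omega_ne_zero (m : ℕ) : (-1 : ℂ) ^ m / (omegaThr (m + 1) : ℂ) ≠ 0 := by
  refine div_ne_zero (pow_ne_zero _ (by norm_num)) ?_
  exact_mod_cast (lt_of_lt_of_le one_pos (omegaThr_ge_one _)).ne'

theorem thrG_thr_one (m : ℕ) : thrG m (omegaThr (m + 1)) 1 = 0 := by
  rw [thrG, sinc_thr, sub_self]

theorem thrG1_thr_one (hm : 0 < m) : thrG1 (omegaThr (m + 1)) 1 = 0 := by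
  rw [thrG1, sinc_thr, cos_thr hm]; simp

theorem thrG2_thr_one (hm : 0 < m) : thrG2 (omegaThr (m + 1)) 1 ≠ 0 := by
  rw [thrG2, sinc_thr, cos_thr hm]
  simpa using ⟨(lt_of_lt_of_le one_pos (omegaThr_ge_one _)).ne', by simpa using K_thr_ne_zero hm⟩

theorem dispersionFun_thr_one (hm : 0 < m) : dispersionFun (omegaThr (m + 1)) 1 = 0 := by
  rw [dispersionFun_eq, sinc_thr, cos_thr hm]; ring

theorem thrG_thr_eventually_ne (hm : 0 < m) :
    ∀ᶠ z in 𝓝[≠] (1 : ℂ), thrG m (omegaThr (m + 1)) z ≠ 0 := by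
  have ha : AnalyticAt ℂ (thrG m (omegaThr (m + 1))) 1 :=
    (differentiable_thrG m _).analyticAt 1
  rcases ha.eventually_eq_zero_or_eventually_ne_zero with h | h
  · exfalso
    have hK : ∀ᶠ z : ℂ in 𝓝 1, ((omegaThr (m + 1) : ℝ) : ℂ) ^ 2 - z ^ 2 ≠ 0 :=
      ContinuousAt.eventually_ne (by fun_prop) (K_thr_ne_zero hm)
    have h1 : ∀ᶠ z in 𝓝 (1 : ℂ), thrG1 (omegaThr (m + 1)) z = 0 := by
      filter_upwards [h.eventually_nhds, hK] with z hz hzK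
      have h0 : HasDerivAt (thrG m (omegaThr (m + 1))) 0 z :=
        (hasDerivAt_const z (0 : ℂ)).congr_of_eventuallyEq hz
      exact (hasDerivAt_thrG m hzK).unique h0
    have h2 : HasDerivAt (thrG1 (omegaThr (m + 1))) 0 1 :=
      (hasDerivAt_const 1 (0 : ℂ)).congr_of_eventuallyEq h1
    exact thrG2_thr_one hm ((hasDerivAt_thrG1 (K_thr_ne_zero hm)).unique h2)
  · exact h

/-- The properties of a disc around `1` that hold for all frequencies near the threshold. -/
structure NearThreshold (m : ℕ) (ω : ℝ) (lam : ℂ) : Prop where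
  K_ne : (ω : ℂ) ^ 2 - lam ^ 2 ≠ 0
  conjugate_ne : cosRt 1 ((ω : ℂ) ^ 2 - lam ^ 2) + lam * sincRt 1 ((ω : ℂ) ^ 2 - lam ^ 2) ≠ 0
  sinc_ne : sincRt 1 ((ω : ℂ) ^ 2 - lam ^ 2) + (-1) ^ m / (ω : ℂ) ≠ 0
  second : ‖thrG2 ω lam - thrG2 (omegaThr (m + 1)) 1‖ ≤ ‖thrG2 (omegaThr (m + 1)) 1‖ / 8
  kappa : Real.sqrt (ω ^ 2 - lam.re ^ 2) ∈ Ioo (m * Real.pi) ((m + 1) * Real.pi)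
  pos : 0 < ω ^ 2 - lam.re ^ 2

theorem eventually_nearThreshold (hm : 0 < m) :
    ∀ᶠ p in 𝓝 (omegaThr (m + 1), (1 : ℂ)), NearThreshold m p.1 p.2 := by
  have hK : ContinuousAt (fun p : ℝ × ℂ => (p.1 : ℂ) ^ 2 - p.2 ^ 2) (omegaThr (m + 1), 1) := by
    fun_prop
  have hC := continuous_cosK.continuousAt (x := (omegaThr (m + 1), (1 : ℂ)))
  have hS := continuous_sincK.continuousAt (x := (omegaThr (m + 1), (1 : ℂ)))
  have hK0 := K_thr_ne_zero hm
  have hω0 : omegaThr (m + 1) ≠ 0 := (lt_of_lt_of_le one_pos (omegaThr_ge_one _)).ne'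
  have hs0 := sign_div_omega_ne_zero m
  have hsnd : ContinuousAt (fun p : ℝ × ℂ => p.2) (omegaThr (m + 1), (1 : ℂ)) := by fun_prop
  have hsgn : ContinuousAt (fun p : ℝ × ℂ => (-1 : ℂ) ^ m / (p.1 : ℂ)) (omegaThr (m + 1), (1 : ℂ)) :=
    continuousAt_const.div (by fun_prop) (by exact_mod_cast hω0)
  have e1 := hK.eventually_ne hK0
  have e2 := (hC.add (hsnd.mul hS)).eventually_ne (y := 0) (by
    change cosRt 1 (((omegaThr (m + 1) : ℝ) : ℂ) ^ 2 - 1 ^ 2) +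
      1 * sincRt 1 (((omegaThr (m + 1) : ℝ) : ℂ) ^ 2 - 1 ^ 2) ≠ 0
    rw [sinc_thr, cos_thr hm]
    rw [one_mul, ← two_mul]
    exact mul_ne_zero two_ne_zero hs0)
  have e3 := (hS.add hsgn).eventually_ne (y := 0) (by
    change sincRt 1 (((omegaThr (m + 1) : ℝ) : ℂ) ^ 2 - 1 ^ 2) + _ ≠ 0
    rw [sinc_thr]
    rw [← two_mul]
    exact mul_ne_zero two_ne_zero hs0)
  have h2 : ContinuousAt (fun p : ℝ × ℂ => thrG2 p.1 p.2) (omegaThr (m + 1), (1 : ℂ)) := by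
    unfold thrG2
    exact ((((hsnd.pow 2).mul hS).div hK hK0).add ((hC.sub hS).mul
      ((continuousAt_const.div hK hK0).add ((continuousAt_const.mul (hsnd.pow 2)).div (hK.pow 2)
        (pow_ne_zero _ hK0))))).neg
  have h3 : ContinuousAt (fun p : ℝ × ℂ => ‖thrG2 p.1 p.2 - thrG2 (omegaThr (m + 1)) 1‖)
    (omegaThr (m + 1), (1 : ℂ)) := (h2.sub continuousAt_const).norm
  have e4 := h3.eventually (gt_mem_nhds (a := ‖thrG2 (omegaThr (m + 1)) 1‖ / 8) (by
      change ‖thrG2 (omegaThr (m + 1)) 1 - thrG2 (omegaThr (m + 1)) 1‖ < _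
      rw [sub_self, norm_zero]
      have := norm_pos_iff.2 (thrG2_thr_one hm)
      positivity))
  have hre : ContinuousAt (fun p : ℝ × ℂ => p.1 ^ 2 - p.2.re ^ 2) (omegaThr (m + 1), (1 : ℂ)) := by
    fun_prop
  have hre0 : omegaThr (m + 1) ^ 2 - (1 : ℂ).re ^ 2 = kappaThr (m + 1) ^ 2 := by
    rw [omegaThr_sq, Complex.one_re]; ring
  have e5 := hre.sqrt.eventually_mem (s := Ioo (m * Real.pi) ((m + 1) * Real.pi))
    (isOpen_Ioo.mem_nhds (by
      simp only [hre0]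
      rw [Real.sqrt_sq (kappaThr_nonneg m)]
      exact ⟨kappaThr_gt hm, (kappaThr_mem m).2⟩))
  have e6 := hre.eventually (lt_mem_nhds (a := 0) (by
    simp only [hre0]; have := kappaThr_pos hm; positivity))
  filter_upwards [e1, e2, e3, e4, e5, e6] with p h1 h2 h3 h4 h5 h6
  exact ⟨h1, h2, h3, h4.le, h5, h6⟩

/-- Minimum modulus principle: without a zero, `1/f` would be larger at the centre than on the
circle. -/
theorem exists_root_of_small {f : ℂ → ℂ} (hf : Differentiable ℂ f) {z : ℂ} {r d : ℝ} (hr : 0 < r)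
    (hd : 0 < d) (h : ∀ w ∈ Metric.sphere z r, d < ‖f w‖) (hz : ‖f z‖ < d) :
    ∃ w, ‖w - z‖ < r ∧ f w = 0 := by
  by_contra hcon
  push Not at hcon
  have hne : ∀ w ∈ Metric.closedBall z r, f w ≠ 0 := by
    intro w hw
    rcases (mem_closedBall_iff_norm.1 hw).lt_or_eq with h1 | h1
    · exact hcon w h1
    · have := h w (mem_sphere_iff_norm.2 h1)
      intro h0
      rw [h0, norm_zero] at this
      linarith
  have hcl : closure (Metric.ball z r) = Metric.closedBall z r := closure_ball z hr.ne'
  have := Complex.norm_le_of_forall_mem_frontier_norm_le (f := fun w => (f w)⁻¹)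
    (U := Metric.ball z r) (C := d⁻¹) Metric.isBounded_ball
    ⟨fun w hw => ((hf w).inv (hne w (Metric.ball_subset_closedBall hw))).differentiableWithinAt, by
      rw [hcl]
      exact hf.continuous.continuousOn.inv₀ hne⟩
    (fun w hw => by
      rw [frontier_ball z hr.ne'] at hw
      rw [norm_inv]
      exact inv_anti₀ hd (h w hw).le)
    (subset_closure (Metric.mem_ball_self hr))
  rw [norm_inv] at this
  have hfz : 0 < ‖f z‖ := norm_pos_iff.2 (hne z (Metric.mem_closedBall_self hr.le))
  have := (inv_le_inv₀ hfz hd).1 this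
  linarith

/-- A radius such that near the threshold frequency the disc around `1` contains the two split
roots and nothing else. -/
theorem exists_threshold_disc (hm : 0 < m) {γ : ℝ} (hγ : 0 < γ) :
    ∃ r, 0 < r ∧ r < γ ∧ ∀ᶠ ω in 𝓝 (omegaThr (m + 1)), r < ω - 1 ∧
      (∀ lam ∈ Metric.closedBall (1 : ℂ) r, NearThreshold m ω lam) ∧
      (ω < omegaThr (m + 1) → ∃ z : ℂ, ‖z - 1‖ < r ∧ 0 < z.im ∧
        ∀ lam : ℂ, ‖lam - 1‖ ≤ r → (thrG m ω lam = 0 ↔ lam = z ∨ lam = conj z)) ∧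
      (∀ lam : ℂ, ‖lam - 1‖ ≤ r → (thrG m (omegaThr (m + 1)) lam = 0 ↔ lam = 1)) := by
  set ω₀ := omegaThr (m + 1) with hω₀
  obtain ⟨r1, hr1, h1⟩ := exists_closedBall_of_eventually (eventually_nearThreshold hm)
  obtain ⟨r2, hr2, h2⟩ := Metric.nhds_basis_closedBall.eventually_iff.1
    (eventually_nhdsWithin_iff.1 (thrG_thr_eventually_ne hm))
  have hω1 : 1 < ω₀ := omegaThr_gt_one hm
  set r := min (min r1 r2) (min (γ / 2) ((ω₀ - 1) / 2)) with hr
  have hr0 : 0 < r := lt_min (lt_min hr1 hr2) (lt_min (by linarith) (by linarith))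
  have hrr1 : r ≤ r1 := (min_le_left _ _).trans (min_le_left _ _)
  have hrr2 : r ≤ r2 := (min_le_left _ _).trans (min_le_right _ _)
  have hrγ : r ≤ γ / 2 := (min_le_right _ _).trans (min_le_left _ _)
  have hrω : r ≤ (ω₀ - 1) / 2 := (min_le_right _ _).trans (min_le_right _ _)
  have hzero : ∀ lam : ℂ, ‖lam - 1‖ ≤ r → (thrG m ω₀ lam = 0 ↔ lam = 1) := by
    intro lam hlam
    refine ⟨fun h0 => ?_, fun h0 => by rw [h0]; exact thrG_thr_one m⟩
    by_contra hne
    exact h2 (mem_closedBall_iff_norm.2 (hlam.trans hrr2)) hne h0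
  have hsph : IsCompact (Metric.sphere (1 : ℂ) r) := isCompact_sphere _ _
  have hpos : ∀ w ∈ Metric.sphere (1 : ℂ) r, 0 < ‖thrG m ω₀ w‖ := fun w hw => by
    rw [mem_sphere_iff_norm] at hw
    refine norm_pos_iff.2 fun h0 => ?_
    rw [hzero w hw.le] at h0
    rw [h0, sub_self, norm_zero] at hw
    linarith
  obtain ⟨d, hd, hdle⟩ := hsph.exists_forall_le' (a := 0)
    (differentiable_thrG m ω₀).continuous.norm.continuousOn hpos
  have hω0' : ω₀ ≠ 0 := by linarith
  -- The circle is compact, so the lower bound for `thrG` on it survives a small change of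
  -- frequency, while the value at the centre stays small. This forces a root inside the disc.
  have ev1 : ∀ᶠ ω in 𝓝 ω₀, ∀ w ∈ Metric.sphere (1 : ℂ) r, d / 2 < ‖thrG m ω w‖ := by
    refine hsph.eventually_forall_of_forall_eventually fun w hw => ?_
    refine (continuous_thrG m (p := (ω₀, w)) hω0').norm.eventually (lt_mem_nhds ?_)
    have := hdle w hw
    simp only
    linarith
  have ev2 : ∀ᶠ ω in 𝓝 ω₀, ‖thrG m ω 1‖ < d / 2 := by
    have hc : ContinuousAt (fun ω : ℝ => ‖thrG m ω 1‖) ω₀ :=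
      ((continuous_thrG m (p := (ω₀, 1)) hω0').comp (f := fun ω : ℝ => (ω, (1 : ℂ)))
        (by fun_prop)).norm
    refine hc.eventually (gt_mem_nhds ?_)
    change ‖thrG m (omegaThr (m + 1)) 1‖ < d / 2
    rw [thrG_thr_one, norm_zero]
    positivity
  have ev3 : ∀ᶠ ω in 𝓝 ω₀, r < ω - 1 :=
    (continuousAt_id.sub continuousAt_const).eventually (lt_mem_nhds (by
      change r < ω₀ - 1; linarith))
  refine ⟨r, hr0, by linarith, ?_⟩
  filter_upwards [h1, ev1, ev2, ev3] with ω h1 h3 h4 h5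
  have hN : ∀ lam ∈ Metric.closedBall (1 : ℂ) r, NearThreshold m ω lam := fun lam hlam => by
    exact h1 lam (Metric.closedBall_subset_closedBall hrr1 hlam)
  refine ⟨h5, hN, fun hlt => ?_, hzero⟩
  have hωpos : 0 < ω := by linarith
  obtain ⟨z, hz, hz0⟩ := exists_root_of_small (differentiable_thrG m ω) hr0 (by positivity) h3 h4
  -- A real root would give a point where `(-1)^m sinc` equals `1/ω`, but for `ω < ω₀` this exceeds
  -- the peak height `1/ω₀`.
  have him : z.im ≠ 0 := by
    intro him
    have hzr : z = (z.re : ℂ) := Complex.ext (by simp) (by simp [him])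
    have hN' := hN z (mem_closedBall_iff_norm.2 hz.le)
    have hκ := hN'.kappa
    set κ := Real.sqrt (ω ^ 2 - z.re ^ 2) with hκdef
    have hκ2 : κ ^ 2 = ω ^ 2 - z.re ^ 2 := Real.sq_sqrt hN'.pos.le
    have hK : (ω : ℂ) ^ 2 - z ^ 2 = (κ : ℂ) ^ 2 := by
      rw [hzr]; norm_cast; rw [hκ2]
    rw [thrG, hK, sincRt_one_ofReal_sq, sub_eq_zero] at hz0
    have hz1 : Real.sinc κ = (-1) ^ m / ω := by exact_mod_cast hz0
    have h6 := sign_sinc_le ⟨hκ.1.le, hκ.2⟩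
    rw [hz1, ← mul_div_assoc, neg_one_pow_mul_self] at h6
    have := (one_div_le_one_div hωpos (by linarith)).1 h6
    linarith
  -- The conjugate of the root is a second root, and near-constancy of the second derivative
  -- excludes a third.
  have key : ∀ z : ℂ, ‖z - 1‖ < r → thrG m ω z = 0 → 0 < z.im → ∃ z : ℂ, ‖z - 1‖ < r ∧ 0 < z.im ∧
        ∀ lam : ℂ, ‖lam - 1‖ ≤ r → (thrG m ω lam = 0 ↔ lam = z ∨ lam = conj z) := by
    intro z hz hz0 him
    have hzc : thrG m ω (conj z) = 0 := by rw [thrG_conj, hz0, map_zero]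
    refine ⟨z, hz, him, fun lam hlam => ⟨fun h0 => ?_, ?_⟩⟩
    · have hcz : ‖conj z - 1‖ ≤ r := by
        rw [← map_one (starRingEnd ℂ), ← map_sub, RCLike.norm_conj]; exact hz.le
      refine eq_or_eq_of_second_deriv_near (convex_closedBall (1 : ℂ) r) (thrG2_thr_one hm)
        (fun w hw => hasDerivAt_thrG m (hN w hw).K_ne) (fun w hw => hasDerivAt_thrG1 (hN w hw).K_ne)
        (fun w hw => (hN w hw).second) (mem_closedBall_iff_norm.2 hz.le)
        (mem_closedBall_iff_norm.2 hcz) (mem_closedBall_iff_norm.2 hlam) ?_ hz0 hzc h0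
      intro h
      have := congrArg Complex.im h
      rw [Complex.conj_im] at this
      linarith
    · rintro (rfl | rfl)
      · exact hz0
      · exact hzc
  rcases lt_or_gt_of_ne him with h6 | h6
  · refine key (conj z) ?_ (by rw [thrG_conj, hz0, map_zero]) (by rw [Complex.conj_im]; linarith)
    rw [← map_one (starRingEnd ℂ), ← map_sub, RCLike.norm_conj]; exact hz
  · exact key z hz hz0 h6

/-! ### Roots in a strip -/

/-- A simple real root stays real under perturbation: roots come in conjugate pairs, and local
injectivity on a disc symmetric about the real axis identifies a root with its conjugate. -/
theorem eventually_root_near {ω₀ : ℝ} (hω : 1 < ω₀) {y : ℂ} (hy : dispersionFun ω₀ y = 0)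
    (him : y.im = 0) (h1 : y ≠ 1) :
    ∀ᶠ p in 𝓝 (ω₀, y), dispersionFun p.1 p.2 = 0 → p.2.im = 0 := by
  have hK0 := K_ne_zero_of_sq_eq_one hω (sq_eq_one_of_root hy)
  have hK : ContinuousAt (fun p : ℝ × ℂ => (p.1 : ℂ) ^ 2 - p.2 ^ 2) (ω₀, y) := by fun_prop
  have hC := continuous_cosK.continuousAt (x := (ω₀, y))
  have hS := continuous_sincK.continuousAt (x := (ω₀, y))
  have hsnd : ContinuousAt (fun p : ℝ × ℂ => p.2) (ω₀, y) := by fun_prop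
  set D1 : ℝ → ℂ → ℂ := fun ω lam => lam * sincRt 1 ((ω : ℂ) ^ 2 - lam ^ 2) -
      sincRt 1 ((ω : ℂ) ^ 2 - lam ^ 2) + lam ^ 2 * (cosRt 1 ((ω : ℂ) ^ 2 - lam ^ 2) -
        sincRt 1 ((ω : ℂ) ^ 2 - lam ^ 2)) / ((ω : ℂ) ^ 2 - lam ^ 2) with hD1
  have hc : ContinuousAt (fun p : ℝ × ℂ => D1 p.1 p.2) (ω₀, y) :=
    ((hsnd.mul hS).sub hS).add (((hsnd.pow 2).mul (hC.sub hS)).div hK hK0)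
  have hne : D1 ω₀ y ≠ 0 := by
    have := deriv_dispersionFun_ne_zero hω hy h1
    rwa [(hasDerivAt_dispersionFun hK0).deriv] at this
  have e1 := hK.eventually_ne hK0
  have hc' : ContinuousAt (fun p : ℝ × ℂ => ‖D1 p.1 p.2 - D1 ω₀ y‖) (ω₀, y) :=
    (hc.sub continuousAt_const).norm
  have e2 := hc'.eventually (gt_mem_nhds (a := ‖D1 ω₀ y‖ / 2) (by
      change ‖D1 ω₀ y - D1 ω₀ y‖ < _
      rw [sub_self, norm_zero]
      have := norm_pos_iff.2 hne
      positivity))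
  obtain ⟨r, hr, h⟩ := exists_closedBall_of_eventually
    (P := fun ω lam => (ω : ℂ) ^ 2 - lam ^ 2 ≠ 0 ∧ ‖D1 ω lam - D1 ω₀ y‖ < ‖D1 ω₀ y‖ / 2)
    (e1.and e2)
  have hball : ∀ᶠ z in 𝓝 y, z ∈ Metric.closedBall y r := Metric.closedBall_mem_nhds y hr
  rw [nhds_prod_eq]
  filter_upwards [h.prod_mk hball] with p hp hp0
  have hinj := injOn_of_hasDerivAt_near (convex_closedBall y r) hne
    (fun z hz => hasDerivAt_dispersionFun (hp.1 z hz).1) (fun z hz => (hp.1 z hz).2.le)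
  have hyc : conj y = y := Complex.conj_eq_iff_im.2 him
  have := hinj (show conj p.2 ∈ Metric.closedBall y r by
    rw [mem_closedBall_iff_norm, ← hyc, ← map_sub, RCLike.norm_conj]
    exact mem_closedBall_iff_norm.1 hp.2) hp.2 (by rw [dispersionFun_conj, hp0, map_zero])
  exact Complex.conj_eq_iff_im.1 this

/-- Roots in the strip lie in a fixed rectangle for `ω ≤ ω₀ + 1`. Compactness reduces the claim to
neighbourhoods of points of three kinds: non-roots, simple real roots, and the double root `1`. -/
theorem eventually_roots_in_strip (hm : 0 < m) {γ : ℝ} (hγ : 0 < γ)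
    (h : IsThresholdWidth (m + 1) γ) {r : ℝ} (hr : 0 < r) :
    ∀ᶠ ω in 𝓝 (omegaThr (m + 1)), ∀ lam : ℂ, |lam.im| ≤ γ → dispersionFun ω lam = 0 →
      lam.im = 0 ∨ (‖lam - 1‖ < r ∧ thrG m ω lam = 0) := by
  set ω₀ := omegaThr (m + 1) with hω₀
  have hω1 : 1 < ω₀ := omegaThr_gt_one hm
  set R := 20 + 2 * (γ + (ω₀ + 1)) with hR
  have hcomp : IsCompact (Icc (-R) R ×ℂ Icc (-γ) γ) := isCompact_Icc.reProdIm isCompact_Icc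
  have key : ∀ᶠ ω in 𝓝 ω₀, ∀ lam ∈ Icc (-R) R ×ℂ Icc (-γ) γ, dispersionFun ω lam = 0 →
      lam.im = 0 ∨ (‖lam - 1‖ < r ∧ thrG m ω lam = 0) := by
    refine hcomp.eventually_forall_of_forall_eventually fun y hy => ?_
    by_cases hD : dispersionFun ω₀ y = 0
    · have him : y.im = 0 := h y (abs_le.2 hy.2) hD
      by_cases hy1 : y = 1
      · subst hy1
        have hb : ∀ᶠ p : ℝ × ℂ in 𝓝 (ω₀, 1), ‖p.2 - 1‖ < r :=
          ContinuousAt.eventually_lt (by fun_prop) continuousAt_const (by simpa using hr)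
        have hpos : ∀ᶠ p : ℝ × ℂ in 𝓝 (ω₀, 1), p.1 ≠ 0 :=
          ContinuousAt.eventually_ne (by fun_prop) (by simp; linarith)
        filter_upwards [hb, hpos, eventually_nearThreshold hm] with p h1 h2 h3 hp0
        refine Or.inr ⟨h1, ?_⟩
        have := dispersionFun_mul_eq_thrG (lam := p.2) m h2
        rw [hp0, zero_mul, eq_comm, neg_eq_zero] at this
        have h4 := (mul_eq_zero.1 this).resolve_right h3.sinc_ne
        exact (mul_eq_zero.1 h4).resolve_left (pow_ne_zero _ (by exact_mod_cast h2))
      · filter_upwards [eventually_root_near hω1 hD him hy1] with p hp hp0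
        exact Or.inl (hp hp0)
    · have := (continuous_dispersionFun_prod.continuousAt (x := (ω₀, y))).eventually_ne hD
      filter_upwards [this] with p hp hp0
      exact absurd hp0 hp
  have e1 : ∀ᶠ ω in 𝓝 ω₀, ω ≤ ω₀ + 1 := eventually_le_nhds (by linarith)
  have e2 : ∀ᶠ ω in 𝓝 ω₀, 1 ≤ ω := eventually_ge_nhds hω1
  filter_upwards [key, e1, e2] with ω h1 h2 h3 lam hlam h0
  refine h1 lam ⟨?_, abs_le.1 hlam⟩ h0
  by_contra hcon
  have : R ≤ |lam.re| := by
    by_contra hlt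
    push Not at hlt
    exact hcon ⟨(abs_lt.1 hlt).1.le, (abs_lt.1 hlt).2.le⟩
  exact dispersionFun_ne_zero_of_re_large hγ.le h3 h2 hlam this h0

/-- Roots with `|Im lam| ≤ 1` lie in a bounded rectangle. Since zeros are isolated, compactness of
the real segment keeps nonreal roots a positive distance from it. -/
theorem exists_isThresholdWidth (hm : 0 < m) : ∃ γ : ℝ, 0 < γ ∧ IsThresholdWidth (m + 1) γ := by
  set ω₀ := omegaThr (m + 1) with hω₀
  have hω1 : 1 < ω₀ := omegaThr_gt_one hm
  set R := 20 + 2 * (1 + ω₀) with hR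
  have key : ∀ᶠ t : ℝ in 𝓝 0, ∀ x ∈ Icc (-R) R, dispersionFun ω₀ ((x : ℝ) + (t : ℝ) * I) = 0 → t = 0 := by
    refine isCompact_Icc.eventually_forall_of_forall_eventually fun x hx => ?_
    have h1 := eventually_nhdsWithin_iff.1 (dispersionFun_eventually_ne hω1.le (x : ℂ))
    have hc : ContinuousAt (fun p : ℝ × ℝ => (p.2 : ℂ) + p.1 * I) (0, x) := by fun_prop
    have h2 : Tendsto (fun p : ℝ × ℝ => (p.2 : ℂ) + p.1 * I) (𝓝 (0, x)) (𝓝 (x : ℂ)) := by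
      have := hc.tendsto
      simpa using this
    filter_upwards [h2.eventually h1] with p hp hp0
    by_contra hne
    refine hp ?_ hp0
    simp only [mem_compl_iff, mem_singleton_iff]
    intro heq
    have := congrArg Complex.im heq
    simp at this
    exact hne this
  obtain ⟨δ, hδ, hδ'⟩ := Metric.nhds_basis_closedBall.eventually_iff.1 key
  refine ⟨min δ 1, lt_min hδ one_pos, fun lam hlam h0 => ?_⟩
  have hre : lam.re ∈ Icc (-R) R := by
    by_contra hcon
    have : R ≤ |lam.re| := by
      by_contra hlt
      push Not at hlt
      exact hcon ⟨(abs_lt.1 hlt).1.le, (abs_lt.1 hlt).2.le⟩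
    exact dispersionFun_ne_zero_of_re_large zero_le_one hω1.le le_rfl (hlam.trans (min_le_right _ _))
      this h0
  refine hδ' (x := lam.im) ?_ lam.re hre ?_
  · rw [mem_closedBall_iff_norm, sub_zero]
    exact hlam.trans (min_le_left _ _)
  · rw [Complex.re_add_im]; exact h0

/-! ### The frequencies near the threshold -/

theorem omegaEps_zero (N : ℕ) : omegaEps N 0 = omegaThr N := by simp [omegaEps]

theorem tendsto_omegaEps (N : ℕ) : Tendsto (omegaEps N) (𝓝 0) (𝓝 (omegaThr N)) := by
  have : ContinuousAt (omegaEps N) 0 := by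
    unfold omegaEps
    exact continuousAt_const.div (by fun_prop) (by simp)
  simpa [omegaEps_zero] using this.tendsto

theorem omegaEps_lt {N : ℕ} {ε : ℝ} (hε : 0 < ε) : omegaEps N ε < omegaThr N := by
  have := omegaThr_ge_one N
  have h1 : 0 < ε * omegaThr N := mul_pos hε (by linarith)
  rw [omegaEps, div_lt_iff₀ (by linarith)]
  nlinarith

theorem omegaEps_le {N : ℕ} {ε : ℝ} (hε : 0 ≤ ε) : omegaEps N ε ≤ omegaThr N := by
  rcases hε.eq_or_lt with rfl | h
  · rw [omegaEps_zero]
  · exact (omegaEps_lt h).le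

end

/-! ### Smooth solutions of the homogeneous problem -/

/-- Smooth solutions of the homogeneous problem that grow at most like `e^{β|y|}`. -/
structure SmoothSol (ω β : ℝ) (w : ℝ × ℝ → ℂ × ℂ) : Prop where
  smoothU : ContDiff ℝ (⊤ : ℕ∞) (fun p => (w p).1)
  smoothV : ContDiff ℝ (⊤ : ℕ∞) (fun p => (w p).2)
  eqU : ∀ p, dOp I (fun p => (w p).1) p = -(ω * (w p).2)
  eqV : ∀ p, dOp (-I) (fun p => (w p).2) p = ω * (w p).1
  bcU : ∀ y, (w (0, y)).1 = 0
  bcV : ∀ y, (w (1, y)).2 = 0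
  bound : ∃ C, 0 ≤ C ∧ ∀ x ∈ Ioo (0 : ℝ) 1, ∀ y,
    ‖(w (x, y)).1‖ ≤ x * (C * Real.exp (β * |y|)) ∧
    ‖(w (x, y)).2‖ ≤ (1 - x) * (C * Real.exp (β * |y|))

namespace SmoothSol

variable {ω β : ℝ} {w w' : ℝ × ℝ → ℂ × ℂ}

theorem diffU (h : SmoothSol ω β w) (p : ℝ × ℝ) : DifferentiableAt ℝ (fun p => (w p).1) p :=
  h.smoothU.differentiable (by simp) p

theorem diffV (h : SmoothSol ω β w) (p : ℝ × ℝ) : DifferentiableAt ℝ (fun p => (w p).2) p :=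
  h.smoothV.differentiable (by simp) p

theorem add (h : SmoothSol ω β w) (h' : SmoothSol ω β w') :
    SmoothSol ω β (fun p => w p + w' p) := by
  refine ⟨h.smoothU.add h'.smoothU, h.smoothV.add h'.smoothV, fun p => ?_, fun p => ?_,
    fun y => ?_, fun y => ?_, ?_⟩
  · simp only [Prod.fst_add, Prod.snd_add]
    rw [dOp_add (h.diffU p) (h'.diffU p), h.eqU, h'.eqU]; ring
  · simp only [Prod.fst_add, Prod.snd_add]
    rw [dOp_add (h.diffV p) (h'.diffV p), h.eqV, h'.eqV]; ring
  · simp [h.bcU, h'.bcU]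
  · simp [h.bcV, h'.bcV]
  · obtain ⟨C, hC, hb⟩ := h.bound
    obtain ⟨C', hC', hb'⟩ := h'.bound
    refine ⟨C + C', by positivity, fun x hx y => ⟨?_, ?_⟩⟩
    · refine (norm_add_le _ _).trans ((add_le_add (hb x hx y).1 (hb' x hx y).1).trans ?_)
      apply le_of_eq; ring
    · refine (norm_add_le _ _).trans ((add_le_add (hb x hx y).2 (hb' x hx y).2).trans ?_)
      apply le_of_eq; ring

theorem smul (h : SmoothSol ω β w) (c : ℂ) : SmoothSol ω β (fun p => c • w p) := by
  refine ⟨contDiff_const.mul h.smoothU, contDiff_const.mul h.smoothV, fun p => ?_, fun p => ?_,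
    fun y => ?_, fun y => ?_, ?_⟩
  · simp only [Prod.smul_fst, Prod.smul_snd, smul_eq_mul]
    rw [dOp_const_mul (h.diffU p), h.eqU]; ring
  · simp only [Prod.smul_fst, Prod.smul_snd, smul_eq_mul]
    rw [dOp_const_mul (h.diffV p), h.eqV]; ring
  · simp [h.bcU]
  · simp [h.bcV]
  · obtain ⟨C, hC, hb⟩ := h.bound
    refine ⟨‖c‖ * C, by positivity, fun x hx y => ⟨?_, ?_⟩⟩
    · simp only [Prod.smul_fst, norm_smul]
      refine (mul_le_mul_of_nonneg_left (hb x hx y).1 (norm_nonneg c)).trans (le_of_eq ?_)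
      ring
    · simp only [Prod.smul_snd, norm_smul]
      refine (mul_le_mul_of_nonneg_left (hb x hx y).2 (norm_nonneg c)).trans (le_of_eq ?_)
      ring

theorem zero : SmoothSol ω β (fun _ => 0) := by
  refine ⟨contDiff_const, contDiff_const, fun p => ?_, fun p => ?_, fun y => rfl, fun y => rfl,
    0, le_rfl, fun x hx y => ?_⟩
  · simp [dOp]
  · simp [dOp]
  · simp

theorem sum {ι : Type*} (s : Finset ι) {W : ι → ℝ × ℝ → ℂ × ℂ} (c : ι → ℂ)
    (h : ∀ i ∈ s, SmoothSol ω β (W i)) : SmoothSol ω β (fun p => ∑ i ∈ s, c i • W i p) := by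
  classical
  induction s using Finset.induction_on with
  | empty => simpa using zero
  | insert a s ha ih =>
    simp only [Finset.sum_insert ha]
    exact ((h a (Finset.mem_insert_self _ _)).smul (c a)).add
      (ih fun i hi => h i (Finset.mem_insert_of_mem hi))

theorem contU (h : SmoothSol ω β w) : Continuous (fun p => (w p).1) := h.smoothU.continuous

theorem contV (h : SmoothSol ω β w) : Continuous (fun p => (w p).2) := h.smoothV.continuous

theorem norm_le (h : SmoothSol ω β w) : ∃ C, 0 ≤ C ∧ ∀ x ∈ Ioo (0 : ℝ) 1, ∀ y,
    ‖(w (x, y)).1‖ ≤ C * Real.exp (β * |y|) ∧ ‖(w (x, y)).2‖ ≤ C * Real.exp (β * |y|) := by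
  obtain ⟨C, hC, hb⟩ := h.bound
  refine ⟨C, hC, fun x hx y => ⟨(hb x hx y).1.trans ?_, (hb x hx y).2.trans ?_⟩⟩
  · exact mul_le_of_le_one_left (by positivity) hx.2.le
  · exact mul_le_of_le_one_left (by positivity) (by linarith [hx.1])

theorem isHomogeneous (h : SmoothSol ω β w) {γ : ℝ} (hβ : β < γ) :
    IsHomogeneous ω γ (fun p => (w p).1) (fun p => (w p).2) := by
  obtain ⟨C, hC, hb⟩ := h.norm_le
  refine ⟨MemTempered.of_norm_le hβ h.contU fun x hx y => (hb x hx y).1,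
    MemTempered.of_norm_le hβ h.contV fun x hx y => (hb x hx y).2, ?_, ?_⟩
  · have := hasWeakOp_of_contDiff (c := I) (U := {p : ℝ × ℝ | p.1 < 1})
      (h.smoothU.of_le (by exact_mod_cast le_top)) (fun y => Or.inl (h.bcU y))
      (fun y => Or.inr (by simp))
    rwa [show dOp I (fun p => (w p).1) = fun p => -(ω * (w p).2) from funext h.eqU] at this
  · have := hasWeakOp_of_contDiff (c := -I) (U := {p : ℝ × ℝ | 0 < p.1})
      (h.smoothV.of_le (by exact_mod_cast le_top)) (fun y => Or.inr (by simp))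
      (fun y => Or.inl (h.bcV y))
    rwa [show dOp (-I) (fun p => (w p).2) = fun p => ω * (w p).1 from funext h.eqV] at this

end SmoothSol

/-! ### The symplectic form -/

/-- The symplectic form on the section at height `y`. -/
def qSec (w w' : ℝ × ℝ → ℂ × ℂ) (y : ℝ) : ℂ :=
  - ∫ x in (0 : ℝ)..1,
    ((w (x, y)).1 * conj (w' (x, y)).2 - (w (x, y)).2 * conj (w' (x, y)).1)

/-- The symplectic form averaged over the support of the derivative of the cutoff. -/
def qEta (u v : ℝ × ℝ → ℂ) (w : ℝ × ℝ → ℂ × ℂ) : ℂ :=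
  ∫ p in strip, (deriv eta p.2 : ℝ) * (v p * conj (w p).1 - u p * conj (w p).2)

theorem qForm_conj (w w' : ℝ × ℝ → ℂ × ℂ) : qForm w' w = -conj (qForm w w') := by
  rw [qForm, qForm, map_neg, neg_neg, ← intervalIntegral.intervalIntegral_conj, ← intervalIntegral.integral_neg]
  refine intervalIntegral.integral_congr fun x _ => ?_
  simp only [map_sub, map_mul, Complex.conj_conj]
  ring

section
variable {ω β : ℝ} {w w' : ℝ × ℝ → ℂ × ℂ}

/-- The equations make `(-i(α + κ), α - κ)` divergence free, where `α = v conj u'` and `κ = u conj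
v'`. The boundary conditions annihilate the flux through the edges, so the flux through horizontal
sections is constant. -/
theorem qSec_eq_qForm (h : SmoothSol ω β w) (h' : SmoothSol ω β w') (y : ℝ) :
    qSec w w' y = qForm w w' := by
  set α : ℝ × ℝ → ℂ := fun p => (w p).2 * conj (w' p).1 with hα
  set κ : ℝ × ℝ → ℂ := fun p => (w p).1 * conj (w' p).2 with hκ
  have hc1 : ContDiff ℝ (⊤ : ℕ∞) (fun p => conj (w' p).1) :=
    Complex.conjCLE.contDiff.comp h'.smoothU
  have hc2 : ContDiff ℝ (⊤ : ℕ∞) (fun p => conj (w' p).2) :=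
    Complex.conjCLE.contDiff.comp h'.smoothV
  have hαs : ContDiff ℝ (⊤ : ℕ∞) α := h.smoothV.mul hc1
  have hκs : ContDiff ℝ (⊤ : ℕ∞) κ := h.smoothU.mul hc2
  have hαd : Differentiable ℝ α := hαs.differentiable (by simp)
  have hκd : Differentiable ℝ κ := hκs.differentiable (by simp)
  have key : ∀ p, dOp (-I) α p = dOp I κ p := by
    intro p
    rw [hα, hκ, dOp_mul (h.diffV p) (hc1.differentiable (by simp) p),
      dOp_mul (h.diffU p) (hc2.differentiable (by simp) p), dOp_conj (h'.diffU p),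
      dOp_conj (h'.diffV p), h.eqV, h.eqU]
    simp only [map_neg, Complex.conj_I, neg_neg, h'.eqU, h'.eqV, map_mul, Complex.conj_ofReal]
    ring
  have h2 := integral2_divergence_prod_of_hasFDerivAt
    (fun p => -I * (α p + κ p)) (fun p => α p - κ p)
    (fun p => (-I) • (fderiv ℝ α p + fderiv ℝ κ p)) (fun p => fderiv ℝ α p - fderiv ℝ κ p)
    0 0 1 y (by have := hαd.continuous; have := hκd.continuous; fun_prop)
    (by have := hαd.continuous; have := hκd.continuous; fun_prop)
    (fun p _ => ((hαd p).hasFDerivAt.add (hκd p).hasFDerivAt).const_mul (-I))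
    (fun p _ => (hαd p).hasFDerivAt.sub (hκd p).hasFDerivAt)
    ((integrableOn_zero (μ := volume) (ε' := ℂ)).congr (Eventually.of_forall fun p => by
      have := key p
      simp only [dOp] at this
      simp
      linear_combination -this))
  have h3 : ∀ x y : ℝ, ((-I) • (fderiv ℝ α (x, y) + fderiv ℝ κ (x, y))) (1, 0) +
      (fderiv ℝ α (x, y) - fderiv ℝ κ (x, y)) (0, 1) = 0 := fun x y => by
    have := key (x, y)
    simp only [dOp] at this
    simp
    linear_combination this
  simp only [h3] at h2
  have e1 : ∀ y, α (1, y) + κ (1, y) = 0 := fun y => by simp [hα, hκ, h.bcV, h'.bcV]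
  have e0 : ∀ y, α (0, y) + κ (0, y) = 0 := fun y => by simp [hα, hκ, h.bcU, h'.bcU]
  simp only [e1, e0, mul_zero, intervalIntegral.integral_zero, add_zero, sub_zero] at h2
  rw [eq_comm, sub_eq_zero] at h2
  have e : ∀ y, qSec w w' y = ∫ x in (0 : ℝ)..1, (α (x, y) - κ (x, y)) := fun y => by
    rw [qSec, ← intervalIntegral.integral_neg]
    refine intervalIntegral.integral_congr fun x _ => ?_
    simp [hα, hκ]
  rw [e y, h2, ← e 0]
  rfl

theorem integral_deriv_eta : ∫ y, deriv eta y = 1 := by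
  have hd : ∀ y, HasDerivAt eta (deriv eta y) y := fun y => hasDerivAt_smoothTransition y
  have hc : Continuous (deriv eta) :=
    (Real.smoothTransition.contDiff (n := 1)).continuous_deriv le_rfl
  have h1 : ∫ y in (0 : ℝ)..1, deriv eta y = 1 := by
    rw [intervalIntegral.integral_eq_sub_of_hasDerivAt (fun y _ => hd y) (hc.intervalIntegrable _ _)]
    simp [eta]
  rw [← h1, intervalIntegral.integral_of_le zero_le_one, ← integral_Icc_eq_integral_Ioc,
    setIntegral_eq_integral_of_forall_compl_eq_zero]
  intro y hy
  rw [mem_Icc, not_and_or, not_le, not_le] at hy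
  exact deriv_smoothTransition_eq_zero hy

theorem integrable_qEta {γ : ℝ} {u v : ℝ × ℝ → ℂ} (hu : MemTempered γ u) (hv : MemTempered γ v)
    (h : SmoothSol ω β w) :
    Integrable (fun p : ℝ × ℝ => (deriv eta p.2 : ℝ) * (v p * conj (w p).1 - u p * conj (w p).2))
      (volume.restrict strip) := by
  obtain ⟨M, hM⟩ := exists_isCutoff_deriv_eta
  obtain ⟨C, hC, hb⟩ := h.norm_le
  have hM0 : 0 ≤ M := (abs_nonneg _).trans (hM.le 0)
  have hdm : Measurable (fun p : ℝ × ℝ => ((deriv eta p.2 : ℝ) : ℂ)) :=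
    Complex.measurable_ofReal.comp (hM.meas.comp measurable_snd)
  have h1 : Continuous (fun p => conj (w p).1) := Complex.continuous_conj.comp h.contU
  have h2 : Continuous (fun p => conj (w p).2) := Complex.continuous_conj.comp h.contV
  refine (((hv.integrable (lt_add_one γ)).add (hu.integrable (lt_add_one γ))).const_mul
    (M * C * Real.exp (|β| + |γ + 1|))).mono' ?_ ?_
  · exact hdm.aestronglyMeasurable.mul ((hv.aestronglyMeasurable.mul h1.aestronglyMeasurable).sub
      (hu.aestronglyMeasurable.mul h2.aestronglyMeasurable))
  · filter_upwards [ae_restrict_mem measurableSet_strip] with ⟨x, y⟩ hp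
    simp only [Pi.add_apply]
    by_cases hy : y ∈ Icc (0 : ℝ) 1
    · have hy1 : |y| ≤ 1 := by rw [abs_of_nonneg hy.1]; exact hy.2
      obtain ⟨b1, b2⟩ := hb x hp.1 y
      have hE : Real.exp (β * |y|) ≤ Real.exp (|β| + |γ + 1|) * Real.exp (-((γ + 1) * |y|)) := by
        rw [← Real.exp_add, Real.exp_le_exp]
        nlinarith [abs_nonneg β, abs_nonneg (γ + 1), le_abs_self β, le_abs_self (γ + 1), abs_nonneg y]
      set E := Real.exp (|β| + |γ + 1|)
      set e := Real.exp (-((γ + 1) * |y|))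
      have b1' : ‖(w (x, y)).1‖ ≤ C * (E * e) := b1.trans (by gcongr)
      have b2' : ‖(w (x, y)).2‖ ≤ C * (E * e) := b2.trans (by gcongr)
      rw [norm_mul, Complex.norm_real, Real.norm_eq_abs]
      calc |deriv eta y| * ‖v (x, y) * conj (w (x, y)).1 - u (x, y) * conj (w (x, y)).2‖
          ≤ M * (‖v (x, y)‖ * (C * (E * e)) + ‖u (x, y)‖ * (C * (E * e))) := by
            gcongr
            · exact hM.le y
            · refine (norm_sub_le _ _).trans ?_
              rw [norm_mul, norm_mul, RCLike.norm_conj, RCLike.norm_conj]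
              gcongr
        _ = _ := by ring
    · have := hM.supp y hy
      simp only [this, Complex.ofReal_zero, zero_mul, norm_zero]
      positivity

/-- The section form is constant and `η'` has integral `1`. For solutions that are merely square
integrable, `qEta` takes the place of a trace on a section. -/
theorem qEta_eq_qForm (h : SmoothSol ω β w) (h' : SmoothSol ω β w') :
    qEta (fun p => (w p).1) (fun p => (w p).2) w' = qForm w w' := by
  have hh := h.isHomogeneous (lt_add_one β)
  have hi := integrable_qEta hh.memU hh.memV h'
  rw [qEta]
  rw [volume_restrict_strip] at hi ⊢
  rw [integral_prod_symm _ hi]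
  have : ∀ y : ℝ, ∫ x in Ioo (0 : ℝ) 1, ((deriv eta y : ℝ) : ℂ) *
      ((w (x, y)).2 * conj (w' (x, y)).1 - (w (x, y)).1 * conj (w' (x, y)).2) =
      (deriv eta y : ℝ) * qForm w w' := fun y => by
    rw [integral_const_mul, ← qSec_eq_qForm h h' y, qSec, intervalIntegral.integral_of_le zero_le_one,
      integral_Ioc_eq_integral_Ioo, ← integral_neg]
    congr 2
    funext x
    ring
  simp only [this]
  rw [integral_mul_const, integral_complex_ofReal, integral_deriv_eta]
  simp

end

/-! ### Sesquilinearity -/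

section
variable {ω β γ : ℝ} {u v u' v' : ℝ × ℝ → ℂ} {w w' : ℝ × ℝ → ℂ × ℂ}

theorem qEta_add_right (hu : MemTempered γ u) (hv : MemTempered γ v) (h : SmoothSol ω β w)
    (h' : SmoothSol ω β w') :
    qEta u v (fun p => w p + w' p) = qEta u v w + qEta u v w' := by
  rw [qEta, qEta, qEta, ← integral_add (integrable_qEta hu hv h) (integrable_qEta hu hv h')]
  refine integral_congr_ae (Eventually.of_forall fun p => ?_)
  simp only [Prod.fst_add, Prod.snd_add, map_add]
  ring

theorem qEta_smul_right (u v : ℝ × ℝ → ℂ) (w : ℝ × ℝ → ℂ × ℂ) (c : ℂ) :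
    qEta u v (fun p => c • w p) = conj c * qEta u v w := by
  rw [qEta, qEta, ← integral_const_mul]
  refine integral_congr_ae (Eventually.of_forall fun p => ?_)
  simp only [Prod.smul_fst, Prod.smul_snd, smul_eq_mul, map_mul]
  ring

theorem qEta_sub_left (hu : MemTempered γ u) (hv : MemTempered γ v) (hu' : MemTempered γ u')
    (hv' : MemTempered γ v') (h : SmoothSol ω β w) :
    qEta (fun p => u p - u' p) (fun p => v p - v' p) w = qEta u v w - qEta u' v' w := by
  rw [qEta, qEta, qEta, ← integral_sub (integrable_qEta hu hv h) (integrable_qEta hu' hv' h)]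
  refine integral_congr_ae (Eventually.of_forall fun p => ?_)
  simp only
  ring

theorem qForm_add_right {w'' : ℝ × ℝ → ℂ × ℂ} (h : SmoothSol ω β w) (h' : SmoothSol ω β w')
    (h'' : SmoothSol ω β w'') :
    qForm w (fun p => w' p + w'' p) = qForm w w' + qForm w w'' := by
  have hh := h.isHomogeneous (lt_add_one β)
  rw [← qEta_eq_qForm h (h'.add h''), ← qEta_eq_qForm h h', ← qEta_eq_qForm h h'',
    qEta_add_right hh.memU hh.memV h' h'']

theorem qForm_smul_right (w w' : ℝ × ℝ → ℂ × ℂ) (c : ℂ) :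
    qForm w (fun p => c • w' p) = conj c * qForm w w' := by
  rw [qForm, qForm, mul_neg, ← intervalIntegral.integral_const_mul]
  congr 1
  refine intervalIntegral.integral_congr fun x _ => ?_
  simp only [Prod.smul_fst, Prod.smul_snd, smul_eq_mul, map_mul]
  ring

theorem qForm_smul_left (w w' : ℝ × ℝ → ℂ × ℂ) (c : ℂ) :
    qForm (fun p => c • w p) w' = c * qForm w w' := by
  rw [qForm_conj, qForm_smul_right, map_mul, Complex.conj_conj, ← mul_neg, ← qForm_conj]

theorem qForm_add_left {w'' : ℝ × ℝ → ℂ × ℂ} (h : SmoothSol ω β w) (h' : SmoothSol ω β w')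
    (h'' : SmoothSol ω β w'') :
    qForm (fun p => w' p + w'' p) w = qForm w' w + qForm w'' w := by
  rw [qForm_conj, qForm_add_right h h' h'', map_add, neg_add, ← qForm_conj, ← qForm_conj]

theorem qForm_zero_left (w : ℝ × ℝ → ℂ × ℂ) : qForm (fun _ => 0) w = 0 := by
  simp [qForm]

theorem qForm_sum_left {ι : Type*} (s : Finset ι) {W : ι → ℝ × ℝ → ℂ × ℂ} (c : ι → ℂ)
    (h : ∀ i ∈ s, SmoothSol ω β (W i)) (h' : SmoothSol ω β w') :
    qForm (fun p => ∑ i ∈ s, c i • W i p) w' = ∑ i ∈ s, c i * qForm (W i) w' := by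
  classical
  induction s using Finset.induction_on with
  | empty => simpa using qForm_zero_left w'
  | insert a s ha ih =>
    simp only [Finset.sum_insert ha]
    rw [qForm_add_left h' ((h a (Finset.mem_insert_self _ _)).smul (c a))
      (SmoothSol.sum s c fun i hi => h i (Finset.mem_insert_of_mem hi)), qForm_smul_left,
      ih fun i hi => h i (Finset.mem_insert_of_mem hi)]

end

/-! ### Green's formula for the inhomogeneous problem -/

theorem MemWeightedL2.aestronglyMeasurable {s : ℝ} {u : ℝ × ℝ → ℂ} (h : MemWeightedL2 s u) :
    AEStronglyMeasurable u (volume.restrict strip) :=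
  aestronglyMeasurable_of_exp_mul (w := fun p : ℝ × ℝ => s * p.2) (by fun_prop) h.1

theorem MemWeightedL2.integrable_mul {s a : ℝ} {u : ℝ × ℝ → ℂ} (h : MemWeightedL2 s u)
    (ha : 0 < a) :
    Integrable (fun p => ‖u p‖ * Real.exp (s * p.2 - a * |p.2|)) (volume.restrict strip) := by
  have h1 := MemLp.integrable_mul (memLp_exp_neg_abs ha) h.norm
  refine h1.congr (Eventually.of_forall fun p => ?_)
  simp only [Pi.mul_apply, norm_mul, Complex.norm_real, Real.norm_of_nonneg (Real.exp_pos _).le]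
  rw [← mul_assoc, ← Real.exp_add, mul_comm]
  congr 2; ring

theorem MemWeightedL2.add {s : ℝ} {u v : ℝ × ℝ → ℂ} (hu : MemWeightedL2 s u)
    (hv : MemWeightedL2 s v) : MemWeightedL2 s (fun p => u p + v p) := by
  unfold MemWeightedL2
  convert MemLp.add hu hv using 2
  simp [mul_add]

theorem MemWeightedL2.const_mul {s : ℝ} {u : ℝ × ℝ → ℂ} (hu : MemWeightedL2 s u) (c : ℂ) :
    MemWeightedL2 s (fun p => c * u p) := by
  have := MemLp.const_mul hu c
  unfold MemWeightedL2
  convert this using 2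
  ring

theorem integrable_mul_of_hasCompactSupport {γ : ℝ} {u φ : ℝ × ℝ → ℂ} (hu : MemTempered γ u)
    (hφ : Continuous φ) (hc : HasCompactSupport φ) :
    Integrable (fun p => u p * φ p) (volume.restrict strip) := by
  have hcont : Continuous (fun p : ℝ × ℝ => φ p * (Real.exp ((γ + 1) * |p.2|) : ℂ)) := by fun_prop
  obtain ⟨C, hC⟩ := (hc.mul_right (f' := fun p : ℝ × ℝ => (Real.exp ((γ + 1) * |p.2|) : ℂ))
    ).exists_bound_of_continuous hcont
  refine ((hu.integrable (lt_add_one γ)).const_mul C).mono'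
    (hu.aestronglyMeasurable.mul hφ.aestronglyMeasurable) (Eventually.of_forall fun p => ?_)
  have h1 : ‖φ p * (Real.exp ((γ + 1) * |p.2|) : ℂ)‖ ≤ C := hC p
  rw [norm_mul, Complex.norm_real, Real.norm_of_nonneg (Real.exp_pos _).le] at h1
  rw [norm_mul]
  have h2 : ‖φ p‖ = ‖φ p‖ * Real.exp ((γ + 1) * |p.2|) * Real.exp (-((γ + 1) * |p.2|)) := by
    rw [mul_assoc, ← Real.exp_add, add_neg_cancel, Real.exp_zero, mul_one]
  rw [h2]
  calc _ ≤ ‖u p‖ * (C * Real.exp (-((γ + 1) * |p.2|))) := by gcongr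
    _ = _ := by ring

theorem HasCompactSupport.dOp {c : ℂ} {φ : ℝ × ℝ → ℂ} (h : HasCompactSupport φ) :
    HasCompactSupport (dOp c φ) := by
  refine h.mono' fun p hp => ?_
  by_contra hcon
  refine hp ?_
  have h0 : fderiv ℝ φ p = 0 := by
    by_contra h1
    exact hcon (support_fderiv_subset ℝ h1)
  simp [DiracStrip.dOp, h0]

theorem HasWeakOp.sub {γ : ℝ} {c : ℂ} {U : Set (ℝ × ℝ)} {u u' f f' : ℝ × ℝ → ℂ}
    (h : HasWeakOp c U u f) (h' : HasWeakOp c U u' f') (hu : MemTempered γ u)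
    (hu' : MemTempered γ u') (hf : MemTempered γ f) (hf' : MemTempered γ f') :
    HasWeakOp c U (fun p => u p - u' p) (fun p => f p - f' p) := by
  intro φ hφ hφc hφU
  have h1 := h φ hφ hφc hφU
  have h2 := h' φ hφ hφc hφU
  have hd : Continuous (DiracStrip.dOp c φ) :=
    continuous_dOp (hφ.of_le (by exact_mod_cast le_top))
  have hdc : HasCompactSupport (DiracStrip.dOp c φ) := HasCompactSupport.dOp hφc
  simp only [sub_mul]
  rw [integral_sub (integrable_mul_of_hasCompactSupport hu hd hdc)
    (integrable_mul_of_hasCompactSupport hu' hd hdc),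
    integral_sub (integrable_mul_of_hasCompactSupport hf hφ.continuous hφc)
    (integrable_mul_of_hasCompactSupport hf' hφ.continuous hφc), h1, h2]
  ring

/-- Membership in `X` or `Y` provides a boundary condition with some right-hand side. Testing in the
interior identifies it almost everywhere with the one from the equation, so the boundary condition
may be used with the latter. -/
theorem HasWeakOp.upgrade {γ : ℝ} {c : ℂ} {U : Set (ℝ × ℝ)} {u f f' : ℝ × ℝ → ℂ}
    (h : HasWeakOp c U u f) (h' : HasWeakOp c strip u f') (hU : strip ⊆ U)
    (hf : MemTempered γ f) (hf' : MemTempered γ f') : HasWeakOp c U u f' := by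
  have hd : MemTempered γ (fun p => f p + (-1) * f' p) := hf.add (hf'.const_mul (-1))
  have hae := ae_eq_zero_of_forall_test hd.aestronglyMeasurable (hd.integrable (lt_add_one γ))
    fun φ hφ hφc hφs => by
      have h1 := h φ hφ hφc (hφs.trans hU)
      have h2 := h' φ hφ hφc hφs
      have i1 := integrable_mul_of_hasCompactSupport hf hφ.continuous hφc
      have i2 := integrable_mul_of_hasCompactSupport hf' hφ.continuous hφc
      have : ∀ p, (f p + (-1) * f' p) * φ p = f p * φ p - f' p * φ p := fun p => by ring
      simp only [this]
      rw [integral_sub i1 i2]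
      rw [h1] at h2
      linear_combination -h2
  intro φ hφ hφc hφU
  rw [h φ hφ hφc hφU]
  congr 1
  refine integral_congr_ae ?_
  filter_upwards [hae] with p hp
  rw [show f p = f' p by linear_combination hp]

section
variable {ω s : ℝ} {g h u v : ℝ × ℝ → ℂ}

theorem IsSolution.eqU (S : IsSolution ω s g h u v) (hh : MemWeightedL2 s h) :
    HasWeakOp I {p | p.1 < 1} u (fun p => -(h p + ω * v p)) := by
  obtain ⟨hu, f, hf, hw⟩ := S.memX
  refine hw.upgrade S.eq₂ (fun p hp => hp.1.2) (hf.memTempered (le_refl |s|)) ?_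
  have : MemWeightedL2 s (fun p => -1 * (h p + ω * v p)) := (hh.add (S.memY.1.const_mul ω)).const_mul (-1)
  simpa using this.memTempered (le_refl |s|)

theorem IsSolution.eqV (S : IsSolution ω s g h u v) (hg : MemWeightedL2 s g) :
    HasWeakOp (-I) {p | 0 < p.1} v (fun p => g p + ω * u p) := by
  obtain ⟨hv, f, hf, hw⟩ := S.memY
  exact hw.upgrade S.eq₁ (fun p hp => hp.1.1) (hf.memTempered (le_refl |s|))
    ((hg.add (S.memX.1.const_mul ω)).memTempered (le_refl |s|))

/-- The test pair is `ζ conj w`. As `w` solves the homogeneous problem, the terms with `ω` cancel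
and only `ζ'` remains. The hypotheses on `ζ` say that the cutoff times the growth of the wave is
absorbed by the weight, which replaces compact support. -/
theorem IsSolution.green {β a A : ℝ} (S : IsSolution ω s g h u v) (hg : MemWeightedL2 s g)
    (hh : MemWeightedL2 s h) (ha : 0 < a) {w : ℝ × ℝ → ℂ × ℂ} (hw : SmoothSol ω β w) {ζ : ℝ → ℝ}
    (hζ : ContDiff ℝ (⊤ : ℕ∞) ζ)
    (h1 : ∀ y, |ζ y| * Real.exp (β * |y|) ≤ A * Real.exp (s * y - a * |y|))
    (h2 : ∀ y, |deriv ζ y| * Real.exp (β * |y|) ≤ A * Real.exp (s * y - a * |y|)) :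
    ∫ p in strip, (ζ p.2 : ℂ) * pairing g h w p =
      -∫ p in strip, (deriv ζ p.2 : ℝ) * (v p * conj (w p).1 - u p * conj (w p).2) := by
  obtain ⟨C, hC, hb⟩ := hw.bound
  have hA : 0 ≤ A := by
    have := (mul_nonneg (abs_nonneg (ζ 0)) (Real.exp_pos (β * |0|)).le).trans (h1 0)
    simpa using this
  set E : ℝ → ℝ := fun y => Real.exp (s * y - a * |y|) with hE
  have hc1 : ContDiff ℝ (⊤ : ℕ∞) (fun p => conj (w p).1) :=
    Complex.conjCLE.contDiff.comp hw.smoothU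
  have hc2 : ContDiff ℝ (⊤ : ℕ∞) (fun p => conj (w p).2) :=
    Complex.conjCLE.contDiff.comp hw.smoothV
  have hz : ContDiff ℝ (⊤ : ℕ∞) (fun p : ℝ × ℝ => (ζ p.2 : ℂ)) :=
    Complex.ofRealCLM.contDiff.comp (hζ.comp contDiff_snd)
  have hdz : ∀ (c : ℂ) p, dOp c (fun p : ℝ × ℝ => (ζ p.2 : ℂ)) p = (deriv ζ p.2 : ℝ) := by
    intro c p
    have hd : HasDerivAt (fun y => (ζ y : ℂ)) (deriv ζ p.2 : ℝ) p.2 :=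
      (hζ.differentiable (by simp) p.2).hasDerivAt.ofReal_comp
    rw [dOp_eq_of_partial (hz.differentiable (by simp) p) (hasDerivAt_const p.1 ((ζ p.2 : ℝ) : ℂ)) hd]
    simp
  have d2 : ∀ p, dOp I (fun p => (ζ p.2 : ℂ) * conj (w p).2) p =
      (deriv ζ p.2 : ℝ) * conj (w p).2 + ζ p.2 * (ω * conj (w p).1) := fun p => by
    rw [dOp_mul (hz.differentiable (by simp) p) (hc2.differentiable (by simp) p), hdz,
      dOp_conj (hw.diffV p), Complex.conj_I, hw.eqV, map_mul, Complex.conj_ofReal]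
    ring
  have d1 : ∀ p, dOp (-I) (fun p => (ζ p.2 : ℂ) * conj (w p).1) p =
      (deriv ζ p.2 : ℝ) * conj (w p).1 - ζ p.2 * (ω * conj (w p).2) := fun p => by
    rw [dOp_mul (hz.differentiable (by simp) p) (hc1.differentiable (by simp) p), hdz,
      dOp_conj (hw.diffU p), map_neg, Complex.conj_I, neg_neg, hw.eqU, map_neg, map_mul,
      Complex.conj_ofReal]
    ring
  set B : ℝ → ℝ := fun y => (1 + |ω|) * (A * C) * E y with hB
  have hEpos : ∀ y, 0 ≤ E y := fun y => (Real.exp_pos _).le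
  have hAC : ∀ y, A * C * E y ≤ B y := fun y => by
    rw [hB]
    have : 0 ≤ A * C * E y := by have := hEpos y; positivity
    simp only
    nlinarith [abs_nonneg ω]
  -- pointwise bounds for the products with the cutoff
  have hzw : ∀ {t r : ℝ} {q : ℂ} {y : ℝ}, 0 ≤ r → ‖q‖ ≤ r * (C * Real.exp (β * |y|)) →
      |t| * Real.exp (β * |y|) ≤ A * E y → ‖(t : ℂ) * q‖ ≤ r * (A * C * E y) := by
    intro t r q y hr hq ht
    rw [norm_mul, Complex.norm_real, Real.norm_eq_abs]
    calc |t| * ‖q‖ ≤ |t| * (r * (C * Real.exp (β * |y|))) := by gcongr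
      _ = r * C * (|t| * Real.exp (β * |y|)) := by ring
      _ ≤ r * C * (A * E y) := by gcongr
      _ = _ := by ring
  have hle1 : ∀ {r t : ℝ}, r ≤ 1 → 0 ≤ t → r * t ≤ t := fun hr ht => mul_le_of_le_one_left ht hr
  have hACE : ∀ y, 0 ≤ A * C * E y := fun y => by have := hEpos y; positivity
  have iB : ∀ {f : ℝ × ℝ → ℂ}, MemWeightedL2 s f →
      Integrable (fun p => ‖f p‖ * B p.2) (volume.restrict strip) := by
    intro f hf
    refine ((hf.integrable_mul ha).const_mul ((1 + |ω|) * (A * C))).congr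
      (Eventually.of_forall fun p => ?_)
    simp only [hB, hE]
    ring
  have hfu : MemWeightedL2 s (fun p => -(h p + ω * v p)) := by
    have : MemWeightedL2 s (fun p => -1 * (h p + ω * v p)) :=
      (hh.add (S.memY.1.const_mul ω)).const_mul (-1)
    simpa using this
  have hfv : MemWeightedL2 s (fun p => g p + ω * u p) := hg.add (S.memX.1.const_mul ω)
  have G2 := (S.eqU hh).green_right S.memX.1.aestronglyMeasurable hfu.aestronglyMeasurable
    (hz.mul hc2) (B := B) (fun x hx y => ?_) (fun x hx y => ?_) (iB S.memX.1) (iB hfu)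
  have G1 := (S.eqV hg).green_left S.memY.1.aestronglyMeasurable hfv.aestronglyMeasurable
    (hz.mul hc1) (B := B) (fun x hx y => ?_) (fun x hx y => ?_) (iB S.memY.1) (iB hfv)
  · simp only [d1, d2] at G1 G2
    have hdc : Continuous (deriv ζ) := hζ.continuous_deriv (by simp)
    have mk : ∀ {f : ℝ × ℝ → ℂ} {t : ℝ → ℝ} {q : ℝ × ℝ → ℂ}, MemWeightedL2 s f → Continuous t →
        Continuous q → (∀ x ∈ Ioo (0 : ℝ) 1, ∀ y, ‖q (x, y)‖ ≤ C * Real.exp (β * |y|)) →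
        (∀ y, |t y| * Real.exp (β * |y|) ≤ A * E y) →
        Integrable (fun p : ℝ × ℝ => f p * ((t p.2 : ℂ) * q p)) (volume.restrict strip) := by
      intro f t q hf ht hq hqb htb
      refine ((hf.integrable_mul ha).const_mul (A * C)).mono' (hf.aestronglyMeasurable.mul
        (by apply Continuous.aestronglyMeasurable; fun_prop)) ?_
      filter_upwards [ae_restrict_mem measurableSet_strip] with ⟨x, y⟩ hp
      rw [norm_mul]
      have := hzw (t := t y) (q := q (x, y)) (y := y) (zero_le_one) (by rw [one_mul]; exact hqb x hp.1 y) (htb y)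
      calc _ ≤ ‖f (x, y)‖ * (1 * (A * C * E y)) := by gcongr
        _ = _ := by simp only [hE]; ring
    obtain ⟨hn⟩ : Nonempty (∀ x ∈ Ioo (0 : ℝ) 1, ∀ y,
        ‖conj (w (x, y)).1‖ ≤ C * Real.exp (β * |y|) ∧
        ‖conj (w (x, y)).2‖ ≤ C * Real.exp (β * |y|)) := ⟨fun x hx y => by
      rw [RCLike.norm_conj, RCLike.norm_conj]
      have := hb x hx y
      have hp : 0 ≤ C * Real.exp (β * |y|) := by positivity
      exact ⟨this.1.trans (hle1 hx.2.le hp), this.2.trans (hle1 (by linarith [hx.1]) hp)⟩⟩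
    have k1 := hc1.continuous
    have k2 := hc2.continuous
    have n1 := fun x hx y => (hn x hx y).1
    have n2 := fun x hx y => (hn x hx y).2
    have a1 := mk S.memX.1 hdc k2 n2 h2
    have a2 := mk S.memX.1 hζ.continuous k1 n1 h1
    have a3 := mk hh hζ.continuous k2 n2 h1
    have a4 := mk S.memY.1 hζ.continuous k2 n2 h1
    have b1 := mk S.memY.1 hdc k1 n1 h2
    have b3 := mk hg hζ.continuous k1 n1 h1
    have E1 : ∫ p in strip, u p * ((deriv ζ p.2 : ℝ) * conj (w p).2 + ζ p.2 * (ω * conj (w p).1)) =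
        (∫ p in strip, u p * ((deriv ζ p.2 : ℝ) * conj (w p).2)) +
          ω * ∫ p in strip, u p * (ζ p.2 * conj (w p).1) := by
      rw [← integral_const_mul, ← integral_add a1 (a2.const_mul _)]
      refine integral_congr_ae (Eventually.of_forall fun p => ?_)
      simp only; ring
    have E2 : ∫ p in strip, -(h p + ω * v p) * (ζ p.2 * conj (w p).2) =
        -((∫ p in strip, h p * (ζ p.2 * conj (w p).2)) +
          ω * ∫ p in strip, v p * (ζ p.2 * conj (w p).2)) := by
      rw [← integral_const_mul, ← integral_add a3 (a4.const_mul _), ← integral_neg]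
      refine integral_congr_ae (Eventually.of_forall fun p => ?_)
      simp only; ring
    have E3 : ∫ p in strip, v p * ((deriv ζ p.2 : ℝ) * conj (w p).1 - ζ p.2 * (ω * conj (w p).2)) =
        (∫ p in strip, v p * ((deriv ζ p.2 : ℝ) * conj (w p).1)) -
          ω * ∫ p in strip, v p * (ζ p.2 * conj (w p).2) := by
      rw [← integral_const_mul, ← integral_sub b1 (a4.const_mul _)]
      refine integral_congr_ae (Eventually.of_forall fun p => ?_)
      simp only; ring
    have E4 : ∫ p in strip, (g p + ω * u p) * (ζ p.2 * conj (w p).1) =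
        (∫ p in strip, g p * (ζ p.2 * conj (w p).1)) +
          ω * ∫ p in strip, u p * (ζ p.2 * conj (w p).1) := by
      rw [← integral_const_mul, ← integral_add b3 (a2.const_mul _)]
      refine integral_congr_ae (Eventually.of_forall fun p => ?_)
      simp only; ring
    have E5 : ∫ p in strip, (ζ p.2 : ℂ) * pairing g h w p =
        (∫ p in strip, g p * (ζ p.2 * conj (w p).1)) +
          ∫ p in strip, h p * (ζ p.2 * conj (w p).2) := by
      rw [← integral_add b3 a3]
      refine integral_congr_ae (Eventually.of_forall fun p => ?_)
      simp only [pairing]; ring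
    have E6 : ∫ p in strip, (deriv ζ p.2 : ℝ) * (v p * conj (w p).1 - u p * conj (w p).2) =
        (∫ p in strip, v p * ((deriv ζ p.2 : ℝ) * conj (w p).1)) -
          ∫ p in strip, u p * ((deriv ζ p.2 : ℝ) * conj (w p).2) := by
      rw [← integral_sub b1 a1]
      refine integral_congr_ae (Eventually.of_forall fun p => ?_)
      simp only; ring
    rw [E1, E2] at G2
    rw [E3, E4] at G1
    rw [E5, E6]
    linear_combination G1 - G2
  · exact (hzw hx.1.le (by rw [RCLike.norm_conj]; exact (hb x hx y).1) (h1 y)).trans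
      (mul_le_mul_of_nonneg_left (hAC y) hx.1.le)
  · rw [d1]
    have e1 := hzw hx.1.le (by rw [RCLike.norm_conj]; exact (hb x hx y).1) (h2 y)
    have e2 := hzw (by linarith [hx.2] : 0 ≤ 1 - x)
      (by rw [RCLike.norm_conj]; exact (hb x hx y).2) (h1 y)
    have e1' := e1.trans (hle1 hx.2.le (hACE y))
    have e2' := e2.trans (hle1 (by linarith [hx.1]) (hACE y))
    refine (norm_sub_le _ _).trans ?_
    rw [mul_left_comm, norm_mul (ω : ℂ), Complex.norm_real, Real.norm_eq_abs]
    calc _ ≤ A * C * E y + |ω| * (A * C * E y) := by gcongr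
      _ = B y := by simp only [hB]; ring
  · exact (hzw (by linarith [hx.2]) (by rw [RCLike.norm_conj]; exact (hb x hx y).2) (h1 y)).trans
      (mul_le_mul_of_nonneg_left (hAC y) (by linarith [hx.2]))
  · rw [d2]
    have e1 := hzw hx.1.le (by rw [RCLike.norm_conj]; exact (hb x hx y).1) (h1 y)
    have e2 := hzw (by linarith [hx.2] : 0 ≤ 1 - x)
      (by rw [RCLike.norm_conj]; exact (hb x hx y).2) (h2 y)
    have e1' := e1.trans (hle1 hx.2.le (hACE y))
    have e2' := e2.trans (hle1 (by linarith [hx.1]) (hACE y))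
    refine (norm_add_le _ _).trans ?_
    rw [mul_left_comm (ζ y : ℂ), norm_mul (ω : ℂ), Complex.norm_real, Real.norm_eq_abs]
    calc _ ≤ A * C * E y + |ω| * (A * C * E y) := by gcongr
      _ = B y := by simp only [hB]; ring

end

/-! ### Pairings of the data with solutions of the homogeneous problem -/

section
variable {ω β γ : ℝ} {g h uP vP uM vM : ℝ × ℝ → ℂ} {w : ℝ × ℝ → ℂ × ℂ}

theorem exp_mul_abs_le (β γ y : ℝ) : Real.exp (β * |y|) ≤
    Real.exp (γ * y - (γ - β) * |y|) + Real.exp (-γ * y - (γ - β) * |y|) := by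
  rcases le_total 0 y with hy | hy
  · rw [abs_of_nonneg hy, show γ * y - (γ - β) * y = β * y by ring]
    linarith [Real.exp_pos (-γ * y - (γ - β) * y)]
  · rw [abs_of_nonpos hy, show -γ * y - (γ - β) * -y = β * -y by ring]
    linarith [Real.exp_pos (γ * y - (γ - β) * -y)]

theorem MemWeightedL2.integrable_mul_exp {f : ℝ × ℝ → ℂ} (hβ : β < γ) (h1 : MemWeightedL2 γ f)
    (h2 : MemWeightedL2 (-γ) f) :
    Integrable (fun p => ‖f p‖ * Real.exp (β * |p.2|)) (volume.restrict strip) := by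
  refine ((h1.integrable_mul (sub_pos.2 hβ)).add (h2.integrable_mul (sub_pos.2 hβ))).mono'
    (h1.aestronglyMeasurable.norm.mul (by apply Continuous.aestronglyMeasurable; fun_prop))
    (Eventually.of_forall fun p => ?_)
  rw [Real.norm_of_nonneg (by positivity), Pi.add_apply, ← mul_add]
  exact mul_le_mul_of_nonneg_left (exp_mul_abs_le β γ p.2) (norm_nonneg _)

theorem integrable_pairing (hβ : β < γ) (hg : MemWeightedL2 γ g) (hg' : MemWeightedL2 (-γ) g)
    (hh : MemWeightedL2 γ h) (hh' : MemWeightedL2 (-γ) h) (hw : SmoothSol ω β w) :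
    Integrable (pairing g h w) (volume.restrict strip) := by
  obtain ⟨C, hC, hb⟩ := hw.norm_le
  have m1 : Continuous (fun p => conj (w p).1) := Complex.continuous_conj.comp hw.contU
  have m2 : Continuous (fun p => conj (w p).2) := Complex.continuous_conj.comp hw.contV
  refine (((hg.integrable_mul_exp hβ hg').add (hh.integrable_mul_exp hβ hh')).const_mul C).mono'
    ((hg.aestronglyMeasurable.mul m1.aestronglyMeasurable).add
      (hh.aestronglyMeasurable.mul m2.aestronglyMeasurable)) ?_
  filter_upwards [ae_restrict_mem measurableSet_strip] with ⟨x, y⟩ hp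
  obtain ⟨b1, b2⟩ := hb x hp.1 y
  refine (norm_add_le _ _).trans ?_
  rw [norm_mul, norm_mul, RCLike.norm_conj, RCLike.norm_conj, Pi.add_apply, mul_add]
  calc _ ≤ ‖g (x, y)‖ * (C * Real.exp (β * |y|)) + ‖h (x, y)‖ * (C * Real.exp (β * |y|)) := by
        gcongr
    _ = _ := by ring

theorem IsSolution.isHomogeneous_sub (SP : IsSolution ω γ g h uP vP)
    (SM : IsSolution ω (-γ) g h uM vM) (hγ : 0 < γ) (hg : MemWeightedL2 γ g)
    (hg' : MemWeightedL2 (-γ) g) (hh : MemWeightedL2 γ h) (hh' : MemWeightedL2 (-γ) h) :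
    IsHomogeneous ω γ (fun p => uP p - uM p) (fun p => vP p - vM p) := by
  have a1 : |γ| ≤ γ := (abs_of_pos hγ).le
  have a2 : |-γ| ≤ γ := by rw [abs_neg]; exact a1
  have uP' := SP.memX.1.memTempered a1
  have vP' := SP.memY.1.memTempered a1
  have uM' := SM.memX.1.memTempered a2
  have vM' := SM.memY.1.memTempered a2
  have gP := hg.memTempered a1
  have hP := hh.memTempered a1
  refine ⟨?_, ?_, ?_, ?_⟩
  · have := uP'.add (uM'.const_mul (-1))
    simpa [sub_eq_add_neg] using this
  · have := vP'.add (vM'.const_mul (-1))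
    simpa [sub_eq_add_neg] using this
  · have f1 := (hP.add (vP'.const_mul ω)).const_mul (-1)
    have f2 := (hP.add (vM'.const_mul ω)).const_mul (-1)
    have := (SP.eqU hh).sub (SM.eqU hh') uP' uM' (by simpa using f1) (by simpa using f2)
    convert this using 2
    ring
  · have f1 := gP.add (uP'.const_mul ω)
    have f2 := gP.add (uM'.const_mul ω)
    have := (SP.eqV hg).sub (SM.eqV hg') vP' vM' f1 f2
    convert this using 2
    ring

/-- The solution with weight `γ` decays as `y → +∞` and is cut off by `η`; the one with weight `-γ`
decays as `y → -∞` and is cut off by `1 - η`. The data integrals add up to the full one, and the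
opposite derivatives of the cutoffs produce the flux of the difference. -/
theorem integral_pairing_eq (hγ : 0 < γ) (hβ : β < γ) (SP : IsSolution ω γ g h uP vP)
    (SM : IsSolution ω (-γ) g h uM vM) (hg : MemWeightedL2 γ g) (hg' : MemWeightedL2 (-γ) g)
    (hh : MemWeightedL2 γ h) (hh' : MemWeightedL2 (-γ) h) (hw : SmoothSol ω β w) :
    ∫ p in strip, pairing g h w p =
      -qEta (fun p => uP p - uM p) (fun p => vP p - vM p) w := by
  obtain ⟨M, hM⟩ := exists_isCutoff_deriv_eta
  have hM0 : 0 ≤ M := (abs_nonneg _).trans (hM.le 0)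
  have a1 : |γ| ≤ γ := (abs_of_pos hγ).le
  have a2 : |-γ| ≤ γ := by rw [abs_neg]; exact a1
  have hη : ContDiff ℝ (⊤ : ℕ∞) eta := Real.smoothTransition.contDiff
  have hle : ∀ {t A B E F : ℝ}, 0 ≤ E → |t| ≤ A → A * E ≤ F → |t| * E ≤ F := fun hE ht h =>
    (mul_le_mul_of_nonneg_right ht hE).trans h
  have GP := SP.green (A := 1 + M) hg hh (sub_pos.2 hβ) hw hη (fun y => by
      rcases le_or_gt y 0 with hy | hy
      · rw [show eta y = 0 from Real.smoothTransition.zero_of_nonpos hy, abs_zero, zero_mul]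
        positivity
      · have : |eta y| ≤ 1 := by
          rw [abs_of_nonneg (Real.smoothTransition.nonneg y)]
          exact Real.smoothTransition.le_one y
        rw [abs_of_pos hy, show γ * y - (γ - β) * y = β * y by ring]
        gcongr
        linarith) (fun y => by
      by_cases hy : y ∈ Icc (0 : ℝ) 1
      · rw [abs_of_nonneg hy.1, show γ * y - (γ - β) * y = β * y by ring]
        gcongr
        linarith [hM.le y]
      · rw [hM.supp y hy, abs_zero, zero_mul]
        positivity)
  -- The support of `1 - η` extends to `y = 1`, where the weight is on the wrong side; the factor
  -- `e^{2γ}` pays for `0 ≤ y ≤ 1`.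
  have hexp : ∀ {y : ℝ}, y ≤ 1 → Real.exp (β * |y|) ≤
      Real.exp (2 * γ) * Real.exp (-γ * y - (γ - β) * |y|) := by
    intro y hy
    rw [← Real.exp_add, Real.exp_le_exp]
    rcases le_total 0 y with h0 | h0
    · rw [abs_of_nonneg h0]; nlinarith
    · rw [abs_of_nonpos h0]; nlinarith
  have hdη : ∀ y, deriv (fun y => 1 - eta y) y = -deriv eta y := fun y => by
    rw [deriv_const_sub]
  have GM := SM.green (A := (1 + M) * Real.exp (2 * γ)) hg' hh' (sub_pos.2 hβ) hw
    (ζ := fun y => 1 - eta y) (contDiff_const.sub hη) (fun y => by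
      rcases le_or_gt y 1 with hy | hy
      · have : |1 - eta y| ≤ 1 := by
          rw [abs_le]
          constructor <;> linarith [Real.smoothTransition.nonneg y, Real.smoothTransition.le_one y]
        rw [mul_assoc]
        exact mul_le_mul (by linarith) (hexp hy) (Real.exp_pos _).le (by linarith)
      · rw [show eta y = 1 from Real.smoothTransition.one_of_one_le hy.le, sub_self, abs_zero,
          zero_mul]
        positivity) (fun y => by
      rw [hdη, abs_neg]
      by_cases hy : y ∈ Icc (0 : ℝ) 1
      · rw [mul_assoc]
        exact mul_le_mul (by linarith [hM.le y]) (hexp hy.2) (Real.exp_pos _).le (by linarith)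
      · rw [hM.supp y hy, abs_zero, zero_mul]
        positivity)
  have hi := integrable_pairing hβ hg hg' hh hh' hw
  have hi1 : Integrable (fun p : ℝ × ℝ => (eta p.2 : ℂ) * pairing g h w p)
      (volume.restrict strip) := by
    refine hi.norm.mono' (Continuous.aestronglyMeasurable (by have := hη.continuous; fun_prop)
      |>.mul hi.aestronglyMeasurable) (Eventually.of_forall fun p => ?_)
    rw [norm_mul, Complex.norm_real, Real.norm_of_nonneg (Real.smoothTransition.nonneg _)]
    exact mul_le_of_le_one_left (norm_nonneg _) (Real.smoothTransition.le_one _)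
  have e : ∫ p in strip, (((1 - eta p.2 : ℝ)) : ℂ) * pairing g h w p =
      (∫ p in strip, pairing g h w p) - ∫ p in strip, (eta p.2 : ℂ) * pairing g h w p := by
    rw [← integral_sub hi hi1]
    refine integral_congr_ae (Eventually.of_forall fun p => ?_)
    push_cast
    ring
  have eM : ∫ p in strip, (deriv (fun y => 1 - eta y) p.2 : ℝ) *
      (vM p * conj (w p).1 - uM p * conj (w p).2) = -qEta uM vM w := by
    rw [qEta, ← integral_neg]
    refine integral_congr_ae (Eventually.of_forall fun p => ?_)
    simp only [hdη]
    push_cast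
    ring
  rw [eM, e] at GM
  rw [qEta_sub_left (SP.memX.1.memTempered a1) (SP.memY.1.memTempered a1)
    (SM.memX.1.memTempered a2) (SM.memY.1.memTempered a2) hw]
  have GP' : ∫ p in strip, (eta p.2 : ℂ) * pairing g h w p = -qEta uP vP w := GP
  linear_combination GM + GP'

end

/-! ### Separated and generalized separated solutions -/

/-- `e^{-i lam y} ((U₁, V₁) - i y (U₀, V₀))`. -/
def jordanWave (lam : ℂ) (U₀ V₀ U₁ V₁ : ℝ → ℂ) (p : ℝ × ℝ) : ℂ × ℂ :=
  Complex.exp (-I * lam * p.2) • (U₁ p.1 + -I * p.2 * U₀ p.1, V₁ p.1 + -I * p.2 * V₀ p.1)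

theorem norm_exp_neg_I_mul_le (lam : ℂ) (y : ℝ) :
    ‖cexp (-I * lam * y)‖ ≤ Real.exp (|lam.im| * |y|) := by
  rw [Complex.norm_exp, Real.exp_le_exp]
  have : (-I * lam * y).re = lam.im * y := by simp
  rw [this, ← abs_mul]
  exact le_abs_self _

/-- Serves simple roots, with `U₀ = V₀ = 0`, and the Jordan chain of a double root alike. The linear
factor `|y|` is absorbed by the gap between `|Im lam|` and `β`. -/
theorem SmoothSol.jordanWave {ω β : ℝ} {lam : ℂ} {U₀ V₀ U₁ V₁ : ℝ → ℂ} (hβ : |lam.im| < β)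
    (sU₀ : ContDiff ℝ (⊤ : ℕ∞) U₀) (sV₀ : ContDiff ℝ (⊤ : ℕ∞) V₀)
    (sU₁ : ContDiff ℝ (⊤ : ℕ∞) U₁) (sV₁ : ContDiff ℝ (⊤ : ℕ∞) V₁)
    (dU₀ : ∀ x, HasDerivAt U₀ (lam * U₀ x + I * ω * V₀ x) x)
    (dV₀ : ∀ x, HasDerivAt V₀ (-lam * V₀ x + I * ω * U₀ x) x)
    (dU₁ : ∀ x, HasDerivAt U₁ (lam * U₁ x + U₀ x + I * ω * V₁ x) x)
    (dV₁ : ∀ x, HasDerivAt V₁ (-lam * V₁ x - V₀ x + I * ω * U₁ x) x)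
    (bU₀ : U₀ 0 = 0) (bU₁ : U₁ 0 = 0) (bV₀ : V₀ 1 = 0) (bV₁ : V₁ 1 = 0) :
    SmoothSol ω β (DiracStrip.jordanWave lam U₀ V₀ U₁ V₁) := by
  have se : ContDiff ℝ (⊤ : ℕ∞) (fun p : ℝ × ℝ => cexp (-I * lam * p.2)) :=
    (contDiff_const.mul (Complex.ofRealCLM.contDiff.comp contDiff_snd)).cexp
  have sy : ContDiff ℝ (⊤ : ℕ∞) (fun p : ℝ × ℝ => -I * (p.2 : ℂ)) :=
    contDiff_const.mul (Complex.ofRealCLM.contDiff.comp contDiff_snd)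
  have sm : ∀ {A B : ℝ → ℂ}, ContDiff ℝ (⊤ : ℕ∞) A → ContDiff ℝ (⊤ : ℕ∞) B →
      ContDiff ℝ (⊤ : ℕ∞) (fun p : ℝ × ℝ => cexp (-I * lam * p.2) * (B p.1 + -I * p.2 * A p.1)) :=
    fun hA hB => se.mul ((hB.comp contDiff_fst).add (sy.mul (hA.comp contDiff_fst)))
  have de : ∀ y : ℝ, HasDerivAt (fun y : ℝ => cexp (-I * lam * y))
      (cexp (-I * lam * y) * (-I * lam)) y := fun y =>
    (hasDerivAt_ofReal_mul (-I * lam) y).cexp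
  have dd : ∀ {A B : ℝ → ℂ} {a b : ℂ} (c : ℂ) (p : ℝ × ℝ), ContDiff ℝ (⊤ : ℕ∞) A →
      ContDiff ℝ (⊤ : ℕ∞) B → HasDerivAt A a p.1 → HasDerivAt B b p.1 →
      dOp c (fun p : ℝ × ℝ => cexp (-I * lam * p.2) * (B p.1 + -I * p.2 * A p.1)) p =
        c * (cexp (-I * lam * p.2) * (b + -I * p.2 * a)) +
        (cexp (-I * lam * p.2) * (-I * lam) * (B p.1 + -I * p.2 * A p.1) +
          cexp (-I * lam * p.2) * (-I * A p.1)) := by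
    intro A B a b c p hA hB ha hb
    refine dOp_eq_of_partial ((sm hA hB).differentiable (by simp) p) ?_ ?_
    · exact (hb.fun_add (ha.const_mul (-I * (p.2 : ℂ)))).const_mul (cexp (-I * lam * p.2))
    · exact (de p.2).mul (((hasDerivAt_ofReal_mul (-I) p.2).mul_const (A p.1)).const_add (B p.1))
  refine ⟨sm sU₀ sU₁, sm sV₀ sV₁, fun p => ?_, fun p => ?_, fun y => ?_, fun y => ?_, ?_⟩
  · have := dd I p sU₀ sU₁ (dU₀ p.1) (dU₁ p.1)
    simp only [DiracStrip.jordanWave, Prod.smul_fst, Prod.smul_snd, smul_eq_mul]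
    rw [this]
    linear_combination (cexp (-I * lam * p.2) * (ω * V₁ p.1 - I * ω * p.2 * V₀ p.1 )) * Complex.I_sq
  · have := dd (-I) p sV₀ sV₁ (dV₀ p.1) (dV₁ p.1)
    simp only [DiracStrip.jordanWave, Prod.smul_fst, Prod.smul_snd, smul_eq_mul]
    rw [this]
    linear_combination (-cexp (-I * lam * p.2) * (ω * U₁ p.1 - I * ω * p.2 * U₀ p.1)) * Complex.I_sq
  · simp [DiracStrip.jordanWave, bU₀, bU₁]
  · simp [DiracStrip.jordanWave, bV₀, bV₁]
  · obtain ⟨C0, hC0, c0⟩ := exists_bound_of_contDiff sU₀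
    obtain ⟨C1, hC1, c1⟩ := exists_bound_of_contDiff sU₁
    obtain ⟨D0, hD0, d0⟩ := exists_bound_of_contDiff sV₀
    obtain ⟨D1, hD1, d1⟩ := exists_bound_of_contDiff sV₁
    set δ := β - |lam.im| with hδ
    have hδ0 : 0 < δ := sub_pos.2 hβ
    have key : ∀ {t A B : ℝ} {a b : ℂ} (y : ℝ), 0 ≤ t → 0 ≤ A → 0 ≤ B → ‖a‖ ≤ t * A → ‖b‖ ≤ t * B →
        ‖cexp (-I * lam * y) * (b + -I * y * a)‖ ≤ t * ((B + A / δ) * Real.exp (β * |y|)) := by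
      intro t A B a b y ht hA hB ha hb
      have e1 : |y| ≤ Real.exp (δ * |y|) / δ := by
        rw [le_div_iff₀ hδ0]
        linarith [Real.add_one_le_exp (δ * |y|)]
      have e2 : (1 : ℝ) ≤ Real.exp (δ * |y|) := Real.one_le_exp (by positivity)
      have e3 : Real.exp (β * |y|) = Real.exp (|lam.im| * |y|) * Real.exp (δ * |y|) := by
        rw [← Real.exp_add]; congr 1; rw [hδ]; ring
      have e4 : ‖b + -I * y * a‖ ≤ t * B + |y| * (t * A) := by
        refine (norm_add_le _ _).trans (add_le_add hb ?_)
        rw [norm_mul, norm_mul, norm_neg, Complex.norm_I, one_mul, Complex.norm_real,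
          Real.norm_eq_abs]
        gcongr
      rw [norm_mul, e3]
      calc _ ≤ Real.exp (|lam.im| * |y|) * (t * B + |y| * (t * A)) := by
            gcongr
            exact norm_exp_neg_I_mul_le lam y
        _ ≤ Real.exp (|lam.im| * |y|) * (t * B * Real.exp (δ * |y|) +
              (Real.exp (δ * |y|) / δ) * (t * A)) := by
            exact mul_le_mul_of_nonneg_left (add_le_add (le_mul_of_one_le_right (by positivity) e2)
              (mul_le_mul_of_nonneg_right e1 (by positivity))) (Real.exp_pos _).le
        _ = _ := by ring
    refine ⟨(C1 + C0 / δ) + (D1 + D0 / δ), by positivity, fun x hx y => ⟨?_, ?_⟩⟩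
    · have hx' : x ∈ Icc (0 : ℝ) 1 := ⟨hx.1.le, hx.2.le⟩
      have k0 := (c0 x hx').2.2.1
      have k1 := (c1 x hx').2.2.1
      rw [bU₀, sub_zero] at k0
      rw [bU₁, sub_zero] at k1
      refine (key y hx.1.le hC0 hC1 k0 k1).trans ?_
      exact mul_le_mul_of_nonneg_left (mul_le_mul_of_nonneg_right
        (le_add_of_nonneg_right (by positivity)) (Real.exp_pos _).le) hx.1.le
    · have hx' : x ∈ Icc (0 : ℝ) 1 := ⟨hx.1.le, hx.2.le⟩
      have k0 := (d0 x hx').2.2.2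
      have k1 := (d1 x hx').2.2.2
      rw [bV₀, sub_zero] at k0
      rw [bV₁, sub_zero] at k1
      have hx1 : 0 ≤ 1 - x := by linarith [hx.2]
      refine (key y hx1 hD0 hD1 k0 k1).trans ?_
      exact mul_le_mul_of_nonneg_left (mul_le_mul_of_nonneg_right
        (le_add_of_nonneg_left (by positivity)) (Real.exp_pos _).le) hx1

/-! ### The solutions vanishing on the left edge -/

/-- `e^{-i lam y} (leftU, leftV)`. -/
def leftWave (ω : ℝ) (lam : ℂ) (p : ℝ × ℝ) : ℂ × ℂ :=
  Complex.exp (-I * lam * p.2) • (leftU ω lam p.1, leftV ω lam p.1)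

/-- The derivative of `leftU` with respect to the spectral parameter. -/
def leftUDeriv (ω : ℝ) (lam : ℂ) (x : ℝ) : ℂ :=
  I * ω * -(lam * (x * cosRt x ((ω : ℂ) ^ 2 - lam ^ 2) - sincRt x ((ω : ℂ) ^ 2 - lam ^ 2)) /
    ((ω : ℂ) ^ 2 - lam ^ 2))

/-- The derivative of `leftV` with respect to the spectral parameter. -/
def leftVDeriv (ω : ℝ) (lam : ℂ) (x : ℝ) : ℂ :=
  lam * x * sincRt x ((ω : ℂ) ^ 2 - lam ^ 2) - (sincRt x ((ω : ℂ) ^ 2 - lam ^ 2) +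
    lam * -(lam * (x * cosRt x ((ω : ℂ) ^ 2 - lam ^ 2) - sincRt x ((ω : ℂ) ^ 2 - lam ^ 2)) /
    ((ω : ℂ) ^ 2 - lam ^ 2)))

/-- The derivative of `leftWave` with respect to the spectral parameter. -/
def leftWaveDeriv (ω : ℝ) (lam : ℂ) : ℝ × ℝ → ℂ × ℂ :=
  jordanWave lam (leftU ω lam) (leftV ω lam) (leftUDeriv ω lam) (leftVDeriv ω lam)

section
variable {ω β γ : ℝ} {lam : ℂ}

theorem leftWave_eq_jordanWave (ω : ℝ) (lam : ℂ) :
    leftWave ω lam = jordanWave lam (fun _ => 0) (fun _ => 0) (leftU ω lam) (leftV ω lam) := by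
  funext p
  simp [leftWave, jordanWave]

theorem hasDerivAt_leftU (x : ℝ) : HasDerivAt (leftU ω lam)
    (lam * leftU ω lam x + I * ω * leftV ω lam x) x := by
  refine ((hasDerivAt_sincRt _ x).const_mul (I * (ω : ℂ))).congr_deriv ?_
  simp only [leftU, leftV]; ring

theorem hasDerivAt_leftV (x : ℝ) : HasDerivAt (leftV ω lam)
    (-lam * leftV ω lam x + I * ω * leftU ω lam x) x := by
  refine ((hasDerivAt_cosRt _ x).sub ((hasDerivAt_sincRt _ x).const_mul lam)).congr_deriv ?_
  simp only [leftU, leftV]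
  linear_combination ((-(ω : ℂ) ^ 2) * sincRt x ((ω : ℂ) ^ 2 - lam ^ 2)) * Complex.I_sq

theorem contDiff_leftU : ContDiff ℝ (⊤ : ℕ∞) (leftU ω lam) :=
  contDiff_const.mul (contDiff_sincRt _)

theorem contDiff_leftV : ContDiff ℝ (⊤ : ℕ∞) (leftV ω lam) :=
  (contDiff_cosRt _).sub (contDiff_const.mul (contDiff_sincRt _))

theorem leftU_zero : leftU ω lam 0 = 0 := by simp [leftU]

theorem contDiff_mul_cosRt_sub (K : ℂ) :
    ContDiff ℝ (⊤ : ℕ∞) (fun x : ℝ => (x : ℂ) * cosRt x K - sincRt x K) :=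
  (Complex.ofRealCLM.contDiff.mul (contDiff_cosRt K)).sub (contDiff_sincRt K)

theorem hasDerivAt_mul_cosRt_sub (K : ℂ) (x : ℝ) :
    HasDerivAt (fun x : ℝ => (x : ℂ) * cosRt x K - sincRt x K) (-(x * K * sincRt x K)) x := by
  refine (((hasDerivAt_id x).ofReal_comp.mul (hasDerivAt_cosRt K x)).sub
    (hasDerivAt_sincRt K x)).congr_deriv ?_
  simp
  ring

theorem contDiff_leftUDeriv : ContDiff ℝ (⊤ : ℕ∞) (leftUDeriv ω lam) :=
  contDiff_const.mul ((contDiff_const.mul (contDiff_mul_cosRt_sub _)).div_const _).neg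

theorem contDiff_leftVDeriv : ContDiff ℝ (⊤ : ℕ∞) (leftVDeriv ω lam) := by
  refine ((contDiff_const.mul Complex.ofRealCLM.contDiff).mul (contDiff_sincRt _)).sub
    ((contDiff_sincRt _).add (contDiff_const.mul ?_))
  exact ((contDiff_const.mul (contDiff_mul_cosRt_sub _)).div_const _).neg

theorem hasDerivAt_leftUDeriv (hK : (ω : ℂ) ^ 2 - lam ^ 2 ≠ 0) (x : ℝ) :
    HasDerivAt (leftUDeriv ω lam)
      (lam * leftUDeriv ω lam x + leftU ω lam x + I * ω * leftVDeriv ω lam x) x := by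
  refine ((((hasDerivAt_mul_cosRt_sub ((ω : ℂ) ^ 2 - lam ^ 2) x).const_mul lam).div_const
    ((ω : ℂ) ^ 2 - lam ^ 2)).neg.const_mul (I * (ω : ℂ))).congr_deriv ?_
  simp only [leftU, leftVDeriv, leftUDeriv]
  field_simp
  ring

theorem hasDerivAt_leftVDeriv (hK : (ω : ℂ) ^ 2 - lam ^ 2 ≠ 0) (x : ℝ) :
    HasDerivAt (leftVDeriv ω lam)
      (-lam * leftVDeriv ω lam x - leftV ω lam x + I * ω * leftUDeriv ω lam x) x := by
  have h1 : HasDerivAt (fun x : ℝ => lam * (x : ℂ)) lam x := hasDerivAt_ofReal_mul lam x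
  refine ((h1.mul (hasDerivAt_sincRt ((ω : ℂ) ^ 2 - lam ^ 2) x)).sub
    ((hasDerivAt_sincRt ((ω : ℂ) ^ 2 - lam ^ 2) x).add
      ((((hasDerivAt_mul_cosRt_sub ((ω : ℂ) ^ 2 - lam ^ 2) x).const_mul lam).div_const
        ((ω : ℂ) ^ 2 - lam ^ 2)).neg.const_mul lam))).congr_deriv ?_
  simp only [leftV, leftVDeriv, leftUDeriv]
  set K := (ω : ℂ) ^ 2 - lam ^ 2 with hKd
  set S := sincRt x K
  set C := cosRt x K
  have hw : (ω : ℂ) ^ 2 = K + lam ^ 2 := by rw [hKd]; ring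
  field_simp
  linear_combination ((ω : ℂ) ^ 2 * lam * (x * C - S)) * Complex.I_sq + (lam * (x * C - S)) * hw

theorem leftUDeriv_zero : leftUDeriv ω lam 0 = 0 := by simp [leftUDeriv]

/-- The generalised wave satisfies the condition at `x = 1` exactly when the characteristic function
has zero derivative, since `leftV` at `1` is that function. -/
theorem leftVDeriv_one (hK : (ω : ℂ) ^ 2 - lam ^ 2 ≠ 0) :
    leftVDeriv ω lam 1 = deriv (dispersionFun ω) lam := by
  have h := ((hasDerivAt_cosRt_lam 1 ω hK).sub
    ((hasDerivAt_id lam).mul (hasDerivAt_sincRt_lam 1 ω hK)))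
  have e : dispersionFun ω = fun l : ℂ => cosRt 1 ((ω : ℂ) ^ 2 - l ^ 2) -
      id l * sincRt 1 ((ω : ℂ) ^ 2 - l ^ 2) := funext fun l => dispersionFun_eq ω l
  rw [e]
  refine Eq.trans ?_ h.deriv.symm
  simp only [leftVDeriv, id]
  ring

theorem SmoothSol.leftWave (hβ : |lam.im| < β) (h : dispersionFun ω lam = 0) :
    SmoothSol ω β (leftWave ω lam) := by
  rw [leftWave_eq_jordanWave]
  refine SmoothSol.jordanWave hβ contDiff_const contDiff_const contDiff_leftU contDiff_leftV
    (fun x => ?_) (fun x => ?_) (fun x => ?_) (fun x => ?_) rfl leftU_zero rfl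
    (by rw [leftV_one, h])
  · simpa using hasDerivAt_const x (0 : ℂ)
  · simpa using hasDerivAt_const x (0 : ℂ)
  · simpa using hasDerivAt_leftU x
  · simpa using hasDerivAt_leftV x

theorem SmoothSol.leftWaveDeriv (hβ : |lam.im| < β) (h : dispersionFun ω lam = 0)
    (hK : (ω : ℂ) ^ 2 - lam ^ 2 ≠ 0) (h' : deriv (dispersionFun ω) lam = 0) :
    SmoothSol ω β (leftWaveDeriv ω lam) :=
  SmoothSol.jordanWave hβ contDiff_leftU contDiff_leftV contDiff_leftUDeriv contDiff_leftVDeriv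
    hasDerivAt_leftU hasDerivAt_leftV (hasDerivAt_leftUDeriv hK) (hasDerivAt_leftVDeriv hK)
    leftU_zero leftUDeriv_zero (by rw [leftV_one, h]) (by rw [leftVDeriv_one hK, h'])

/-! ### Pairing with these solutions -/

theorem leftU_conj (ω : ℝ) (lam : ℂ) (x : ℝ) : conj (leftU ω lam x) = -leftU ω (conj lam) x := by
  simp [leftU, ← sincRt_conj]

theorem leftV_conj (ω : ℝ) (lam : ℂ) (x : ℝ) : conj (leftV ω lam x) = leftV ω (conj lam) x := by
  simp [leftV, ← sincRt_conj, ← cosRt_conj]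

theorem leftUDeriv_conj (ω : ℝ) (lam : ℂ) (x : ℝ) :
    conj (leftUDeriv ω lam x) = -leftUDeriv ω (conj lam) x := by
  simp [leftUDeriv, ← sincRt_conj, ← cosRt_conj]

theorem leftVDeriv_conj (ω : ℝ) (lam : ℂ) (x : ℝ) :
    conj (leftVDeriv ω lam x) = leftVDeriv ω (conj lam) x := by
  simp [leftVDeriv, ← sincRt_conj, ← cosRt_conj]

theorem exp_neg_I_mul_conj (lam : ℂ) (y : ℝ) :
    conj (cexp (-I * lam * y)) = cexp (I * conj lam * y) := by
  rw [← Complex.exp_conj]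
  simp

/-- The bridge between uniqueness and symplectic geometry: the obstruction `leftPair` is a flux. The
conjugate appears because the form is conjugate linear in the wave. -/
theorem qEta_leftWave {u v : ℝ × ℝ → ℂ} (hu : MemTempered γ u) (hv : MemTempered γ v) (ω : ℝ)
    (lam : ℂ) : qEta u v (leftWave ω lam) = -leftPair ω u v (conj lam) := by
  obtain ⟨M, hM⟩ := exists_isCutoff_deriv_eta
  rw [leftPair, stripInt, stripInt, qEta, ← integral_add
    (integrable_stripInt hM (isKernel_leftV ω) hu.aestronglyMeasurable
      (hu.integrable (lt_add_one γ)) _)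
    (integrable_stripInt hM (isKernel_leftU ω) hv.aestronglyMeasurable
      (hv.integrable (lt_add_one γ)) _), ← integral_neg]
  refine integral_congr_ae (Eventually.of_forall fun p => ?_)
  simp only [leftWave, Prod.smul_fst, Prod.smul_snd, smul_eq_mul, map_mul, exp_neg_I_mul_conj,
    leftU_conj, leftV_conj]
  ring

theorem hasDerivAt_stripInt_of_hasDerivAt {ζ : ℝ → ℝ} {M s : ℝ} {k : ℂ → ℝ → ℂ} {k' : ℝ → ℂ}
    {w : ℝ × ℝ → ℂ} (hζ : IsCutoff ζ M) (hk : IsKernel k)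
    (hw : AEStronglyMeasurable w (volume.restrict strip))
    (hi : Integrable (fun p => ‖w p‖ * Real.exp (-(s * |p.2|))) (volume.restrict strip))
    (hk' : ∀ x, HasDerivAt (fun l => k l x) (k' x) lam) :
    HasDerivAt (stripInt ζ k w) (∫ p in strip,
      (cexp (I * lam * p.2) * (I * p.2) * ζ p.2 * k lam p.1 * w p +
        cexp (I * lam * p.2) * ζ p.2 * k' p.1 * w p)) lam := by
  refine (hasDerivAt_stripInt hζ hk hw hi lam).congr_deriv ?_
  refine integral_congr_ae (Eventually.of_forall fun p => ?_)
  have h1 : HasDerivAt (fun l : ℂ => cexp (I * l * p.2)) (cexp (I * lam * p.2) * (I * p.2)) lam := by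
    have : HasDerivAt (fun l : ℂ => I * l * p.2) (I * p.2) lam := by
      simpa using ((hasDerivAt_id lam).const_mul I).mul_const (p.2 : ℂ)
    exact this.cexp
  refine ((((h1.mul_const (ζ p.2 : ℂ)).mul (hk' p.1)).mul_const (w p)).congr_deriv ?_).deriv
  ring

/-- Differentiating in the spectral parameter replaces the wave by its Jordan companion; this
supplies the second order of vanishing needed at the double root. -/
theorem hasDerivAt_leftPair {u v : ℝ × ℝ → ℂ} (hu : MemTempered γ u) (hv : MemTempered γ v)
    (hK : (ω : ℂ) ^ 2 - lam ^ 2 ≠ 0) :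
    HasDerivAt (leftPair ω u v) (-qEta u v (leftWaveDeriv ω (conj lam))) lam := by
  obtain ⟨M, hM⟩ := exists_isCutoff_deriv_eta
  have hM' : IsCutoff (fun y => y * deriv eta y) M := by
    refine ⟨measurable_id.mul hM.meas, fun y => ?_, fun y hy => by rw [hM.supp y hy, mul_zero]⟩
    by_cases hy : y ∈ Icc (0 : ℝ) 1
    · rw [abs_mul, abs_of_nonneg hy.1]
      exact (mul_le_of_le_one_left (abs_nonneg _) hy.2).trans (hM.le y)
    · rw [hM.supp y hy, mul_zero, abs_zero]
      exact (abs_nonneg _).trans (hM.le 0)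
  have dU : ∀ x, HasDerivAt (fun l => leftU ω l x) (leftUDeriv ω lam x) lam := fun x =>
    (hasDerivAt_sincRt_lam x ω hK).const_mul (I * (ω : ℂ))
  have dV : ∀ x, HasDerivAt (fun l => leftV ω l x) (leftVDeriv ω lam x) lam := fun x => by
    refine ((hasDerivAt_cosRt_lam x ω hK).sub
      ((hasDerivAt_id lam).mul (hasDerivAt_sincRt_lam x ω hK))).congr_deriv ?_
    simp only [leftVDeriv, id]
    ring
  have iu := hu.integrable (lt_add_one γ)
  have iv := hv.integrable (lt_add_one γ)
  have int : ∀ {w : ℝ × ℝ → ℂ} {k : ℂ → ℝ → ℂ} {k' : ℝ → ℂ}, MemTempered γ w → IsKernel k →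
      Continuous k' → Integrable (fun p : ℝ × ℝ =>
        cexp (I * lam * p.2) * (I * p.2) * (deriv eta p.2 : ℝ) * k lam p.1 * w p +
        cexp (I * lam * p.2) * (deriv eta p.2 : ℝ) * k' p.1 * w p) (volume.restrict strip) := by
    intro w k k' hw hk hk'
    have iw := hw.integrable (lt_add_one γ)
    have i1 := (integrable_stripInt hM' hk hw.aestronglyMeasurable iw lam).const_mul I
    have i2 := integrable_stripInt hM (IsKernel.ofFun hk') hw.aestronglyMeasurable iw lam
    refine (i1.add i2).congr (Eventually.of_forall fun p => ?_)
    simp only [Pi.add_apply]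
    push_cast
    ring
  refine ((hasDerivAt_stripInt_of_hasDerivAt hM (isKernel_leftV ω) hu.aestronglyMeasurable iu
    dV).add (hasDerivAt_stripInt_of_hasDerivAt hM (isKernel_leftU ω) hv.aestronglyMeasurable iv
    dU)).congr_deriv ?_
  rw [← integral_add (int hu (isKernel_leftV ω) contDiff_leftVDeriv.continuous)
    (int hv (isKernel_leftU ω) contDiff_leftUDeriv.continuous), qEta, ← integral_neg]
  refine integral_congr_ae (Eventually.of_forall fun p => ?_)
  simp only [leftWaveDeriv, jordanWave, Prod.smul_fst, Prod.smul_snd, smul_eq_mul, map_mul,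
    exp_neg_I_mul_conj, leftU_conj, leftV_conj, leftUDeriv_conj, leftVDeriv_conj, map_add, map_neg,
    Complex.conj_I, Complex.conj_ofReal, Complex.conj_conj]
  ring

end

/-! ### Exponential waves -/

/-- The conditions on `lam`, `κ` under which `expWave j lam κ` solves the homogeneous problem. -/
structure IsMode (ω : ℝ) (j : ℕ) (lam κ : ℂ) : Prop where
  omega_pos : 0 < ω
  ne_zero : κ ≠ 0
  sq : κ ^ 2 = (ω : ℂ) ^ 2 - lam ^ 2
  sin : ω * Complex.sin κ = (-1) ^ (j + 1) * κ
  cos : ω * Complex.cos κ = (-1) ^ (j + 1) * lam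

theorem neg_one_pow_mul_self_complex (n : ℕ) : (-1 : ℂ) ^ n * (-1) ^ n = 1 := by
  rw [← mul_pow]; simp

namespace IsMode

variable {ω β : ℝ} {j : ℕ} {lam κ : ℂ}

theorem omega_ne (h : IsMode ω j lam κ) : (ω : ℂ) ≠ 0 := by exact_mod_cast h.omega_pos.ne'

theorem conjugate (h : IsMode ω j lam κ) : IsMode ω j (conj lam) (conj κ) := by
  refine ⟨h.omega_pos, by simpa using h.ne_zero, ?_, ?_, ?_⟩
  · rw [← map_pow, h.sq]; simp
  · have := congrArg (starRingEnd ℂ) h.sin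
    simpa [← Complex.sin_conj] using this
  · have := congrArg (starRingEnd ℂ) h.cos
    simpa [← Complex.cos_conj] using this

theorem sin_eq (h : IsMode ω j lam κ) : Complex.sin κ = (-1) ^ (j + 1) * κ / ω := by
  rw [← h.sin, mul_div_cancel_left₀ _ h.omega_ne]

theorem cos_eq (h : IsMode ω j lam κ) : Complex.cos κ = (-1) ^ (j + 1) * lam / ω := by
  rw [← h.cos, mul_div_cancel_left₀ _ h.omega_ne]

theorem cosRt_eq (h : IsMode ω j lam κ) (x : ℝ) :
    cosRt x ((ω : ℂ) ^ 2 - lam ^ 2) = Complex.cos (κ * x) := by rw [← h.sq, cosRt_sq]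

theorem sincRt_eq (h : IsMode ω j lam κ) (x : ℝ) :
    sincRt x ((ω : ℂ) ^ 2 - lam ^ 2) = Complex.sin (κ * x) / κ := by
  rw [← h.sq, sincRt_sq_of_ne x h.ne_zero]

theorem dispersionFun_eq_zero (h : IsMode ω j lam κ) : dispersionFun ω lam = 0 := by
  rw [dispersionFun_eq, h.cosRt_eq, h.sincRt_eq]
  have := h.ne_zero
  simp only [Complex.ofReal_one, mul_one, h.cos_eq, h.sin_eq]
  field_simp
  ring

theorem sin_sub (h : IsMode ω j lam κ) (x : ℝ) : Complex.sin (κ * ((x : ℂ) - 1)) =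
    (-1) ^ (j + 1) / ω * (lam * Complex.sin (κ * x) - κ * Complex.cos (κ * x)) := by
  have hω := h.omega_ne
  rw [mul_sub, mul_one, Complex.sin_sub]
  field_simp
  linear_combination Complex.sin (κ * x) * h.cos - Complex.cos (κ * x) * h.sin

theorem cos_sub (h : IsMode ω j lam κ) (x : ℝ) : Complex.cos (κ * ((x : ℂ) - 1)) =
    (-1) ^ (j + 1) / ω * (lam * Complex.cos (κ * x) + κ * Complex.sin (κ * x)) := by
  have hω := h.omega_ne
  rw [mul_sub, mul_one, Complex.cos_sub]
  field_simp
  linear_combination Complex.cos (κ * x) * h.cos + Complex.sin (κ * x) * h.sin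

/-- The trigonometric form displays the boundary condition at `x = 1`, the left solution the one at
`x = 0`; at a mode they are proportional. -/
theorem expWave_eq (h : IsMode ω j lam κ) :
    expWave j lam κ = fun p => (κ / (I * ω)) • leftWave ω lam p := by
  funext p
  have hκ := h.ne_zero
  have hω := h.omega_ne
  have hs := neg_one_pow_mul_self_complex (j + 1)
  rw [expWave, leftWave, smul_comm]
  congr 1
  ext1
  · simp only [Prod.smul_fst, smul_eq_mul, leftU, h.sincRt_eq]
    field_simp
  · simp only [Prod.smul_snd, smul_eq_mul, leftV, h.sincRt_eq, h.cosRt_eq, h.sin_sub]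
    have hI : (I : ℂ) ≠ 0 := Complex.I_ne_zero
    field_simp
    linear_combination (I ^ 2 * (lam * Complex.sin (κ * p.1) - κ * Complex.cos (κ * p.1))) * hs +
      (lam * Complex.sin (κ * p.1) - κ * Complex.cos (κ * p.1)) * Complex.I_sq

theorem smoothSol (h : IsMode ω j lam κ) (hβ : |lam.im| < β) :
    SmoothSol ω β (expWave j lam κ) := by
  rw [h.expWave_eq]
  exact (SmoothSol.leftWave hβ h.dispersionFun_eq_zero).smul _

theorem leftPair_eq_zero (h : IsMode ω j lam κ) {γ : ℝ} {u v : ℝ × ℝ → ℂ} (hu : MemTempered γ u)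
    (hv : MemTempered γ v) (h0 : qEta u v (expWave j lam κ) = 0) :
    leftPair ω u v (starRingEnd ℂ lam) = 0 := by
  rw [h.expWave_eq, qEta_smul_right, qEta_leftWave hu hv] at h0
  have : starRingEnd ℂ (κ / (I * ω)) ≠ 0 := by
    rw [ne_eq, map_eq_zero]
    exact div_ne_zero h.ne_zero (mul_ne_zero Complex.I_ne_zero h.omega_ne)
  exact neg_eq_zero.1 ((mul_eq_zero.1 h0).resolve_left this)

end IsMode

/-- The derivative of `expWave j lam κ` along the curve `κ² = ω² - lam²`. -/
def expWaveDeriv (j : ℕ) (lam κ : ℂ) : ℝ × ℝ → ℂ × ℂ :=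
  jordanWave lam (fun x => Complex.sin (κ * x))
    (fun x => (-1) ^ (j + 1) * I * Complex.sin (κ * ((x : ℂ) - 1)))
    (fun x => -(lam / κ) * x * Complex.cos (κ * x))
    (fun x => (-1) ^ (j + 1) * I * (-(lam / κ) * ((x : ℂ) - 1) * Complex.cos (κ * ((x : ℂ) - 1))))

namespace IsMode

variable {ω β : ℝ} {j : ℕ} {κ : ℂ}

theorem deriv_dispersionFun_eq_zero (h : IsMode ω j 1 κ) : deriv (dispersionFun ω) 1 = 0 := by
  have hK : (ω : ℂ) ^ 2 - 1 ^ 2 ≠ 0 := by rw [← h.sq]; exact pow_ne_zero 2 h.ne_zero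
  have h0 := h.dispersionFun_eq_zero
  rw [dispersionFun_eq] at h0
  rw [← leftVDeriv_one hK, leftVDeriv, Complex.ofReal_one]
  linear_combination (((ω : ℂ) ^ 2 - 1 ^ 2)⁻¹) * h0

/-- The product rule for `(κ / (iω)) leftWave` explains the coefficients: along the curve `κ' =
-lam/κ`, so at `lam = 1` the factor `κ` contributes `κ'/κ = -κ⁻²`. -/
theorem expWaveDeriv_eq (h : IsMode ω j 1 κ) : expWaveDeriv j 1 κ =
    fun p => (κ / (I * ω)) • leftWaveDeriv ω 1 p + (-(κ ^ 2)⁻¹) • expWave j 1 κ p := by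
  funext p
  have hκ := h.ne_zero
  have hω := h.omega_ne
  have hI : (I : ℂ) ≠ 0 := Complex.I_ne_zero
  have hs := neg_one_pow_mul_self_complex (j + 1)
  ext1
  · simp only [expWaveDeriv, leftWaveDeriv, jordanWave, expWave, Prod.smul_fst, smul_eq_mul,
      Prod.fst_add, leftU, leftUDeriv, h.cosRt_eq, h.sincRt_eq]
    simp only [← h.sq]
    field_simp
    ring
  · simp only [expWaveDeriv, leftWaveDeriv, jordanWave, expWave, Prod.smul_snd, smul_eq_mul,
      Prod.snd_add, leftV, leftVDeriv, h.cosRt_eq, h.sincRt_eq, h.sin_sub, h.cos_sub]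
    simp only [← h.sq]
    set S := Complex.sin (κ * p.1)
    set C := Complex.cos (κ * p.1)
    set e := cexp (-I * 1 * p.2)
    set s : ℂ := (-1) ^ (j + 1)
    have h1 : s * I * (s / (ω : ℂ)) = I / ω := by linear_combination (I / ω) * hs
    have h2 : κ / (I * ω) = -(I * κ / ω) := by
      field_simp
      linear_combination Complex.I_sq
    rw [h2]
    calc _ = e * (-(1 / κ) * ((p.1 : ℂ) - 1) * (s * I * (s / (ω : ℂ)) * (1 * C + κ * S)) +
          -I * p.2 * (s * I * (s / (ω : ℂ)) * (1 * S - κ * C))) := by ring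
      _ = e * (-(1 / κ) * ((p.1 : ℂ) - 1) * (I / ω * (1 * C + κ * S)) +
          -I * p.2 * (I / ω * (1 * S - κ * C))) := by rw [h1]
      _ = -(I * κ / ω) * (e * (1 * p.1 * (S / κ) - (S / κ + 1 * -(1 * (p.1 * C - S / κ) / κ ^ 2)) +
            -I * p.2 * (C - 1 * (S / κ)))) +
          -(κ ^ 2)⁻¹ * (e * ((I / ω) * (1 * S - κ * C))) := by
        field_simp
        ring
      _ = _ := by rw [← h1]; ring

theorem smoothSol_deriv (h : IsMode ω j 1 κ) (hβ : 0 < β) :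
    SmoothSol ω β (expWaveDeriv j 1 κ) := by
  have hK : (ω : ℂ) ^ 2 - 1 ^ 2 ≠ 0 := by rw [← h.sq]; exact pow_ne_zero 2 h.ne_zero
  have hβ' : |(1 : ℂ).im| < β := by simpa using hβ
  rw [h.expWaveDeriv_eq]
  exact ((SmoothSol.leftWaveDeriv hβ' h.dispersionFun_eq_zero hK
    h.deriv_dispersionFun_eq_zero).smul _).add ((h.smoothSol hβ').smul _)

/-- Zero flux through both members of the Jordan chain means a double zero of `leftPair` at `1`. -/
theorem hasDerivAt_leftPair_zero (h : IsMode ω j 1 κ) {γ : ℝ} {u v : ℝ × ℝ → ℂ}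
    (hu : MemTempered γ u) (hv : MemTempered γ v) (h0 : qEta u v (expWave j 1 κ) = 0)
    (h1 : qEta u v (expWaveDeriv j 1 κ) = 0) : HasDerivAt (leftPair ω u v) 0 1 := by
  have hK : (ω : ℂ) ^ 2 - 1 ^ 2 ≠ 0 := by rw [← h.sq]; exact pow_ne_zero 2 h.ne_zero
  have hβ : |(1 : ℂ).im| < 1 := by simp
  have e : leftWaveDeriv ω 1 = fun p => (κ / (I * ω))⁻¹ •
      (expWaveDeriv j 1 κ p + (κ ^ 2)⁻¹ • expWave j 1 κ p) := by
    funext p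
    have hc : κ / (I * ω) ≠ 0 :=
      div_ne_zero h.ne_zero (mul_ne_zero Complex.I_ne_zero h.omega_ne)
    rw [h.expWaveDeriv_eq]
    beta_reduce
    rw [neg_smul, neg_add_cancel_right, smul_smul, inv_mul_cancel₀ hc, one_smul]
  have := hasDerivAt_leftPair hu hv hK
  rw [map_one, e, qEta_smul_right, qEta_add_right hu hv (h.smoothSol_deriv one_pos)
    ((h.smoothSol hβ).smul _), qEta_smul_right, h0, h1] at this
  simpa using this

end IsMode

/-! ### The symplectic form of exponential waves -/

/-- Moving the section to height `y` multiplies the form by `e^{-i(lam - conj μ)y}`, while the form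
does not depend on `y`; the Jordan term drops out because of `h0`. Differentiating at `y = 0` gives
the claim. -/
theorem qForm_eq_zero_of_jordan {ω β : ℝ} {w w' w'' : ℝ × ℝ → ℂ × ℂ} {lam μ : ℂ}
    (h : SmoothSol ω β w) (h' : SmoothSol ω β w') (h'' : SmoothSol ω β w'')
    (e : ∀ x y, w (x, y) = cexp (-I * lam * (y : ℝ)) • w (x, 0))
    (e' : ∀ x y, w' (x, y) = cexp (-I * μ * (y : ℝ)) • (w' (x, 0) + (-I * (y : ℝ)) • w'' (x, 0)))
    (h0 : qForm w w'' = 0) (hne : lam ≠ conj μ) : qForm w w' = 0 := by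
  have key : ∀ y : ℝ, cexp (-I * (lam - conj μ) * y) * qForm w w' = qForm w w' := by
    intro y
    conv_rhs => rw [← qSec_eq_qForm h h' y]
    have e1 : qSec w w' y = cexp (-I * (lam - conj μ) * y) *
        qForm w (fun p => w' p + (-I * (y : ℂ)) • w'' p) := by
      rw [qSec, qForm, mul_neg, ← intervalIntegral.integral_const_mul]
      congr 1
      refine intervalIntegral.integral_congr fun x _ => ?_
      have e2 : cexp (-I * (lam - conj μ) * y) =
          cexp (-I * lam * y) * cexp (I * conj μ * y) := by
        rw [← Complex.exp_add]; congr 1; ring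
      rw [e x y, e' x y, e2, ← exp_neg_I_mul_conj]
      simp only [Prod.smul_fst, Prod.smul_snd, smul_eq_mul, map_mul, Prod.fst_add, Prod.snd_add]
      ring
    rw [e1, qForm_add_right h h' (h''.smul _), qForm_smul_right, h0, mul_zero, add_zero]
  have hd : HasDerivAt (fun y : ℝ => cexp (-I * (lam - conj μ) * y) * qForm w w')
      (-I * (lam - conj μ) * qForm w w') 0 := by
    have := ((hasDerivAt_ofReal_mul (-I * (lam - conj μ)) 0).cexp).mul_const (qForm w w')
    simpa using this
  have h1 := hd.unique ((hasDerivAt_const (0 : ℝ) (qForm w w')).congr_of_eventuallyEq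
    (Eventually.of_forall key))
  have h2 : -I * (lam - conj μ) ≠ 0 :=
    mul_ne_zero (neg_ne_zero.2 Complex.I_ne_zero) (sub_ne_zero.2 hne)
  exact (mul_eq_zero.1 h1).resolve_left h2

theorem expWave_eq_smul (j : ℕ) (lam κ : ℂ) (x y : ℝ) :
    expWave j lam κ (x, y) = cexp (-I * lam * y) • expWave j lam κ (x, 0) := by
  simp [expWave]

theorem expWaveDeriv_eq_smul (j : ℕ) (lam κ : ℂ) (x y : ℝ) : expWaveDeriv j lam κ (x, y) =
    cexp (-I * lam * y) • (expWaveDeriv j lam κ (x, 0) + (-I * y : ℂ) • expWave j lam κ (x, 0)) := by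
  simp [expWave, expWaveDeriv, jordanWave]

section
variable {ω : ℝ} {j j' : ℕ} {lam μ κ κ' : ℂ}

theorem IsMode.qForm_eq_zero (h : IsMode ω j lam κ) (h' : IsMode ω j' μ κ')
    (hne : lam ≠ conj μ) : qForm (expWave j lam κ) (expWave j' μ κ') = 0 := by
  have b1 : |lam.im| < 1 + |lam.im| + |μ.im| := by linarith [abs_nonneg μ.im]
  have b2 : |μ.im| < 1 + |lam.im| + |μ.im| := by linarith [abs_nonneg lam.im]
  refine qForm_eq_zero_of_jordan (h.smoothSol b1) (h'.smoothSol b2) SmoothSol.zero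
    (expWave_eq_smul _ _ _) (fun x y => ?_) (by simp [qForm]) hne
  rw [expWave_eq_smul, smul_zero, add_zero]

theorem IsMode.qForm_deriv_eq_zero (h : IsMode ω j lam κ) (h' : IsMode ω j' 1 κ')
    (hne : lam ≠ 1) : qForm (expWave j lam κ) (expWaveDeriv j' 1 κ') = 0 := by
  have hne' : lam ≠ conj (1 : ℂ) := by simpa using hne
  have b1 : |lam.im| < 1 + |lam.im| := by linarith
  have b2 : 0 < 1 + |lam.im| := by positivity
  exact qForm_eq_zero_of_jordan (h.smoothSol b1) (h'.smoothSol_deriv b2)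
    (h'.smoothSol (by simpa using b2)) (expWave_eq_smul _ _ _) (expWaveDeriv_eq_smul _ _ _)
    (h.qForm_eq_zero h' hne') hne'

theorem hasDerivAt_mul_sub (κ c : ℂ) (x : ℝ) : HasDerivAt (fun x : ℝ => κ * (x : ℂ) - c) κ x :=
  (hasDerivAt_ofReal_mul κ x).sub_const c

theorem hasDerivAt_sin_mul_sub (κ c : ℂ) (x : ℝ) :
    HasDerivAt (fun x : ℝ => Complex.sin (κ * (x : ℂ) - c)) (Complex.cos (κ * x - c) * κ) x :=
  HasDerivAt.comp (h₂ := Complex.sin) x (Complex.hasDerivAt_sin (κ * x - c))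
    (hasDerivAt_mul_sub κ c x)

theorem hasDerivAt_cos_mul_sub (κ c : ℂ) (x : ℝ) :
    HasDerivAt (fun x : ℝ => Complex.cos (κ * (x : ℂ) - c)) (-Complex.sin (κ * x - c) * κ) x :=
  HasDerivAt.comp (h₂ := Complex.cos) x (Complex.hasDerivAt_cos (κ * x - c))
    (hasDerivAt_mul_sub κ c x)

/-- Product-to-sum formulas give an elementary integral. The factor `lam - 1` shows that the flux
degenerates exactly at the threshold root, which is why other waves are needed there. -/
theorem IsMode.qForm_conj (h : IsMode ω j lam κ) :
    qForm (expWave j lam κ) (expWave j (conj lam) (conj κ)) = I * (lam - 1) / ω := by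
  have hκ := h.ne_zero
  have hω := h.omega_ne
  have hs := neg_one_pow_mul_self_complex (j + 1)
  have hint : ∫ x in (0 : ℝ)..1, (Complex.cos κ - Complex.cos (2 * κ * x - κ)) =
      Complex.cos κ - Complex.sin κ / κ := by
    rw [intervalIntegral.integral_eq_sub_of_hasDerivAt
      (f := fun x : ℝ => Complex.cos κ * x - Complex.sin (2 * κ * x - κ) / (2 * κ))
      (fun x _ => ?_) (by apply Continuous.intervalIntegrable; fun_prop)]
    · simp only [Complex.ofReal_one, Complex.ofReal_zero, mul_one, mul_zero, zero_sub,
        Complex.sin_neg]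
      rw [show 2 * κ - κ = κ by ring]
      field_simp
      ring
    · refine ((hasDerivAt_ofReal_mul _ x).sub
        ((hasDerivAt_sin_mul_sub (2 * κ) κ x).div_const (2 * κ))).congr_deriv ?_
      field_simp
  have e : qForm (expWave j lam κ) (expWave j (conj lam) (conj κ)) =
      (-1) ^ (j + 1) * I * ∫ x in (0 : ℝ)..1, (Complex.cos κ - Complex.cos (2 * κ * x - κ)) := by
    rw [qForm, ← intervalIntegral.integral_const_mul, ← intervalIntegral.integral_neg]
    refine intervalIntegral.integral_congr fun x _ => ?_
    have e1 : Complex.cos κ - Complex.cos (2 * κ * x - κ) =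
        2 * Complex.sin (κ * x) * Complex.sin (κ * ((x : ℂ) - 1)) := by
      have a1 := Complex.cos_sub (κ * x) (κ * ((x : ℂ) - 1))
      have a2 := Complex.cos_add (κ * x) (κ * ((x : ℂ) - 1))
      rw [show κ * (x : ℂ) - κ * ((x : ℂ) - 1) = κ by ring] at a1
      rw [show κ * (x : ℂ) + κ * ((x : ℂ) - 1) = 2 * κ * x - κ by ring] at a2
      rw [a1, a2]; ring
    simp only [e1, expWave, Prod.smul_fst, Prod.smul_snd, smul_eq_mul, Complex.ofReal_zero,
      mul_zero, Complex.exp_zero, one_mul, map_mul, map_pow, map_neg, map_one, Complex.conj_I,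
      ← Complex.sin_conj, Complex.conj_conj, Complex.conj_ofReal, map_sub]
    ring
  rw [e, hint, h.sin_eq, h.cos_eq]
  have : (-1) ^ (j + 1) * I * ((-1) ^ (j + 1) * lam / ω - (-1) ^ (j + 1) * κ / ω / κ) =
      ((-1) ^ (j + 1) * (-1) ^ (j + 1)) * (I * (lam - 1) / ω) := by
    field_simp
  rw [this, hs, one_mul]

/-- The moment integrals at a double root. -/
theorem integral_moment_sin (hκ : κ ≠ 0) (h : Complex.sin κ = κ * Complex.cos κ) :
    ∫ x in (0 : ℝ)..1, (((x : ℂ) - 1) * (Complex.sin (κ * x) * Complex.cos (κ * ((x : ℂ) - 1))) +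
      x * (Complex.sin (κ * ((x : ℂ) - 1)) * Complex.cos (κ * x))) = -(Complex.sin κ / 2) := by
  have e : ∀ x : ℝ, (((x : ℂ) - 1) * (Complex.sin (κ * x) * Complex.cos (κ * ((x : ℂ) - 1))) +
      x * (Complex.sin (κ * ((x : ℂ) - 1)) * Complex.cos (κ * x))) =
      (x - 1 / 2) * Complex.sin (2 * κ * x - κ) - Complex.sin κ / 2 := by
    intro x
    have a1 := Complex.sin_sub (κ * x) (κ * ((x : ℂ) - 1))
    have a2 := Complex.sin_add (κ * x) (κ * ((x : ℂ) - 1))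
    rw [show κ * (x : ℂ) - κ * ((x : ℂ) - 1) = κ by ring] at a1
    rw [show κ * (x : ℂ) + κ * ((x : ℂ) - 1) = 2 * κ * x - κ by ring] at a2
    rw [a1, a2]; ring
  simp only [e]
  rw [intervalIntegral.integral_eq_sub_of_hasDerivAt
    (f := fun x : ℝ => -((1 * (x : ℂ) - 1 / 2) * (Complex.cos (2 * κ * x - κ) / (2 * κ))) +
      Complex.sin (2 * κ * x - κ) / (4 * κ ^ 2) - Complex.sin κ / 2 * x)
    (fun x _ => ?_) (by apply Continuous.intervalIntegrable; fun_prop)]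
  · simp only [Complex.ofReal_one, Complex.ofReal_zero, mul_one, mul_zero, zero_sub,
      Complex.sin_neg, Complex.cos_neg]
    rw [show 2 * κ - κ = κ by ring, h]
    field_simp
    ring
  · refine ((((hasDerivAt_mul_sub 1 (1 / 2) x).mul
      ((hasDerivAt_cos_mul_sub (2 * κ) κ x).div_const (2 * κ))).neg.add
      ((hasDerivAt_sin_mul_sub (2 * κ) κ x).div_const (4 * κ ^ 2))).sub
      (hasDerivAt_ofReal_mul _ x)).congr_deriv ?_
    field_simp
    ring

theorem integral_moment_cos (hκ : κ ≠ 0) (h : Complex.sin κ = κ * Complex.cos κ) :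
    ∫ x in (0 : ℝ)..1, (x : ℂ) * ((x : ℂ) - 1) *
      (Complex.cos (κ * x) * Complex.cos (κ * ((x : ℂ) - 1))) = -(Complex.cos κ / 12) := by
  have e : ∀ x : ℝ, (x : ℂ) * ((x : ℂ) - 1) *
      (Complex.cos (κ * x) * Complex.cos (κ * ((x : ℂ) - 1))) =
      (x * (x - 1)) * (Complex.cos κ / 2) + (x * (x - 1)) * (Complex.cos (2 * κ * x - κ) / 2) := by
    intro x
    have a1 := Complex.cos_sub (κ * x) (κ * ((x : ℂ) - 1))
    have a2 := Complex.cos_add (κ * x) (κ * ((x : ℂ) - 1))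
    rw [show κ * (x : ℂ) - κ * ((x : ℂ) - 1) = κ by ring] at a1
    rw [show κ * (x : ℂ) + κ * ((x : ℂ) - 1) = 2 * κ * x - κ by ring] at a2
    rw [a1, a2]; ring
  simp only [e]
  rw [intervalIntegral.integral_eq_sub_of_hasDerivAt
    (f := fun x : ℝ => ((x : ℂ) ^ 3 / 3 - (x : ℂ) ^ 2 / 2) * (Complex.cos κ / 2) +
      ((x : ℂ) ^ 2 - x) * (Complex.sin (2 * κ * x - κ) / (4 * κ)) +
      (2 * (x : ℂ) - 1) * (Complex.cos (2 * κ * x - κ) / (8 * κ ^ 2)) -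
      Complex.sin (2 * κ * x - κ) / (8 * κ ^ 3))
    (fun x _ => ?_) (by apply Continuous.intervalIntegrable; fun_prop)]
  · simp only [Complex.ofReal_one, Complex.ofReal_zero, mul_one, mul_zero, zero_sub,
      Complex.sin_neg, Complex.cos_neg]
    rw [show 2 * κ - κ = κ by ring, h]
    field_simp
    ring
  · have hx : HasDerivAt (fun x : ℝ => (x : ℂ)) 1 x := by simpa using hasDerivAt_ofReal_mul 1 x
    refine (((((((hx.pow 3).div_const 3).sub ((hx.pow 2).div_const 2)).mul_const
      (Complex.cos κ / 2)).add (((hx.pow 2).sub hx).mul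
        ((hasDerivAt_sin_mul_sub (2 * κ) κ x).div_const (4 * κ)))).add
      ((hasDerivAt_mul_sub 2 1 x).mul
        ((hasDerivAt_cos_mul_sub (2 * κ) κ x).div_const (8 * κ ^ 2)))).sub
      ((hasDerivAt_sin_mul_sub (2 * κ) κ x).div_const (8 * κ ^ 3))).congr_deriv ?_
    simp
    field_simp
    ring

end

/-! ### Sections real up to a symmetry -/

/-- The section `y = 0` is invariant under `(u, v) ↦ (conj u, -conj v)`. -/
def RealSection (w : ℝ × ℝ → ℂ × ℂ) : Prop :=
  ∀ x : ℝ, conj (w (x, 0)).1 = (w (x, 0)).1 ∧ conj (w (x, 0)).2 = -(w (x, 0)).2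

theorem RealSection.conj_qForm {w w' : ℝ × ℝ → ℂ × ℂ} (h : RealSection w) (h' : RealSection w') :
    conj (qForm w w') = -qForm w w' := by
  rw [qForm, map_neg, ← intervalIntegral.intervalIntegral_conj]
  rw [neg_neg, ← intervalIntegral.integral_neg]
  refine intervalIntegral.integral_congr fun x _ => ?_
  simp only [map_sub, map_mul, (h x).1, (h x).2, (h' x).1, (h' x).2, map_neg]
  ring

theorem RealSection.add {w w' : ℝ × ℝ → ℂ × ℂ} (h : RealSection w) (h' : RealSection w') :
    RealSection (fun p => w p + w' p) := fun x => by
  simp only [Prod.fst_add, Prod.snd_add, map_add, (h x).1, (h x).2, (h' x).1, (h' x).2, true_and]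
  ring

theorem RealSection.smul {w : ℝ × ℝ → ℂ × ℂ} (h : RealSection w) {c : ℂ} (hc : conj c = c) :
    RealSection (fun p => c • w p) := fun x => by
  simp only [Prod.smul_fst, Prod.smul_snd, smul_eq_mul, map_mul, (h x).1, (h x).2, hc, true_and]
  ring

/-- Shows that the real parts in `aEps`, `bEps` and `cEps` discard nothing. -/
theorem RealSection.mul_I_im {w w' : ℝ × ℝ → ℂ × ℂ} (h : RealSection w) (h' : RealSection w') :
    ((I * qForm w w').re : ℂ) = I * qForm w w' := by
  rw [← Complex.conj_eq_iff_re, map_mul, h.conj_qForm h', Complex.conj_I, neg_mul_neg]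

theorem expWave_conj_section (j : ℕ) (lam κ : ℂ) (x : ℝ) :
    (expWave j (conj lam) (conj κ) (x, 0)).1 = conj (expWave j lam κ (x, 0)).1 ∧
    (expWave j (conj lam) (conj κ) (x, 0)).2 = -conj (expWave j lam κ (x, 0)).2 := by
  constructor
  · simp [expWave, ← Complex.sin_conj]
  · simp [expWave, ← Complex.sin_conj]

theorem realSection_add_conj (j : ℕ) (lam κ c : ℂ) :
    RealSection (fun p => c • expWave j lam κ p + conj c • expWave j (conj lam) (conj κ) p) := by
  intro x
  obtain ⟨h1, h2⟩ := expWave_conj_section j lam κ x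
  simp only [Prod.fst_add, Prod.snd_add, Prod.smul_fst, Prod.smul_snd, smul_eq_mul, h1, h2,
    map_add, map_mul, map_neg, Complex.conj_conj]
  constructor <;> ring

theorem realSection_expWave {j : ℕ} {lam κ : ℂ} (hl : conj lam = lam) (hκ : conj κ = κ) :
    RealSection (expWave j lam κ) := by
  intro x
  have := expWave_conj_section j lam κ x
  rw [hl, hκ] at this
  exact ⟨this.1.symm, by linear_combination this.2⟩

theorem realSection_expWaveDeriv {j : ℕ} {κ : ℂ} (hκ : conj κ = κ) :
    RealSection (expWaveDeriv j 1 κ) := by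
  intro x
  constructor
  · simp [expWaveDeriv, jordanWave, ← Complex.cos_conj, hκ]
  · simp [expWaveDeriv, jordanWave, ← Complex.cos_conj, hκ]

/-! ### The symplectic form at a double root -/

section
variable {ω : ℝ} {j : ℕ} {κ : ℂ}

theorem IsMode.sin_eq_mul_cos (h : IsMode ω j 1 κ) : Complex.sin κ = κ * Complex.cos κ := by
  rw [h.sin_eq, h.cos_eq]; ring

theorem IsMode.qForm_self_one (h : IsMode ω j 1 κ) (hκ : conj κ = κ) :
    qForm (expWave j 1 κ) (expWave j 1 κ) = 0 := by
  have := h.qForm_conj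
  rw [map_one, hκ] at this
  simpa using this

theorem IsMode.qForm_expWave_deriv (h : IsMode ω j 1 κ) (hκ : conj κ = κ) :
    qForm (expWave j 1 κ) (expWaveDeriv j 1 κ) = I / (2 * ω) := by
  have hs := neg_one_pow_mul_self_complex (j + 1)
  have hκ0 := h.ne_zero
  have hω := h.omega_ne
  have e : qForm (expWave j 1 κ) (expWaveDeriv j 1 κ) = -((-1) ^ (j + 1) * I / κ) *
      ∫ x in (0 : ℝ)..1, (((x : ℂ) - 1) * (Complex.sin (κ * x) * Complex.cos (κ * ((x : ℂ) - 1))) +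
      x * (Complex.sin (κ * ((x : ℂ) - 1)) * Complex.cos (κ * x))) := by
    rw [qForm, neg_mul, ← intervalIntegral.integral_const_mul]
    congr 1
    refine intervalIntegral.integral_congr fun x _ => ?_
    simp only [expWave, expWaveDeriv, jordanWave, Prod.smul_fst, Prod.smul_snd, smul_eq_mul,
      Complex.ofReal_zero, mul_zero, Complex.exp_zero, one_mul, map_mul, map_pow, map_neg, map_one,
      Complex.conj_I, ← Complex.cos_conj, Complex.conj_ofReal, map_sub, zero_mul,
      add_zero, map_div₀, hκ]
    ring
  rw [e, integral_moment_sin hκ0 h.sin_eq_mul_cos, h.sin_eq]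
  have : -((-1) ^ (j + 1) * I / κ) * -((-1) ^ (j + 1) * κ / ω / 2) =
      ((-1) ^ (j + 1) * (-1) ^ (j + 1)) * (I / (2 * ω)) := by
    field_simp
  rw [this, hs, one_mul]

theorem IsMode.qForm_deriv_deriv (h : IsMode ω j 1 κ) (hκ : conj κ = κ) :
    qForm (expWaveDeriv j 1 κ) (expWaveDeriv j 1 κ) = -(I / (6 * ω * κ ^ 2)) := by
  have hs := neg_one_pow_mul_self_complex (j + 1)
  have hκ0 := h.ne_zero
  have hω := h.omega_ne
  have e : qForm (expWaveDeriv j 1 κ) (expWaveDeriv j 1 κ) = (2 * ((-1) ^ (j + 1) * I) / κ ^ 2) *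
      ∫ x in (0 : ℝ)..1, (x : ℂ) * ((x : ℂ) - 1) *
      (Complex.cos (κ * x) * Complex.cos (κ * ((x : ℂ) - 1))) := by
    rw [qForm, ← intervalIntegral.integral_const_mul, ← intervalIntegral.integral_neg]
    refine intervalIntegral.integral_congr fun x _ => ?_
    simp only [expWaveDeriv, jordanWave, Prod.smul_fst, Prod.smul_snd, smul_eq_mul,
      Complex.ofReal_zero, mul_zero, Complex.exp_zero, one_mul, map_mul, map_pow, map_neg, map_one,
      Complex.conj_I, ← Complex.cos_conj, Complex.conj_ofReal, map_sub, zero_mul,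
      add_zero, map_div₀, hκ]
    field_simp
    ring
  rw [e, integral_moment_cos hκ0 h.sin_eq_mul_cos, h.cos_eq]
  have : (2 * ((-1) ^ (j + 1) * I) / κ ^ 2) * -((-1) ^ (j + 1) * 1 / ω / 12) =
      ((-1) ^ (j + 1) * (-1) ^ (j + 1)) * -(I / (6 * ω * κ ^ 2)) := by
    field_simp
    norm_num
  rw [this, hs, one_mul]

end

/-! ### The oscillatory waves -/

section
variable {n : ℕ} {ω κ : ℝ}

theorem isMode_of_sinc (hω : 0 < ω) (hκ : κ ≠ 0) (h : (-1) ^ n * Real.sinc κ = 1 / ω) :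
    IsMode ω (n + 1) ((κ * Real.cot κ : ℝ) : ℂ) (κ : ℂ) := by
  have hsq := sq_mul_cot_add_sq hω.ne' hκ h
  have hs : (-1 : ℝ) ^ (n + 1 + 1) = (-1) ^ n := by rw [pow_succ, pow_succ]; ring
  have h2 := neg_one_pow_mul_self n
  rw [Real.sinc_of_ne_zero hκ] at h
  have hsin : ω * Real.sin κ = (-1) ^ (n + 1 + 1) * κ := by
    rw [hs]
    field_simp at h
    linear_combination (-1) ^ n * h - ω * Real.sin κ * h2
  have hs0 : Real.sin κ ≠ 0 := by
    intro h0
    rw [h0] at h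
    simp at h
    exact hω.ne h
  refine ⟨hω, by exact_mod_cast hκ, ?_, ?_, ?_⟩
  · norm_cast
    linarith
  · have := congrArg (fun x : ℝ => (x : ℂ)) hsin
    push_cast at this
    exact this
  · have : ω * Real.cos κ = (-1) ^ (n + 1 + 1) * (κ * Real.cot κ) := by
      rw [Real.cot_eq_cos_div_sin]
      field_simp
      linear_combination Real.cos κ * hsin
    have := congrArg (fun x : ℝ => (x : ℂ)) this
    push_cast at this ⊢
    exact this

theorem smoothSol_oscWave {β : ℝ} (hω : 0 < ω) (hκ : κ ≠ 0)
    (h : (-1) ^ n * Real.sinc κ = 1 / ω) (hβ : 0 < β) : SmoothSol ω β (oscWave ω (n + 1) κ) :=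
  ((isMode_of_sinc hω hκ h).smoothSol (by rwa [Complex.ofReal_im, abs_zero])).smul _

theorem qForm_oscWave_self (hω : 0 < ω) (hκ : κ ≠ 0) (h : (-1) ^ n * Real.sinc κ = 1 / ω)
    (h1 : κ * Real.cot κ ≠ 1) : qForm (oscWave ω (n + 1) κ) (oscWave ω (n + 1) κ) =
      I * ((κ * Real.cot κ - 1) / |κ * Real.cot κ - 1| : ℝ) := by
  have hm := (isMode_of_sinc hω hκ h).qForm_conj
  rw [Complex.conj_ofReal, Complex.conj_ofReal] at hm
  have hp : 0 < |κ * Real.cot κ - 1| := abs_pos.2 (sub_ne_zero.2 h1)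
  have hsq : (Real.sqrt ω / Real.sqrt |κ * Real.cot κ - 1|) *
      (Real.sqrt ω / Real.sqrt |κ * Real.cot κ - 1|) = ω / |κ * Real.cot κ - 1| := by
    rw [div_mul_div_comm, Real.mul_self_sqrt hω.le, Real.mul_self_sqrt hp.le]
  have e := qForm_smul_left (expWave (n + 1) ((κ * Real.cot κ : ℝ) : ℂ) (κ : ℂ))
    (fun p => ((Real.sqrt ω / Real.sqrt |κ * Real.cot κ - 1| : ℝ) : ℂ) •
      expWave (n + 1) ((κ * Real.cot κ : ℝ) : ℂ) (κ : ℂ) p)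
    ((Real.sqrt ω / Real.sqrt |κ * Real.cot κ - 1| : ℝ) : ℂ)
  rw [qForm_smul_right (expWave (n + 1) ((κ * Real.cot κ : ℝ) : ℂ) (κ : ℂ)), hm,
    Complex.conj_ofReal, ← mul_assoc, ← Complex.ofReal_mul, hsq] at e
  refine Eq.trans e ?_
  have hω' : (ω : ℂ) ≠ 0 := by exact_mod_cast hω.ne'
  push_cast
  field_simp

theorem qForm_oscWave_left {w : ℝ × ℝ → ℂ × ℂ} {j : ℕ}
    (h : qForm (expWave j ((κ * Real.cot κ : ℝ) : ℂ) (κ : ℂ)) w = 0) :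
    qForm (oscWave ω j κ) w = 0 := by
  refine (qForm_smul_left _ _ _).trans ?_
  rw [h, mul_zero]

theorem qForm_oscWave_ne {n' : ℕ} {κ' : ℝ} (hω : 0 < ω) (hκ : κ ≠ 0)
    (h : (-1) ^ n * Real.sinc κ = 1 / ω) (hκ' : κ' ≠ 0)
    (h' : (-1) ^ n' * Real.sinc κ' = 1 / ω) (hne : κ * Real.cot κ ≠ κ' * Real.cot κ') :
    qForm (oscWave ω (n + 1) κ) (oscWave ω (n' + 1) κ') = 0 := by
  apply qForm_oscWave_left
  refine (qForm_smul_right _ _ _).trans ?_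
  rw [(isMode_of_sinc hω hκ h).qForm_eq_zero (isMode_of_sinc hω hκ' h') (by
    rw [Complex.conj_ofReal]
    exact_mod_cast hne), mul_zero]

theorem leftPair_oscWave_eq_zero {γ : ℝ} {u v : ℝ × ℝ → ℂ} (hω : 0 < ω) (hκ : κ ≠ 0)
    (h : (-1) ^ n * Real.sinc κ = 1 / ω) (h1 : κ * Real.cot κ ≠ 1) (hu : MemTempered γ u)
    (hv : MemTempered γ v) (h0 : qEta u v (oscWave ω (n + 1) κ) = 0) :
    leftPair ω u v ((κ * Real.cot κ : ℝ) : ℂ) = 0 := by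
  have e := qEta_smul_right u v (expWave (n + 1) ((κ * Real.cot κ : ℝ) : ℂ) (κ : ℂ))
    ((Real.sqrt ω / Real.sqrt |κ * Real.cot κ - 1| : ℝ) : ℂ)
  have h2 := e.symm.trans h0
  have hp : 0 < |κ * Real.cot κ - 1| := abs_pos.2 (sub_ne_zero.2 h1)
  have hc : conj ((Real.sqrt ω / Real.sqrt |κ * Real.cot κ - 1| : ℝ) : ℂ) ≠ 0 := by
    rw [Complex.conj_ofReal]
    have : 0 < Real.sqrt ω / Real.sqrt |κ * Real.cot κ - 1| := by positivity
    exact_mod_cast this.ne'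
  have := (isMode_of_sinc hω hκ h).leftPair_eq_zero hu hv ((mul_eq_zero.1 h2).resolve_left hc)
  rwa [Complex.conj_ofReal] at this

end

/-! ### Modes near the threshold -/

section
variable {m : ℕ} {ω r : ℝ} {lam : ℂ}

theorem isMode_kappaOf (hω : 0 < ω) (hK : (ω : ℂ) ^ 2 - lam ^ 2 ≠ 0)
    (hG : thrG m ω lam = 0) (hD : dispersionFun ω lam = 0) :
    IsMode ω (m + 1) lam (kappaOf ω lam) := by
  have hsq := kappaOf_sq ω lam
  have hκ : kappaOf ω lam ≠ 0 := by
    intro h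
    rw [h] at hsq
    exact hK (by rw [← hsq]; simp)
  have hω' : (ω : ℂ) ≠ 0 := by exact_mod_cast hω.ne'
  have hs : (-1 : ℂ) ^ (m + 1 + 1) = (-1) ^ m := by rw [pow_succ, pow_succ]; ring
  have h1 := mul_sincRt_sq 1 (kappaOf ω lam)
  have h2 := cosRt_sq 1 (kappaOf ω lam)
  rw [hsq, Complex.ofReal_one, mul_one] at h1 h2
  have hS : sincRt 1 ((ω : ℂ) ^ 2 - lam ^ 2) = (-1) ^ m / ω := sub_eq_zero.1 hG
  rw [dispersionFun_eq] at hD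
  refine ⟨hω, hκ, hsq, ?_, ?_⟩
  · rw [← h1, hS, hs]
    field_simp
  · rw [← h2, sub_eq_zero.1 hD, hS, hs]
    field_simp

/-- On the disc `‖lam‖ < ω`, so `ω² - lam²` stays in the right half-plane, where the principal
square root is analytic and commutes with conjugation. -/
theorem re_K_pos (hr : r < ω - 1) (h : ‖lam - 1‖ ≤ r) : 0 < ((ω : ℂ) ^ 2 - lam ^ 2).re := by
  have h1 : ‖lam‖ < ω := by
    have := norm_add_le (lam - 1) 1
    rw [sub_add_cancel, norm_one] at this
    linarith
  have h2 : ‖lam ^ 2‖ < ω ^ 2 := by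
    rw [norm_pow]
    exact pow_lt_pow_left₀ h1 (norm_nonneg _) two_ne_zero
  have h3 := Complex.re_le_norm (lam ^ 2)
  have h4 : ((ω : ℂ) ^ 2 - lam ^ 2).re = ω ^ 2 - (lam ^ 2).re := by
    rw [Complex.sub_re, ← Complex.ofReal_pow, Complex.ofReal_re]
  rw [h4]
  linarith

theorem K_mem_slitPlane (hr : r < ω - 1) (h : ‖lam - 1‖ ≤ r) :
    (ω : ℂ) ^ 2 - lam ^ 2 ∈ slitPlane := Or.inl (re_K_pos hr h)

theorem kappaOf_conj (h : (ω : ℂ) ^ 2 - lam ^ 2 ∈ slitPlane) :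
    kappaOf ω (conj lam) = conj (kappaOf ω lam) := by
  rw [kappaOf, kappaOf, K_conj]
  have h1 := Complex.cpow_conj ((ω : ℂ) ^ 2 - lam ^ 2) (1 / 2) (Complex.slitPlane_arg_ne_pi h)
  have h2 : conj (1 / 2 : ℂ) = 1 / 2 := by rw [map_div₀, map_one, map_ofNat]
  rw [h2] at h1
  rw [h1, Complex.conj_conj]

theorem hasDerivAt_kappaOf (h : (ω : ℂ) ^ 2 - lam ^ 2 ∈ slitPlane) :
    HasDerivAt (kappaOf ω) (-(lam / kappaOf ω lam)) lam := by
  have h0 : (ω : ℂ) ^ 2 - lam ^ 2 ≠ 0 := slitPlane_ne_zero h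
  refine ((hasDerivAt_K ω lam).cpow_const h).congr_deriv ?_
  have h1 : ((ω : ℂ) ^ 2 - lam ^ 2) ^ ((1 / 2 : ℂ) - 1) = (kappaOf ω lam)⁻¹ := by
    rw [kappaOf, show (1 / 2 : ℂ) - 1 = -(1 / 2) by norm_num, Complex.cpow_neg]
  rw [h1]
  ring

theorem hasDerivAt_expWave_kappaOf (h : (ω : ℂ) ^ 2 - lam ^ 2 ∈ slitPlane) (j : ℕ) (p : ℝ × ℝ) :
    HasDerivAt (fun lam => expWave j lam (kappaOf ω lam) p)
      (expWaveDeriv j lam (kappaOf ω lam) p) lam := by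
  have hk := hasDerivAt_kappaOf h
  have he : HasDerivAt (fun lam : ℂ => cexp (-I * lam * p.2)) (cexp (-I * lam * p.2) * (-I * p.2))
      lam := by
    have : HasDerivAt (fun lam : ℂ => -I * lam * p.2) (-I * p.2) lam := by
      simpa using ((hasDerivAt_id lam).const_mul (-I)).mul_const (p.2 : ℂ)
    exact this.cexp
  have h1 := (hk.mul_const (p.1 : ℂ)).csin
  have h2 := ((hk.mul_const ((p.1 : ℂ) - 1)).csin).const_mul ((-1) ^ (j + 1) * I)
  refine (he.smul (h1.prodMk h2)).congr_deriv ?_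
  ext1
  · simp [expWaveDeriv, jordanWave]
    ring
  · simp [expWaveDeriv, jordanWave]
    ring

end

/-! ### Contour integrals around two poles -/

theorem differentiable_dslope {f : ℂ → ℂ} (hf : Differentiable ℂ f) (c : ℂ) :
    Differentiable ℂ (dslope f c) :=
  differentiableOn_univ.1 ((Complex.differentiableOn_dslope univ_mem).2 hf.differentiableOn)

theorem eq_mul_dslope {f : ℂ → ℂ} {c : ℂ} (h : f c = 0) (z : ℂ) : f z = (z - c) * dslope f c z := by
  have := sub_smul_dslope f c z
  rw [h, sub_zero, smul_eq_mul] at this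
  exact this.symm

theorem deriv_eq_mul_of_eq {f g : ℂ → ℂ} {c : ℂ} (hg : Differentiable ℂ g)
    (h : ∀ z, f z = (z - c) * g z) (z : ℂ) :
    HasDerivAt f (g z + (z - c) * deriv g z) z := by
  have e : f = fun z => (z - c) * g z := funext h
  rw [e]
  refine (((hasDerivAt_id z).sub_const c).mul (hg z).hasDerivAt).congr_deriv ?_
  simp

section
variable {G : ℂ → ℂ} {F : ℂ → ℂ × ℂ} {c : ℂ} {R : ℝ} {U : Set ℂ}

/-- Write `G = (z - z₁)(z - z₂) H` with `H` zero free on the disc, split into partial fractions and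
apply Cauchy's formula twice; `G'(z₁) = (z₁ - z₂) H(z₁)` and similarly at `z₂`. -/
theorem circleIntegral_inv_smul_two_poles (hG : Differentiable ℂ G)
    (hcU : Metric.closedBall c R ⊆ U) (hF : DifferentiableOn ℂ F U) {z₁ z₂ : ℂ}
    (h₁ : z₁ ∈ Metric.ball c R) (h₂ : z₂ ∈ Metric.ball c R) (hne : z₁ ≠ z₂)
    (hroots : ∀ z ∈ Metric.closedBall c R, G z = 0 ↔ z = z₁ ∨ z = z₂)
    (d₁ : deriv G z₁ ≠ 0) (d₂ : deriv G z₂ ≠ 0) :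
    (2 * (Real.pi : ℂ) * I)⁻¹ • ∮ z in C(c, R), (G z)⁻¹ • F z =
      (deriv G z₁)⁻¹ • F z₁ + (deriv G z₂)⁻¹ • F z₂ := by
  have hsub := Metric.ball_subset_closedBall (x := c) (ε := R)
  have hR : 0 < R := lt_of_le_of_lt dist_nonneg h₁
  have g1 : G z₁ = 0 := (hroots z₁ (hsub h₁)).2 (Or.inl rfl)
  have g2 : G z₂ = 0 := (hroots z₂ (hsub h₂)).2 (Or.inr rfl)
  have hne' : z₁ - z₂ ≠ 0 := sub_ne_zero.2 hne
  have hne'' : z₂ - z₁ ≠ 0 := sub_ne_zero.2 hne.symm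
  set g := dslope G z₁ with hg
  have hgd : Differentiable ℂ g := differentiable_dslope hG z₁
  have e1 : ∀ z, G z = (z - z₁) * g z := eq_mul_dslope g1
  have gz2 : g z₂ = 0 := by
    have := e1 z₂
    rw [g2] at this
    exact (mul_eq_zero.1 this.symm).resolve_left hne''
  set H := dslope g z₂ with hH
  have hHd : Differentiable ℂ H := differentiable_dslope hgd z₂
  have e2 : ∀ z, g z = (z - z₂) * H z := eq_mul_dslope gz2
  have D1 : deriv G z₁ = (z₁ - z₂) * H z₁ := by
    rw [(deriv_eq_mul_of_eq hgd e1 z₁).deriv, e2]; simp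
  have D2 : deriv G z₂ = (z₂ - z₁) * H z₂ := by
    rw [(deriv_eq_mul_of_eq hgd e1 z₂).deriv, (deriv_eq_mul_of_eq hHd e2 z₂).deriv, gz2]; simp
  have hH0 : ∀ z ∈ Metric.closedBall c R, H z ≠ 0 := by
    intro z hz h0
    have : G z = 0 := by rw [e1, e2, h0]; simp
    rcases (hroots z hz).1 this with rfl | rfl
    · exact d₁ (by rw [D1, h0, mul_zero])
    · exact d₂ (by rw [D2, h0, mul_zero])
  set f : ℂ → ℂ × ℂ := fun z => (H z)⁻¹ • F z with hf
  have hfd : DifferentiableOn ℂ f (Metric.closedBall c R) := fun z hz =>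
    ((hHd z).inv (hH0 z hz)).differentiableWithinAt.smul (hF.mono hcU z hz)
  have hfc : ContinuousOn f (Metric.sphere c R) :=
    hfd.continuousOn.mono Metric.sphere_subset_closedBall
  have hint : ∀ w ∈ Metric.ball c R, CircleIntegrable (fun z => (z - w)⁻¹ • f z) c R := by
    intro w hw
    refine ContinuousOn.circleIntegrable hR.le (ContinuousOn.smul (ContinuousOn.inv₀
      (continuous_id.sub continuous_const).continuousOn
      fun z hz h0 => ?_) hfc)
    rw [show z = w from sub_eq_zero.1 h0, Metric.mem_sphere] at hz
    rw [Metric.mem_ball, hz] at hw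
    exact lt_irrefl _ hw
  have e3 : ∮ z in C(c, R), (G z)⁻¹ • F z =
      ∮ z in C(c, R), (z₁ - z₂)⁻¹ • ((z - z₁)⁻¹ • f z - (z - z₂)⁻¹ • f z) := by
    refine circleIntegral.integral_congr hR.le fun z hz => ?_
    have n1 : z - z₁ ≠ 0 := fun h0 => by
      rw [sub_eq_zero.1 h0, Metric.mem_sphere] at hz
      rw [Metric.mem_ball, hz] at h₁
      exact lt_irrefl _ h₁
    have n2 : z - z₂ ≠ 0 := fun h0 => by
      rw [sub_eq_zero.1 h0, Metric.mem_sphere] at hz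
      rw [Metric.mem_ball, hz] at h₂
      exact lt_irrefl _ h₂
    have hz0 := hH0 z (Metric.sphere_subset_closedBall hz)
    simp only [hf, ← sub_smul, smul_smul, e1 z, e2 z]
    congr 1
    field_simp
    ring
  rw [e3, circleIntegral.integral_smul, circleIntegral.integral_sub (hint z₁ h₁) (hint z₂ h₂),
    hfd.circleIntegral_sub_inv_smul h₁, hfd.circleIntegral_sub_inv_smul h₂, D1, D2, ← smul_sub,
    smul_comm, smul_smul (2 * (Real.pi : ℂ) * I)⁻¹, inv_mul_cancel₀ Complex.two_pi_I_ne_zero,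
    one_smul, smul_sub, mul_inv, mul_inv, ← smul_smul, ← smul_smul, sub_eq_add_neg]
  congr 1
  rw [← neg_smul, ← inv_neg, neg_sub]

/-- Here `G = (z - c)² H`, so the first integral is the derivative of `H⁻¹ F` at `c` and the second
its value. -/
theorem circleIntegral_inv_smul_double_pole (hG : Differentiable ℂ G) (hU : IsOpen U)
    (hR : 0 < R) (hcU : Metric.closedBall c R ⊆ U) (hF : DifferentiableOn ℂ F U)
    (hroots : ∀ z ∈ Metric.closedBall c R, G z = 0 ↔ z = c)
    (d₁ : deriv G c = 0) (hH : dslope (dslope G c) c c ≠ 0) :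
    (2 * (Real.pi : ℂ) * I)⁻¹ • ∮ z in C(c, R), (G z)⁻¹ • F z =
      (dslope (dslope G c) c c)⁻¹ • deriv F c -
        (deriv (dslope (dslope G c) c) c / dslope (dslope G c) c c ^ 2) • F c ∧
    (2 * (Real.pi : ℂ) * I)⁻¹ • ∮ z in C(c, R), ((z - c) / G z) • F z =
      (dslope (dslope G c) c c)⁻¹ • F c := by
  have hcc : c ∈ Metric.closedBall c R := Metric.mem_closedBall_self hR.le
  have hcb : c ∈ Metric.ball c R := Metric.mem_ball_self hR
  have g1 : G c = 0 := (hroots c hcc).2 rfl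
  have e1 : ∀ z, G z = (z - c) * dslope G c z := eq_mul_dslope g1
  have gc : dslope G c c = 0 := by rw [dslope_same, d₁]
  have e2 : ∀ z, dslope G c z = (z - c) * dslope (dslope G c) c z := eq_mul_dslope gc
  have hHd : Differentiable ℂ (dslope (dslope G c) c) :=
    differentiable_dslope (differentiable_dslope hG c) c
  set H := dslope (dslope G c) c
  have hH0 : ∀ z ∈ Metric.closedBall c R, H z ≠ 0 := by
    intro z hz h0
    have : G z = 0 := by rw [e1, e2, h0]; simp
    rw [(hroots z hz).1 this] at h0
    exact hH h0
  set f : ℂ → ℂ × ℂ := fun z => (H z)⁻¹ • F z with hf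
  set V := U ∩ {z | H z ≠ 0}
  have hV : IsOpen V := hU.inter (isOpen_ne_fun hHd.continuous continuous_const)
  have hcV : Metric.closedBall c R ⊆ V := fun z hz => ⟨hcU hz, hH0 z hz⟩
  have hfd : DifferentiableOn ℂ f V := fun z hz =>
    ((hHd z).inv hz.2).differentiableWithinAt.smul
      ((hF z hz.1).mono inter_subset_left)
  have n1 : ∀ {z}, z ∈ Metric.sphere c R → z - c ≠ 0 := fun {z} hz h0 => by
    rw [sub_eq_zero.1 h0, Metric.mem_sphere, dist_self] at hz
    exact hR.ne hz
  constructor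
  · have e3 : ∮ z in C(c, R), (G z)⁻¹ • F z = ∮ z in C(c, R), ((z - c) ^ 2)⁻¹ • f z := by
      refine circleIntegral.integral_congr hR.le fun z hz => ?_
      simp only [hf, smul_smul, e1 z, e2 z]
      congr 1
      rw [← mul_inv]
      congr 1
      ring
    rw [e3, Complex.two_pi_I_inv_smul_circleIntegral_sub_sq_inv_smul_of_differentiable hV hcV hfd hcb]
    have hFc : HasDerivAt F (deriv F c) c := (hF.differentiableAt (hU.mem_nhds (hcU hcc))).hasDerivAt
    have hfc : HasDerivAt f ((H c)⁻¹ • deriv F c + (-deriv H c / H c ^ 2) • F c) c :=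
      ((hHd c).hasDerivAt.inv hH).smul hFc
    rw [hfc.deriv, sub_eq_add_neg, ← neg_smul, neg_div]
  · have e3 : ∮ z in C(c, R), ((z - c) / G z) • F z = ∮ z in C(c, R), (z - c)⁻¹ • f z := by
      refine circleIntegral.integral_congr hR.le fun z hz => ?_
      have := n1 hz
      have hz0 := hH0 z (Metric.sphere_subset_closedBall hz)
      simp only [hf, smul_smul, e1 z, e2 z]
      congr 1
      field_simp
    rw [e3, (hfd.mono hcV).circleIntegral_sub_inv_smul hcb, smul_smul,
      inv_mul_cancel₀ Complex.two_pi_I_ne_zero, one_smul]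

/-- The iterated slope is the Taylor quotient `H` of `G = (z - c)² H`, so its value and derivative
are the coefficients `G''/2` and `G'''/6`. The derivatives are assumed only near `c`, since the
closed formulas require `ω² - lam² ≠ 0`. -/
theorem dslope_dslope_of_hasDerivAt (hG : Differentiable ℂ G) {G₁ G₂ : ℂ → ℂ} {G₃ : ℂ}
    (h0 : G c = 0) (h1 : ∀ᶠ z in 𝓝 c, HasDerivAt G (G₁ z) z)
    (h2 : ∀ᶠ z in 𝓝 c, HasDerivAt G₁ (G₂ z) z) (h3 : HasDerivAt G₂ G₃ c) (hc : G₁ c = 0) :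
    dslope (dslope G c) c c = G₂ c / 2 ∧ deriv (dslope (dslope G c) c) c = G₃ / 6 := by
  have e1 : ∀ z, G z = (z - c) * dslope G c z := eq_mul_dslope h0
  have gc : dslope G c c = 0 := by rw [dslope_same, h1.self_of_nhds.deriv, hc]
  have e2 : ∀ z, dslope G c z = (z - c) * dslope (dslope G c) c z := eq_mul_dslope gc
  have hg := differentiable_dslope hG c
  have hHd : Differentiable ℂ (dslope (dslope G c) c) := differentiable_dslope hg c
  set H := dslope (dslope G c) c
  have hH1 : Differentiable ℂ (deriv H) := fun z => (hHd.analyticAt z).deriv.differentiableAt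
  have hH2 : Differentiable ℂ (deriv (deriv H)) := fun z =>
    (hH1.analyticAt z).deriv.differentiableAt
  have s : ∀ z, HasDerivAt (fun z : ℂ => z - c) 1 z := fun z => (hasDerivAt_id z).sub_const c
  have f1 : ∀ᶠ z in 𝓝 c, G₁ z = 2 * (z - c) * H z + (z - c) ^ 2 * deriv H z := by
    filter_upwards [h1] with z hz
    rw [hz.unique (deriv_eq_mul_of_eq hg e1 z), e2, (deriv_eq_mul_of_eq hHd e2 z).deriv]
    ring
  have f2 : ∀ᶠ z in 𝓝 c, G₂ z = 2 * H z + 4 * (z - c) * deriv H z +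
      (z - c) ^ 2 * deriv (deriv H) z := by
    filter_upwards [h2, f1.eventually_nhds] with z hz hz1
    refine (hz.congr_of_eventuallyEq (hz1.mono fun _ h => h.symm)).unique ?_
    refine ((((s z).const_mul 2).mul (hHd z).hasDerivAt).add
      (((s z).pow 2).mul (hH1 z).hasDerivAt)).congr_deriv ?_
    simp
    ring
  have v := f2.self_of_nhds
  have f3 : G₃ = 6 * deriv H c := by
    refine (h3.congr_of_eventuallyEq (f2.mono fun _ h => h.symm)).unique ?_
    refine ((((hHd c).hasDerivAt.const_mul 2).add
      (((s c).const_mul 4).mul (hH1 c).hasDerivAt)).add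
      (((s c).pow 2).mul (hH2 c).hasDerivAt)).congr_deriv ?_
    simp
    ring
  constructor
  · rw [v]; simp
  · rw [f3]; ring

end

/-! ### The threshold waves -/

/-- The contour integrals that define the threshold waves, with a weight `k`. -/
def thrWave (m : ℕ) (ω r : ℝ) (k : ℂ → ℂ) (p : ℝ × ℝ) : ℂ × ℂ :=
  (2 * (Real.pi : ℂ) * I)⁻¹ • ∮ lam in C(1, r),
    (thrG m ω lam)⁻¹ • (k lam • expWave (m + 1) lam (kappaOf ω lam) p)

theorem threshWavePlus_eq (m : ℕ) (ε r : ℝ) :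
    threshWavePlus (m + 1) ε r = thrWave m (omegaEps (m + 1) ε) r (fun _ => 1) := by
  funext p
  simp only [threshWavePlus, thrWave, threshFun_eq_thrG, one_smul]

theorem threshWaveMinus_eq (m : ℕ) (ε r : ℝ) :
    threshWaveMinus (m + 1) ε r = thrWave m (omegaEps (m + 1) ε) r (fun lam => lam - 1) := by
  funext p
  simp only [threshWaveMinus, thrWave, threshFun_eq_thrG, smul_smul, div_eq_inv_mul]

theorem isOpen_re_K_pos (ω : ℝ) : IsOpen {lam : ℂ | 0 < ((ω : ℂ) ^ 2 - lam ^ 2).re} :=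
  isOpen_lt continuous_const (by fun_prop)

theorem differentiableOn_expWave_kappaOf (ω : ℝ) (j : ℕ) (p : ℝ × ℝ) :
    DifferentiableOn ℂ (fun lam => expWave j lam (kappaOf ω lam) p)
      {lam : ℂ | 0 < ((ω : ℂ) ^ 2 - lam ^ 2).re} := fun _ hl =>
  (hasDerivAt_expWave_kappaOf (Or.inl hl) j p).differentiableAt.differentiableWithinAt

theorem closedBall_subset_re_K_pos {ω r : ℝ} (hr : r < ω - 1) :
    Metric.closedBall (1 : ℂ) r ⊆ {lam : ℂ | 0 < ((ω : ℂ) ^ 2 - lam ^ 2).re} := fun lam h =>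
  re_K_pos hr (by rwa [← dist_eq_norm])

/-! #### Two simple roots -/

/-- A nonreal root near the threshold. -/
structure IsSplitRoot (m : ℕ) (ω : ℝ) (z : ℂ) : Prop where
  omega_pos : 0 < ω
  slit : (ω : ℂ) ^ 2 - z ^ 2 ∈ slitPlane
  im_pos : 0 < z.im
  root : thrG m ω z = 0
  disp : dispersionFun ω z = 0

namespace IsSplitRoot

variable {m : ℕ} {ω r : ℝ} {z : ℂ}

theorem K_ne (h : IsSplitRoot m ω z) : (ω : ℂ) ^ 2 - z ^ 2 ≠ 0 := slitPlane_ne_zero h.slit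

theorem ne_one (h : IsSplitRoot m ω z) : z ≠ 1 := fun h0 => by
  have := h.im_pos; rw [h0] at this; simp at this

theorem ne_conj (h : IsSplitRoot m ω z) : z ≠ conj z := fun h0 => by
  have := congrArg Complex.im h0
  have h1 := h.im_pos
  rw [Complex.conj_im] at this
  linarith

theorem isMode (h : IsSplitRoot m ω z) : IsMode ω (m + 1) z (kappaOf ω z) :=
  isMode_kappaOf h.omega_pos h.K_ne h.root h.disp

theorem isMode_conj (h : IsSplitRoot m ω z) :
    IsMode ω (m + 1) (conj z) (conj (kappaOf ω z)) := h.isMode.conjugate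

theorem thrG1_ne (h : IsSplitRoot m ω z) : thrG1 ω z ≠ 0 := by
  have hd := h.disp
  have hS : sincRt 1 ((ω : ℂ) ^ 2 - z ^ 2) = (-1) ^ m / ω := sub_eq_zero.1 h.root
  rw [dispersionFun_eq] at hd
  have hz0 : z ≠ 0 := fun h0 => by have := h.im_pos; rw [h0] at this; simp at this
  have hω : (ω : ℂ) ≠ 0 := by exact_mod_cast h.omega_pos.ne'
  have hs : (-1 : ℂ) ^ m ≠ 0 := pow_ne_zero _ (by norm_num)
  rw [thrG1, sub_eq_zero.1 hd, hS, ← sub_one_mul]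
  exact neg_ne_zero.2 (div_ne_zero (mul_ne_zero hz0 (mul_ne_zero (sub_ne_zero.2 h.ne_one)
    (div_ne_zero hs hω))) h.K_ne)

theorem thrG1_conj (ω : ℝ) (z : ℂ) : thrG1 ω (conj z) = conj (thrG1 ω z) := by
  simp [thrG1, ← cosRt_conj, ← sincRt_conj]

/-- The residues at the two roots are conjugate because `thrG` and the square root commute with
conjugation. The right-hand side does not involve `r`, so the waves do not depend on the isolating
disc. -/
theorem thrWave_eq (h : IsSplitRoot m ω z) (hr : r < ω - 1) (hz : ‖z - 1‖ < r)
    (hroots : ∀ lam : ℂ, ‖lam - 1‖ ≤ r → (thrG m ω lam = 0 ↔ lam = z ∨ lam = conj z))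
    {k : ℂ → ℂ} (hk : Differentiable ℂ k) (hkc : k (conj z) = conj (k z)) :
    thrWave m ω r k = fun p => ((thrG1 ω z)⁻¹ * k z) • expWave (m + 1) z (kappaOf ω z) p +
      conj ((thrG1 ω z)⁻¹ * k z) • expWave (m + 1) (conj z) (conj (kappaOf ω z)) p := by
  funext p
  have hz' : ‖conj z - 1‖ < r := by
    rw [← map_one (starRingEnd ℂ), ← map_sub, RCLike.norm_conj]; exact hz
  have hKc : (ω : ℂ) ^ 2 - (conj z) ^ 2 ≠ 0 := by
    rw [K_conj]; exact (map_ne_zero _).2 h.K_ne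
  have d1 := hasDerivAt_thrG m h.K_ne
  have d2 := hasDerivAt_thrG m hKc
  rw [thrG1_conj] at d2
  have := circleIntegral_inv_smul_two_poles (F := fun lam => k lam •
    expWave (m + 1) lam (kappaOf ω lam) p) (differentiable_thrG m ω)
    (closedBall_subset_re_K_pos hr)
    (hk.differentiableOn.smul (differentiableOn_expWave_kappaOf ω (m + 1) p))
    (by rwa [Metric.mem_ball, dist_eq_norm]) (by rwa [Metric.mem_ball, dist_eq_norm]) h.ne_conj
    (fun lam hl => hroots lam (by rwa [← dist_eq_norm])) (by rw [d1.deriv]; exact h.thrG1_ne)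
    (by rw [d2.deriv]; simpa using h.thrG1_ne)
  rw [thrWave, this, d1.deriv, d2.deriv, kappaOf_conj h.slit, hkc, smul_smul, smul_smul, map_mul,
    map_inv₀]

end IsSplitRoot

/-! #### The double root -/

section
variable {m : ℕ} {r : ℝ}

/-- The reciprocal of the leading coefficient of `thrG` at the double root. -/
def thrLead (m : ℕ) : ℝ := -(2 * kappaThr (m + 1) ^ 2 * omegaThr (m + 1) * (-1) ^ m)

/-- The relative size of the next coefficient. -/
def thrNext (m : ℕ) : ℝ := 1 + 5 / (3 * kappaThr (m + 1) ^ 2)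

theorem thrLead_ne_zero (hm : 0 < m) : thrLead m ≠ 0 := by
  have h1 := kappaThr_pos hm
  have h2 := omegaThr_ge_one (m + 1)
  have h3 : (-1 : ℝ) ^ m ≠ 0 := pow_ne_zero _ (by norm_num)
  exact neg_ne_zero.2 (mul_ne_zero (by positivity) h3)

theorem kappaOf_thr (hm : 0 < m) : conj (kappaOf (omegaThr (m + 1)) 1) = kappaOf (omegaThr (m + 1)) 1 := by
  have h1 : ((omegaThr (m + 1) : ℝ) : ℂ) ^ 2 - 1 ^ 2 ∈ slitPlane := by
    rw [K_thr]
    left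
    norm_cast
    exact pow_pos (kappaThr_pos hm) 2
  have := kappaOf_conj h1
  rw [map_one] at this
  exact this.symm

theorem isMode_thr (hm : 0 < m) :
    IsMode (omegaThr (m + 1)) (m + 1) 1 (kappaOf (omegaThr (m + 1)) 1) :=
  isMode_kappaOf (lt_of_lt_of_le one_pos (omegaThr_ge_one _)) (K_thr_ne_zero hm) (thrG_thr_one m)
    (dispersionFun_thr_one hm)

theorem hasDerivAt_thrG2_thr (hm : 0 < m) : HasDerivAt (thrG2 (omegaThr (m + 1)))
    (-((-1) ^ m / (omegaThr (m + 1) : ℂ) * (3 / (kappaThr (m + 1) : ℂ) ^ 2 +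
      5 / ((kappaThr (m + 1) : ℂ) ^ 2) ^ 2))) 1 := by
  have hK := K_thr_ne_zero hm
  have hC := hasDerivAt_cosRt_lam 1 _ hK
  have hS := hasDerivAt_sincRt_lam 1 _ hK
  have hKd := hasDerivAt_K (omegaThr (m + 1)) 1
  have hsq : HasDerivAt (fun z : ℂ => z ^ 2) 2 1 := by simpa using hasDerivAt_pow 2 (1 : ℂ)
  rw [cos_thr hm, sinc_thr] at hS
  rw [sinc_thr] at hC
  have := (((hsq.mul hS).div hKd hK).add ((hC.sub hS).mul
    (((hasDerivAt_const (1 : ℂ) (1 : ℂ)).div hKd hK).add ((hsq.const_mul 3).div (hKd.pow 2)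
      (pow_ne_zero 2 hK))))).neg
  refine this.congr_deriv ?_
  simp only [Pi.mul_apply, Pi.sub_apply, Pi.add_apply, Pi.div_apply, Pi.pow_apply]
  rw [cos_thr hm, sinc_thr]
  rw [K_thr] at hK ⊢
  have hκ : (kappaThr (m + 1) : ℂ) ≠ 0 := by exact_mod_cast (kappaThr_pos hm).ne'
  have hω : (omegaThr (m + 1) : ℂ) ≠ 0 := by
    exact_mod_cast (lt_of_lt_of_le one_pos (omegaThr_ge_one _)).ne'
  simp
  field_simp
  ring

theorem dslope_thrG (hm : 0 < m) :
    dslope (dslope (thrG m (omegaThr (m + 1))) 1) 1 1 = ((thrLead m : ℂ))⁻¹ ∧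
    deriv (dslope (dslope (thrG m (omegaThr (m + 1))) 1) 1) 1 =
      ((thrLead m : ℂ))⁻¹ * (thrNext m : ℂ) := by
  have hK : ∀ᶠ z in 𝓝 (1 : ℂ), ((omegaThr (m + 1) : ℝ) : ℂ) ^ 2 - z ^ 2 ≠ 0 :=
    ContinuousAt.eventually_ne (by fun_prop) (K_thr_ne_zero hm)
  obtain ⟨h1, h2⟩ := dslope_dslope_of_hasDerivAt (differentiable_thrG m (omegaThr (m + 1)))
    (thrG_thr_one m) (hK.mono fun z hz => hasDerivAt_thrG m hz)
    (hK.mono fun z hz => hasDerivAt_thrG1 hz) (hasDerivAt_thrG2_thr hm) (thrG1_thr_one hm)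
  have hs := neg_one_pow_mul_self_complex m
  have hs0 : (-1 : ℂ) ^ m ≠ 0 := pow_ne_zero _ (by norm_num)
  have hκ : (kappaThr (m + 1) : ℂ) ≠ 0 := by exact_mod_cast (kappaThr_pos hm).ne'
  have hω : (omegaThr (m + 1) : ℂ) ≠ 0 := by
    exact_mod_cast (lt_of_lt_of_le one_pos (omegaThr_ge_one _)).ne'
  rw [h1, h2, thrG2, sinc_thr, cos_thr hm, K_thr]
  simp only [thrLead, thrNext]
  push_cast
  constructor
  · field_simp
    linear_combination -(kappaThr (m + 1) : ℂ) ^ 2 * hs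
  · field_simp
    linear_combination -(30 + 18 * (kappaThr (m + 1) : ℂ) ^ 2) * hs

/-- Weight `1` sees the double pole and yields the generalised wave plus a multiple of the wave;
weight `lam - 1` lowers the order and leaves the wave alone. Together they span the Jordan chain. -/
theorem thrWave_thr_eq (hm : 0 < m) (hr0 : 0 < r) (hr : r < omegaThr (m + 1) - 1)
    (hroots : ∀ lam : ℂ, ‖lam - 1‖ ≤ r → (thrG m (omegaThr (m + 1)) lam = 0 ↔ lam = 1)) :
    thrWave m (omegaThr (m + 1)) r (fun _ => 1) = (fun p =>
      (thrLead m : ℂ) • expWaveDeriv (m + 1) 1 (kappaOf (omegaThr (m + 1)) 1) p +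
      (-((thrLead m : ℂ) * thrNext m)) • expWave (m + 1) 1 (kappaOf (omegaThr (m + 1)) 1) p) ∧
    thrWave m (omegaThr (m + 1)) r (fun lam => lam - 1) = (fun p =>
      (thrLead m : ℂ) • expWave (m + 1) 1 (kappaOf (omegaThr (m + 1)) 1) p) := by
  obtain ⟨d1, d2⟩ := dslope_thrG hm
  have hl : (thrLead m : ℂ) ≠ 0 := by exact_mod_cast thrLead_ne_zero hm
  have dG : deriv (thrG m (omegaThr (m + 1))) 1 = 0 := by
    rw [(hasDerivAt_thrG m (K_thr_ne_zero hm)).deriv, thrG1_thr_one hm]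
  have hslit : ((omegaThr (m + 1) : ℝ) : ℂ) ^ 2 - 1 ^ 2 ∈ slitPlane :=
    K_mem_slitPlane hr (by simpa using hr0.le)
  have key := fun p => circleIntegral_inv_smul_double_pole (c := (1 : ℂ)) (R := r)
    (F := fun lam => expWave (m + 1) lam (kappaOf (omegaThr (m + 1)) lam) p)
    (differentiable_thrG m (omegaThr (m + 1))) (isOpen_re_K_pos _) hr0
    (closedBall_subset_re_K_pos hr) (differentiableOn_expWave_kappaOf _ (m + 1) p)
    (fun lam hl => hroots lam (by rwa [← dist_eq_norm])) dG (by rw [d1]; exact inv_ne_zero hl)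
  constructor
  · funext p
    have := (key p).1
    rw [d1, d2, (hasDerivAt_expWave_kappaOf hslit (m + 1) p).deriv, inv_inv] at this
    simp only [thrWave, one_smul]
    rw [this, sub_eq_add_neg, ← neg_smul]
    congr 3
    field_simp
  · funext p
    have := (key p).2
    rw [d1, inv_inv] at this
    rw [← this]
    simp only [thrWave, smul_smul, div_eq_inv_mul]

end

/-! ### Division by the characteristic function -/

theorem exists_factor_simple {L D : ℂ → ℂ} (hL : Differentiable ℂ L) (hD : Differentiable ℂ D)
    {z : ℂ} (h0 : D z = 0) (h1 : deriv D z ≠ 0) (hL0 : L z = 0) :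
    ∃ g, AnalyticAt ℂ g z ∧ ∀ᶠ w in 𝓝 z, L w = D w * g w := by
  have dL := differentiable_dslope hL z
  have dD := differentiable_dslope hD z
  have hne : dslope D z z ≠ 0 := by rwa [dslope_same]
  refine ⟨fun w => dslope L z w / dslope D z w, (dL.analyticAt z).div (dD.analyticAt z) hne, ?_⟩
  filter_upwards [(dD z).continuousAt.eventually_ne hne] with w hw
  rw [eq_mul_dslope hL0 w, eq_mul_dslope h0 w]
  field_simp

theorem exists_factor_double {L D : ℂ → ℂ} (hL : Differentiable ℂ L) (hD : Differentiable ℂ D)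
    {z : ℂ} (h0 : D z = 0) (h1 : deriv D z = 0) (h2 : dslope (dslope D z) z z ≠ 0) (hL0 : L z = 0)
    (hL1 : deriv L z = 0) : ∃ g, AnalyticAt ℂ g z ∧ ∀ᶠ w in 𝓝 z, L w = D w * g w := by
  have dL := differentiable_dslope hL z
  have dD := differentiable_dslope hD z
  have ddL := differentiable_dslope dL z
  have ddD := differentiable_dslope dD z
  refine ⟨fun w => dslope (dslope L z) z w / dslope (dslope D z) z w,
    (ddL.analyticAt z).div (ddD.analyticAt z) h2, ?_⟩
  filter_upwards [(ddD z).continuousAt.eventually_ne h2] with w hw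
  rw [eq_mul_dslope hL0 w, eq_mul_dslope h0 w,
    eq_mul_dslope (f := dslope L z) (c := z) (by rw [dslope_same, hL1]) w,
    eq_mul_dslope (f := dslope D z) (c := z) (by rw [dslope_same, h1]) w]
  field_simp

section
variable {m : ℕ}

/-- The identity relating `dispersionFun` to `thrG` is divided by `(z - 1)²` off the point and
extended to `z = 1` by continuity; the leading coefficient of `thrG` is known and nonzero. -/
theorem dslope_dispersionFun_thr_ne (hm : 0 < m) :
    dslope (dslope (dispersionFun (omegaThr (m + 1))) 1) 1 1 ≠ 0 := by
  set ω := omegaThr (m + 1) with hω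
  have hω0 : ω ≠ 0 := (lt_of_lt_of_le one_pos (omegaThr_ge_one _)).ne'
  have hωc : (ω : ℂ) ≠ 0 := by exact_mod_cast hω0
  have dd1 : deriv (dispersionFun ω) 1 = 0 := (isMode_thr hm).deriv_dispersionFun_eq_zero
  have dg1 : deriv (thrG m ω) 1 = 0 := by
    rw [(hasDerivAt_thrG m (K_thr_ne_zero hm)).deriv, thrG1_thr_one hm]
  have e1 := eq_mul_dslope (dispersionFun_thr_one hm)
  have e2 := eq_mul_dslope (f := dslope (dispersionFun ω) 1) (c := 1) (by rw [dslope_same, dd1])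
  have f1 := eq_mul_dslope (thrG_thr_one m)
  have f2 := eq_mul_dslope (f := dslope (thrG m ω) 1) (c := 1) (by rw [dslope_same, dg1])
  have cD := (differentiable_dslope (differentiable_dslope (differentiable_dispersionFun ω) 1) 1).continuous
  have cG := (differentiable_dslope (differentiable_dslope (differentiable_thrG m ω) 1) 1).continuous
  set Dd := dslope (dslope (dispersionFun ω) 1) 1
  set Gd := dslope (dslope (thrG m ω) 1) 1 with hGd
  have cC : Continuous (fun z : ℂ => cosRt 1 ((ω : ℂ) ^ 2 - z ^ 2)) :=
    (differentiable_cosRt 1).continuous.comp (by fun_prop)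
  have cS : Continuous (fun z : ℂ => sincRt 1 ((ω : ℂ) ^ 2 - z ^ 2)) :=
    (differentiable_sincRt 1).continuous.comp (by fun_prop)
  have key : (fun z : ℂ => Dd z * (cosRt 1 ((ω : ℂ) ^ 2 - z ^ 2) +
      z * sincRt 1 ((ω : ℂ) ^ 2 - z ^ 2))) = fun z : ℂ =>
      -((ω : ℂ) ^ 2 * Gd z * (sincRt 1 ((ω : ℂ) ^ 2 - z ^ 2) + (-1) ^ m / (ω : ℂ))) := by
    refine Continuous.ext_on (dense_compl_singleton (1 : ℂ)) (by fun_prop) (by fun_prop)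
      fun z hz => ?_
    have hz1 : z - 1 ≠ 0 := sub_ne_zero.2 hz
    have := dispersionFun_mul_eq_thrG (lam := z) m hω0
    rw [e1 z, e2 z, f1 z, f2 z] at this
    apply mul_left_cancel₀ (mul_ne_zero hz1 hz1)
    linear_combination this
  have k1 := congrFun key 1
  beta_reduce at k1
  intro h0
  have hG1 : Gd 1 ≠ 0 := by
    rw [hGd, (dslope_thrG hm).1]
    exact inv_ne_zero (by exact_mod_cast thrLead_ne_zero hm)
  rw [h0, zero_mul, sinc_thr] at k1
  have hs := sign_div_omega_ne_zero m
  have : (-1) ^ m / ((ω : ℝ) : ℂ) + (-1) ^ m / ((ω : ℝ) : ℂ) ≠ 0 := by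
    rw [← two_mul]; exact mul_ne_zero two_ne_zero hs
  exact neg_ne_zero.2 (mul_ne_zero (mul_ne_zero (pow_ne_zero 2 hωc) hG1) this) k1.symm

/-! ### Pairs of threshold waves -/

/-- The properties of the two threshold waves that the asymptotic formula uses. -/
structure IsThresholdPair (m : ℕ) (ω γ r : ℝ) (A B : ℝ × ℝ → ℂ × ℂ) : Prop where
  smooth : ∃ β, 0 < β ∧ β < γ ∧ SmoothSol ω β A ∧ SmoothSol ω β B
  realA : RealSection A
  realB : RealSection B
  orth : ∀ {j : ℕ} {lam κ : ℂ}, IsMode ω j lam κ → lam.im = 0 → lam ≠ 1 →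
    qForm (expWave j lam κ) A = 0 ∧ qForm (expWave j lam κ) B = 0
  resolve : ∀ {u v : ℝ × ℝ → ℂ}, IsHomogeneous ω γ u v → qEta u v A = 0 → qEta u v B = 0 →
    ∀ z : ℂ, ‖z - 1‖ ≤ r → thrG m ω z = 0 →
      ∃ g, AnalyticAt ℂ g z ∧ ∀ᶠ w in 𝓝 z, leftPair ω u v w = dispersionFun ω w * g w

/-- The weights `1` and `lam - 1` at `z` and `conj z` form an invertible Vandermonde system, so zero
flux through both threshold waves gives zero flux through both exponentials. The wave at `z`
controls `leftPair` at `conj z` and conversely. -/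
theorem IsSplitRoot.isThresholdPair {ω γ r : ℝ} {z : ℂ} (h : IsSplitRoot m ω z) (hω : 1 < ω)
    (hzγ : z.im < γ) (hr : r < ω - 1) (hz : ‖z - 1‖ < r)
    (hroots : ∀ lam : ℂ, ‖lam - 1‖ ≤ r → (thrG m ω lam = 0 ↔ lam = z ∨ lam = conj z)) :
    IsThresholdPair m ω γ r (thrWave m ω r (fun _ => 1)) (thrWave m ω r (fun lam => lam - 1)) := by
  rw [h.thrWave_eq hr hz hroots (differentiable_const _) (by simp),
    h.thrWave_eq hr hz hroots (by fun_prop) (by simp)]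
  have hM := h.isMode
  have hM' := h.isMode_conj
  obtain ⟨β, hβ1, hβ2⟩ := exists_between hzγ
  have hβ0 : 0 < β := h.im_pos.trans hβ1
  have b1 : |z.im| < β := by rwa [abs_of_pos h.im_pos]
  have b2 : |(conj z).im| < β := by rwa [Complex.conj_im, abs_neg]
  have sm : ∀ c : ℂ, SmoothSol ω β (fun p => c • expWave (m + 1) z (kappaOf ω z) p +
      conj c • expWave (m + 1) (conj z) (conj (kappaOf ω z)) p) := fun c =>
    ((hM.smoothSol b1).smul c).add ((hM'.smoothSol b2).smul (conj c))
  refine ⟨⟨β, hβ0, hβ2, sm _, sm _⟩, realSection_add_conj _ _ _ _, realSection_add_conj _ _ _ _,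
    fun {j lam κ} hm hl _ => ?_, fun {u v} huv hA hB w hw hw0 => ?_⟩
  · have hl' : |lam.im| < β := by rwa [hl, abs_zero]
    have o1 : lam ≠ conj z := fun h0 => by
      rw [h0, Complex.conj_im, neg_eq_zero] at hl; exact h.im_pos.ne' hl
    have o2 : lam ≠ conj (conj z) := fun h0 => by
      rw [h0, Complex.conj_conj] at hl; exact h.im_pos.ne' hl
    have o : ∀ c : ℂ, qForm (expWave j lam κ) (fun p => c • expWave (m + 1) z (kappaOf ω z) p +
        conj c • expWave (m + 1) (conj z) (conj (kappaOf ω z)) p) = 0 := fun c => by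
      rw [qForm_add_right (hm.smoothSol hl') ((hM.smoothSol b1).smul c)
        ((hM'.smoothSol b2).smul (conj c)), qForm_smul_right, qForm_smul_right,
        hm.qForm_eq_zero hM o1, hm.qForm_eq_zero hM' o2]
      simp
    exact ⟨o _, o _⟩
  · have lin : ∀ c : ℂ, qEta u v (fun p => c • expWave (m + 1) z (kappaOf ω z) p +
        conj c • expWave (m + 1) (conj z) (conj (kappaOf ω z)) p) =
        conj c * qEta u v (expWave (m + 1) z (kappaOf ω z)) +
        c * qEta u v (expWave (m + 1) (conj z) (conj (kappaOf ω z))) := fun c => by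
      rw [qEta_add_right huv.memU huv.memV ((hM.smoothSol b1).smul c)
        ((hM'.smoothSol b2).smul (conj c)), qEta_smul_right, qEta_smul_right, Complex.conj_conj]
    rw [lin] at hA hB
    simp only [mul_one] at hA
    set c := (thrG1 ω z)⁻¹
    have hc : c ≠ 0 := inv_ne_zero h.thrG1_ne
    have hcc : conj c ≠ 0 := (map_ne_zero _).2 hc
    have hd : conj z - z ≠ 0 := sub_ne_zero.2 h.ne_conj.symm
    rw [map_mul, map_sub, map_one] at hB
    have q1 : qEta u v (expWave (m + 1) z (kappaOf ω z)) = 0 := by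
      apply (mul_eq_zero.1 (_ : (conj c * (conj z - z)) * _ = 0)).resolve_left
        (mul_ne_zero hcc hd)
      linear_combination hB - (z - 1) * hA
    rw [q1, mul_zero, zero_add] at hA
    have q2 := (mul_eq_zero.1 hA).resolve_left hc
    have L1 := hM.leftPair_eq_zero huv.memU huv.memV q1
    have L2 := hM'.leftPair_eq_zero huv.memU huv.memV q2
    rw [Complex.conj_conj] at L2
    have hz1 := h.ne_one
    have hz1' : conj z ≠ 1 := fun h0 => hz1 (by
      rw [← Complex.conj_conj z, h0, map_one])
    rcases (hroots w hw).1 hw0 with rfl | rfl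
    · exact exists_factor_simple (differentiable_leftPair huv) (differentiable_dispersionFun ω)
        hM.dispersionFun_eq_zero
        (deriv_dispersionFun_ne_zero hω hM.dispersionFun_eq_zero hz1) L2
    · exact exists_factor_simple (differentiable_leftPair huv) (differentiable_dispersionFun ω)
        hM'.dispersionFun_eq_zero
        (deriv_dispersionFun_ne_zero hω hM'.dispersionFun_eq_zero hz1') L1

/-- The system is triangular: the second wave gives the value of `leftPair` at `1`, the first then
its derivative. -/
theorem isThresholdPair_thr {γ r : ℝ} (hm : 0 < m) (hγ : 0 < γ) (hr0 : 0 < r)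
    (hr : r < omegaThr (m + 1) - 1)
    (hroots : ∀ lam : ℂ, ‖lam - 1‖ ≤ r → (thrG m (omegaThr (m + 1)) lam = 0 ↔ lam = 1)) :
    IsThresholdPair m (omegaThr (m + 1)) γ r (thrWave m (omegaThr (m + 1)) r (fun _ => 1))
      (thrWave m (omegaThr (m + 1)) r (fun lam => lam - 1)) := by
  obtain ⟨eA, eB⟩ := thrWave_thr_eq hm hr0 hr hroots
  rw [eA, eB]
  have hM := isMode_thr hm
  have hκ := kappaOf_thr hm
  obtain ⟨β, hβ0, hβ2⟩ := exists_between hγ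
  have b1 : |(1 : ℂ).im| < β := by simpa using hβ0
  have hl : (thrLead m : ℂ) ≠ 0 := by exact_mod_cast thrLead_ne_zero hm
  have sT := hM.smoothSol b1
  have sE := hM.smoothSol_deriv hβ0
  have rT : RealSection (expWave (m + 1) 1 (kappaOf (omegaThr (m + 1)) 1)) :=
    realSection_expWave (map_one _) hκ
  have rE : RealSection (expWaveDeriv (m + 1) 1 (kappaOf (omegaThr (m + 1)) 1)) :=
    realSection_expWaveDeriv hκ
  have c1 : conj (thrLead m : ℂ) = thrLead m := Complex.conj_ofReal _
  have c2 : conj (-((thrLead m : ℂ) * thrNext m)) = -((thrLead m : ℂ) * thrNext m) := by simp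
  refine ⟨⟨β, hβ0, hβ2, (sE.smul _).add (sT.smul _), sT.smul _⟩, (rE.smul c1).add (rT.smul c2),
    rT.smul c1, fun {j lam κ} hm' hl' hne => ?_, fun {u v} huv hA hB w hw hw0 => ?_⟩
  · have b2 : |lam.im| < β := by rwa [hl', abs_zero]
    have o1 := hm'.qForm_eq_zero hM (by simpa using hne)
    have o2 := hm'.qForm_deriv_eq_zero hM hne
    constructor
    · rw [qForm_add_right (hm'.smoothSol b2) (sE.smul _) (sT.smul _), qForm_smul_right,
        qForm_smul_right, o1, o2]
      simp
    · rw [qForm_smul_right, o1, mul_zero]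
  · rw [qEta_smul_right] at hB
    have q1 := (mul_eq_zero.1 hB).resolve_left ((map_ne_zero _).2 hl)
    rw [qEta_add_right huv.memU huv.memV (sE.smul _) (sT.smul _), qEta_smul_right,
      qEta_smul_right, q1, mul_zero, add_zero] at hA
    have q2 := (mul_eq_zero.1 hA).resolve_left ((map_ne_zero _).2 hl)
    have L0 := hM.leftPair_eq_zero huv.memU huv.memV q1
    have L1 := (hM.hasDerivAt_leftPair_zero huv.memU huv.memV q1 q2).deriv
    rw [map_one] at L0
    rw [(hroots w hw).1 hw0]
    exact exists_factor_double (differentiable_leftPair huv) (differentiable_dispersionFun _)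
      (dispersionFun_thr_one hm) hM.deriv_dispersionFun_eq_zero (dslope_dispersionFun_thr_ne hm)
      L0 L1

/-! ### The normalising factors near the threshold -/

/-- The purpose of the contour integrals: as the roots merge the individual residue coefficients
blow up, but the circle stays away from the roots and the integrand is continuous in the frequency.
-/
theorem continuousAt_qForm_thrWave {ω₀ r : ℝ} (hr0 : 0 < r) (hr : r < ω₀ - 1)
    (hne : ∀ lam ∈ Metric.sphere (1 : ℂ) r, thrG m ω₀ lam ≠ 0) {k k' : ℂ → ℂ} (hk : Continuous k)
    (hk' : Continuous k') :
    ContinuousAt (fun ω => qForm (thrWave m ω r k) (thrWave m ω r k')) ω₀ := by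
  set J : Set ℝ := {ω | r < ω - 1 ∧ ∀ lam ∈ Metric.sphere (1 : ℂ) r, thrG m ω lam ≠ 0} with hJ
  have hJn : J ∈ 𝓝 ω₀ := by
    have h1 : ∀ᶠ ω : ℝ in 𝓝 ω₀, r < ω - 1 :=
      (continuous_id.sub continuous_const).continuousAt.eventually (lt_mem_nhds hr)
    have h2 : ∀ᶠ ω : ℝ in 𝓝 ω₀, ∀ lam ∈ Metric.sphere (1 : ℂ) r, thrG m ω lam ≠ 0 :=
      (isCompact_sphere (1 : ℂ) r).eventually_forall_of_forall_eventually fun lam hl =>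
        (continuous_thrG m (p := (ω₀, lam)) (by change ω₀ ≠ 0; linarith)).eventually_ne (y := 0)
          (hne lam hl)
    exact h1.and h2
  have hw : ∀ {k : ℂ → ℂ}, Continuous k →
      Continuous (fun q : J × ℝ => thrWave m (q.1 : ℝ) r k (q.2, 0)) := by
    intro k hk
    have hmem : ∀ θ : ℝ, circleMap 1 r θ ∈ Metric.sphere (1 : ℂ) r :=
      circleMap_mem_sphere 1 hr0.le
    have hc : Continuous (fun x : (J × ℝ) × ℝ => circleMap 1 r x.2) :=
      (continuous_circleMap 1 r).comp continuous_snd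
    have hω : Continuous (fun x : (J × ℝ) × ℝ => (x.1.1 : ℝ)) := by fun_prop
    have hG : Continuous (fun x : (J × ℝ) × ℝ => thrG m (x.1.1 : ℝ) (circleMap 1 r x.2)) := by
      refine continuous_iff_continuousAt.2 fun x => ?_
      have hx : ((x.1.1 : ℝ), circleMap 1 r x.2).1 ≠ 0 := by
        have := x.1.1.2.1
        change (x.1.1 : ℝ) ≠ 0
        linarith
      exact ContinuousAt.comp (g := fun p : ℝ × ℂ => thrG m p.1 p.2)
        (f := fun x : (J × ℝ) × ℝ => ((x.1.1 : ℝ), circleMap 1 r x.2)) (continuous_thrG m hx)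
        (hω.prodMk hc).continuousAt
    have hGi := hG.inv₀ fun x => x.1.1.2.2 _ (hmem x.2)
    have hκ : Continuous (fun x : (J × ℝ) × ℝ => kappaOf (x.1.1 : ℝ) (circleMap 1 r x.2)) := by
      refine Continuous.cpow (by fun_prop) continuous_const fun x => ?_
      exact K_mem_slitPlane x.1.1.2.1 (by
        rw [← dist_eq_norm]; exact (Metric.mem_sphere.1 (hmem x.2)).le)
    have hx : Continuous (fun x : (J × ℝ) × ℝ => ((x.1.2 : ℝ) : ℂ)) := by fun_prop
    have hI : Continuous (Function.uncurry fun (q : J × ℝ) (θ : ℝ) => deriv (circleMap 1 r) θ •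
        ((thrG m (q.1 : ℝ) (circleMap 1 r θ))⁻¹ • (k (circleMap 1 r θ) •
          expWave (m + 1) (circleMap 1 r θ) (kappaOf (q.1 : ℝ) (circleMap 1 r θ)) (q.2, 0)))) := by
      simp only [Function.uncurry_def, deriv_circleMap, expWave]
      have hc0 : Continuous (fun x : (J × ℝ) × ℝ => circleMap 0 r x.2) :=
        (continuous_circleMap 0 r).comp continuous_snd
      have he : Continuous (fun x : (J × ℝ) × ℝ =>
          cexp (-I * circleMap 1 r x.2 * ((0 : ℝ) : ℂ))) := by fun_prop
      have hp : Continuous (fun x : (J × ℝ) × ℝ =>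
          (Complex.sin (kappaOf (x.1.1 : ℝ) (circleMap 1 r x.2) * ((x.1.2 : ℝ) : ℂ)),
            (-1 : ℂ) ^ (m + 1 + 1) * I * Complex.sin (kappaOf (x.1.1 : ℝ) (circleMap 1 r x.2) *
              (((x.1.2 : ℝ) : ℂ) - 1)))) :=
        (Complex.continuous_sin.comp (hκ.mul hx)).prodMk (continuous_const.mul
          (Complex.continuous_sin.comp (hκ.mul (hx.sub continuous_const))))
      exact (hc0.mul continuous_const).smul (hGi.smul ((hk.comp hc).smul (he.smul hp)))
    have hJ := intervalIntegral.continuous_parametric_intervalIntegral_of_continuous' (μ := volume)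
      hI 0 (2 * Real.pi)
    exact hJ.const_smul ((2 * (Real.pi : ℂ) * I)⁻¹)
  have hcont : ContinuousOn (fun ω => qForm (thrWave m ω r k) (thrWave m ω r k')) J := by
    rw [continuousOn_iff_continuous_domRestrict]
    have h1 := hw hk
    have h2 := hw hk'
    unfold qForm
    refine Continuous.neg ?_
    refine intervalIntegral.continuous_parametric_intervalIntegral_of_continuous'
      (f := fun (q : J) (x : ℝ) => (thrWave m q r k (x, 0)).1 * conj (thrWave m q r k' (x, 0)).2 -
        (thrWave m q r k (x, 0)).2 * conj (thrWave m q r k' (x, 0)).1) ?_ 0 1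
    exact (h1.fst.mul (Complex.continuous_conj.comp h2.snd)).sub
      (h1.snd.mul (Complex.continuous_conj.comp h2.fst))
  exact hcont.continuousAt hJn

theorem qForm_thrWave_thr {r : ℝ} (hm : 0 < m) (hr0 : 0 < r) (hr : r < omegaThr (m + 1) - 1)
    (hroots : ∀ lam : ℂ, ‖lam - 1‖ ≤ r → (thrG m (omegaThr (m + 1)) lam = 0 ↔ lam = 1)) :
    I * qForm (thrWave m (omegaThr (m + 1)) r (fun _ => 1))
        (thrWave m (omegaThr (m + 1)) r (fun _ => 1)) =
      ((thrLead m ^ 2 * (1 / (6 * omegaThr (m + 1) * kappaThr (m + 1) ^ 2) +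
        thrNext m / omegaThr (m + 1)) : ℝ) : ℂ) ∧
    -I * qForm (thrWave m (omegaThr (m + 1)) r (fun _ => 1))
        (thrWave m (omegaThr (m + 1)) r (fun lam => lam - 1)) =
      ((thrLead m ^ 2 / (2 * omegaThr (m + 1)) : ℝ) : ℂ) ∧
    qForm (thrWave m (omegaThr (m + 1)) r (fun lam => lam - 1))
        (thrWave m (omegaThr (m + 1)) r (fun lam => lam - 1)) = 0 := by
  obtain ⟨eA, eB⟩ := thrWave_thr_eq hm hr0 hr hroots
  rw [eA, eB]
  have hM := isMode_thr hm
  have hκ := kappaOf_thr hm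
  have sT := hM.smoothSol (β := 1) (by simp)
  have sE := hM.smoothSol_deriv (β := 1) one_pos
  have q1 := hM.qForm_self_one hκ
  have q2 := hM.qForm_expWave_deriv hκ
  have q3 := hM.qForm_deriv_deriv hκ
  have hsq : kappaOf (omegaThr (m + 1)) 1 ^ 2 = (kappaThr (m + 1) : ℂ) ^ 2 := by
    rw [hM.sq, K_thr]
  rw [hsq] at q3
  set T := expWave (m + 1) 1 (kappaOf (omegaThr (m + 1)) 1)
  set E := expWaveDeriv (m + 1) 1 (kappaOf (omegaThr (m + 1)) 1)
  have q4 : qForm E T = I / (2 * omegaThr (m + 1)) := by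
    rw [qForm_conj, q2, map_div₀, Complex.conj_I, map_mul, Complex.conj_ofReal, map_ofNat]
    ring
  have c1 : conj (thrLead m : ℂ) = thrLead m := Complex.conj_ofReal _
  have c2 : conj (-((thrLead m : ℂ) * thrNext m)) = -((thrLead m : ℂ) * thrNext m) := by simp
  refine ⟨?_, ?_, ?_⟩
  · rw [qForm_add_left ((sE.smul _).add (sT.smul _)) (sE.smul _) (sT.smul _), qForm_smul_left,
      qForm_smul_left, qForm_add_right sE (sE.smul _) (sT.smul _),
      qForm_add_right sT (sE.smul _) (sT.smul _), qForm_smul_right, qForm_smul_right,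
      qForm_smul_right, qForm_smul_right, c1, c2, q1, q2, q3, q4]
    push_cast
    linear_combination (-((thrLead m : ℂ) ^ 2 * (1 / (6 * omegaThr (m + 1) *
      (kappaThr (m + 1) : ℂ) ^ 2) + thrNext m / omegaThr (m + 1)))) * Complex.I_sq
  · rw [qForm_add_left (sT.smul _) (sE.smul _) (sT.smul _), qForm_smul_left,
      qForm_smul_left, qForm_smul_right, qForm_smul_right, c1, q1, q4]
    push_cast
    linear_combination (-((thrLead m : ℂ) ^ 2 / (2 * omegaThr (m + 1)))) * Complex.I_sq
  · rw [qForm_smul_left, qForm_smul_right, q1]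
    simp

/-- The constants `a`, `b`, `c` at a general frequency. -/
theorem eventually_normalization_pos {r : ℝ} (hm : 0 < m) (hr0 : 0 < r)
    (hr : r < omegaThr (m + 1) - 1)
    (hroots : ∀ lam : ℂ, ‖lam - 1‖ ≤ r → (thrG m (omegaThr (m + 1)) lam = 0 ↔ lam = 1)) :
    ∀ᶠ ω in 𝓝 (omegaThr (m + 1)), ∃ a b c : ℝ, 0 < a ∧ b ≠ 0 ∧ 0 < a + (a / b) ^ 2 * c ∧
      (I * qForm (thrWave m ω r (fun _ => 1)) (thrWave m ω r (fun _ => 1))).re = a ∧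
      (-I * qForm (thrWave m ω r (fun _ => 1)) (thrWave m ω r (fun lam => lam - 1))).re = b ∧
      (-I * qForm (thrWave m ω r (fun lam => lam - 1))
        (thrWave m ω r (fun lam => lam - 1))).re = c := by
  obtain ⟨h1, h2, h3⟩ := qForm_thrWave_thr hm hr0 hr hroots
  have hne : ∀ lam ∈ Metric.sphere (1 : ℂ) r, thrG m (omegaThr (m + 1)) lam ≠ 0 := by
    intro lam hl h0
    rw [mem_sphere_iff_norm] at hl
    rw [(hroots lam hl.le).1 h0, sub_self, norm_zero] at hl
    exact hr0.ne hl
  have ca := (continuousAt_const (y := I)).mul (continuousAt_qForm_thrWave hr0 hr hne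
    (continuous_const (y := (1 : ℂ))) (continuous_const (y := (1 : ℂ))))
  have cb := (continuousAt_const (y := -I)).mul (continuousAt_qForm_thrWave hr0 hr hne
    (continuous_const (y := (1 : ℂ))) (continuous_id.sub (continuous_const (y := (1 : ℂ)))))
  have cc := (continuousAt_const (y := -I)).mul (continuousAt_qForm_thrWave hr0 hr hne
    (continuous_id.sub (continuous_const (y := (1 : ℂ))))
    (continuous_id.sub (continuous_const (y := (1 : ℂ)))))
  have ca' := Complex.continuous_re.continuousAt.comp ca
  have cb' := Complex.continuous_re.continuousAt.comp cb
  have cc' := Complex.continuous_re.continuousAt.comp cc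
  have hl := thrLead_ne_zero hm
  have hω : 0 < omegaThr (m + 1) := lt_of_lt_of_le one_pos (omegaThr_ge_one _)
  have hκ := kappaThr_pos hm
  have pn : 0 < thrNext m := by unfold thrNext; positivity
  have pa : 0 < (I * qForm (thrWave m (omegaThr (m + 1)) r (fun _ => 1))
      (thrWave m (omegaThr (m + 1)) r (fun _ => 1))).re := by
    rw [h1, Complex.ofReal_re]; positivity
  have pb : (-I * qForm (thrWave m (omegaThr (m + 1)) r (fun _ => 1))
      (thrWave m (omegaThr (m + 1)) r (fun lam => lam - 1))).re ≠ 0 := by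
    rw [h2, Complex.ofReal_re]; positivity
  have pc := pa
  have h3' : (-I * qForm (thrWave m (omegaThr (m + 1)) r (fun lam => lam - 1))
      (thrWave m (omegaThr (m + 1)) r (fun lam => lam - 1))).re = 0 := by rw [h3]; simp
  -- At the threshold `c = 0`, so the normalising expression reduces to `a`, which is positive.
  have cn := ca'.add (((ca'.div cb' pb).pow 2).mul cc')
  filter_upwards [ca'.eventually (lt_mem_nhds pa), cb'.eventually_ne pb,
    cn.eventually (lt_mem_nhds (a := 0) (by
      simp only [Pi.add_apply, Pi.mul_apply, Pi.pow_apply, Pi.div_apply, Function.comp_apply]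
      refine lt_of_lt_of_eq pa ?_
      rw [left_eq_add]
      exact mul_eq_zero_of_right _ h3'))] with ω e1 e2 e3
  exact ⟨_, _, _, e1, e2, e3, rfl, rfl, rfl⟩

end

/-! ### Expansion in a biorthogonal family of waves -/

section
variable {ω β γ : ℝ} {u v u' v' : ℝ × ℝ → ℂ}

theorem IsHomogeneous.sub (h : IsHomogeneous ω γ u v) (h' : IsHomogeneous ω γ u' v') :
    IsHomogeneous ω γ (fun p => u p - u' p) (fun p => v p - v' p) := by
  refine ⟨?_, ?_, ?_, ?_⟩
  · simpa [sub_eq_add_neg] using h.memU.add (h'.memU.const_mul (-1))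
  · simpa [sub_eq_add_neg] using h.memV.add (h'.memV.const_mul (-1))
  · have f1 := (h.memV.const_mul ω).const_mul (-1)
    have f2 := (h'.memV.const_mul ω).const_mul (-1)
    have := h.eqU.sub h'.eqU h.memU h'.memU (by simpa using f1) (by simpa using f2)
    convert this using 2
    ring
  · have := h.eqV.sub h'.eqV h.memV h'.memV (h.memU.const_mul ω) (h'.memU.const_mul ω)
    convert this using 2
    ring

/-- A solution of the homogeneous problem is determined by its fluxes through a family of waves
which is orthogonal with respect to `qForm` and resolves all roots in the strip. -/
theorem IsHomogeneous.ae_eq_sum {ι : Type*} [DecidableEq ι] {s : Finset ι}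
    {W : ι → ℝ × ℝ → ℂ × ℂ} {d : ι → ℂ} (h : IsHomogeneous ω γ u v) (hω : 1 ≤ ω) (hγ : 0 < γ)
    (hβ : β < γ) (hW : ∀ i ∈ s, SmoothSol ω β (W i)) (hd : ∀ i ∈ s, d i ≠ 0)
    (hq : ∀ i ∈ s, ∀ k ∈ s, qForm (W i) (W k) = if i = k then d k else 0)
    (hres : ∀ u v : ℝ × ℝ → ℂ, IsHomogeneous ω γ u v → (∀ i ∈ s, qEta u v (W i) = 0) →
      PairVanishes ω γ u v) :
    ∀ᵐ p ∂(volume.restrict strip), (u p, v p) = ∑ i ∈ s, (qEta u v (W i) / d i) • W i p := by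
  set c : ι → ℂ := fun i => qEta u v (W i) / d i
  have hS := SmoothSol.sum s c hW
  have hH := hS.isHomogeneous hβ
  -- The Gram matrix is diagonal, so subtracting the sum removes every flux and uniqueness applies
  -- to the remainder.
  have h0 := (h.sub hH).ae_eq_zero hω hγ (hres _ _ (h.sub hH) fun k hk => by
    rw [qEta_sub_left h.memU h.memV hH.memU hH.memV (hW k hk), qEta_eq_qForm hS (hW k hk),
      qForm_sum_left s c hW (hW k hk), Finset.sum_congr rfl fun i hi => by rw [hq i hi k hk]]
    simp only [mul_ite, mul_zero, Finset.sum_ite_eq', hk, if_true]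
    rw [div_mul_cancel₀ _ (hd k hk), sub_self])
  filter_upwards [h0] with p hp
  exact Prod.ext (sub_eq_zero.1 hp.1) (sub_eq_zero.1 hp.2)

end

/-! ### The oscillatory waves -/

section
variable {ω : ℝ}

/-- `κ` is a solution of `sin κ / κ = (-1)^n / ω` in `(nπ, (n+1)π)` with `κ cot κ ≠ 1`. -/
structure IsOsc (ω : ℝ) (n : ℕ) (κ : ℝ) : Prop where
  pos : 0 < ω
  mem : κ ∈ Ioo (n * Real.pi) ((n + 1) * Real.pi)
  sinc : (-1) ^ n * Real.sinc κ = 1 / ω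
  ne_one : κ * Real.cot κ ≠ 1

theorem isOsc_kappaMinus {n : ℕ} (hω : omegaThr (n + 1) < ω) :
    IsOsc ω n (kappaMinus ω (n + 1)) ∧
      kappaMinus ω (n + 1) * Real.cot (kappaMinus ω (n + 1)) < 1 := by
  obtain ⟨h1, h2⟩ := kappaMinus_spec hω
  have h3 := mul_cot_lt_one h1
  exact ⟨⟨(zero_lt_one.trans_le (omegaThr_ge_one _)).trans hω,
    ⟨(kappaThr_mem n).1.trans_lt h1.1, h1.2⟩, h2, h3.ne⟩, h3⟩

theorem isOsc_kappaPlus {n : ℕ} (hn : 0 < n) (hω : omegaThr (n + 1) < ω) :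
    IsOsc ω n (kappaPlus ω (n + 1)) ∧
      1 < kappaPlus ω (n + 1) * Real.cot (kappaPlus ω (n + 1)) := by
  obtain ⟨h1, h2⟩ := kappaPlus_spec hn hω
  have h3 := mul_cot_gt_one h1
  exact ⟨⟨(zero_lt_one.trans_le (omegaThr_ge_one _)).trans hω,
    ⟨h1.1, h1.2.trans (kappaThr_mem n).2⟩, h2, h3.ne'⟩, h3⟩

namespace IsOsc

variable {n n' : ℕ} {κ κ' : ℝ}

theorem kappa_pos (h : IsOsc ω n κ) : 0 < κ :=
  lt_of_le_of_lt (by have := Real.pi_pos; positivity) h.mem.1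

theorem index_le (h : IsOsc ω n κ) (h' : IsOsc ω n' κ) : n ≤ n' := by
  have h1 := h.mem.1.trans h'.mem.2
  have h2 : (n : ℝ) < n' + 1 := lt_of_mul_lt_mul_right h1 Real.pi_pos.le
  exact Nat.lt_succ_iff.1 (by exact_mod_cast h2)

theorem index_eq (h : IsOsc ω n κ) (h' : IsOsc ω n' κ) : n = n' :=
  le_antisymm (h.index_le h') (h'.index_le h)

theorem eq_of_mul_cot_eq (h : IsOsc ω n κ) (h' : IsOsc ω n' κ')
    (he : κ * Real.cot κ = κ' * Real.cot κ') : κ = κ' := by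
  have h1 := sq_mul_cot_add_sq h.pos.ne' h.kappa_pos.ne' h.sinc
  have h2 := sq_mul_cot_add_sq h'.pos.ne' h'.kappa_pos.ne' h'.sinc
  rw [he] at h1
  exact (sq_eq_sq₀ h.kappa_pos.le h'.kappa_pos.le).1 (by linarith)

theorem smoothSol (h : IsOsc ω n κ) {β : ℝ} (hβ : 0 < β) : SmoothSol ω β (oscWave ω (n + 1) κ) :=
  smoothSol_oscWave h.pos h.kappa_pos.ne' h.sinc hβ

theorem qForm_ne (h : IsOsc ω n κ) (h' : IsOsc ω n' κ')
    (hne : κ * Real.cot κ ≠ κ' * Real.cot κ') :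
    qForm (oscWave ω (n + 1) κ) (oscWave ω (n' + 1) κ') = 0 :=
  qForm_oscWave_ne h.pos h.kappa_pos.ne' h.sinc h'.kappa_pos.ne' h'.sinc hne

theorem qForm_self_of_gt (h : IsOsc ω n κ) (h1 : 1 < κ * Real.cot κ) :
    qForm (oscWave ω (n + 1) κ) (oscWave ω (n + 1) κ) = I := by
  rw [qForm_oscWave_self h.pos h.kappa_pos.ne' h.sinc h.ne_one, abs_of_pos (sub_pos.2 h1),
    div_self (sub_pos.2 h1).ne', Complex.ofReal_one, mul_one]

theorem qForm_self_of_lt (h : IsOsc ω n κ) (h1 : κ * Real.cot κ < 1) :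
    qForm (oscWave ω (n + 1) κ) (oscWave ω (n + 1) κ) = -I := by
  rw [qForm_oscWave_self h.pos h.kappa_pos.ne' h.sinc h.ne_one, abs_of_neg (sub_neg.2 h1),
    div_neg, div_self (sub_neg.2 h1).ne, Complex.ofReal_neg, Complex.ofReal_one, mul_neg_one]

theorem qForm_thresholdPair (h : IsOsc ω n κ) {m : ℕ} {γ r : ℝ} {A B : ℝ × ℝ → ℂ × ℂ}
    (hP : IsThresholdPair m ω γ r A B) :
    qForm (oscWave ω (n + 1) κ) A = 0 ∧ qForm (oscWave ω (n + 1) κ) B = 0 := by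
  obtain ⟨h1, h2⟩ := hP.orth (isMode_of_sinc h.pos h.kappa_pos.ne' h.sinc) (Complex.ofReal_im _)
    (by exact_mod_cast h.ne_one)
  exact ⟨qForm_oscWave_left h1, qForm_oscWave_left h2⟩

theorem leftPair_factor (h : IsOsc ω n κ) (hω : 1 < ω) {γ : ℝ} {u v : ℝ × ℝ → ℂ}
    (hz : IsHomogeneous ω γ u v) (h0 : qEta u v (oscWave ω (n + 1) κ) = 0) :
    ∃ g, AnalyticAt ℂ g ((κ * Real.cot κ : ℝ) : ℂ) ∧
      ∀ᶠ w in 𝓝 ((κ * Real.cot κ : ℝ) : ℂ), leftPair ω u v w = dispersionFun ω w * g w := by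
  have hM := isMode_of_sinc h.pos h.kappa_pos.ne' h.sinc
  exact exists_factor_simple (differentiable_leftPair hz) (differentiable_dispersionFun ω)
    hM.dispersionFun_eq_zero
    (deriv_dispersionFun_ne_zero hω hM.dispersionFun_eq_zero (by exact_mod_cast h.ne_one))
    (leftPair_oscWave_eq_zero h.pos h.kappa_pos.ne' h.sinc h.ne_one hz.memU hz.memV h0)

end IsOsc

end

/-! ### Normalised threshold waves -/

section
variable {ω β : ℝ} {A B w : ℝ × ℝ → ℂ × ℂ}

/-- The combination `d (A + α B)` of two waves. -/
def comb (d α : ℂ) (A B : ℝ × ℝ → ℂ × ℂ) (p : ℝ × ℝ) : ℂ × ℂ := d • (A p + α • B p)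

theorem SmoothSol.comb (hA : SmoothSol ω β A) (hB : SmoothSol ω β B) (d α : ℂ) :
    SmoothSol ω β (comb d α A B) := (hA.add (hB.smul α)).smul d

theorem qForm_comb_right (hw : SmoothSol ω β w) (hA : SmoothSol ω β A) (hB : SmoothSol ω β B)
    (d α : ℂ) : qForm w (DiracStrip.comb d α A B) =
      conj d * (qForm w A + conj α * qForm w B) := by
  rw [← qForm_smul_right w B, ← qForm_add_right hw hA (hB.smul α), ← qForm_smul_right]
  rfl

theorem qForm_comb_left (hw : SmoothSol ω β w) (hA : SmoothSol ω β A) (hB : SmoothSol ω β B)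
    (d α : ℂ) : qForm (DiracStrip.comb d α A B) w = d * (qForm A w + α * qForm B w) := by
  rw [← qForm_smul_left B w, ← qForm_add_left hw hA (hB.smul α), ← qForm_smul_left]
  rfl

theorem qEta_comb {γ : ℝ} {u v : ℝ × ℝ → ℂ} (hu : MemTempered γ u) (hv : MemTempered γ v)
    (hA : SmoothSol ω β A) (hB : SmoothSol ω β B) (d α : ℂ) :
    qEta u v (DiracStrip.comb d α A B) = conj d * (qEta u v A + conj α * qEta u v B) := by
  rw [← qEta_smul_right u v B, ← qEta_add_right hu hv hA (hB.smul α), ← qEta_smul_right]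
  rfl

/-- The Gram matrix is `q(A,A) = -ia`, `q(A,B) = q(B,A) = ib`, `q(B,B) = ic`. The choice `α = a/b`
makes `A + αB` orthogonal to `A`, and then its self-pairing is `i(a + α²c)`. -/
theorem qForm_normalised (hA : SmoothSol ω β A) (hB : SmoothSol ω β B) (rA : RealSection A)
    (rB : RealSection B) {a b c : ℝ} (ha : 0 < a) (hb : b ≠ 0) (hc : 0 < a + (a / b) ^ 2 * c)
    (ea : (I * qForm A A).re = a) (eb : (-I * qForm A B).re = b)
    (ec : (-I * qForm B B).re = c) :
    qForm (comb ((Real.sqrt (a + (a / b) ^ 2 * c) : ℝ) : ℂ)⁻¹ ((a / b : ℝ) : ℂ) A B)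
      (comb ((Real.sqrt (a + (a / b) ^ 2 * c) : ℝ) : ℂ)⁻¹ ((a / b : ℝ) : ℂ) A B) = I ∧
    qForm (comb ((Real.sqrt (a + (a / b) ^ 2 * c) : ℝ) : ℂ)⁻¹ ((a / b : ℝ) : ℂ) A B)
      (comb ((Real.sqrt a : ℝ) : ℂ)⁻¹ 0 A B) = 0 ∧
    qForm (comb ((Real.sqrt a : ℝ) : ℂ)⁻¹ 0 A B) (comb ((Real.sqrt a : ℝ) : ℂ)⁻¹ 0 A B) = -I := by
  have I2 := Complex.I_sq
  have qa : qForm A A = -I * a := by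
    have := rA.mul_I_im rA
    rw [ea] at this
    rw [this]; linear_combination (qForm A A) * I2
  have qb : qForm A B = I * b := by
    have := rA.mul_I_im rB
    rw [neg_mul, Complex.neg_re, neg_eq_iff_eq_neg] at eb
    rw [eb, Complex.ofReal_neg] at this
    linear_combination I * this + (qForm A B) * I2
  have qb' : qForm B A = I * b := by
    rw [qForm_conj, rA.conj_qForm rB, neg_neg, qb]
  have qc : qForm B B = I * c := by
    have := rB.mul_I_im rB
    rw [neg_mul, Complex.neg_re, neg_eq_iff_eq_neg] at ec
    rw [ec, Complex.ofReal_neg] at this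
    linear_combination I * this + (qForm B B) * I2
  have hbc : (b : ℂ) ≠ 0 := by exact_mod_cast hb
  set α : ℂ := ((a / b : ℝ) : ℂ) with hα
  have hαb : α * b = a := by rw [hα]; push_cast; field_simp
  have cα : conj α = α := Complex.conj_ofReal _
  have key : ∀ {t : ℝ}, 0 < t → ((Real.sqrt t : ℝ) : ℂ)⁻¹ * ((Real.sqrt t : ℝ) : ℂ)⁻¹ * t = 1 := by
    intro t ht
    have : ((Real.sqrt t : ℝ) : ℂ) * ((Real.sqrt t : ℝ) : ℂ) = t := by
      exact_mod_cast Real.mul_self_sqrt ht.le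
    rw [← mul_inv, this, inv_mul_cancel₀ (by exact_mod_cast ht.ne')]
  have k1 := key hc
  have k2 := key ha
  set d := ((Real.sqrt (a + (a / b) ^ 2 * c) : ℝ) : ℂ)⁻¹ with hd
  set e := ((Real.sqrt a : ℝ) : ℂ)⁻¹ with he
  have cd : conj d = d := by rw [hd, map_inv₀, Complex.conj_ofReal]
  have ce : conj e = e := by rw [he, map_inv₀, Complex.conj_ofReal]
  push_cast at k1
  rw [Complex.ofReal_div] at hα
  rw [← hα] at k1
  refine ⟨?_, ?_, ?_⟩
  · rw [qForm_comb_left (hA.comb hB _ _) hA hB, qForm_comb_right hA hA hB,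
      qForm_comb_right hB hA hB, qa, qb, qb', qc, cd, cα]
    linear_combination I * k1 + 2 * d * d * I * hαb
  · rw [qForm_comb_left (hA.comb hB _ _) hA hB, qForm_comb_right hA hA hB,
      qForm_comb_right hB hA hB, qa, qb', ce, map_zero]
    linear_combination d * e * I * hαb
  · rw [qForm_comb_left (hA.comb hB _ _) hA hB, qForm_comb_right hA hA hB, qa, ce, map_zero]
    linear_combination -I * k2

end

/-! ### The family of all waves -/

section
variable {m : ℕ} {γ ε r : ℝ}

theorem qForm_eq_zero_symm {w w' : ℝ × ℝ → ℂ × ℂ} (h : qForm w w' = 0) : qForm w' w = 0 := by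
  rw [qForm_conj, h, map_zero, neg_zero]

/-- The conditions on frequency, strip and disc under which the waves span. -/
structure IsAdmissible (m : ℕ) (γ ε r : ℝ) : Prop where
  m_pos : 0 < m
  r_pos : 0 < r
  lower : omegaThr m < omegaEps (m + 1) ε
  upper : omegaEps (m + 1) ε ≤ omegaThr (m + 1)
  pair : IsThresholdPair m (omegaEps (m + 1) ε) γ r (threshWavePlus (m + 1) ε r)
    (threshWaveMinus (m + 1) ε r)
  a_pos : 0 < aEps (m + 1) ε r
  b_ne : bEps (m + 1) ε r ≠ 0
  norm_pos : 0 < aEps (m + 1) ε r +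
    (aEps (m + 1) ε r / bEps (m + 1) ε r) ^ 2 * cEps (m + 1) ε r
  roots : ∀ lam : ℂ, |lam.im| ≤ γ → dispersionFun (omegaEps (m + 1) ε) lam = 0 →
    lam.im = 0 ∨ (‖lam - 1‖ ≤ r ∧ thrG m (omegaEps (m + 1) ε) lam = 0)

/-- Both families of waves, indexed by a sum type. -/
def waves (N : ℕ) (ε r : ℝ) : ℕ ⊕ ℕ → ℝ × ℝ → ℂ × ℂ :=
  Sum.elim (wavePlus N ε r) (waveMinus N ε r)

/-- The flux of each wave through a section. -/
def flux : ℕ ⊕ ℕ → ℂ := Sum.elim (fun _ => I) (fun _ => -I)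

/-- The indices of the waves. -/
def waveIndex (N : ℕ) : Finset (ℕ ⊕ ℕ) := (Finset.Icc 2 N).disjSum (Finset.Icc 1 N)

theorem waveIndex_cases {i : ℕ ⊕ ℕ} (h : i ∈ waveIndex (m + 1)) :
    i = Sum.inl (m + 1) ∨ i = Sum.inr (m + 1) ∨
      (∃ n, 0 < n ∧ n < m ∧ i = Sum.inl (n + 1)) ∨ ∃ n, n < m ∧ i = Sum.inr (n + 1) := by
  rcases i with j | j
  · rw [waveIndex, Finset.inl_mem_disjSum, Finset.mem_Icc] at h
    rcases eq_or_lt_of_le h.2 with e | e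
    · exact Or.inl (by rw [e])
    · exact Or.inr (Or.inr (Or.inl ⟨j - 1, by omega, by omega, by congr 1; omega⟩))
  · rw [waveIndex, Finset.inr_mem_disjSum, Finset.mem_Icc] at h
    rcases eq_or_lt_of_le h.2 with e | e
    · exact Or.inr (Or.inl (by rw [e]))
    · exact Or.inr (Or.inr (Or.inr ⟨j - 1, by omega, by congr 1; omega⟩))

theorem inl_mem_waveIndex {n : ℕ} (h0 : 0 < n) (h : n ≤ m) :
    Sum.inl (n + 1) ∈ waveIndex (m + 1) := by
  rw [waveIndex, Finset.inl_mem_disjSum, Finset.mem_Icc]; omega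

theorem inr_mem_waveIndex {n : ℕ} (h : n ≤ m) : Sum.inr (n + 1) ∈ waveIndex (m + 1) := by
  rw [waveIndex, Finset.inr_mem_disjSum, Finset.mem_Icc]; omega

theorem waves_inl_top (m : ℕ) (ε r : ℝ) : waves (m + 1) ε r (Sum.inl (m + 1)) =
    comb ((normOne (m + 1) ε r : ℝ) : ℂ)⁻¹ (alphaEps (m + 1) ε r : ℂ)
      (threshWavePlus (m + 1) ε r) (threshWaveMinus (m + 1) ε r) := by
  funext p
  simp only [waves, Sum.elim_inl, wavePlus, if_true, comb]

theorem waves_inr_top (m : ℕ) (ε r : ℝ) : waves (m + 1) ε r (Sum.inr (m + 1)) =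
    comb ((normTwo (m + 1) ε r : ℝ) : ℂ)⁻¹ 0
      (threshWavePlus (m + 1) ε r) (threshWaveMinus (m + 1) ε r) := by
  funext p
  simp only [waves, Sum.elim_inr, waveMinus, if_true, comb, zero_smul, add_zero]

theorem waves_inl {n : ℕ} (h : n < m) (ε r : ℝ) : waves (m + 1) ε r (Sum.inl (n + 1)) =
    oscWave (omegaEps (m + 1) ε) (n + 1) (kappaPlus (omegaEps (m + 1) ε) (n + 1)) := by
  funext p
  simp only [waves, Sum.elim_inl, wavePlus, if_neg (show n + 1 ≠ m + 1 by omega)]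

theorem waves_inr {n : ℕ} (h : n < m) (ε r : ℝ) : waves (m + 1) ε r (Sum.inr (n + 1)) =
    oscWave (omegaEps (m + 1) ε) (n + 1) (kappaMinus (omegaEps (m + 1) ε) (n + 1)) := by
  funext p
  simp only [waves, Sum.elim_inr, waveMinus, if_neg (show n + 1 ≠ m + 1 by omega)]

namespace IsAdmissible

theorem thr_lt (h : IsAdmissible m γ ε r) {n : ℕ} (hn : n < m) :
    omegaThr (n + 1) < omegaEps (m + 1) ε := by
  obtain ⟨k, rfl⟩ := Nat.exists_eq_succ_of_ne_zero h.m_pos.ne'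
  exact (omegaThr_strictMono.monotone (Nat.lt_succ_iff.1 hn)).trans_lt h.lower

theorem one_lt (h : IsAdmissible m γ ε r) : 1 < omegaEps (m + 1) ε :=
  (omegaThr_ge_one _).trans_lt (h.thr_lt h.m_pos)

theorem smoothSol (h : IsAdmissible m γ ε r) : ∃ β, β < γ ∧
    ∀ i ∈ waveIndex (m + 1), SmoothSol (omegaEps (m + 1) ε) β (waves (m + 1) ε r i) := by
  obtain ⟨β, hβ0, hβ, hA, hB⟩ := h.pair.smooth
  refine ⟨β, hβ, fun i hi => ?_⟩
  rcases waveIndex_cases hi with rfl | rfl | ⟨n, h0, hn, rfl⟩ | ⟨n, hn, rfl⟩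
  · rw [waves_inl_top]; exact hA.comb hB _ _
  · rw [waves_inr_top]; exact hA.comb hB _ _
  · rw [waves_inl hn]; exact (isOsc_kappaPlus h0 (h.thr_lt hn)).1.smoothSol hβ0
  · rw [waves_inr hn]; exact (isOsc_kappaMinus (h.thr_lt hn)).1.smoothSol hβ0

/-- Distinct spectral parameters give orthogonality. They are distinct because `λ² + κ² = ω²` makes
`κ` a function of `λ` and `κ` determines its interval, while plus and minus waves lie on opposite
sides of `λ = 1`. -/
theorem qForm_waves (h : IsAdmissible m γ ε r) : ∀ i ∈ waveIndex (m + 1),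
    ∀ k ∈ waveIndex (m + 1), qForm (waves (m + 1) ε r i) (waves (m + 1) ε r k) =
      if i = k then flux k else 0 := by
  obtain ⟨β, hβ0, hβ, hA, hB⟩ := h.pair.smooth
  obtain ⟨q1, q2, q3⟩ := qForm_normalised hA hB h.pair.realA h.pair.realB h.a_pos h.b_ne
    h.norm_pos rfl rfl rfl
  rw [← alphaEps] at q1 q2
  have q1' : qForm (waves (m + 1) ε r (Sum.inl (m + 1))) (waves (m + 1) ε r (Sum.inl (m + 1))) = I := by
    rw [waves_inl_top]; exact q1
  have q2' : qForm (waves (m + 1) ε r (Sum.inl (m + 1))) (waves (m + 1) ε r (Sum.inr (m + 1))) = 0 := by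
    rw [waves_inl_top, waves_inr_top]; exact q2
  have q3' : qForm (waves (m + 1) ε r (Sum.inr (m + 1))) (waves (m + 1) ε r (Sum.inr (m + 1))) = -I := by
    rw [waves_inr_top]; exact q3
  have thr : ∀ {n : ℕ} {κ : ℝ}, IsOsc (omegaEps (m + 1) ε) n κ → ∀ d α : ℂ,
      qForm (oscWave (omegaEps (m + 1) ε) (n + 1) κ)
        (comb d α (threshWavePlus (m + 1) ε r) (threshWaveMinus (m + 1) ε r)) = 0 := by
    intro n κ hO d α
    obtain ⟨e1, e2⟩ := hO.qForm_thresholdPair h.pair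
    rw [qForm_comb_right (hO.smoothSol hβ0) hA hB, e1, e2]
    simp
  have oP := fun {n : ℕ} (h0 : 0 < n) (hn : n < m) => isOsc_kappaPlus h0 (h.thr_lt hn)
  have oM := fun {n : ℕ} (hn : n < m) => isOsc_kappaMinus (h.thr_lt hn)
  have tP : ∀ {n : ℕ}, 0 < n → n < m → ∀ d α : ℂ, qForm (waves (m + 1) ε r (Sum.inl (n + 1)))
      (comb d α (threshWavePlus (m + 1) ε r) (threshWaveMinus (m + 1) ε r)) = 0 := by
    intro n h0 hn d α
    rw [waves_inl hn]; exact thr (oP h0 hn).1 d α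
  have tM : ∀ {n : ℕ}, n < m → ∀ d α : ℂ, qForm (waves (m + 1) ε r (Sum.inr (n + 1)))
      (comb d α (threshWavePlus (m + 1) ε r) (threshWaveMinus (m + 1) ε r)) = 0 := by
    intro n hn d α
    rw [waves_inr hn]; exact thr (oM hn).1 d α
  have PM : ∀ {n n' : ℕ}, 0 < n → n < m → n' < m → qForm (waves (m + 1) ε r (Sum.inl (n + 1)))
      (waves (m + 1) ε r (Sum.inr (n' + 1))) = 0 := by
    intro n n' h0 hn hn'
    rw [waves_inl hn, waves_inr hn']
    exact (oP h0 hn).1.qForm_ne (oM hn').1 ((oM hn').2.trans (oP h0 hn).2).ne'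
  have off : ∀ {n n' : ℕ} {κ κ' : ℝ}, IsOsc (omegaEps (m + 1) ε) n κ →
      IsOsc (omegaEps (m + 1) ε) n' κ' → n ≠ n' →
      qForm (oscWave (omegaEps (m + 1) ε) (n + 1) κ) (oscWave (omegaEps (m + 1) ε) (n' + 1) κ') = 0 := by
    intro n n' κ κ' hO hO' hne
    refine hO.qForm_ne hO' fun he => hne ?_
    have := hO.eq_of_mul_cot_eq hO' he
    subst this
    exact hO.index_eq hO'
  intro i hi k hk
  rcases waveIndex_cases hi with rfl | rfl | ⟨n, h0, hn, rfl⟩ | ⟨n, hn, rfl⟩ <;>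
  rcases waveIndex_cases hk with rfl | rfl | ⟨n', h0', hn', rfl⟩ | ⟨n', hn', rfl⟩
  · rw [q1', if_pos rfl]; rfl
  · rw [q2', if_neg (by simp)]
  · rw [if_neg (by simp; omega), waves_inl_top]; exact qForm_eq_zero_symm (tP h0' hn' _ _)
  · rw [if_neg (by simp), waves_inl_top]; exact qForm_eq_zero_symm (tM hn' _ _)
  · rw [qForm_eq_zero_symm q2', if_neg (by simp)]
  · rw [q3', if_pos rfl]; rfl
  · rw [if_neg (by simp), waves_inr_top]; exact qForm_eq_zero_symm (tP h0' hn' _ _)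
  · rw [if_neg (by simp; omega), waves_inr_top]; exact qForm_eq_zero_symm (tM hn' _ _)
  · rw [if_neg (by simp; omega), waves_inl_top]; exact tP h0 hn _ _
  · rw [if_neg (by simp), waves_inr_top]; exact tP h0 hn _ _
  · rw [waves_inl hn, waves_inl hn']
    rcases eq_or_ne n n' with rfl | hne
    · rw [(oP h0 hn).1.qForm_self_of_gt (oP h0 hn).2, if_pos rfl]; rfl
    · rw [if_neg (by simpa using hne)]
      exact off (oP h0 hn).1 (oP h0' hn').1 hne
  · rw [if_neg (by simp)]; exact PM h0 hn hn'
  · rw [if_neg (by simp), waves_inl_top]; exact tM hn _ _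
  · rw [if_neg (by simp; omega), waves_inr_top]; exact tM hn _ _
  · rw [if_neg (by simp)]; exact qForm_eq_zero_symm (PM h0' hn' hn)
  · rw [waves_inr hn, waves_inr hn']
    rcases eq_or_ne n n' with rfl | hne
    · rw [(oM hn).1.qForm_self_of_lt (oM hn).2, if_pos rfl]; rfl
    · rw [if_neg (by simpa using hne)]
      exact off (oM hn).1 (oM hn').1 hne

/-- The top minus wave is a multiple of the first threshold wave; once that flux is zero, the top
plus wave gives the second, since `α ≠ 0`. Every root in the strip then belongs to a wave of the
family; the real root `1` occurs only at the threshold frequency itself. -/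
theorem pairVanishes (h : IsAdmissible m γ ε r) {u v : ℝ × ℝ → ℂ}
    (hz : IsHomogeneous (omegaEps (m + 1) ε) γ u v)
    (h0 : ∀ i ∈ waveIndex (m + 1), qEta u v (waves (m + 1) ε r i) = 0) :
    PairVanishes (omegaEps (m + 1) ε) γ u v := by
  obtain ⟨β, hβ0, hβ, hA, hB⟩ := h.pair.smooth
  have cinv : ∀ {t : ℝ}, 0 < t → conj ((Real.sqrt t : ℝ) : ℂ)⁻¹ ≠ 0 := fun ht => by
    rw [map_inv₀, Complex.conj_ofReal]
    exact inv_ne_zero (by exact_mod_cast (Real.sqrt_pos.2 ht).ne')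
  have eA : qEta u v (threshWavePlus (m + 1) ε r) = 0 := by
    have := h0 _ (inr_mem_waveIndex le_rfl)
    rw [waves_inr_top, qEta_comb hz.memU hz.memV hA hB, map_zero, zero_mul, add_zero] at this
    exact (mul_eq_zero.1 this).resolve_left (cinv h.a_pos)
  have eB : qEta u v (threshWaveMinus (m + 1) ε r) = 0 := by
    have := h0 _ (inl_mem_waveIndex h.m_pos le_rfl)
    rw [waves_inl_top, qEta_comb hz.memU hz.memV hA hB, eA, zero_add] at this
    have h1 := (mul_eq_zero.1 this).resolve_left (cinv h.norm_pos)
    rw [Complex.conj_ofReal] at h1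
    exact (mul_eq_zero.1 h1).resolve_left
      (by exact_mod_cast (div_ne_zero h.a_pos.ne' h.b_ne))
  intro z hzγ hD
  rcases h.roots z hzγ hD with him | ⟨hr, hG⟩
  · have hre : z = ((z.re : ℝ) : ℂ) := Complex.ext rfl (by simp [him])
    rw [hre] at hD
    rcases root_real_classify h.m_pos h.lower h.upper hD with ⟨n, hn, he⟩ | ⟨n, hn0, hn, he⟩ | ⟨he, hω⟩
    · rw [hre, he]
      refine (isOsc_kappaMinus (h.thr_lt hn)).1.leftPair_factor h.one_lt hz ?_
      rw [← waves_inr hn ε r]; exact h0 _ (inr_mem_waveIndex hn.le)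
    · rw [hre, he]
      refine (isOsc_kappaPlus hn0 (h.thr_lt hn)).1.leftPair_factor h.one_lt hz ?_
      rw [← waves_inl hn ε r]; exact h0 _ (inl_mem_waveIndex hn0 hn.le)
    · rw [he, Complex.ofReal_one] at hre
      exact h.pair.resolve hz eA eB z (by rw [hre, sub_self, norm_zero]; exact h.r_pos.le)
        (by rw [hω, hre]; exact thrG_thr_one m)
  · exact h.pair.resolve hz eA eB z hr hG

theorem ae_eq_sum (h : IsAdmissible m γ ε r) (hγ : 0 < γ) {u v : ℝ × ℝ → ℂ}
    (hz : IsHomogeneous (omegaEps (m + 1) ε) γ u v) :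
    ∀ᵐ p ∂(volume.restrict strip), (u p, v p) = ∑ i ∈ waveIndex (m + 1),
      (qEta u v (waves (m + 1) ε r i) / flux i) • waves (m + 1) ε r i p := by
  obtain ⟨β, hβ, hW⟩ := h.smoothSol
  refine hz.ae_eq_sum h.one_lt.le hγ hβ hW (fun i _ => ?_) h.qForm_waves
    fun u v hz h0 => h.pairVanishes hz h0
  rcases i with j | j <;> simp [flux]

theorem asymptotics (h : IsAdmissible m γ ε r) (hγ : 0 < γ) {g h' uP vP uM vM : ℝ × ℝ → ℂ}
    (hg : MemWeightedL2 γ g) (hg' : MemWeightedL2 (-γ) g) (hh : MemWeightedL2 γ h')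
    (hh' : MemWeightedL2 (-γ) h') (SP : IsSolution (omegaEps (m + 1) ε) γ g h' uP vP)
    (SM : IsSolution (omegaEps (m + 1) ε) (-γ) g h' uM vM) :
    ∃ CP CM : ℕ → ℂ,
      (∀ᵐ p ∂(volume.restrict strip), (uP p, vP p) = (uM p, vM p)
        + ∑ j ∈ Finset.Icc 2 (m + 1), CP j • wavePlus (m + 1) ε r j p
        + ∑ j ∈ Finset.Icc 1 (m + 1), CM j • waveMinus (m + 1) ε r j p) ∧
      (∀ j ∈ Finset.Icc 2 (m + 1),
        IntegrableOn (pairing g h' (wavePlus (m + 1) ε r j)) strip ∧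
        -I * CP j = ∫ p in strip, pairing g h' (wavePlus (m + 1) ε r j) p) ∧
      (∀ j ∈ Finset.Icc 1 (m + 1),
        IntegrableOn (pairing g h' (waveMinus (m + 1) ε r j)) strip ∧
        I * CM j = ∫ p in strip, pairing g h' (waveMinus (m + 1) ε r j) p) := by
  obtain ⟨β, hβ, hW⟩ := h.smoothSol
  have hz := SP.isHomogeneous_sub SM hγ hg hg' hh hh'
  set u := fun p => uP p - uM p
  set v := fun p => vP p - vM p
  have hP : ∀ j ∈ Finset.Icc 2 (m + 1),
      SmoothSol (omegaEps (m + 1) ε) β (wavePlus (m + 1) ε r j) := fun j hj =>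
    hW (Sum.inl j) (Finset.inl_mem_disjSum.2 hj)
  have hM : ∀ j ∈ Finset.Icc 1 (m + 1),
      SmoothSol (omegaEps (m + 1) ε) β (waveMinus (m + 1) ε r j) := fun j hj =>
    hW (Sum.inr j) (Finset.inr_mem_disjSum.2 hj)
  refine ⟨fun j => qEta u v (wavePlus (m + 1) ε r j) / I,
    fun j => qEta u v (waveMinus (m + 1) ε r j) / (-I), ?_, fun j hj => ⟨?_, ?_⟩,
    fun j hj => ⟨?_, ?_⟩⟩
  · filter_upwards [h.ae_eq_sum hγ hz] with p hp
    rw [waveIndex, Finset.sum_disjSum] at hp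
    rw [add_assoc, ← sub_eq_iff_eq_add']
    exact hp
  · exact integrable_pairing hβ hg hg' hh hh' (hP j hj)
  · rw [integral_pairing_eq hγ hβ SP SM hg hg' hh hh' (hP j hj)]
    field_simp
    rfl
  · exact integrable_pairing hβ hg hg' hh hh' (hM j hj)
  · rw [integral_pairing_eq hγ hβ SP SM hg hg' hh hh' (hM j hj)]
    field_simp
    rfl

end IsAdmissible

end

/-! ### Frequencies near the threshold -/

section
variable {m : ℕ} {γ ω ε r s : ℝ}

/-- The conditions on the frequency, relative to a fixed disc of radius `s`, that hold near the
threshold. -/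
structure IsNear (m : ℕ) (γ s ω : ℝ) : Prop where
  lower : omegaThr m < ω
  radius : s < ω - 1
  near : ∀ lam ∈ Metric.closedBall (1 : ℂ) s, NearThreshold m ω lam
  split : ω < omegaThr (m + 1) → ∃ z : ℂ, ‖z - 1‖ < s ∧ 0 < z.im ∧
    ∀ lam : ℂ, ‖lam - 1‖ ≤ s → (thrG m ω lam = 0 ↔ lam = z ∨ lam = conj z)
  roots : ∀ lam : ℂ, |lam.im| ≤ γ → dispersionFun ω lam = 0 →
    lam.im = 0 ∨ (‖lam - 1‖ < s ∧ thrG m ω lam = 0)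
  normal : ∃ a b c : ℝ, 0 < a ∧ b ≠ 0 ∧ 0 < a + (a / b) ^ 2 * c ∧
    (I * qForm (thrWave m ω s (fun _ => 1)) (thrWave m ω s (fun _ => 1))).re = a ∧
    (-I * qForm (thrWave m ω s (fun _ => 1)) (thrWave m ω s (fun lam => lam - 1))).re = b ∧
    (-I * qForm (thrWave m ω s (fun lam => lam - 1))
      (thrWave m ω s (fun lam => lam - 1))).re = c

theorem exists_isNear (hm : 0 < m) (hγ : 0 < γ) (h : IsThresholdWidth (m + 1) γ) :
    ∃ s εN, 0 < s ∧ s < γ ∧ 0 < εN ∧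
      (∀ lam : ℂ, ‖lam - 1‖ ≤ s → (thrG m (omegaThr (m + 1)) lam = 0 ↔ lam = 1)) ∧
      ∀ ε ∈ Icc 0 εN, IsNear m γ s (omegaEps (m + 1) ε) := by
  obtain ⟨s, hs0, hsγ, hev⟩ := exists_threshold_disc hm hγ
  obtain ⟨hs1, -, -, hthr⟩ := hev.self_of_nhds
  have h1 := eventually_roots_in_strip hm hγ h hs0
  have h2 := eventually_normalization_pos hm hs0 hs1 hthr
  have h3 : ∀ᶠ ω in 𝓝 (omegaThr (m + 1)), omegaThr m < ω := by
    obtain ⟨k, rfl⟩ := Nat.exists_eq_succ_of_ne_zero hm.ne'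
    exact lt_mem_nhds (omegaThr_strictMono (Nat.lt_succ_self k))
  have hall : ∀ᶠ ω in 𝓝 (omegaThr (m + 1)), IsNear m γ s ω := by
    filter_upwards [hev, h1, h2, h3] with ω a1 a2 a3 a4
    exact ⟨a4, a1.1, a1.2.1, a1.2.2.1, a2, a3⟩
  obtain ⟨δ, hδ, hb⟩ := Metric.eventually_nhds_iff.1 ((tendsto_omegaEps (m + 1)).eventually hall)
  refine ⟨s, δ / 2, hs0, hsγ, half_pos hδ, hthr, fun ε hε => hb ?_⟩
  rw [Real.dist_0_eq_abs, abs_of_nonneg hε.1]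
  linarith [hε.2]

theorem norm_conj_sub_one (z : ℂ) : ‖conj z - 1‖ = ‖z - 1‖ := by
  rw [← map_one (starRingEnd ℂ), ← map_sub, RCLike.norm_conj, map_one]

theorem im_le_norm_sub_one (z : ℂ) : z.im ≤ ‖z - 1‖ := by
  simpa using (Complex.im_le_norm (z - 1))

/-- Two discs isolating a pair of conjugate roots isolate the same pair. -/
theorem eq_of_isolated {G : ℂ → ℂ} {r s : ℝ} {z z' : ℂ} (hz : ‖z - 1‖ < r) (hz' : ‖z' - 1‖ < s)
    (him : 0 < z.im) (him' : 0 < z'.im)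
    (h : ∀ lam : ℂ, ‖lam - 1‖ ≤ r → (G lam = 0 ↔ lam = z ∨ lam = conj z))
    (h' : ∀ lam : ℂ, ‖lam - 1‖ ≤ s → (G lam = 0 ↔ lam = z' ∨ lam = conj z')) : z = z' := by
  have key : ∀ {a b : ℂ}, 0 < a.im → 0 < b.im → a = b ∨ a = conj b → a = b := by
    rintro a b ha hb (e | e)
    · exact e
    · rw [e, Complex.conj_im] at ha; linarith
  rcases le_total r s with hrs | hrs
  · exact key him him' ((h' z (hz.le.trans hrs)).1 ((h z hz.le).2 (Or.inl rfl)))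
  · exact (key him' him ((h z' (hz'.le.trans hrs)).1 ((h' z' hz'.le).2 (Or.inl rfl)))).symm

theorem IsNear.isSplitRoot (h : IsNear m γ s ω) (hω : 1 < ω) {z : ℂ} (hz : ‖z - 1‖ < s)
    (him : 0 < z.im) (h0 : thrG m ω z = 0) : IsSplitRoot m ω z := by
  refine ⟨one_pos.trans hω, K_mem_slitPlane h.radius hz.le, him, h0, ?_⟩
  have hn := h.near z (by rw [Metric.mem_closedBall, dist_eq_norm]; exact hz.le)
  have := dispersionFun_mul_eq_thrG (lam := z) m (one_pos.trans hω).ne'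
  rw [h0, mul_zero, zero_mul, neg_zero] at this
  exact (mul_eq_zero.1 this).resolve_right hn.conjugate_ne

theorem isThresholdRadius (hε : 0 ≤ ε) (hs0 : 0 < s)
    (hthr : ∀ lam : ℂ, ‖lam - 1‖ ≤ s → (thrG m (omegaThr (m + 1)) lam = 0 ↔ lam = 1))
    (h : IsNear m γ s (omegaEps (m + 1) ε)) : IsThresholdRadius (m + 1) ε s := by
  refine ⟨hs0, h.radius, ?_⟩
  simp only [threshFun_eq_thrG]
  rcases hε.eq_or_lt with rfl | hε'
  · refine ⟨1, by simpa using hs0, fun _ => rfl, fun h => absurd h (lt_irrefl _), fun lam hl => ?_⟩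
    rw [omegaEps_zero, hthr lam hl, map_one, or_self]
  · obtain ⟨z, h1, h2, h3⟩ := h.split (omegaEps_lt hε')
    exact ⟨z, h1, fun h0 => absurd h0 hε'.ne', fun _ => h2, h3⟩

/-- The constants `a`, `b`, `c` are controlled only for the reference radius `s`, whereas `r` is
arbitrary. Both discs isolate the same roots, so evaluating the contour integrals by residues shows
that the waves coincide. -/
theorem IsNear.isAdmissible (hm : 0 < m) (hγ : 0 < γ) (hε : 0 ≤ ε) (hs0 : 0 < s) (hsγ : s < γ)
    (hthr : ∀ lam : ℂ, ‖lam - 1‖ ≤ s → (thrG m (omegaThr (m + 1)) lam = 0 ↔ lam = 1))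
    (h : IsNear m γ s (omegaEps (m + 1) ε)) (hr : IsThresholdRadius (m + 1) ε r) :
    IsAdmissible m γ ε r := by
  obtain ⟨hr0, hr1, lamP, hl1, hl2, hl3, hl4⟩ := hr
  simp only [threshFun_eq_thrG] at hl4
  have hω : 1 < omegaEps (m + 1) ε := by linarith [h.radius]
  suffices H : IsThresholdPair m (omegaEps (m + 1) ε) γ r (threshWavePlus (m + 1) ε r)
      (threshWaveMinus (m + 1) ε r) ∧
      threshWavePlus (m + 1) ε r = thrWave m (omegaEps (m + 1) ε) s (fun _ => 1) ∧
      threshWaveMinus (m + 1) ε r = thrWave m (omegaEps (m + 1) ε) s (fun lam => lam - 1) ∧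
      ∀ lam : ℂ, ‖lam - 1‖ < s → thrG m (omegaEps (m + 1) ε) lam = 0 → ‖lam - 1‖ ≤ r by
    obtain ⟨H1, H2, H3, H4⟩ := H
    obtain ⟨a, b, c, ha, hb, hc, ea, eb, ec⟩ := h.normal
    rw [← H2] at ea
    rw [← H2, ← H3] at eb
    rw [← H3] at ec
    rw [← aEps] at ea
    rw [← bEps] at eb
    rw [← cEps] at ec
    subst ea eb ec
    exact ⟨hm, hr0, h.lower, omegaEps_le hε, H1, ha, hb, hc, fun lam h1 h2 =>
      (h.roots lam h1 h2).imp_right fun h3 => ⟨H4 lam h3.1 h3.2, h3.2⟩⟩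
  rw [threshWavePlus_eq, threshWaveMinus_eq]
  rcases hε.eq_or_lt with rfl | hε'
  · obtain rfl := hl2 rfl
    simp only [map_one, or_self] at hl4
    have hs := h.radius
    rw [omegaEps_zero] at hl4 hr1 hs ⊢
    obtain ⟨e1, e2⟩ := thrWave_thr_eq hm hr0 hr1 hl4
    obtain ⟨e3, e4⟩ := thrWave_thr_eq hm hs0 hs hthr
    refine ⟨isThresholdPair_thr hm hγ hr0 hr1 hl4, by rw [e1, e3], by rw [e2, e4],
      fun lam h1 h2 => ?_⟩
    rw [(hthr lam h1.le).1 h2]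
    exact hl1.le
  · obtain ⟨z, h1, h2, h3⟩ := h.split (omegaEps_lt hε')
    obtain rfl := eq_of_isolated hl1 h1 (hl3 hε') h2 hl4 h3
    have hS := h.isSplitRoot hω h1 h2 ((h3 _ h1.le).2 (Or.inl rfl))
    refine ⟨hS.isThresholdPair hω ((im_le_norm_sub_one _).trans_lt (h1.trans hsγ)) hr1 hl1 hl4,
      ?_, ?_, fun lam k1 k2 => ?_⟩
    · rw [hS.thrWave_eq hr1 hl1 hl4 (differentiable_const _) (by simp),
        hS.thrWave_eq h.radius h1 h3 (differentiable_const _) (by simp)]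
    · rw [hS.thrWave_eq hr1 hl1 hl4 (by fun_prop) (by simp),
        hS.thrWave_eq h.radius h1 h3 (by fun_prop) (by simp)]
    · rcases (h3 lam k1.le).1 k2 with rfl | rfl
      · exact hl1.le
      · rw [norm_conj_sub_one]; exact hl1.le

end

end DiracStrip

end

theorem mainTheorem5 (N : ℕ) (hN : 2 ≤ N) :
    (∃ γ : ℝ, 0 < γ ∧ DiracStrip.IsThresholdWidth N γ) ∧
    ∀ γ : ℝ, 0 < γ → DiracStrip.IsThresholdWidth N γ →
      ∃ εN : ℝ, 0 < εN ∧ DiracStrip.IsSpectralStrip N γ εN ∧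
        ∀ ε ∈ Set.Icc 0 εN, ∀ r : ℝ, DiracStrip.IsThresholdRadius N ε r →
          ∀ g h : ℝ × ℝ → ℂ,
            DiracStrip.MemWeightedL2 γ g → DiracStrip.MemWeightedL2 (-γ) g →
            DiracStrip.MemWeightedL2 γ h → DiracStrip.MemWeightedL2 (-γ) h →
            ∀ uP vP uM vM : ℝ × ℝ → ℂ,
              DiracStrip.IsSolution (DiracStrip.omegaEps N ε) γ g h uP vP →
              DiracStrip.IsSolution (DiracStrip.omegaEps N ε) (-γ) g h uM vM →
              ∃ CP CM : ℕ → ℂ,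
                (∀ᵐ p ∂(volume.restrict DiracStrip.strip),
                  (uP p, vP p) = (uM p, vM p)
                    + ∑ j ∈ Finset.Icc 2 N, CP j • DiracStrip.wavePlus N ε r j p
                    + ∑ j ∈ Finset.Icc 1 N, CM j • DiracStrip.waveMinus N ε r j p) ∧
                (∀ j ∈ Finset.Icc 2 N,
                  IntegrableOn (DiracStrip.pairing g h (DiracStrip.wavePlus N ε r j))
                    DiracStrip.strip ∧
                  -I * CP j = ∫ p in DiracStrip.strip,
                    DiracStrip.pairing g h (DiracStrip.wavePlus N ε r j) p) ∧
                (∀ j ∈ Finset.Icc 1 N,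
                  IntegrableOn (DiracStrip.pairing g h (DiracStrip.waveMinus N ε r j))
                    DiracStrip.strip ∧
                  I * CM j = ∫ p in DiracStrip.strip,
                    DiracStrip.pairing g h (DiracStrip.waveMinus N ε r j) p) := by
  obtain ⟨m, rfl⟩ : ∃ m, N = m + 1 := ⟨N - 1, by omega⟩
  have hm : 0 < m := by omega
  refine ⟨DiracStrip.exists_isThresholdWidth hm, fun γ hγ hw => ?_⟩
  -- The radius `s` depends only on `N` and the strip: it is the radius demanded by the spectral
  -- statement and the reference for all other admissible radii.
  obtain ⟨s, εN, hs0, hsγ, hεN, hthr, hnear⟩ := DiracStrip.exists_isNear hm hγ hw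
  refine ⟨εN, hεN, fun ε hε => ⟨(hnear ε hε).lower, s, hsγ,
    DiracStrip.isThresholdRadius hε.1 hs0 hthr (hnear ε hε), fun lam h1 h2 => ?_⟩, ?_⟩
  · rw [DiracStrip.threshFun_eq_thrG]
    exact (hnear ε hε).roots lam h1 h2
  · intro ε hε r hr g h hg hg' hh hh' uP vP uM vM SP SM
    exact ((hnear ε hε).isAdmissible hm hγ hε.1 hs0 hsγ hthr hr).asymptotics hγ hg hg' hh hh' SP SM
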